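/- **Notation.** Let $G$ be a $C^\infty$ vector field on $\mathbb{R}^2$, $O=(0,0)$, and let $\mathbf{G}(z,t)$ denote its (maximal) local flow. For an open set $V\subset\mathbb{R}^2$ and $r\ge 0$, the weak Whitney topology $C^r_W$ on $C^\infty(V,\mathbb{R}^m)$ is the topology of uniform convergence on compact subsets of $V$ of all partial derivatives of order at most $r$; put $C^\infty(V)=C^\infty(V,\mathbb{R})$. A map $\sigma$ between subsets of such spaces is *tamely continuous* if for every $r\ge 0$ there is an integer $s(r)\ge 0$ such that $\sigma$ is continuous from the $C^{s(r)}_W$-topology to the $C^r_W$-topology. Let $\mathcal{E}(G,V)\subset C^\infty(V,\mathbb{R}^2)$ be the set of smooth maps $h:V\to\mathbb{R}^2$ such that $h(\omega\cap V)\subset\omega$ for every orbit $\omega$ of $G$ and $h$ is a local diffeomorphism at every singular point of $G$ in $V$. Let $\mathcal{E}_{\mathrm{id}}(G,V)$ be the set of those $h\in\mathcal{E}(G,V)$ that are homotopic to $\mathrm{id}_V$ in $\mathcal{E}(G,V)$ by a homotopy which, together with its first partial derivatives, depends continuously on the parameter, i.e. by a path in $\mathcal{E}(G,V)$ continuous in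 the $C^1_W$-topology. Let $p\ge 1$ and let $g\in\mathbb{R}[x,y]$ be a homogeneous polynomial of degree $p+1$ without multiple factors. Say that $G$ has *property $(*)$ at $O$ (with the polynomial $g$)* if there are a smooth everywhere non-zero function $\eta:\mathbb{R}^2\to\mathbb{R}\setminus\{0\}$ and smooth local coordinates $(x,y)$ centred at $O$ in which $G=\eta\cdot(-g'_y,\,g'_x)$. **Theorem 3.2.** Let $G$ have property $(*)$ at $O$ with the polynomial $g$, $\deg g=p+1$. Then there is a neighborhood $W$ of $O$ such that the following holds for every connected open neighborhood $V$ of $O$ with $V\subset W$. For every $f\in\mathcal{E}_{\mathrm{id}}(G,V)$ there exist a neighborhood $\mathcal{U}_f$ of $f$ in $\mathcal{E}_{\mathrm{id}}(G,V)$ with respect to the $C^p_W$-topology and a tamely continuous map $$\sigma_V:\mathcal{E}_{\mathrm{id}}(G,V)\supset\mathcal{U}_f\longrightarrow C^\infty(V)$$ such that for every $h\in\mathcal{U}_f$ and every $z\in V$ the value $\mathbf{G}(z,\sigma_V(h)(z))$ is defined and $$h(z)=\mathbf{G}\bigl(z,\sigma_V(h)(z)\bigr).$$ Moreover, if $\deg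 g\ge 3$, then $\sigma_V$ can be defined on all of $\mathcal{E}_{\mathrm{id}}(G,V)$: there is a tamely continuous map $\sigma_V:\mathcal{E}_{\mathrm{id}}(G,V)\to C^\infty(V)$ with $h(z)=\mathbf{G}(z,\sigma_V(h)(z))$ for all $h\in\mathcal{E}_{\mathrm{id}}(G,V)$ and $z\in V$. -/

import Mathlib

open Set Topology TopologicalSpace
open scoped ContDiff Manifold

namespace PlaneShift

/-- The plane `ℝ²`. -/
abbrev Plane : Type := EuclideanSpace ℝ (Fin 2)

/-! ### Smooth maps on an open set and the weak Whitney topologies -/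

section SmoothMaps

variable {E F : Type*} [NormedAddCommGroup E] [NormedSpace ℝ E]
  [NormedAddCommGroup F] [NormedSpace ℝ F]

/-- Extension by zero of a map defined on an open set `V`. It is only a device for writing
derivatives at the points of `V`, where it does not depend on the values off `V`. -/
noncomputable def zeroExt {V : Opens E} (f : V → F) : E → F :=
  Function.extend Subtype.val f 0

variable (F) in
/-- `C^∞(V, F)`: the smooth maps defined on the open set `V`. -/
def SmoothMaps (V : Opens E) : Type _ :=
  {f : V → F // ContDiffOn ℝ ∞ (zeroExt f) (V : Set E)}

namespace SmoothMaps

instance (V : Opens E) : CoeFun (SmoothMaps F V) (fun _ => V → F) := ⟨fun f => f.1⟩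

/-- `C^r`-closeness on `K`: all derivatives of order at most `r` of `f` and `h` differ by less
than `ε` at every point of `K`. -/
def CloseOn {V : Opens E} (r : ℕ) (K : Set E) (ε : ℝ) (f h : SmoothMaps F V) : Prop :=
  ∀ k ≤ r, ∀ x ∈ K,
    ‖iteratedFDeriv ℝ k (zeroExt h.1) x - iteratedFDeriv ℝ k (zeroExt f.1) x‖ < ε

theorem CloseOn.mono {V : Opens E} {r : ℕ} {K K' : Set E} {ε ε' : ℝ} {f h : SmoothMaps F V}
    (H : CloseOn r K ε f h) (hK : K' ⊆ K) (hε : ε ≤ ε') : CloseOn r K' ε' f h :=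
  fun k hk x hx => (H k hk x (hK hx)).trans_le hε

variable (F) in
/-- The weak Whitney topology `C^r_W` on `C^∞(V, F)`: the topology given by the `r`-norms on the
compact subsets of `V`. -/
@[reducible] def weakTopology (V : Opens E) (r : ℕ) : TopologicalSpace (SmoothMaps F V) where
  IsOpen U := ∀ f ∈ U, ∃ K : Set E, IsCompact K ∧ K ⊆ V ∧ ∃ ε : ℝ, 0 < ε ∧
    ∀ h : SmoothMaps F V, CloseOn r K ε f h → h ∈ U
  isOpen_univ := fun _ _ => ⟨∅, isCompact_empty, empty_subset _, 1, one_pos, fun _ _ => mem_univ _⟩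
  isOpen_inter := by
    rintro A B hA hB f ⟨hfA, hfB⟩
    obtain ⟨K, hK, hKV, ε, hε, h1⟩ := hA f hfA
    obtain ⟨L, hL, hLV, δ, hδ, h2⟩ := hB f hfB
    exact ⟨K ∪ L, hK.union hL, union_subset hKV hLV, min ε δ, lt_min hε hδ, fun h H =>
      ⟨h1 h (H.mono subset_union_left (min_le_left _ _)),
        h2 h (H.mono subset_union_right (min_le_right _ _))⟩⟩
  isOpen_sUnion := by
    rintro S hS f ⟨A, hA, hfA⟩
    obtain ⟨K, hK, hKV, ε, hε, h1⟩ := hS A hA f hfA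
    exact ⟨K, hK, hKV, ε, hε, fun h H => ⟨A, hA, h1 h H⟩⟩

/-- The inclusion `id_V : V → E`. -/
def incl (V : Opens E) : SmoothMaps E V :=
  ⟨Subtype.val, contDiffOn_id.congr fun x hx =>
    Subtype.val_injective.extend_apply Subtype.val 0 (⟨x, hx⟩ : V)⟩

/-- `σ` is tamely continuous on `U`: for every `r` there is `s` such that `σ` is continuous on `U`
from the `C^s_W`-topology to the `C^r_W`-topology. -/
def TamelyContinuousOn {F' : Type*} [NormedAddCommGroup F'] [NormedSpace ℝ F'] {V : Opens E}
    (σ : SmoothMaps F V → SmoothMaps F' V) (U : Set (SmoothMaps F V)) : Prop :=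
  ∀ r : ℕ, ∃ s : ℕ,
    @ContinuousOn _ _ (weakTopology F V s) (weakTopology F' V r) σ U

end SmoothMaps

end SmoothMaps

/-! ### The local flow, its orbits, and orbit preserving maps -/

/-- The graph of the (maximal) local flow `𝐆` of `G`: `𝐆(z, t)` is defined and equals `w`, i.e.
an integral curve of `G` starting at `z` at time `0` exists up to time `t` (which may be negative)
and is at `w` at time `t`. -/
def FlowsTo (G : Plane → Plane) (z : Plane) (t : ℝ) (w : Plane) : Prop :=
  ∃ γ : ℝ → Plane, γ 0 = z ∧ γ t = w ∧ IsIntegralCurveOn γ (fun _ => G) (uIcc 0 t)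

/-- The orbit of `G` through `z`. -/
def orbit (G : Plane → Plane) (z : Plane) : Set Plane :=
  {w | ∃ t : ℝ, FlowsTo G z t w}

/-- `𝓔(G, V)`: smooth maps `h : V → ℝ²` such that `h(ω ∩ V) ⊆ ω` for every orbit `ω` of `G`, and
which are local diffeomorphisms at every singular point of `G` in `V`. -/
def orbitMaps (G : Plane → Plane) (V : Opens Plane) : Set (SmoothMaps Plane V) :=
  {h | (∀ z₀ : Plane, ∀ z : V, (z : Plane) ∈ orbit G z₀ → h z ∈ orbit G z₀) ∧
    ∀ z : V, G z = 0 → IsLocalDiffeomorphAt 𝓘(ℝ, Plane) 𝓘(ℝ, Plane) ∞ (zeroExt h.1) (z : Plane)}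

/-- `𝓔_id(G, V)`: the elements of `𝓔(G, V)` homotopic to `id_V` in `𝓔(G, V)`, by a homotopy that
depends continuously on the parameter together with its first partial derivatives, i.e. a path
that is continuous in the `C^1_W`-topology. -/
def orbitMapsId (G : Plane → Plane) (V : Opens Plane) : Set (SmoothMaps Plane V) :=
  {h | @JoinedIn _ (SmoothMaps.weakTopology Plane V 1) (orbitMaps G V) (SmoothMaps.incl V) h}

/-- `α` is a shift function for `h`: `h(z) = 𝐆(z, α(z))` for all `z ∈ V`. -/
def IsShiftFunction (G : Plane → Plane) {V : Opens Plane} (h : SmoothMaps Plane V)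
    (α : SmoothMaps ℝ V) : Prop :=
  ∀ z : V, FlowsTo G z (α z) (h z)

/-! ### Property (*) -/

/-- Property (*) for a polynomial `g ∈ ℝ[x, y]` of degree `p + 1`: `g` is homogeneous of degree
`p + 1 ≥ 2` and has no multiple factors (in particular `g ≠ 0`). -/
structure PolyStar (p : ℕ) (g : MvPolynomial (Fin 2) ℝ) : Prop where
  one_le : 1 ≤ p
  homogeneous : g.IsHomogeneous (p + 1)
  squarefree : Squarefree g

/-- The Hamiltonian vector field `(-∂g/∂y, ∂g/∂x)`. -/
noncomputable def hamiltonianField (g : MvPolynomial (Fin 2) ℝ) (z : Plane) : Plane :=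
  !₂[-(MvPolynomial.eval (fun i => z i) (MvPolynomial.pderiv 1 g)),
    MvPolynomial.eval (fun i => z i) (MvPolynomial.pderiv 0 g)]

/-- Property (*) at the origin for a vector field `G`, with the polynomial `g`: there are a
smooth everywhere non-zero function `η` and smooth local coordinates `φ` at the origin in which
`G = η H`, where `H` is the Hamiltonian vector field of `g`. -/
def FieldStar (G : Plane → Plane) (p : ℕ) (g : MvPolynomial (Fin 2) ℝ) : Prop :=
  PolyStar p g ∧
  ∃ η : Plane → ℝ, ContDiff ℝ ∞ η ∧ (∀ z, η z ≠ 0) ∧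
  ∃ φ : OpenPartialHomeomorph Plane Plane,
    ContDiffOn ℝ ∞ φ φ.source ∧ ContDiffOn ℝ ∞ φ.symm φ.target ∧
    0 ∈ φ.source ∧ φ 0 = 0 ∧
    ∀ z ∈ φ.source, fderiv ℝ φ z (G z) = η z • hamiltonianField g (φ z)

end PlaneShift

/-!
Away from the zeros of `G`, a homotopy `h_t` along the orbits has a unique continuous family of
times `τ_t` with `h_t(z) = 𝐆(z, τ_t(z))` and `τ_0 = 0`. Flow boxes make this precise
(`exists_flowBox`, `exists_timeLift`): an orbit meets a box in countably many trajectories, so a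
continuous curve in the orbit stays on one of them. There `τ_1` is smooth, and it depends locally
continuously on `h_1` without loss of derivatives, because the time of a point is one of the
coordinates of the box. Incompleteness of `G` is harmless: on bounded sets `𝐆` agrees with the
global flow of a cut-off of `G`, which is smooth (`exists_isCutoffFlow`). That flow is smooth in all
variables by the implicit function theorem for the integral equation in `C([0,1], E)`.

The difficulty is the singular point `O`, where `G` vanishes to order exactly `p`.

* *The size of the times.* In the chart, `g` is a first integral, so the derivatives `Dh_t(0)`
  preserve `g`, up to a linear change of coordinates. If `deg g ≥ 3`, the identity is isolated among
  the linear maps preserving `g`, hence `Dh_t(0) = id`; if `deg g = 2`, the path `Dh_t(0)` runs on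
  a conic `x² - ν y² = 1`. In both cases `Dh_t(0)` is the derivative at `O` of the flow at some time
  `a_t`, continuous in `t` (`StarChart.exists_linear_lift`). Hence `h_t(z)` differs from
  `𝐆(z, a_t)` by `o(‖z‖)`, and a displacement of this size takes a time which is, on the scale
  `‖z‖ ^ (1 - p)`, either small or bounded away from zero. Along the homotopy `τ_t(z) - a_t`
  starts at zero and cannot jump, so it stays `o(‖z‖ ^ (1 - p))` (`OrbitHomotopy.exists_tendsto`).

* *Smoothness.* As `g` has no multiple factors, `∂g/∂x` and `∂g/∂y` are coprime. Forms which are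
  multiples of the leading part of `G` can therefore be divided by it, with a quotient that
  depends linearly on the form (`HasZeroOfOrder.hasDivision`). Iteration yields polynomials which
  approximate the time to any order at `O` (`exists_approxShift`). The remaining shift is by a flat
  time, for which there is a closed formula with a quotient of flat functions. It is smooth and
  depends continuously on the map, with a finite loss of derivatives (`exists_ctendsto_shift`).

* *Continuity.* Tame continuity thus reduces to convergence of the values of the shift functions,
  which propagates over the connected set `V` (`StarChart.tamelyContinuousOn`).

For `deg g ≥ 3` this applies to any choice of smooth shift functions. For `deg g = 2` the values
at `O` have to be controlled. They are determined by the linear part of the map up to the period of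
the linear flow, which is nonzero only if `g` is definite. In that case the trajectories near `O`
are closed with a smooth period function (`StarChart.exists_period`), integer multiples of which
may be added to a shift function. This allows one to select, for all maps in a
`C^1`-neighbourhood of `f`, the shift function whose value at `O` is the one close to that of `f`
(`StarChart.exists_nhds_tame`).
-/

namespace PlaneShift

/-! ### Superposition operators -/

section Superposition

variable {E F : Type*} [NormedAddCommGroup E] [NormedSpace ℝ E]
  [NormedAddCommGroup F] [NormedSpace ℝ F]

/-- Pointwise application `C([0,1], E →L F) → C([0,1], E) → C([0,1], F)` as a continuous bilinear
map. -/
noncomputable def pointwiseApply (E F : Type*) [NormedAddCommGroup E] [NormedSpace ℝ E]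
    [NormedAddCommGroup F] [NormedSpace ℝ F] :
    C(unitInterval, E →L[ℝ] F) →L[ℝ] C(unitInterval, E) →L[ℝ] C(unitInterval, F) :=
  LinearMap.mkContinuous₂
    (LinearMap.mk₂ ℝ (fun (A : C(unitInterval, E →L[ℝ] F)) (v : C(unitInterval, E)) => (⟨fun t => A t (v t), by fun_prop⟩ : C(unitInterval, F)))
      (fun _ _ _ => by ext; simp) (fun _ _ _ => by ext; simp) (fun _ _ _ => by ext; simp)
      (fun _ _ _ => by ext; simp)) 1
    (fun A v => by
      rw [one_mul, ContinuousMap.norm_le _ (by positivity)]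
      intro t
      exact (A t).le_opNorm_of_le (v.norm_coe_le_norm t) |>.trans
        (mul_le_mul_of_nonneg_right (A.norm_coe_le_norm t) (norm_nonneg _)))

theorem hasFDerivAt_superposition {G : E → F} (hG : ContDiff ℝ 1 G)
    (γ : C(unitInterval, E)) :
    HasFDerivAt (fun γ : C(unitInterval, E) => (⟨G, hG.continuous⟩ : C(E, F)).comp γ)
      (pointwiseApply E F
        ((⟨fderiv ℝ G, hG.continuous_fderiv one_ne_zero⟩ : C(E, E →L[ℝ] F)).comp γ)) γ := by
  rw [hasFDerivAt_iff_isLittleO_nhds_zero, Asymptotics.isLittleO_iff]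
  intro ε hε
  have hK : IsCompact (range γ) := isCompact_range γ.continuous
  have hu := hK.uniformContinuousAt_of_continuousAt (fderiv ℝ G)
    (fun x _ => (hG.continuous_fderiv one_ne_zero).continuousAt) (Metric.dist_mem_uniformity hε)
  obtain ⟨δ, hδ, hd⟩ := Metric.mem_uniformity_dist.1 hu
  filter_upwards [Metric.ball_mem_nhds (0 : C(unitInterval, E)) hδ] with v hv
  rw [ContinuousMap.norm_le _ (by positivity)]
  intro t
  have hvt : ‖v t‖ < δ := (v.norm_coe_le_norm t).trans_lt (by simpa using hv)
  have key := (convex_ball (γ t) δ).norm_image_sub_le_of_norm_hasFDerivWithin_le' (f := G)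
    (f' := fderiv ℝ G) (φ := fderiv ℝ G (γ t)) (C := ε) (x := γ t) (y := γ t + v t)
    (fun x _ => ((hG.differentiable one_ne_zero) x).hasFDerivAt.hasFDerivWithinAt)
    (fun x hx => by
      have := hd (a := γ t) (b := x) (by rw [dist_comm]; exact hx) (mem_range_self t)
      rw [← dist_eq_norm, dist_comm]; exact this.le)
    (Metric.mem_ball_self hδ) (by simpa using hvt)
  simp only [add_sub_cancel_left] at key
  change ‖G (γ t + v t) - G (γ t) - (fderiv ℝ G (γ t)) (v t)‖ ≤ _
  exact key.trans (mul_le_mul_of_nonneg_left (v.norm_coe_le_norm t) hε.le)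

theorem contDiff_superposition_nat (n : ℕ) {E F : Type} [NormedAddCommGroup E] [NormedSpace ℝ E]
    [NormedAddCommGroup F] [NormedSpace ℝ F] {G : E → F} (hG : ContDiff ℝ ∞ G) :
    ContDiff ℝ n (fun γ : C(unitInterval, E) => (⟨G, hG.continuous⟩ : C(E, F)).comp γ) := by
  induction n generalizing F with
  | zero =>
    exact contDiff_zero.2 (ContinuousMap.continuous_postcomp _)
  | succ n ih =>
    have hG1 : ContDiff ℝ 1 G := hG.of_le (by exact_mod_cast le_top)
    refine (contDiff_succ_iff_hasFDerivAt (n := n)).2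
      ⟨_, ?_, fun γ => hasFDerivAt_superposition hG1 γ⟩
    have hB : ContDiff ℝ n (pointwiseApply E F) :=
      ContinuousLinearMap.contDiff (𝕜 := ℝ) (E := C(unitInterval, E →L[ℝ] F))
        (F := C(unitInterval, E) →L[ℝ] C(unitInterval, F)) (pointwiseApply E F)
    exact hB.comp (ih (G := fderiv ℝ G) (hG.fderiv_right (by simp)))

theorem contDiff_superposition {E F : Type} [NormedAddCommGroup E] [NormedSpace ℝ E]
    [NormedAddCommGroup F] [NormedSpace ℝ F] {G : E → F} (hG : ContDiff ℝ ∞ G) :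
    ContDiff ℝ ∞ (fun γ : C(unitInterval, E) => (⟨G, hG.continuous⟩ : C(E, F)).comp γ) :=
  contDiff_infty.2 fun n => contDiff_superposition_nat n hG

/-- The primitive vanishing at `0`, as a continuous linear operator on `C([0,1], E)`. -/
noncomputable def primitiveOp (E : Type*) [NormedAddCommGroup E] [NormedSpace ℝ E] :
    C(unitInterval, E) →L[ℝ] C(unitInterval, E) :=
  LinearMap.mkContinuous
    { toFun := fun v => ⟨fun t => ∫ s in (0 : ℝ)..t, v (projIcc 0 1 zero_le_one s), by
        have : Continuous fun t : ℝ => ∫ s in (0 : ℝ)..t, v (projIcc 0 1 zero_le_one s) :=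
          intervalIntegral.continuous_primitive
            (fun a b => ((v.continuous.comp continuous_projIcc).intervalIntegrable a b)) 0
        exact this.comp continuous_subtype_val⟩
      map_add' := fun v w => by
        ext t
        exact intervalIntegral.integral_add ((v.continuous.comp continuous_projIcc).intervalIntegrable _ _)
          ((w.continuous.comp continuous_projIcc).intervalIntegrable _ _)
      map_smul' := fun c v => by
        ext t
        exact intervalIntegral.integral_smul _ _ }
    1 (fun v => by
      rw [ContinuousMap.norm_le _ (by positivity)]
      intro t
      have := intervalIntegral.norm_integral_le_of_norm_le_const (a := 0) (b := (t : ℝ))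
        (f := fun s => v (projIcc 0 1 zero_le_one s)) (C := ‖v‖)
        (fun s _ => v.norm_coe_le_norm _)
      simp only [LinearMap.coe_mk, AddHom.coe_mk, ContinuousMap.coe_mk, one_mul]
      refine this.trans ?_
      rw [sub_zero, abs_of_nonneg t.2.1]
      exact mul_le_of_le_one_right (norm_nonneg _) t.2.2)

theorem primitiveOp_apply (v : C(unitInterval, E)) (t : unitInterval) :
    primitiveOp E v t = ∫ s in (0 : ℝ)..t, v (projIcc 0 1 zero_le_one s) := rfl

theorem norm_primitiveOp_le : ‖primitiveOp E‖ ≤ 1 :=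
  LinearMap.mkContinuous_norm_le _ zero_le_one _

end Superposition

/-! ### The flow of a bounded Lipschitz field -/

section Flow

variable {E : Type} [NormedAddCommGroup E] [NormedSpace ℝ E] [CompleteSpace E]

theorem exists_global_integralCurve {G : E → E} {K L : NNReal} (hL : ∀ x, ‖G x‖ ≤ L)
    (hK : LipschitzWith K G) (x : E) :
    ∃ γ : ℝ → E, γ 0 = x ∧ ∀ t, HasDerivAt γ (G (γ t)) t := by
  have loc : ∀ T : ℝ, 0 < T → ∃ γ : ℝ → E, γ 0 = x ∧ ∀ t ∈ Ioo (-T) T, HasDerivAt γ (G (γ t)) t := by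
    intro T hT
    have h0 : (0 : ℝ) ∈ Icc (-T) T := ⟨by linarith, hT.le⟩
    have pl : IsPicardLindelof (fun _ => G) (tmin := -T) (tmax := T) ⟨0, h0⟩ x
        (L * T.toNNReal) 0 L K :=
      IsPicardLindelof.of_time_independent (fun y _ => hL y) hK.lipschitzOnWith
        (by simp [Real.coe_toNNReal _ hT.le])
    obtain ⟨γ, hγ0, hγ⟩ := pl.exists_eq_forall_mem_Icc_hasDerivWithinAt₀
    exact ⟨γ, hγ0, fun t ht => (hγ t (Ioo_subset_Icc_self ht)).hasDerivAt (Icc_mem_nhds ht.1 ht.2)⟩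
  choose! γ hγ0 hγ using loc
  have uniq : ∀ T T' : ℝ, 0 < T → T ≤ T' → EqOn (γ T) (γ T') (Ioo (-T) T) := by
    intro T T' hT hTT
    refine ODE_solution_unique_of_mem_Ioo (v := fun _ => G) (s := fun _ => univ) (K := K) (t₀ := 0)
      (fun t _ => hK.lipschitzOnWith) ⟨by linarith, hT⟩ (fun t ht => ⟨hγ T hT t ht, trivial⟩)
      (fun t ht => ⟨hγ T' (hT.trans_le hTT) t ⟨by linarith [ht.1], by linarith [ht.2]⟩, trivial⟩) ?_
    rw [hγ0 T hT, hγ0 T' (hT.trans_le hTT)]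
  refine ⟨fun t => γ (|t| + 1) t, by simpa using hγ0 _ (by positivity), fun t => ?_⟩
  have ht : t ∈ Ioo (-(|t| + 1)) (|t| + 1) := by
    constructor <;> [linarith [neg_abs_le t]; linarith [le_abs_self t]]
  have hpos : 0 < |t| + 2 := by positivity
  have e : ∀ s, |s| < |t| + 1 → γ (|s| + 1) s = γ (|t| + 2) s := by
    intro s hs
    refine uniq _ _ (by positivity) (by linarith) ?_
    constructor <;> [linarith [neg_abs_le s]; linarith [le_abs_self s]]
  have e' : (fun s => γ (|s| + 1) s) =ᶠ[𝓝 t] γ (|t| + 2) := by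
    have : ∀ᶠ s in 𝓝 t, |s| < |t| + 1 :=
      continuous_abs.continuousAt.eventually_lt continuousAt_const (by linarith)
    filter_upwards [this] with s hs using e s hs
  have hd := hγ (|t| + 2) hpos t (by
    constructor <;> [linarith [neg_abs_le t]; linarith [le_abs_self t]])
  rw [← e t (by linarith)] at hd
  exact hd.congr_of_eventuallyEq e'

/-- `F` is the flow of the field `G`, defined for all times and smooth. -/
structure IsSmoothFlow (G : E → E) (F : E → ℝ → E) : Prop where
  contDiff : ContDiff ℝ ∞ (Function.uncurry F)
  zero : ∀ x, F x 0 = x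
  hasDerivAt : ∀ x t, HasDerivAt (F x) (G (F x t)) t
  lipschitz : ∃ K, LipschitzWith K G

omit [CompleteSpace E] in
theorem eq_of_hasDerivAt_of_lipschitz {G : E → E} {K : NNReal} (hK : LipschitzWith K G)
    {f g : ℝ → E} (hf : ∀ t, HasDerivAt f (G (f t)) t) (hg : ∀ t, HasDerivAt g (G (g t)) t)
    (h0 : f 0 = g 0) : f = g :=
  ODE_solution_unique_univ (v := fun _ => G) (s := fun _ => univ) (t₀ := 0)
    (fun _ => hK.lipschitzOnWith) (fun t => ⟨hf t, trivial⟩) (fun t => ⟨hg t, trivial⟩) h0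

omit [CompleteSpace E] in
theorem flow_add_of_lipschitz {G : E → E} {F : E → ℝ → E} {K : NNReal} (hK : LipschitzWith K G)
    (h0 : ∀ x, F x 0 = x) (hF : ∀ x t, HasDerivAt (F x) (G (F x t)) t) (x : E) (s t : ℝ) :
    F x (s + t) = F (F x s) t := by
  have := eq_of_hasDerivAt_of_lipschitz hK (f := fun t => F x (s + t)) (g := F (F x s))
    (fun t => by
      have := (hF x (s + t)).scomp t ((hasDerivAt_id t).const_add s)
      simpa [Function.comp_def] using this)
    (hF _) (by simp [h0])
  exact congrFun this t

/-- For short times, the integral equation of the flow is solved by the implicit function theorem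
in `C([0,1], E)`; this gives smooth dependence on the initial point and on time. -/
theorem contDiffAt_flow_of_small_time {G : E → E} (hG : ContDiff ℝ ∞ G) {F : E → ℝ → E}
    {K : NNReal} (hK : LipschitzWith K G)
    (h0 : ∀ x, F x 0 = x) (hF : ∀ x t, HasDerivAt (F x) (G (F x t)) t) (x₀ : E) (t₀ : ℝ)
    (ht₀ : |t₀| * K < 1) :
    ContDiffAt ℝ ∞ (Function.uncurry F) (x₀, t₀) := by
  let cst : E →L[ℝ] C(unitInterval, E) := ContinuousLinearMap.const ℝ unitInterval
  let S : C(unitInterval, E) → C(unitInterval, E) := fun γ => (⟨G, hG.continuous⟩ : C(E, E)).comp γ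
  have hS : ContDiff ℝ ∞ S := contDiff_superposition hG
  let Ψ : (E × ℝ) × C(unitInterval, E) → C(unitInterval, E) := fun q => q.2 - cst q.1.1 - q.1.2 • primitiveOp E (S q.2)
  have hΨ : ContDiff ℝ ∞ Ψ := by
    have h1 : ContDiff ℝ ∞ fun q : (E × ℝ) × C(unitInterval, E) => cst q.1.1 := cst.contDiff.comp (by fun_prop)
    have h2 : ContDiff ℝ ∞ fun q : (E × ℝ) × C(unitInterval, E) => primitiveOp E (S q.2) :=
      (primitiveOp E).contDiff.comp (hS.comp contDiff_snd)
    have h3 : ContDiff ℝ ∞ fun q : (E × ℝ) × C(unitInterval, E) => q.1.2 := by fun_prop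
    exact (contDiff_snd.sub h1).sub (h3.smul h2)
  have hFc : ∀ x, Continuous (F x) := fun x =>
    continuous_iff_continuousAt.2 fun t => (hF x t).continuousAt
  -- the solution of the integral equation given by the flow
  let sol : E × ℝ → C(unitInterval, E) := fun q => ⟨fun t => F q.1 (q.2 * t), by
    have := hFc q.1; fun_prop⟩
  have hsol : ∀ q, Ψ (q, sol q) = 0 := by
    rintro ⟨x, τ⟩
    ext t
    have hder : ∀ s : ℝ, HasDerivAt (fun s => F x (τ * s)) (τ • G (F x (τ * s))) s := by
      intro s
      have := (hF x (τ * s)).scomp s ((hasDerivAt_id s).const_mul τ)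
      simpa [Function.comp_def] using this
    have hint : ∫ s in (0:ℝ)..t, τ • G (F x (τ * s)) = F x (τ * t) - F x (τ * 0) := by
      refine intervalIntegral.integral_eq_sub_of_hasDerivAt (fun s _ => hder s) ?_
      have := hFc x
      have := hG.continuous
      exact Continuous.intervalIntegrable (by fun_prop) _ _
    have hcongr : ∫ s in (0:ℝ)..t, S (sol (x, τ)) (projIcc 0 1 zero_le_one s)
        = ∫ s in (0:ℝ)..t, G (F x (τ * s)) := by
      refine intervalIntegral.integral_congr fun s hs => ?_
      rw [uIcc_of_le t.2.1] at hs
      have : ((projIcc 0 1 zero_le_one s : unitInterval) : ℝ) = s := by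
        rw [projIcc_of_mem zero_le_one ⟨hs.1, hs.2.trans t.2.2⟩]
      change G (F x (τ * (projIcc 0 1 zero_le_one s : unitInterval))) = _
      rw [this]
    rw [intervalIntegral.integral_smul] at hint
    change F x (τ * t) - x - τ • primitiveOp E (S (sol (x, τ))) t = 0
    rw [primitiveOp_apply, hcongr, hint]
    simp [h0]
  -- uniqueness of the solution for short times
  have huniq : ∀ q : E × ℝ, |q.2| * K < 1 → ∀ γ : C(unitInterval, E), Ψ (q, γ) = 0 → γ = sol q := by
    intro q hq γ hγ
    have h1 := hsol q
    have h2 : γ - sol q = q.2 • primitiveOp E (S γ - S (sol q)) := by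
      rw [map_sub, smul_sub]
      simp only [Ψ] at hγ h1
      have e1 := sub_eq_zero.1 hγ
      have e2 := sub_eq_zero.1 h1
      rw [← e1, ← e2]; abel
    have h3 : ‖S γ - S (sol q)‖ ≤ K * ‖γ - sol q‖ := by
      rw [ContinuousMap.norm_le _ (by positivity)]
      intro t
      refine (hK.norm_sub_le _ _).trans (mul_le_mul_of_nonneg_left ?_ K.2)
      exact (γ - sol q).norm_coe_le_norm t
    have h4 : ‖γ - sol q‖ ≤ |q.2| * K * ‖γ - sol q‖ := by
      calc ‖γ - sol q‖ = |q.2| * ‖primitiveOp E (S γ - S (sol q))‖ := by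
            conv_lhs => rw [h2]
            rw [norm_smul, Real.norm_eq_abs]
        _ ≤ |q.2| * (1 * ‖S γ - S (sol q)‖) := by
            gcongr; exact (primitiveOp E).le_of_opNorm_le norm_primitiveOp_le _
        _ ≤ |q.2| * (1 * (K * ‖γ - sol q‖)) := by gcongr
        _ = _ := by ring
    have : ‖γ - sol q‖ = 0 := by nlinarith [norm_nonneg (γ - sol q)]
    exact sub_eq_zero.1 (norm_eq_zero.1 this)
  set u : (E × ℝ) × C(unitInterval, E) := ((x₀, t₀), sol (x₀, t₀)) with hu
  have cdf : ContDiffAt ℝ ∞ Ψ u := hΨ.contDiffAt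
  have hne : (∞ : ℕ∞ω) ≠ 0 := by simp
  let A : C(unitInterval, E) →L[ℝ] C(unitInterval, E) := t₀ • (primitiveOp E).comp (pointwiseApply E E
        ((⟨fderiv ℝ G, hG.continuous_fderiv (by simp)⟩ : C(E, E →L[ℝ] E)).comp (sol (x₀, t₀))))
  have hA : ‖A‖ < 1 := by
    refine lt_of_le_of_lt ?_ ht₀
    refine ContinuousLinearMap.opNorm_le_bound _ (by positivity) fun v => ?_
    simp only [A, smul_apply, ContinuousLinearMap.comp_apply, norm_smul,
      Real.norm_eq_abs, mul_assoc]
    gcongr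
    refine ((primitiveOp E).le_of_opNorm_le norm_primitiveOp_le _).trans ?_
    rw [one_mul, ContinuousMap.norm_le _ (by positivity)]
    intro t
    refine ContinuousLinearMap.le_of_opNorm_le_of_le (fderiv ℝ G (sol (x₀, t₀) t)) ?_
      (v.norm_coe_le_norm t)
    exact norm_fderiv_le_of_lipschitz ℝ hK
  have hder : fderiv ℝ Ψ u ∘L .inr ℝ (E × ℝ) C(unitInterval, E) = 1 - A := by
    have h1 : HasFDerivAt (fun γ : C(unitInterval, E) => Ψ ((x₀, t₀), γ)) (fderiv ℝ Ψ u ∘L .inr ℝ (E × ℝ) C(unitInterval, E))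
        (sol (x₀, t₀)) :=
      HasFDerivAt.comp (sol (x₀, t₀)) (g := Ψ) (f := fun γ : C(unitInterval, E) => ((x₀, t₀), γ))
        (hΨ.differentiable (by simp) u).hasFDerivAt
        (hasFDerivAt_prodMk_right (x₀, t₀) (sol (x₀, t₀)))
    have hG1 : ContDiff ℝ 1 G := hG.of_le (by exact_mod_cast le_top)
    have h2 : HasFDerivAt (fun γ : C(unitInterval, E) => Ψ ((x₀, t₀), γ)) (1 - A) (sol (x₀, t₀)) := by
      have := ((hasFDerivAt_id (𝕜 := ℝ) (sol (x₀, t₀))).sub_const (cst x₀)).sub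
        (((primitiveOp E).hasFDerivAt.comp (sol (x₀, t₀))
          (hasFDerivAt_superposition hG1 (sol (x₀, t₀)))).const_smul t₀)
      exact this
    exact h1.unique h2
  have hinv : (fderiv ℝ Ψ u ∘L .inr ℝ (E × ℝ) C(unitInterval, E)).IsInvertible := by
    rw [hder]
    obtain ⟨w, hw⟩ := isUnit_one_sub_of_norm_lt_one (x := A) hA
    exact ⟨ContinuousLinearEquiv.unitsEquiv ℝ C(unitInterval, E) w, by ext v; simp [← hw]⟩
  have hu0 : Ψ u = 0 := hsol _
  have e1 := cdf.eventually_apply_implicitFunction hne hinv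
  have e2 := cdf.contDiffAt_implicitFunction hne hinv
  have e3 : ∀ᶠ q : E × ℝ in 𝓝 (x₀, t₀), |q.2| * K < 1 :=
    (by fun_prop : Continuous fun q : E × ℝ => |q.2| * (K : ℝ)).continuousAt.eventually_lt
      continuousAt_const ht₀
  have e4 : Function.uncurry F =ᶠ[𝓝 (x₀, t₀)]
      fun q => ContinuousMap.evalCLM ℝ (1 : unitInterval) (cdf.implicitFunction hne hinv q) := by
    filter_upwards [e1, e3] with q hq1 hq3
    rw [hu0] at hq1
    rw [huniq q hq3 _ hq1]
    simp [sol, Function.uncurry]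
  exact (((ContinuousMap.evalCLM ℝ (1 : unitInterval) (M := E)).contDiff.contDiffAt).comp
    (x₀, t₀) e2).congr_of_eventuallyEq e4

/-- A smooth, bounded, globally Lipschitz field has a smooth flow defined for all times. -/
theorem exists_isSmoothFlow {G : E → E} (hG : ContDiff ℝ ∞ G) {K L : NNReal}
    (hL : ∀ x, ‖G x‖ ≤ L) (hK : LipschitzWith K G) : ∃ F, IsSmoothFlow G F := by
  choose F h0 hF using exists_global_integralCurve hL hK
  refine ⟨F, ?_, h0, hF, K, hK⟩
  have step : ∀ n : ℕ, ∀ (x : E) (t : ℝ), |t| * (K : ℝ) < n + 1 → ContDiffAt ℝ ∞ (Function.uncurry F) (x, t) := by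
    intro n
    induction n with
    | zero => intro x t ht; exact contDiffAt_flow_of_small_time hG hK h0 hF x t (by simpa using ht)
    | succ n ih =>
      intro x t ht
      have hn : (0 : ℝ) < n + 1 := by positivity
      -- split the time `t` into a part of size less than `1 / K` and the remaining part
      set c : ℝ := (n + 1) / (n + 2) with hc
      have hc0 : 0 ≤ c := by positivity
      have hc1 : 1 - c = 1 / (n + 2) := by rw [hc]; field_simp; ring
      have b1 : |c * t| * K < n + 1 := by
        rw [abs_mul, abs_of_nonneg hc0, mul_assoc]
        calc c * (|t| * K) < c * (n + 2) := by
              refine mul_lt_mul_of_pos_left ?_ (by positivity)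
              push_cast at ht; linarith
          _ = n + 1 := by rw [hc]; field_simp
      have b2 : |(1 - c) * t| * K < 1 := by
        rw [abs_mul, hc1, abs_of_nonneg (by positivity), mul_assoc, one_div, inv_mul_lt_iff₀ (by positivity)]
        push_cast at ht; linarith
      have e : Function.uncurry F = fun q : E × ℝ =>
          Function.uncurry F (Function.uncurry F (q.1, c * q.2), (1 - c) * q.2) := by
        ext q
        simp only [Function.uncurry]
        rw [← flow_add_of_lipschitz hK h0 hF]
        congr 1; ring
      rw [e]
      have i1 : ContDiffAt ℝ ∞ (fun q : E × ℝ => Function.uncurry F (q.1, c * q.2)) (x, t) :=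
        (ih x (c * t) b1).comp (x, t) (f := fun q : E × ℝ => (q.1, c * q.2)) (by fun_prop)
      have i2 : ContDiffAt ℝ ∞ (fun q : E × ℝ => (Function.uncurry F (q.1, c * q.2), (1 - c) * q.2))
          (x, t) := i1.prodMk (by fun_prop)
      exact (contDiffAt_flow_of_small_time hG hK h0 hF (F x (c * t)) ((1 - c) * t) b2).comp (x, t) i2
  refine contDiff_iff_contDiffAt.2 fun q => ?_
  obtain ⟨n, hn⟩ := exists_nat_gt (|q.2| * K)
  exact step n q.1 q.2 (by linarith)

end Flow

namespace IsSmoothFlow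

variable {E : Type} [NormedAddCommGroup E] [NormedSpace ℝ E] {G : E → E} {F : E → ℝ → E}

theorem add (h : IsSmoothFlow G F) (x : E) (s t : ℝ) : F x (s + t) = F (F x s) t := by
  obtain ⟨K, hK⟩ := h.lipschitz
  exact flow_add_of_lipschitz hK h.zero h.hasDerivAt x s t

theorem continuous (h : IsSmoothFlow G F) : Continuous (Function.uncurry F) :=
  h.contDiff.continuous

theorem continuous_time (h : IsSmoothFlow G F) (x : E) : Continuous (F x) :=
  h.continuous.comp (by fun_prop : Continuous fun t : ℝ => (x, t))

end IsSmoothFlow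

/-! ### Cut-off flows and the relation `FlowsTo` -/

/-- `F` is the complete smooth flow of a field which agrees with `G` on the ball of radius `R`
around the origin. -/
def IsCutoffFlow (G : Plane → Plane) (R : ℝ) (F : Plane → ℝ → Plane) : Prop :=
  ∃ Gt : Plane → Plane, IsSmoothFlow Gt F ∧ ∀ x ∈ Metric.ball (0 : Plane) R, Gt x = G x

theorem exists_isCutoffFlow {G : Plane → Plane} (hG : ContDiff ℝ ∞ G) (R : ℝ) :
    ∃ F, IsCutoffFlow G R F := by
  let χ : ContDiffBump (0 : Plane) :=
    ⟨max R 1, max R 1 + 1, by positivity, by linarith⟩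
  have h1 : ContDiff ℝ ∞ (fun x => χ x • G x) := χ.contDiff.smul hG
  have h2 : HasCompactSupport (fun x => χ x • G x) := χ.hasCompactSupport.smul_right
  obtain ⟨K, hK⟩ := h1.lipschitzWith_of_hasCompactSupport h2 (by simp)
  obtain ⟨C, hC⟩ := h2.exists_bound_of_continuous h1.continuous
  obtain ⟨F, hF⟩ := exists_isSmoothFlow h1 (L := C.toNNReal)
    (fun x => (hC x).trans (Real.le_coe_toNNReal C)) hK
  refine ⟨F, _, hF, fun x hx => ?_⟩
  have : χ x = 1 := χ.one_of_mem_closedBall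
    (Metric.closedBall_subset_closedBall (le_max_left _ _) (Metric.ball_subset_closedBall hx))
  simp [this]

theorem IsCutoffFlow.isSmoothFlow_data {G : Plane → Plane} {R : ℝ} {F : Plane → ℝ → Plane}
    (h : IsCutoffFlow G R F) :
    ContDiff ℝ ∞ (Function.uncurry F) ∧ (∀ x, F x 0 = x) ∧
      (∀ x s t, F x (s + t) = F (F x s) t) := by
  obtain ⟨Gt, h1, -⟩ := h
  exact ⟨h1.contDiff, h1.zero, h1.add⟩

namespace IsCutoffFlow

variable {G : Plane → Plane} {R : ℝ} {F : Plane → ℝ → Plane}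

theorem contDiff (h : IsCutoffFlow G R F) : ContDiff ℝ ∞ (Function.uncurry F) :=
  h.isSmoothFlow_data.1

theorem zero (h : IsCutoffFlow G R F) (x : Plane) : F x 0 = x := h.isSmoothFlow_data.2.1 x

theorem add (h : IsCutoffFlow G R F) (x : Plane) (s t : ℝ) : F x (s + t) = F (F x s) t :=
  h.isSmoothFlow_data.2.2 x s t

theorem continuous (h : IsCutoffFlow G R F) : Continuous (Function.uncurry F) :=
  h.contDiff.continuous

theorem continuous_time (h : IsCutoffFlow G R F) (x : Plane) : Continuous (F x) :=
  h.continuous.comp (by fun_prop : Continuous fun t : ℝ => (x, t))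

theorem hasDerivAt (h : IsCutoffFlow G R F) {x : Plane} {t : ℝ}
    (hx : F x t ∈ Metric.ball (0 : Plane) R) : HasDerivAt (F x) (G (F x t)) t := by
  obtain ⟨Gt, h1, h2⟩ := h
  rw [← h2 _ hx]; exact h1.hasDerivAt x t

/-- An integral curve of `G` inside the ball of radius `R` is a trajectory of the cut-off flow. -/
theorem eq_of_isIntegralCurveOn (h : IsCutoffFlow G R F) {γ : ℝ → Plane} {t : ℝ}
    (hγ : IsIntegralCurveOn γ (fun _ => G) (uIcc 0 t))
    (hR : ∀ s ∈ uIcc 0 t, γ s ∈ Metric.ball (0 : Plane) R) :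
    ∀ s ∈ uIcc 0 t, γ s = F (γ 0) s := by
  obtain ⟨Gt, h1, h2⟩ := h
  obtain ⟨K, hK⟩ := h1.lipschitz
  have hγ' : ∀ s ∈ uIcc 0 t, HasDerivWithinAt γ (Gt (γ s)) (uIcc 0 t) s := by
    intro s hs
    rw [h2 _ (hR s hs)]; exact hγ s hs
  have hc : ContinuousOn γ (uIcc 0 t) := fun s hs => (hγ' s hs).continuousWithinAt
  rcases le_total 0 t with ht | ht
  · rw [uIcc_of_le ht] at *
    exact ODE_solution_unique (v := fun _ => Gt) (fun _ => hK) hc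
      (fun s hs => (hγ' s (Ico_subset_Icc_self hs)).mono_of_mem_nhdsWithin
        (Filter.mem_of_superset (Icc_mem_nhdsGE hs.2) (Icc_subset_Icc_left hs.1)))
      (h1.continuous_time _).continuousOn (fun s _ => (h1.hasDerivAt _ s).hasDerivWithinAt)
      (h1.zero _).symm
  · rw [uIcc_of_ge ht] at *
    exact ODE_solution_unique_of_mem_Icc_left (v := fun _ => Gt) (s := fun _ => univ)
      (fun _ _ => hK.lipschitzOnWith) hc
      (fun s hs => (hγ' s (Ioc_subset_Icc_self hs)).mono_of_mem_nhdsWithin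
        (Filter.mem_of_superset (Icc_mem_nhdsLE hs.1) (Icc_subset_Icc_right hs.2)))
      (fun _ _ => trivial)
      (h1.continuous_time _).continuousOn (fun s _ => (h1.hasDerivAt _ s).hasDerivWithinAt)
      (fun _ _ => trivial) (h1.zero _).symm

theorem flowsTo (h : IsCutoffFlow G R F) {z : Plane} {t : ℝ}
    (hR : ∀ s ∈ uIcc 0 t, F z s ∈ Metric.ball (0 : Plane) R) : FlowsTo G z t (F z t) :=
  ⟨F z, h.zero z, rfl, fun s hs => (h.hasDerivAt (hR s hs)).hasDerivWithinAt⟩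

/-- If the trajectory of the cut-off flow over `[0, t]` stays in the ball, it stays there for
nearby initial points and times. -/
theorem eventually_mem_ball (h : IsCutoffFlow G R F) {z : Plane} {t : ℝ}
    (hR : ∀ s ∈ uIcc 0 t, F z s ∈ Metric.ball (0 : Plane) R) :
    ∀ᶠ q : Plane × ℝ in 𝓝 (z, t), ∀ s ∈ uIcc 0 q.2, F q.1 s ∈ Metric.ball (0 : Plane) R := by
  have hc : Continuous fun p : (Plane × ℝ) × ℝ => F p.1.1 (p.2 * p.1.2) :=
    h.continuous.comp (by fun_prop : Continuous fun p : (Plane × ℝ) × ℝ => (p.1.1, p.2 * p.1.2))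
  have key : ∀ᶠ q : Plane × ℝ in 𝓝 (z, t), ∀ r ∈ Icc (0 : ℝ) 1,
      F q.1 (r * q.2) ∈ Metric.ball (0 : Plane) R := by
    refine isCompact_Icc.eventually_forall_of_forall_eventually fun r hr => ?_
    refine hc.continuousAt.eventually_mem (Metric.isOpen_ball.mem_nhds (hR _ ?_))
    rcases le_total 0 t with ht | ht
    · rw [uIcc_of_le ht]; exact ⟨by nlinarith [hr.1], by nlinarith [hr.2]⟩
    · rw [uIcc_of_ge ht]; exact ⟨by nlinarith [hr.2], by nlinarith [hr.1]⟩
  filter_upwards [key] with q hq s hs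
  by_cases h0 : q.2 = 0
  · rw [h0] at hs
    have := hq 0 ⟨le_rfl, zero_le_one⟩
    simp only [uIcc_self, mem_singleton_iff] at hs
    simpa [hs] using this
  · have hs' : s / q.2 ∈ Icc (0 : ℝ) 1 := by
      rcases lt_or_gt_of_ne h0 with hn | hp
      · rw [uIcc_of_ge hn.le] at hs
        exact ⟨div_nonneg_of_nonpos hs.2 hn.le, (div_le_one_of_neg hn).2 hs.1⟩
      · rw [uIcc_of_le hp.le] at hs
        exact ⟨div_nonneg hs.1 hp.le, (div_le_one hp).2 hs.2⟩
    have := hq _ hs'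
    rwa [div_mul_cancel₀ _ h0] at this

end IsCutoffFlow

section FlowsTo

variable {G : Plane → Plane}

/-- Every trajectory segment of `G` is a trajectory segment of the flow of any cut-off of `G` outside
a sufficiently large ball. -/
theorem FlowsTo.exists_radius {z w : Plane} {t : ℝ} (h : FlowsTo G z t w) :
    ∃ R₀ : ℝ, ∀ R ≥ R₀, ∀ F, IsCutoffFlow G R F →
      (∀ s ∈ uIcc 0 t, F z s ∈ Metric.ball (0 : Plane) R) ∧ F z t = w := by
  obtain ⟨γ, h0, h1, hγ⟩ := h
  have hc : ContinuousOn γ (uIcc 0 t) := fun s hs => (hγ s hs).continuousWithinAt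
  obtain ⟨C, hC⟩ := (isCompact_uIcc.image_of_continuousOn hc).isBounded.exists_norm_le
  refine ⟨C + 1, fun R hR F hF => ?_⟩
  have hball : ∀ s ∈ uIcc 0 t, γ s ∈ Metric.ball (0 : Plane) R := fun s hs => by
    rw [mem_ball_zero_iff]; linarith [hC _ (mem_image_of_mem γ hs)]
  have e := hF.eq_of_isIntegralCurveOn hγ hball
  rw [h0] at e
  exact ⟨fun s hs => by rw [← e s hs]; exact hball s hs, by rw [← e t right_mem_uIcc, h1]⟩

theorem FlowsTo.unique (hG : ContDiff ℝ ∞ G) {z w w' : Plane} {t : ℝ} (h : FlowsTo G z t w)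
    (h' : FlowsTo G z t w') : w = w' := by
  obtain ⟨R, hR⟩ := h.exists_radius
  obtain ⟨R', hR'⟩ := h'.exists_radius
  obtain ⟨F, hF⟩ := exists_isCutoffFlow hG (max R R')
  rw [← (hR _ (le_max_left _ _) F hF).2, (hR' _ (le_max_right _ _) F hF).2]

theorem FlowsTo.refl (z : Plane) : FlowsTo G z 0 z :=
  ⟨fun _ => z, rfl, rfl, fun s hs => by
    have : s = 0 := by simpa using hs
    subst this
    rw [uIcc_self]
    exact HasFDerivWithinAt.singleton⟩

theorem FlowsTo.trans (hG : ContDiff ℝ ∞ G) {z w x : Plane} {s t : ℝ} (h : FlowsTo G z s w)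
    (h' : FlowsTo G w t x) : FlowsTo G z (s + t) x := by
  obtain ⟨R, hR⟩ := h.exists_radius
  obtain ⟨R', hR'⟩ := h'.exists_radius
  obtain ⟨F, hF⟩ := exists_isCutoffFlow hG (max R R')
  obtain ⟨a1, a2⟩ := hR _ (le_max_left _ _) F hF
  obtain ⟨b1, b2⟩ := hR' _ (le_max_right _ _) F hF
  have : F z (s + t) = x := by rw [hF.add, a2, b2]
  rw [← this]
  refine hF.flowsTo fun r hr => ?_
  by_cases hrs : r ∈ uIcc 0 s
  · exact a1 r hrs
  · have e : F z r = F w (r - s) := by rw [← a2, ← hF.add]; congr 1; ring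
    rw [e]
    refine b1 _ ?_
    rw [mem_uIcc] at *
    grind

theorem FlowsTo.symm (hG : ContDiff ℝ ∞ G) {z w : Plane} {t : ℝ} (h : FlowsTo G z t w) :
    FlowsTo G w (-t) z := by
  obtain ⟨R, hR⟩ := h.exists_radius
  obtain ⟨F, hF⟩ := exists_isCutoffFlow hG R
  obtain ⟨a1, a2⟩ := hR _ le_rfl F hF
  have e : ∀ r, F w r = F z (t + r) := fun r => by rw [hF.add, a2]
  have : F w (-t) = z := by rw [e, add_neg_cancel, hF.zero]
  conv_rhs => rw [← this]
  refine hF.flowsTo fun r hr => ?_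
  rw [e]
  refine a1 _ ?_
  rw [mem_uIcc] at *
  grind

theorem FlowsTo.exists_localFlow (hG : ContDiff ℝ ∞ G) {z w : Plane} {t : ℝ}
    (h : FlowsTo G z t w) : ∃ F : Plane → ℝ → Plane, ContDiff ℝ ∞ (Function.uncurry F) ∧
      F z t = w ∧ ∀ᶠ q : Plane × ℝ in 𝓝 (z, t), FlowsTo G q.1 q.2 (F q.1 q.2) := by
  obtain ⟨R, hR⟩ := h.exists_radius
  obtain ⟨F, hF⟩ := exists_isCutoffFlow hG R
  obtain ⟨a1, a2⟩ := hR _ le_rfl F hF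
  refine ⟨F, hF.contDiff, a2, ?_⟩
  filter_upwards [hF.eventually_mem_ball a1] with q hq using hF.flowsTo hq

theorem FlowsTo.eq_of_zero (hG : ContDiff ℝ ∞ G) {z w : Plane} {t : ℝ} (hz : G z = 0)
    (h : FlowsTo G z t w) : w = z :=
  h.unique hG ⟨fun _ => z, rfl, rfl, fun s _ => by
    change HasDerivWithinAt (fun _ => z) (G z) _ _
    rw [hz]; exact hasDerivWithinAt_const _ _ _⟩

theorem flowsTo_of_zero {z : Plane} (hz : G z = 0) (t : ℝ) : FlowsTo G z t z :=
  ⟨fun _ => z, rfl, rfl, fun s _ => by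
    change HasDerivWithinAt (fun _ => z) (G z) _ _
    rw [hz]; exact hasDerivWithinAt_const _ _ _⟩

theorem FlowsTo.ne_zero (hG : ContDiff ℝ ∞ G) {z w : Plane} {t : ℝ} (hz : G z ≠ 0)
    (h : FlowsTo G z t w) : G w ≠ 0 := by
  intro hw
  have := (h.symm hG).eq_of_zero hG hw
  exact hz (this ▸ hw)

theorem self_mem_orbit (z : Plane) : z ∈ orbit G z := ⟨0, FlowsTo.refl z⟩

end FlowsTo

/-! ### Flow boxes -/

/-- Applied to the transversal coordinate of a curve within one orbit, which takes countably many
values only, this keeps the curve on a single trajectory of a flow box. -/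
theorem IsPreconnected.subsingleton_of_countable_real {S : Set ℝ} (hS : IsPreconnected S)
    (hc : S.Countable) : S.Subsingleton := by
  intro a ha b hb
  by_contra hab
  wlog h : a < b generalizing a b
  · exact this hb ha (Ne.symm hab) (lt_of_le_of_ne (not_lt.1 h) (Ne.symm hab))
  obtain ⟨x, hx, hxS⟩ := (hc.dense_compl ℝ).exists_mem_open isOpen_Ioo (nonempty_Ioo.2 h)
  exact hx (hS.Icc_subset ha hb (Ioo_subset_Icc_self hxS))

/-- A flow box around a regular point `w₀`, described by its time function `T`: it measures the
time along short pieces of trajectories, and a connected part of an orbit inside the box lies on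
one trajectory. -/
structure FlowBox (G : Plane → Plane) (w₀ : Plane) where
  /-- The domain of the box. -/
  N : Set Plane
  /-- The time function. -/
  T : Plane → ℝ
  /-- The time scale of the box. -/
  δ : ℝ
  isOpen : IsOpen N
  mem : w₀ ∈ N
  pos : 0 < δ
  contDiffAt : ContDiffAt ℝ ∞ T w₀
  continuousOn : ContinuousOn T N
  time_eq : ∀ w ∈ N, ∀ w' ∈ N, ∀ s, |s| ≤ δ → FlowsTo G w s w' → T w' = T w + s
  flowsTo : ∀ (z : Plane) (S : Set ℝ) (c : ℝ → Plane), IsPreconnected S → ContinuousOn c S →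
    (∀ t ∈ S, c t ∈ N ∧ c t ∈ orbit G z) →
    ∀ t ∈ S, ∀ t' ∈ S, FlowsTo G (c t) (T (c t') - T (c t)) (c t')

/-- Near a regular point there is a flow box: the time and the position on a transversal segment
are local coordinates, by the inverse function theorem. -/
theorem exists_flowBox {G : Plane → Plane} (hG : ContDiff ℝ ∞ G) {w₀ : Plane} (h0 : G w₀ ≠ 0) :
    Nonempty (FlowBox G w₀) := by
  set R := ‖w₀‖ + 1 with hRdef
  obtain ⟨F, hF⟩ := exists_isCutoffFlow hG R
  have hw₀R : F w₀ 0 ∈ Metric.ball (0 : Plane) R := by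
    rw [hF.zero, mem_ball_zero_iff]; linarith
  set ν : Plane := !₂[-(G w₀ 1), G w₀ 0] with hν
  let Θ : ℝ × ℝ → Plane := fun q => F (w₀ + q.1 • ν) q.2
  have hΘ : ContDiff ℝ ∞ Θ :=
    hF.contDiff.comp (by fun_prop : ContDiff ℝ ∞ fun q : ℝ × ℝ => (w₀ + q.1 • ν, q.2))
  let A : ℝ × ℝ →L[ℝ] Plane := (ContinuousLinearMap.fst ℝ ℝ ℝ).smulRight ν +
    (ContinuousLinearMap.snd ℝ ℝ ℝ).smulRight (G w₀)
  have hder : HasFDerivAt Θ A 0 := by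
    have hd := (hΘ.differentiable (by simp) (0 : ℝ × ℝ)).hasFDerivAt
    have e1 : fderiv ℝ Θ 0 (1, 0) = ν := by
      have h1 : HasDerivAt (fun y : ℝ => Θ (y, 0)) (fderiv ℝ Θ 0 (1, 0)) 0 :=
        HasFDerivAt.comp_hasDerivAt (0 : ℝ) (f := fun y : ℝ => (y, (0 : ℝ))) (l := Θ) hd
          ((hasDerivAt_id 0).prodMk (hasDerivAt_const _ _))
      have h2 : HasDerivAt (fun y : ℝ => Θ (y, 0)) ν 0 := by
        have : (fun y : ℝ => Θ (y, 0)) = fun y => w₀ + y • ν := by ext1 y; exact hF.zero _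
        rw [this]
        simpa using ((hasDerivAt_id (0 : ℝ)).smul_const ν).const_add w₀
      exact h1.unique h2
    have e2 : fderiv ℝ Θ 0 (0, 1) = G w₀ := by
      have h1 : HasDerivAt (fun s : ℝ => Θ (0, s)) (fderiv ℝ Θ 0 (0, 1)) 0 :=
        HasFDerivAt.comp_hasDerivAt (0 : ℝ) (f := fun s : ℝ => ((0 : ℝ), s)) (l := Θ) hd
          ((hasDerivAt_const _ _).prodMk (hasDerivAt_id 0))
      have h2 : HasDerivAt (fun s : ℝ => Θ (0, s)) (G w₀) 0 := by
        have : (fun s : ℝ => Θ (0, s)) = F w₀ := by ext1 s; simp [Θ]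
        rw [this]
        have := hF.hasDerivAt hw₀R
        rwa [hF.zero] at this
      exact h1.unique h2
    have : fderiv ℝ Θ 0 = A := by
      ext1
      · ext1; simp [A, e1]
      · ext1; simp [A, e2]
    rwa [this] at hd
  have hinj : Function.Injective A := by
    rw [injective_iff_map_eq_zero]
    rintro ⟨y, s⟩ h
    have c0 := congrArg (fun v : Plane => v 0) h
    have c1 := congrArg (fun v : Plane => v 1) h
    simp [A, hν] at c0 c1
    have hn : 0 < (G w₀ 0) ^ 2 + (G w₀ 1) ^ 2 := by
      by_contra hcon
      have i0 : G w₀ 0 = 0 := by nlinarith [sq_nonneg (G w₀ 0), sq_nonneg (G w₀ 1)]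
      have i1 : G w₀ 1 = 0 := by nlinarith [sq_nonneg (G w₀ 0), sq_nonneg (G w₀ 1)]
      exact h0 (by ext i; fin_cases i <;> simp [i0, i1])
    have hy : y * ((G w₀ 0) ^ 2 + (G w₀ 1) ^ 2) = 0 := by linear_combination (G w₀ 0) * c1 - (G w₀ 1) * c0
    have hs : s * ((G w₀ 0) ^ 2 + (G w₀ 1) ^ 2) = 0 := by linear_combination (G w₀ 1) * c1 + (G w₀ 0) * c0
    simp [(mul_eq_zero.1 hy).resolve_right hn.ne', (mul_eq_zero.1 hs).resolve_right hn.ne']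
  let A' : (ℝ × ℝ) ≃L[ℝ] Plane :=
    (LinearMap.linearEquivOfInjective (A : ℝ × ℝ →ₗ[ℝ] Plane) hinj (by simp)).toContinuousLinearEquiv
  have hA' : HasFDerivAt Θ (A' : ℝ × ℝ →L[ℝ] Plane) 0 := by
    convert hder using 1; ext v <;> rfl
  have hne : (∞ : ℕ∞ω) ≠ 0 := by simp
  set e := hΘ.contDiffAt.toOpenPartialHomeomorph Θ hA' hne with he
  have hcoe : ∀ q, e q = Θ q := fun q => rfl
  have hΘ0 : Θ 0 = w₀ := by simp [Θ, hF.zero]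
  have hsrc : (0 : ℝ × ℝ) ∈ e.source := hΘ.contDiffAt.mem_toOpenPartialHomeomorph_source hA' hne
  have hsm : ContDiffAt ℝ ∞ e.symm w₀ := by
    have := hΘ.contDiffAt.to_localInverse hA' hne
    rwa [hΘ0] at this
  -- a box on which everything stays inside the domain of `e` and inside the ball
  obtain ⟨ε, hε, hbox⟩ : ∃ ε > 0, ∀ q : ℝ × ℝ, |q.1| < ε → |q.2| < ε →
      q ∈ e.source ∧ Θ q ∈ Metric.ball (0 : Plane) R := by
    have h1 : ∀ᶠ q in 𝓝 (0 : ℝ × ℝ), q ∈ e.source ∧ Θ q ∈ Metric.ball (0 : Plane) R := by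
      refine Filter.Eventually.and (e.open_source.mem_nhds hsrc) (hΘ.continuous.continuousAt.eventually_mem
        (Metric.isOpen_ball.mem_nhds ?_))
      simpa [hΘ0, hF.zero] using hw₀R
    obtain ⟨ε, hε, h⟩ := Metric.eventually_nhds_iff.1 h1
    refine ⟨ε, hε, fun q h1 h2 => h ?_⟩
    simpa [Prod.norm_def, dist_zero_right] using ⟨h1, h2⟩
  set δ := ε / 4 with hδ
  have hδ0 : 0 < δ := by positivity
  have hδε : 4 * δ = ε := by rw [hδ]; ring
  set N : Set Plane := e.target ∩ e.symm ⁻¹' (Ioo (-δ) δ ×ˢ Ioo (-δ) δ) with hN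
  have hNo : IsOpen N := e.symm.isOpen_inter_preimage (isOpen_Ioo.prod isOpen_Ioo)
  have hrep : ∀ w ∈ N, |(e.symm w).1| < δ ∧ |(e.symm w).2| < δ ∧
      w = F (w₀ + (e.symm w).1 • ν) (e.symm w).2 := by
    rintro w ⟨hw, hw1, hw2⟩
    exact ⟨abs_lt.2 hw1, abs_lt.2 hw2, (e.right_inv hw).symm⟩
  have hflow : ∀ w ∈ N, ∀ s, |s| ≤ 2 * δ →
      FlowsTo G w s (Θ ((e.symm w).1, (e.symm w).2 + s)) := by
    intro w hw s hs
    obtain ⟨h1, h2, h3⟩ := hrep w hw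
    have key : ∀ r, F w r = Θ ((e.symm w).1, (e.symm w).2 + r) := by
      intro r
      conv_lhs => rw [h3]
      exact (hF.add _ _ _).symm
    rw [← key]
    refine hF.flowsTo fun r hr => ?_
    rw [key]
    refine (hbox _ (by simpa using by linarith) ?_).2
    have hr' : |r| ≤ 2 * δ := by
      rw [mem_uIcc] at hr
      rw [abs_le] at *
      grind
    exact (abs_add_le _ _).trans_lt (by linarith)
  have hcoord : ∀ w ∈ N, ∀ w', ∀ s, |s| ≤ 2 * δ → FlowsTo G w s w' →
      e.symm w' = ((e.symm w).1, (e.symm w).2 + s) := by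
    intro w hw w' s hs h
    obtain ⟨h1, h2, -⟩ := hrep w hw
    rw [h.unique hG (hflow w hw s hs), ← hcoe]
    refine e.left_inv (hbox _ (by simpa using by linarith) ?_).1
    exact (abs_add_le _ _).trans_lt (by linarith)
  refine ⟨⟨N, fun w => (e.symm w).2, δ, hNo, ?_, hδ0, contDiffAt_snd.comp w₀ hsm, ?_, ?_, ?_⟩⟩
  · have h1 : e.symm w₀ = 0 := by rw [← hΘ0, ← hcoe, e.left_inv hsrc]
    refine ⟨?_, ?_⟩
    · rw [← hΘ0, ← hcoe]; exact e.map_source hsrc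
    · simp [h1, hδ0]
  · exact continuous_snd.comp_continuousOn (e.continuousOn_symm.mono inter_subset_left)
  · intro w hw w' _ s hs h
    rw [hcoord w hw w' s (by linarith) h]
  · intro z S c hS hc hcS t ht t' ht'
    -- the transversal coordinate takes countably many values on an orbit
    have hcount : ((fun w => (e.symm w).1) '' (N ∩ orbit G z)).Countable := by
      have hch : ∀ a : (fun w => (e.symm w).1) '' (N ∩ orbit G z), ∃ w s, w ∈ N ∧
          FlowsTo G z s w ∧ (e.symm w).1 = a := by
        rintro ⟨a, w, ⟨hw, s, hs⟩, rfl⟩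
        exact ⟨w, s, hw, hs, rfl⟩
      choose w s hwN hws hwa using hch
      refine countable_coe_iff.1 (Function.Injective.countable (f := fun a => ⌊s a / δ⌋) ?_)
      intro a b hab
      have h1 : |s b / δ - s a / δ| < 1 := Int.abs_sub_lt_one_of_floor_eq_floor hab.symm
      have h2 : |s b - s a| < δ := by
        rw [← sub_div, abs_div, abs_of_pos hδ0, div_lt_one hδ0] at h1
        exact h1
      have h3 : FlowsTo G (w a) (s b - s a) (w b) := by
        have := ((hws a).symm hG).trans hG (hws b)
        rwa [neg_add_eq_sub] at this
      have h4 := hcoord _ (hwN a) _ _ (by linarith) h3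
      apply Subtype.ext
      rw [← hwa a, ← hwa b, h4]
    have hsub : ((fun w => (e.symm w).1) ∘ c '' S).Subsingleton := by
      refine IsPreconnected.subsingleton_of_countable_real (hS.image _ ?_) (hcount.mono ?_)
      · refine continuous_fst.comp_continuousOn (e.continuousOn_symm.comp hc ?_)
        exact fun r hr => (hcS r hr).1.1
      · rintro _ ⟨r, hr, rfl⟩
        exact ⟨c r, hcS r hr, rfl⟩
    have hY : (e.symm (c t)).1 = (e.symm (c t')).1 :=
      hsub ⟨t, ht, rfl⟩ ⟨t', ht', rfl⟩
    obtain ⟨a1, a2, a3⟩ := hrep _ (hcS t ht).1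
    obtain ⟨b1, b2, b3⟩ := hrep _ (hcS t' ht').1
    have := hflow _ (hcS t ht).1 ((e.symm (c t')).2 - (e.symm (c t)).2)
      ((abs_sub _ _).trans (by linarith))
    have e3 : Θ ((e.symm (c t)).1, (e.symm (c t)).2 + ((e.symm (c t')).2 - (e.symm (c t)).2)) = c t' := by
      rw [hY, add_sub_cancel]
      exact b3.symm
    rwa [e3] at this

/-! ### Flatness at the origin and leading terms -/

section Flat

variable {E F : Type} [NormedAddCommGroup E] [NormedSpace ℝ E]
  [NormedAddCommGroup F] [NormedSpace ℝ F]

theorem iteratedDeriv_comp_smul {u : E → F} {z : E} (j : ℕ) {s : ℝ}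
    (hu : ContDiffAt ℝ j u (s • z)) :
    iteratedDeriv j (fun s : ℝ => u (s • z)) s = iteratedFDeriv ℝ j u (s • z) (fun _ => z) := by
  induction j generalizing s with
  | zero => simp
  | succ j ih =>
    rw [iteratedDeriv_succ]
    have hc : Continuous fun s : ℝ => s • z := by fun_prop
    have h1 : ∀ᶠ r in 𝓝 s, ContDiffAt ℝ j u (r • z) := by
      have h2 : ∀ᶠ y in 𝓝 (s • z), ContDiffAt ℝ (j + 1 : ℕ) u y := hu.eventually (by simp)
      filter_upwards [hc.continuousAt.eventually h2] with r hr
      exact hr.of_le (by exact_mod_cast Nat.le_succ j)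
    have h2 : (iteratedDeriv j fun s : ℝ => u (s • z)) =ᶠ[𝓝 s]
        fun r => iteratedFDeriv ℝ j u (r • z) (fun _ => z) := by
      filter_upwards [h1] with r hr using ih hr
    rw [h2.deriv_eq]
    have h3 : HasFDerivAt (iteratedFDeriv ℝ j u) (fderiv ℝ (iteratedFDeriv ℝ j u) (s • z)) (s • z) :=
      (hu.differentiableAt_iteratedFDeriv (by exact_mod_cast Nat.lt_succ_self j)).hasFDerivAt
    have h4 : HasDerivAt (fun r : ℝ => r • z) z s := by
      simpa using (hasDerivAt_id s).smul_const z
    have h5 := h3.comp_hasDerivAt s h4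
    have h6 : HasDerivAt (fun r : ℝ => iteratedFDeriv ℝ j u (r • z) (fun _ => z))
        (fderiv ℝ (iteratedFDeriv ℝ j u) (s • z) z (fun _ => z)) s :=
      ((ContinuousMultilinearMap.apply ℝ (fun _ : Fin j => E) F (fun _ => z)).hasFDerivAt).comp_hasDerivAt
        s h5
    rw [h6.deriv, iteratedFDeriv_succ_apply_left]
    rfl

/-- A function of class `C^n` is so on a ball on which its `n`-th derivative is bounded. -/
theorem ContDiffAt.exists_ball_bound {u : E → F} {n : ℕ} {x : E} (hu : ContDiffAt ℝ n u x) :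
    ∃ ρ > 0, ∃ B ≥ 0, ∀ z ∈ Metric.ball x ρ, ContDiffAt ℝ n u z ∧
      ‖iteratedFDeriv ℝ n u z‖ ≤ B := by
  have h1 : ∀ᶠ y in 𝓝 x, ContDiffAt ℝ n u y := hu.eventually (by simp)
  have h2 : ContinuousAt (iteratedFDeriv ℝ n u) x := hu.continuousAt_iteratedFDeriv le_rfl
  have h3 := h2.norm.eventually_le_const (lt_add_one ‖iteratedFDeriv ℝ n u x‖)
  obtain ⟨ρ, hρ, h⟩ := Metric.eventually_nhds_iff_ball.1 (h1.and h3)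
  exact ⟨ρ, hρ, _, by positivity, h⟩

theorem norm_sub_leading_term_le {u : E → F} {k : ℕ} {z : E} {B : ℝ}
    (hu : ∀ s ∈ Icc (0 : ℝ) 1, ContDiffAt ℝ (k + 1 : ℕ) u (s • z))
    (hB : ∀ s ∈ Icc (0 : ℝ) 1, ‖iteratedFDeriv ℝ (k + 1) u (s • z)‖ ≤ B)
    (hjet : ∀ j < k, iteratedFDeriv ℝ j u 0 = 0) :
    ‖u z - (k.factorial : ℝ)⁻¹ • iteratedFDeriv ℝ k u 0 (fun _ => z)‖ ≤ B * ‖z‖ ^ (k + 1) := by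
  set f : ℝ → F := fun s => u (s • z) with hf
  have hsm : ∀ s ∈ Icc (0 : ℝ) 1, ContDiffAt ℝ (k + 1 : ℕ) f s := fun s hs =>
    (hu s hs).comp s (f := fun s : ℝ => s • z) (by fun_prop)
  have hder : ∀ j ≤ k + 1, ∀ s ∈ Icc (0 : ℝ) 1, iteratedDerivWithin j f (Icc 0 1) s =
      iteratedFDeriv ℝ j u (s • z) (fun _ => z) := by
    intro j hj s hs
    rw [iteratedDerivWithin_eq_iteratedDeriv (uniqueDiffOn_Icc zero_lt_one)
      ((hsm s hs).of_le (by exact_mod_cast hj)) hs]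
    exact iteratedDeriv_comp_smul j ((hu s hs).of_le (by exact_mod_cast hj))
  have key := taylor_mean_remainder_bound (f := f) (a := 0) (b := 1) (x := 1) (n := k)
    (C := B * ‖z‖ ^ (k + 1)) zero_le_one
    (fun s hs => (hsm s hs).contDiffWithinAt) ⟨zero_le_one, le_rfl⟩ (fun s hs => by
      rw [hder _ le_rfl s hs]
      refine (ContinuousMultilinearMap.le_opNorm _ _).trans ?_
      simpa using mul_le_mul_of_nonneg_right (hB s hs) (by positivity))
  have h0 : (0 : ℝ) ∈ Icc (0 : ℝ) 1 := ⟨le_rfl, zero_le_one⟩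
  have htay : taylorWithinEval f k (Icc 0 1) 0 1 =
      (k.factorial : ℝ)⁻¹ • iteratedFDeriv ℝ k u 0 (fun _ => z) := by
    rw [taylor_within_apply, Finset.sum_range_succ, Finset.sum_eq_zero]
    · rw [hder k (Nat.le_succ k) 0 h0]; simp
    · intro j hj
      have hj := Finset.mem_range.1 hj
      rw [hder j (by omega) 0 h0, zero_smul, hjet j hj]; simp
  rw [htay] at key
  simp only [hf, one_smul, sub_zero, one_pow, mul_one] at key
  refine key.trans (div_le_self ?_ (by exact_mod_cast Nat.succ_le_of_lt k.factorial_pos))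
  exact mul_nonneg ((norm_nonneg _).trans (hB 0 h0)) (by positivity)

theorem segment_mem_ball {z : E} {ρ : ℝ} (hz : z ∈ Metric.ball (0 : E) ρ) {s : ℝ}
    (hs : s ∈ Icc (0 : ℝ) 1) : s • z ∈ Metric.ball (0 : E) ρ := by
  rw [mem_ball_zero_iff] at *
  rw [norm_smul, Real.norm_eq_abs, abs_of_nonneg hs.1]
  exact (mul_le_of_le_one_left (norm_nonneg _) hs.2).trans_lt hz

/-- A function whose jet of order less than `k` vanishes differs from its leading term of degree
`k` by `O(‖z‖ ^ (k + 1))`. -/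
theorem isBigO_sub_leading_term {u : E → F} {k : ℕ} (hu : ContDiffAt ℝ (k + 1 : ℕ) u 0)
    (hjet : ∀ j < k, iteratedFDeriv ℝ j u 0 = 0) :
    (fun z => u z - (k.factorial : ℝ)⁻¹ • iteratedFDeriv ℝ k u 0 (fun _ => z))
      =O[𝓝 0] fun z => ‖z‖ ^ (k + 1) := by
  obtain ⟨ρ, hρ, B, hB, h⟩ := ContDiffAt.exists_ball_bound hu
  refine Asymptotics.IsBigO.of_bound B ?_
  filter_upwards [Metric.ball_mem_nhds 0 hρ] with z hz
  rw [norm_pow, norm_norm]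
  exact norm_sub_leading_term_le (fun s hs => (h _ (segment_mem_ball hz hs)).1)
    (fun s hs => (h _ (segment_mem_ball hz hs)).2) hjet

/-- A function whose jet of order less than `k` vanishes is bounded by `‖z‖ ^ k`. -/
theorem norm_le_pow_of_jet_eq_zero {u : E → F} {k : ℕ} {ρ B : ℝ}
    (hu : ∀ z ∈ Metric.ball (0 : E) ρ, ContDiffAt ℝ k u z)
    (hB : ∀ z ∈ Metric.ball (0 : E) ρ, ‖iteratedFDeriv ℝ k u z‖ ≤ B)
    (hjet : ∀ j < k, iteratedFDeriv ℝ j u 0 = 0) :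
    ∀ z ∈ Metric.ball (0 : E) ρ, ‖u z‖ ≤ B * ‖z‖ ^ k := by
  intro z hz
  cases k with
  | zero => simpa using hB z hz
  | succ k =>
    have := norm_sub_leading_term_le (fun s hs => hu _ (segment_mem_ball hz hs))
      (fun s hs => hB _ (segment_mem_ball hz hs)) (fun j hj => hjet j (by omega))
    rw [hjet k (by omega)] at this
    simpa using this

theorem isBigO_pow_of_jet_eq_zero {u : E → F} {k : ℕ} (hu : ContDiffAt ℝ k u 0)
    (hjet : ∀ j < k, iteratedFDeriv ℝ j u 0 = 0) : u =O[𝓝 0] fun z => ‖z‖ ^ k := by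
  obtain ⟨ρ, hρ, B, hB, h⟩ := ContDiffAt.exists_ball_bound hu
  refine Asymptotics.IsBigO.of_bound B ?_
  filter_upwards [Metric.ball_mem_nhds 0 hρ] with z hz
  rw [norm_pow, norm_norm]
  exact norm_le_pow_of_jet_eq_zero (fun z hz => (h z hz).1) (fun z hz => (h z hz).2) hjet z hz

omit [NormedSpace ℝ E] in
theorem isBigO_norm_pow_of_le {m n : ℕ} (h : m ≤ n) :
    (fun z : E => ‖z‖ ^ n) =O[𝓝 0] fun z => ‖z‖ ^ m := by
  refine Asymptotics.IsBigO.of_bound 1 ?_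
  filter_upwards [Metric.ball_mem_nhds (0 : E) one_pos] with z hz
  rw [mem_ball_zero_iff] at hz
  simpa using pow_le_pow_of_le_one (norm_nonneg z) hz.le h

/-- Vanishing of a homogeneous function which is small of higher order. -/
theorem eq_zero_of_homogeneous_of_isBigO {Q : E → F} {k : ℕ}
    (hQ : ∀ (s : ℝ) z, 0 < s → Q (s • z) = s ^ k • Q z)
    (hO : Q =O[𝓝 0] fun z => ‖z‖ ^ (k + 1)) : Q = 0 := by
  ext1 z
  obtain ⟨C, hC⟩ := hO.bound
  obtain ⟨ρ, hρ, h⟩ := Metric.eventually_nhds_iff_ball.1 hC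
  have hc : Continuous fun s : ℝ => s • z := by fun_prop
  have h1 : ∀ᶠ s : ℝ in 𝓝[>] 0, s • z ∈ Metric.ball (0 : E) ρ :=
    (hc.tendsto' 0 0 (by simp)).mono_left nhdsWithin_le_nhds
      |>.eventually_mem (Metric.ball_mem_nhds 0 hρ)
  have h2 : ∀ᶠ s : ℝ in 𝓝[>] 0, ‖Q z‖ ≤ s * (C * ‖z‖ ^ (k + 1)) := by
    filter_upwards [h1, self_mem_nhdsWithin] with s hs hs0
    have hs0 : 0 < s := hs0
    have := h _ hs
    rw [hQ s z hs0, norm_smul, norm_pow, norm_pow, norm_norm, norm_smul, Real.norm_eq_abs,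
      abs_of_pos hs0, mul_pow, pow_succ s k] at this
    have hsk : 0 < s ^ k := by positivity
    refine le_of_mul_le_mul_left ?_ hsk
    linarith
  have h3 : Filter.Tendsto (fun s : ℝ => s * (C * ‖z‖ ^ (k + 1))) (𝓝[>] 0) (𝓝 0) :=
    ((by fun_prop : Continuous fun s : ℝ => s * (C * ‖z‖ ^ (k + 1))).tendsto' 0 0 (by simp)).mono_left
      nhdsWithin_le_nhds
  have := ge_of_tendsto h3 h2
  simpa using this

/-- The derivative of a smooth function which is small of order `k + 1` is small of order `k`.
After rescaling, the functions `u (ρ x) / ρ ^ k` tend to `0` while their derivatives tend to the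
leading term of the derivative, so that the latter vanishes. -/
theorem jet_eq_zero_of_isBigO {k : ℕ} {F : Type} [NormedAddCommGroup F] [NormedSpace ℝ F]
    {u : E → F} (hu : ContDiffAt ℝ k u 0)
    (hO : u =O[𝓝 0] fun z => ‖z‖ ^ k) : ∀ j < k, iteratedFDeriv ℝ j u 0 = 0 := by
  induction k generalizing F with
  | zero => intro j hj; omega
  | succ k ih =>
    have hu1 : ContDiffAt ℝ (k + 1) u 0 := by exact_mod_cast hu
    have h0 : u 0 = 0 := by
      have := hO.eq_zero_imp.self_of_nhds
      simpa using this
    have jets : ∀ j < k, iteratedFDeriv ℝ j u 0 = 0 :=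
      ih (hu.of_le (by exact_mod_cast Nat.le_succ k)) (hO.trans (isBigO_norm_pow_of_le (Nat.le_succ k)))
    cases k with
    | zero =>
      intro j hj
      obtain rfl : j = 0 := by omega
      ext; simp [h0]
    | succ k =>
      have hDu : ContDiffAt ℝ (k + 1 : ℕ) (fderiv ℝ u) 0 := by
        exact_mod_cast hu.fderiv_right (m := (k + 1 : ℕ)) (by norm_cast)
      have jets' : ∀ j < k, iteratedFDeriv ℝ j (fderiv ℝ u) 0 = 0 := by
        intro j hj
        rw [← norm_eq_zero, norm_iteratedFDeriv_fderiv, jets (j + 1) (by omega), norm_zero]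
      set L : E → E →L[ℝ] F := fun z =>
        (k.factorial : ℝ)⁻¹ • iteratedFDeriv ℝ k (fderiv ℝ u) 0 (fun _ => z) with hL
      have hlead : (fun z => fderiv ℝ u z - L z) =O[𝓝 0] fun z => ‖z‖ ^ (k + 1) :=
        isBigO_sub_leading_term hDu jets'
      have hLhom : ∀ (s : ℝ) z, L (s • z) = s ^ k • L z := by
        intro s z
        simp only [hL]
        rw [smul_comm (s ^ k)]
        congr 1
        have := (iteratedFDeriv ℝ k (fderiv ℝ u) 0).map_smul_univ (fun _ => s) (fun _ => z)
        simpa using this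
      have hL0 : ∀ x ∈ Metric.ball (0 : E) 1, L x = 0 := by
        intro x hx
        have hdiff : ∀ᶠ y in 𝓝 (0 : E), DifferentiableAt ℝ u y := by
          filter_upwards [hu.eventually (by simp)] with y hy
          exact hy.differentiableAt (by simp)
        obtain ⟨C, hC⟩ := hO.bound
        obtain ⟨C', hC'⟩ := hlead.bound
        obtain ⟨ρ, hρ, h⟩ := Metric.eventually_nhds_iff_ball.1 (hdiff.and (hC.and hC'))
        have hin : ∀ s : ℝ, 0 < s → s < ρ → ∀ y ∈ Metric.ball (0 : E) 1,
            s • y ∈ Metric.ball (0 : E) ρ := by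
          intro s hs hsρ y hy
          rw [mem_ball_zero_iff] at *
          rw [norm_smul, Real.norm_eq_abs, abs_of_pos hs]
          nlinarith [norm_nonneg y]
        have hev : ∀ᶠ s : ℝ in 𝓝[>] 0, 0 < s ∧ s < ρ :=
          Filter.Eventually.and self_mem_nhdsWithin
            (mem_nhdsWithin_of_mem_nhds (Iio_mem_nhds hρ))
        have hlim : ∀ D : ℝ, Filter.Tendsto (fun s : ℝ => D * s) (𝓝[>] 0) (𝓝 0) := fun D =>
          ((by fun_prop : Continuous fun s : ℝ => D * s).tendsto' 0 0 (by simp)).mono_left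
            nhdsWithin_le_nhds
        have hball : ∀ y ∈ Metric.ball (0 : E) 1, ‖y‖ ^ (k + 1) ≤ 1 ∧ ‖y‖ ^ (k + 1 + 1) ≤ 1 := by
          intro y hy
          rw [mem_ball_zero_iff] at hy
          exact ⟨pow_le_one₀ (norm_nonneg _) hy.le, pow_le_one₀ (norm_nonneg _) hy.le⟩
        have hunif : TendstoUniformlyOn (fun (s : ℝ) y => (s ^ k)⁻¹ • fderiv ℝ u (s • y)) L
            (𝓝[>] 0) (Metric.ball (0 : E) 1) := by
          rw [Metric.tendstoUniformlyOn_iff]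
          intro ε hε
          filter_upwards [hev, (hlim |C'|).eventually_lt_const hε] with s hs hsε y hy
          have hb := (h _ (hin s hs.1 hs.2 y hy)).2.2
          have hs0 : s ≠ 0 := hs.1.ne'
          rw [dist_comm, dist_eq_norm]
          have e : (s ^ k)⁻¹ • fderiv ℝ u (s • y) - L y
              = (s ^ k)⁻¹ • (fderiv ℝ u (s • y) - L (s • y)) := by
            rw [hLhom, smul_sub, inv_smul_smul₀ (pow_ne_zero _ hs0)]
          rw [e, norm_smul, norm_inv, norm_pow, Real.norm_eq_abs, abs_of_pos hs.1]
          refine lt_of_le_of_lt ?_ hsε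
          rw [inv_mul_le_iff₀ (pow_pos hs.1 k)]
          refine hb.trans ?_
          rw [norm_pow, norm_norm, norm_smul, Real.norm_eq_abs, abs_of_pos hs.1, mul_pow]
          calc C' * (s ^ (k + 1) * ‖y‖ ^ (k + 1)) ≤ |C'| * (s ^ (k + 1) * 1) := by
                have := hs.1
                gcongr
                · exact le_abs_self _
                · exact (hball y hy).1
            _ = s ^ k * (|C'| * s) := by ring
        have hpt : ∀ y ∈ Metric.ball (0 : E) 1,
            Filter.Tendsto (fun s : ℝ => (s ^ (k + 1))⁻¹ • u (s • y)) (𝓝[>] 0) (𝓝 0) := by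
          intro y hy
          refine squeeze_zero_norm' ?_ (hlim |C|)
          filter_upwards [hev] with s hs
          have hb := (h _ (hin s hs.1 hs.2 y hy)).2.1
          rw [norm_smul, norm_inv, norm_pow, Real.norm_eq_abs, abs_of_pos hs.1,
            inv_mul_le_iff₀ (pow_pos hs.1 _)]
          refine hb.trans ?_
          rw [norm_pow, norm_norm, norm_smul, Real.norm_eq_abs, abs_of_pos hs.1, mul_pow]
          calc C * (s ^ (k + 1 + 1) * ‖y‖ ^ (k + 1 + 1)) ≤ |C| * (s ^ (k + 1 + 1) * 1) := by
                have := hs.1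
                gcongr
                · exact le_abs_self _
                · exact (hball y hy).2
            _ = s ^ (k + 1) * (|C| * s) := by ring
        have hder : ∀ᶠ s : ℝ in 𝓝[>] 0, ∀ y ∈ Metric.ball (0 : E) 1,
            HasFDerivAt (fun y => (s ^ (k + 1))⁻¹ • u (s • y)) ((s ^ k)⁻¹ • fderiv ℝ u (s • y)) y := by
          filter_upwards [hev] with s hs y hy
          have hd := (h _ (hin s hs.1 hs.2 y hy)).1.hasFDerivAt
          have h2 : HasFDerivAt (fun y : E => s • y) (s • ContinuousLinearMap.id ℝ E) y :=
            (hasFDerivAt_id y).const_smul s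
          refine ((hd.comp y h2).const_smul ((s ^ (k + 1))⁻¹)).congr_fderiv ?_
          ext v
          have hs0 : s ≠ 0 := hs.1.ne'
          change (s ^ (k + 1))⁻¹ • fderiv ℝ u (s • y) (s • v) = (s ^ k)⁻¹ • fderiv ℝ u (s • y) v
          rw [map_smul, smul_smul]
          congr 1
          field_simp
          ring
        have hx' : Metric.ball (0 : E) 1 ∈ 𝓝 x := Metric.isOpen_ball.mem_nhds hx
        have hzero := hasFDerivAt_of_tendstoUniformlyOnFilter (g := fun _ => (0 : F))
          (hunif.tendstoUniformlyOnFilter.mono_right (Filter.le_principal_iff.2 hx'))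
          ((hder.prod_mk hx').mono fun q hq => hq.1 _ hq.2)
          (Filter.mem_of_superset hx' hpt)
        exact hzero.unique (hasFDerivAt_const 0 x)
      have hLz : L = 0 := by
        ext1 z
        have hc : Continuous fun s : ℝ => s • z := by fun_prop
        have h1 : ∀ᶠ s : ℝ in 𝓝[>] 0, s • z ∈ Metric.ball (0 : E) 1 :=
          (hc.tendsto' 0 0 (by simp)).mono_left nhdsWithin_le_nhds
            |>.eventually_mem (Metric.ball_mem_nhds 0 one_pos)
        obtain ⟨s, hs, hs0⟩ := (h1.and self_mem_nhdsWithin).exists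
        have hs0 : (0 : ℝ) < s := hs0
        have := hL0 _ hs
        rw [hLhom, smul_eq_zero] at this
        exact this.resolve_left (pow_ne_zero _ hs0.ne')
      have hDuO : fderiv ℝ u =O[𝓝 0] fun z => ‖z‖ ^ (k + 1) := by simpa [hLz] using hlead
      intro j hj
      cases j with
      | zero => ext; simp [h0]
      | succ j =>
        rw [← norm_eq_zero, ← norm_iteratedFDeriv_fderiv, ih hDu hDuO j (by omega), norm_zero]

theorem isBigO_fderiv_of_isBigO {k : ℕ} {u : E → F} (hu : ContDiffAt ℝ (k + 1 : ℕ) u 0)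
    (hO : u =O[𝓝 0] fun z => ‖z‖ ^ (k + 1)) : fderiv ℝ u =O[𝓝 0] fun z => ‖z‖ ^ k := by
  refine isBigO_pow_of_jet_eq_zero (hu.fderiv_right (m := k) (by norm_cast)) fun j hj => ?_
  rw [← norm_eq_zero, norm_iteratedFDeriv_fderiv, jet_eq_zero_of_isBigO hu hO (j + 1) (by omega),
    norm_zero]

end Flat

/-! ### Convergence in the class `C^n` near a point -/

section CTendsto

variable {E F F' : Type} [NormedAddCommGroup E] [NormedSpace ℝ E]
  [NormedAddCommGroup F] [NormedSpace ℝ F] [NormedAddCommGroup F'] [NormedSpace ℝ F'] {ι : Type}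

/-- The family `u i` tends to `v` along `l` near the point `x₀`, uniformly together with all
derivatives of order at most `n`. As the derivatives of `v` are continuous at `x₀`, this is
expressed by the convergence of the derivatives of `u i` at `y` as `i` and `y` tend to `l` and
`x₀` simultaneously. -/
structure CTendsto (n : ℕ) (l : Filter ι) (u : ι → E → F) (v : E → F) (x₀ : E) : Prop where
  smooth : ∀ᶠ q in l ×ˢ 𝓝 x₀, ContDiffAt ℝ n (u q.1) q.2
  smooth_lim : ContDiffAt ℝ n v x₀
  tendsto : ∀ k ≤ n, Filter.Tendsto (fun q : ι × E => iteratedFDeriv ℝ k (u q.1) q.2) (l ×ˢ 𝓝 x₀)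
    (𝓝 (iteratedFDeriv ℝ k v x₀))

theorem eventually_eventually_prod_nhds {X : Type} [TopologicalSpace X] {l : Filter ι} {x₀ : X}
    {P : ι → X → Prop} (h : ∀ᶠ q in l ×ˢ 𝓝 x₀, P q.1 q.2) :
    ∀ᶠ q in l ×ˢ 𝓝 x₀, ∀ᶠ y in 𝓝 q.2, P q.1 y := by
  obtain ⟨pa, ha, pb, hb, H⟩ := Filter.eventually_prod_iff.1 h
  refine Filter.eventually_prod_iff.2 ⟨pa, ha, _, hb.eventually_nhds, fun {i} hi {y} hy => ?_⟩
  exact hy.mono fun x hx => H hi hx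

variable {n : ℕ} {l : Filter ι} {u : ι → E → F} {v : E → F} {x₀ : E}

namespace CTendsto

theorem mono (h : CTendsto n l u v x₀) {m : ℕ} (hm : m ≤ n) : CTendsto m l u v x₀ :=
  ⟨h.smooth.mono fun _ hq => hq.of_le (by exact_mod_cast hm), h.smooth_lim.of_le (by exact_mod_cast hm),
    fun k hk => h.tendsto k (hk.trans hm)⟩

theorem mono_left (h : CTendsto n l u v x₀) {l' : Filter ι} (hl : l' ≤ l) : CTendsto n l' u v x₀ :=
  ⟨h.smooth.filter_mono (Filter.prod_mono_left _ hl), h.smooth_lim,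
    fun k hk => (h.tendsto k hk).mono_left (Filter.prod_mono_left _ hl)⟩

theorem tendsto_zero (h : CTendsto n l u v x₀) :
    Filter.Tendsto (fun q : ι × E => u q.1 q.2) (l ×ˢ 𝓝 x₀) (𝓝 (v x₀)) := by
  have := h.tendsto 0 (Nat.zero_le n)
  have h2 := ((ContinuousMultilinearMap.apply ℝ (fun _ : Fin 0 => E) F 0).continuous.tendsto _).comp this
  simpa [Function.comp_def] using h2

theorem tendsto_fderiv (h : CTendsto n l u v x₀) (hn : 1 ≤ n) :
    Filter.Tendsto (fun q : ι × E => fderiv ℝ (u q.1) q.2) (l ×ˢ 𝓝 x₀) (𝓝 (fderiv ℝ v x₀)) := by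
  have := h.tendsto 1 hn
  have e : ∀ f : E → F, ∀ x, continuousMultilinearCurryFin1 ℝ E F (iteratedFDeriv ℝ 1 f x)
      = fderiv ℝ f x := by
    intro f x; ext m; simp [continuousMultilinearCurryFin1]
  have h2 := ((continuousMultilinearCurryFin1 ℝ E F).continuous.tendsto _).comp this
  rw [e] at h2
  exact h2.congr fun q => e _ _

theorem congr (h : CTendsto n l u v x₀) {u' : ι → E → F} {v' : E → F}
    (hu : ∀ᶠ q in l ×ˢ 𝓝 x₀, u' q.1 q.2 = u q.1 q.2) (hv : v' =ᶠ[𝓝 x₀] v) :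
    CTendsto n l u' v' x₀ := by
  have hu' : ∀ᶠ q in l ×ˢ 𝓝 x₀, ∀ᶠ y in 𝓝 q.2, u' q.1 y = u q.1 y :=
    eventually_eventually_prod_nhds (P := fun i y => u' i y = u i y) hu
  refine ⟨?_, h.smooth_lim.congr_of_eventuallyEq hv, fun k hk => ?_⟩
  · filter_upwards [h.smooth, hu'] with q h1 h2 using h1.congr_of_eventuallyEq h2
  · rw [(Filter.EventuallyEq.iteratedFDeriv ℝ hv k).self_of_nhds]
    refine (h.tendsto k hk).congr' ?_
    filter_upwards [hu'] with q h2
    exact (Filter.EventuallyEq.iteratedFDeriv ℝ h2 k).self_of_nhds.symm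

theorem tendsto_iteratedFDeriv_succ {k : ℕ} :
    Filter.Tendsto (fun q : ι × E => iteratedFDeriv ℝ (k + 1) (u q.1) q.2) (l ×ˢ 𝓝 x₀)
      (𝓝 (iteratedFDeriv ℝ (k + 1) v x₀)) ↔
    Filter.Tendsto (fun q : ι × E => iteratedFDeriv ℝ k (fderiv ℝ (u q.1)) q.2) (l ×ˢ 𝓝 x₀)
      (𝓝 (iteratedFDeriv ℝ k (fderiv ℝ v) x₀)) := by
  have e : ∀ f : E → F, iteratedFDeriv ℝ (k + 1) f =
      (continuousMultilinearCurryRightEquiv' ℝ k E F).symm ∘ iteratedFDeriv ℝ k (_root_.fderiv ℝ f) :=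
    fun f => funext fun x => iteratedFDeriv_succ_eq_comp_right
  simp only [e]
  exact (((continuousMultilinearCurryRightEquiv' ℝ k E F).symm.isometry.isEmbedding).tendsto_nhds_iff).symm

theorem fderiv (h : CTendsto (n + 1) l u v x₀) :
    CTendsto n l (fun i => fderiv ℝ (u i)) (fderiv ℝ v) x₀ :=
  ⟨h.smooth.mono fun _ hq => hq.fderiv_right (by norm_cast), h.smooth_lim.fderiv_right (by norm_cast),
    fun k hk => tendsto_iteratedFDeriv_succ.1 (h.tendsto (k + 1) (by omega))⟩

theorem of_fderiv (h0 : Filter.Tendsto (fun q : ι × E => u q.1 q.2) (l ×ˢ 𝓝 x₀) (𝓝 (v x₀)))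
    (hu : ∀ᶠ q in l ×ˢ 𝓝 x₀, DifferentiableAt ℝ (u q.1) q.2)
    (hv : ∀ᶠ y in 𝓝 x₀, DifferentiableAt ℝ v y)
    (h : CTendsto n l (fun i => _root_.fderiv ℝ (u i)) (_root_.fderiv ℝ v) x₀) :
    CTendsto (n + 1) l u v x₀ := by
  refine ⟨?_, ?_, fun k hk => ?_⟩
  · filter_upwards [eventually_eventually_prod_nhds (P := fun i y => DifferentiableAt ℝ (u i) y) hu,
      h.smooth] with q h1 h2
    have := (contDiffAt_succ_iff_hasFDerivAt (𝕜 := ℝ) (n := n) (f := u q.1) (x := q.2)).2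
      ⟨_root_.fderiv ℝ (u q.1), ⟨_, h1, fun y hy => hy.hasFDerivAt⟩, h2⟩
    exact_mod_cast this
  · have := (contDiffAt_succ_iff_hasFDerivAt (𝕜 := ℝ) (n := n) (f := v) (x := x₀)).2
      ⟨_root_.fderiv ℝ v, ⟨_, hv, fun y hy => hy.hasFDerivAt⟩, h.smooth_lim⟩
    exact_mod_cast this
  · cases k with
    | zero =>
      have h2 := ((continuousMultilinearCurryFin0 ℝ E F).symm.continuous.tendsto _).comp h0
      exact h2
    | succ k => exact tendsto_iteratedFDeriv_succ.2 (h.tendsto k (by omega))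

theorem const (hv : ContDiffAt ℝ n v x₀) : CTendsto n l (fun _ => v) v x₀ :=
  ⟨Filter.tendsto_snd.eventually (hv.eventually (by simp)), hv, fun k hk =>
    (hv.continuousAt_iteratedFDeriv (by exact_mod_cast hk)).tendsto.comp Filter.tendsto_snd⟩

theorem const_param {a : ι → F} {a₀ : F} (ha : Filter.Tendsto a l (𝓝 a₀)) :
    CTendsto n l (fun i _ => a i) (fun _ : E => a₀) x₀ := by
  refine ⟨Filter.Eventually.of_forall fun _ => contDiffAt_const, contDiffAt_const, fun k _ => ?_⟩
  cases k with
  | zero =>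
    have h2 := ((continuousMultilinearCurryFin0 ℝ E F).symm.continuous.tendsto a₀).comp
      (ha.comp (Filter.tendsto_fst (f := l) (g := 𝓝 x₀)))
    exact h2
  | succ k =>
    simp only [iteratedFDeriv_succ_const]
    exact tendsto_const_nhds

theorem prodMk {w : ι → E → F'} {z : E → F'} (h : CTendsto n l u v x₀) (h' : CTendsto n l w z x₀) :
    CTendsto n l (fun i x => (u i x, w i x)) (fun x => (v x, z x)) x₀ := by
  refine ⟨?_, h.smooth_lim.prodMk h'.smooth_lim, fun k hk => ?_⟩
  · filter_upwards [h.smooth, h'.smooth] with q h1 h2 using h1.prodMk h2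
  · rw [iteratedFDeriv_prodMk h.smooth_lim h'.smooth_lim (by exact_mod_cast hk)]
    have e : ∀ᶠ q in l ×ˢ 𝓝 x₀, (iteratedFDeriv ℝ k (u q.1) q.2).prod (iteratedFDeriv ℝ k (w q.1) q.2)
        = iteratedFDeriv ℝ k (fun x => (u q.1 x, w q.1 x)) q.2 := by
      filter_upwards [h.smooth, h'.smooth] with q h1 h2
      rw [iteratedFDeriv_prodMk h1 h2 (by exact_mod_cast hk)]
    refine Filter.Tendsto.congr' e ?_
    rw [tendsto_iff_norm_sub_tendsto_zero]
    have t1 := tendsto_iff_norm_sub_tendsto_zero.1 (h.tendsto k hk)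
    have t2 := tendsto_iff_norm_sub_tendsto_zero.1 (h'.tendsto k hk)
    refine (by simpa using t1.max t2 : Filter.Tendsto _ _ (𝓝 (0 : ℝ))).congr fun q => ?_
    rw [← ContinuousMultilinearMap.opNorm_prod]
    rfl

/-- Composition on the left with a fixed map of class `C^n`. -/
theorem comp {n : ℕ} {F F' : Type} [NormedAddCommGroup F] [NormedSpace ℝ F]
    [NormedAddCommGroup F'] [NormedSpace ℝ F'] {Φ : F → F'} {u : ι → E → F} {v : E → F}
    (hΦ : ContDiffAt ℝ n Φ (v x₀)) (h : CTendsto n l u v x₀) :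
    CTendsto n l (fun i x => Φ (u i x)) (fun x => Φ (v x)) x₀ := by
  induction n generalizing F F' with
  | zero =>
    have hΦ' : ∀ᶠ y in 𝓝 (v x₀), ContDiffAt ℝ (0 : ℕ) Φ y := hΦ.eventually (by simp)
    refine ⟨?_, hΦ.comp x₀ h.smooth_lim, fun k hk => ?_⟩
    · filter_upwards [h.smooth, h.tendsto_zero.eventually hΦ'] with q h1 h2 using h2.comp _ h1
    · obtain rfl : k = 0 := by omega
      have h2 := ((continuousMultilinearCurryFin0 ℝ E F').symm.continuous.tendsto _).comp
        (hΦ.continuousAt.tendsto.comp h.tendsto_zero)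
      exact h2
  | succ n ih =>
    have hΦ' : ∀ᶠ y in 𝓝 (v x₀), ContDiffAt ℝ (n + 1 : ℕ) Φ y := hΦ.eventually (by simp)
    have hne : ((n + 1 : ℕ) : ℕ∞ω) ≠ 0 := by simp
    have ev1 : ∀ᶠ q in l ×ˢ 𝓝 x₀, DifferentiableAt ℝ (u q.1) q.2 ∧ DifferentiableAt ℝ Φ (u q.1 q.2) := by
      filter_upwards [h.smooth, h.tendsto_zero.eventually hΦ'] with q h1 h2
      exact ⟨h1.differentiableAt hne, h2.differentiableAt hne⟩
    have ev2 : ∀ᶠ y in 𝓝 x₀, DifferentiableAt ℝ v y ∧ DifferentiableAt ℝ Φ (v y) := by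
      filter_upwards [h.smooth_lim.eventually (by simp),
        h.smooth_lim.continuousAt.eventually hΦ'] with y h1 h2
      exact ⟨h1.differentiableAt hne, h2.differentiableAt hne⟩
    refine of_fderiv (hΦ.continuousAt.tendsto.comp h.tendsto_zero) (ev1.mono fun q hq =>
      hq.2.comp _ hq.1) (ev2.mono fun y hy => hy.2.comp _ hy.1) ?_
    have hpair := (h.mono (Nat.le_succ n)).prodMk h.fderiv
    -- the derivative of the composition is a fixed map applied to `u i` and its derivative
    let Ψ : F × (E →L[ℝ] F) → E →L[ℝ] F' := fun p => (_root_.fderiv ℝ Φ p.1).comp p.2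
    have hΨ : ContDiffAt ℝ n Ψ (v x₀, _root_.fderiv ℝ v x₀) := by
      have h1 : ContDiffAt ℝ n (_root_.fderiv ℝ Φ) (v x₀) := hΦ.fderiv_right (by norm_cast)
      have h2 : ContDiffAt ℝ n (fun p : F × (E →L[ℝ] F) => _root_.fderiv ℝ Φ p.1)
          (v x₀, _root_.fderiv ℝ v x₀) := h1.comp (v x₀, _root_.fderiv ℝ v x₀) contDiffAt_fst
      exact h2.clm_comp contDiffAt_snd
    refine (ih hΨ hpair).congr ?_ ?_
    · filter_upwards [ev1] with q hq
      exact fderiv_comp q.2 hq.2 hq.1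
    · filter_upwards [ev2] with y hy
      exact fderiv_comp y hy.2 hy.1

theorem sub {w : ι → E → F} {z : E → F} (h : CTendsto n l u v x₀) (h' : CTendsto n l w z x₀) :
    CTendsto n l (fun i x => u i x - w i x) (fun x => v x - z x) x₀ :=
  comp (Φ := fun p : F × F => p.1 - p.2) (by fun_prop) (h.prodMk h')

theorem add {w : ι → E → F} {z : E → F} (h : CTendsto n l u v x₀) (h' : CTendsto n l w z x₀) :
    CTendsto n l (fun i x => u i x + w i x) (fun x => v x + z x) x₀ :=
  comp (Φ := fun p : F × F => p.1 + p.2) (by fun_prop) (h.prodMk h')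

theorem smul {w : ι → E → ℝ} {z : E → ℝ} (h' : CTendsto n l w z x₀) (h : CTendsto n l u v x₀) :
    CTendsto n l (fun i x => w i x • u i x) (fun x => z x • v x) x₀ :=
  comp (Φ := fun p : ℝ × F => p.1 • p.2) (by fun_prop) (h'.prodMk h)

end CTendsto

/-! ### Division of flat functions -/

/-- The order of flatness needed to divide by a function of size `‖z‖ ^ m` within class `C^r`. -/
def divisionOrder : ℕ → ℕ → ℕ
  | 0, m => m + 1
  | r + 1, m => divisionOrder r (2 * m) + m + 3

theorem add_one_le_divisionOrder (r m : ℕ) : m + 1 ≤ divisionOrder r m := by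
  cases r with
  | zero => exact le_rfl
  | succ r => simp only [divisionOrder]; omega

/-- A family which is flat of order `M` and converges in class `C^M` is bounded by `‖z‖ ^ M`,
uniformly. -/
theorem CTendsto.exists_flat_bound {M : ℕ} {u : ι → E → F} {v : E → F} (hM : CTendsto M l u v 0)
    (hOM : ∀ᶠ i in l, u i =O[𝓝 0] fun z => ‖z‖ ^ M) :
    ∃ B, 0 ≤ B ∧ ∀ᶠ p in l ×ˢ 𝓝 (0 : E), ‖u p.1 p.2‖ ≤ B * ‖p.2‖ ^ M := by
  obtain ⟨A, hA⟩ : ∃ A, A = ‖iteratedFDeriv ℝ M v 0‖ + 1 := ⟨_, rfl⟩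
  have hA0 : 0 ≤ A := by rw [hA]; positivity
  have h1 : ∀ᶠ p in l ×ˢ 𝓝 (0 : E), ‖iteratedFDeriv ℝ M (u p.1) p.2‖ ≤ A :=
    (hM.tendsto M le_rfl).norm.eventually_le_const (by rw [hA]; exact lt_add_one _)
  have h2 : ∀ᶠ p in l ×ˢ 𝓝 (0 : E), ContDiffAt ℝ M (u p.1) p.2 := hM.smooth
  obtain ⟨pa, ha, pb, hb, H⟩ := Filter.eventually_prod_iff.1 (h1.and h2)
  obtain ⟨ρ, hρ, hball⟩ := Metric.eventually_nhds_iff_ball.1 hb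
  have key : ∀ i, (pa i ∧ u i =O[𝓝 0] fun z => ‖z‖ ^ M) → ∀ y ∈ Metric.ball (0 : E) ρ,
      ‖u i y‖ ≤ A * ‖y‖ ^ M := by
    intro i hi y hy
    have s1 : ∀ z ∈ Metric.ball (0 : E) ρ, ContDiffAt ℝ M (u i) z :=
      fun z hz => (H hi.1 (hball z hz)).2
    have s2 : ∀ z ∈ Metric.ball (0 : E) ρ, ‖iteratedFDeriv ℝ M (u i) z‖ ≤ A :=
      fun z hz => (H hi.1 (hball z hz)).1
    have s3 := jet_eq_zero_of_isBigO (s1 0 (Metric.mem_ball_self hρ)) hi.2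
    exact norm_le_pow_of_jet_eq_zero s1 s2 s3 y hy
  refine ⟨A, hA0, Filter.eventually_prod_iff.2
    ⟨_, ha.and hOM, fun y => y ∈ Metric.ball (0 : E) ρ, Metric.ball_mem_nhds 0 hρ,
      fun {i} hi {y} hy => key i hi y hy⟩⟩

theorem CTendsto.exists_quotient_bound {m d : ℕ} {u : ι → E → F} {v : E → F} {q : E → ℝ} {c : ℝ}
    (hc : 0 < c) (hqc : ∀ᶠ z in 𝓝 (0 : E), c * ‖z‖ ^ m ≤ q z)
    (hd : CTendsto (m + d) l u v 0) (hOd : ∀ᶠ i in l, u i =O[𝓝 0] fun z => ‖z‖ ^ (m + d))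
    (hd1 : 1 ≤ d) :
    ∃ B, 0 ≤ B ∧ ∀ᶠ p in l ×ˢ 𝓝 (0 : E), ‖(q p.2)⁻¹ • u p.1 p.2‖ ≤ B * ‖p.2‖ ^ d := by
  have hq2 : ∀ᶠ p in l ×ˢ 𝓝 (0 : E), c * ‖p.2‖ ^ m ≤ q p.2 := Filter.tendsto_snd.eventually hqc
  obtain ⟨B, hB, hb⟩ := hd.exists_flat_bound hOd
  refine ⟨c⁻¹ * B, by positivity, ?_⟩
  filter_upwards [hb, hq2] with p h1 h2
  rcases eq_or_ne p.2 0 with h0 | h0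
  · rw [h0, norm_zero, zero_pow (by omega), mul_zero] at h1
    rw [h0, norm_le_zero_iff.1 h1]; simp; positivity
  · have hn : 0 < ‖p.2‖ := norm_pos_iff.2 h0
    have hqp : 0 < q p.2 := lt_of_lt_of_le (by positivity) h2
    rw [norm_smul, norm_inv, Real.norm_eq_abs, abs_of_pos hqp, inv_mul_le_iff₀ hqp]
    calc ‖u p.1 p.2‖ ≤ B * ‖p.2‖ ^ (m + d) := h1
      _ = (c * ‖p.2‖ ^ m) * (c⁻¹ * B * ‖p.2‖ ^ d) := by rw [pow_add]; field_simp
      _ ≤ q p.2 * (c⁻¹ * B * ‖p.2‖ ^ d) := by gcongr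

omit [NormedSpace ℝ E] in
theorem tendsto_norm_snd_zero :
    Filter.Tendsto (fun p : ι × E => ‖p.2‖) (l ×ˢ 𝓝 (0 : E)) (𝓝 0) := by
  have : Filter.Tendsto (fun x : E => ‖x‖) (𝓝 0) (𝓝 0) := by
    simpa using (continuous_norm (E := E)).tendsto 0
  exact this.comp Filter.tendsto_snd

/-- Near the origin, the quotient of a family of functions which are flat of high order by a
function of size `‖z‖ ^ m` tends to `0` at the origin together with its derivatives of order at
most `r`, if the family is bounded in a suitable class. -/
theorem ctendsto_zero_inv_smul {r m : ℕ} {F : Type} [NormedAddCommGroup F] [NormedSpace ℝ F]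
    {u : ι → E → F} {v : E → F} {q : E → ℝ} {c : ℝ} (hq : ContDiff ℝ ∞ q) (hc : 0 < c)
    (hqc : ∀ᶠ z in 𝓝 (0 : E), c * ‖z‖ ^ m ≤ q z)
    (hu : CTendsto (divisionOrder r m) l u v 0)
    (hO : ∀ᶠ i in l, u i =O[𝓝 0] fun z => ‖z‖ ^ divisionOrder r m) :
    CTendsto r l (fun i z => (q z)⁻¹ • u i z) (fun _ => 0) 0 := by
  induction r generalizing F m c q v with
  | zero =>
    have qpos : ∀ᶠ p in l ×ˢ 𝓝 (0 : E), p.2 ≠ 0 → 0 < q p.2 := by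
      filter_upwards [(Filter.tendsto_snd (f := l)).eventually hqc] with p h2 h0
      have hn : 0 < ‖p.2‖ := norm_pos_iff.2 h0
      exact lt_of_lt_of_le (by positivity) h2
    obtain ⟨B, hB, hb⟩ := CTendsto.exists_quotient_bound (d := 1) hc hqc hu hO le_rfl
    have lim : Filter.Tendsto (fun p : ι × E => (q p.2)⁻¹ • u p.1 p.2) (l ×ˢ 𝓝 (0 : E)) (𝓝 0) := by
      refine squeeze_zero_norm' hb ?_
      simpa using tendsto_norm_snd_zero.const_mul B
    refine ⟨?_, contDiffAt_const, fun k hk => ?_⟩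
    · have hcont : ∀ᶠ p in l ×ˢ 𝓝 (0 : E), ContinuousAt (fun z => (q z)⁻¹ • u p.1 z) p.2 := by
        filter_upwards [hu.smooth, eventually_eventually_prod_nhds
          (P := fun i z => ‖(q z)⁻¹ • u i z‖ ≤ B * ‖z‖ ^ 1) hb, qpos] with p h1 h2 h3
        rcases eq_or_ne p.2 0 with h0 | h0
        · rw [h0] at h2 ⊢
          have e0 : (q 0)⁻¹ • u p.1 0 = 0 := by simpa using h2.self_of_nhds
          rw [ContinuousAt, e0]
          refine squeeze_zero_norm' h2 ?_
          simpa using ((continuous_norm (E := E)).tendsto 0).const_mul B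
        · exact (hq.continuous.continuousAt.inv₀ (h3 h0).ne').smul h1.continuousAt
      filter_upwards [eventually_eventually_prod_nhds
        (P := fun i y => ContinuousAt (fun z => (q z)⁻¹ • u i z) y) hcont] with p hp
      rw [Nat.cast_zero, contDiffAt_zero]
      exact ⟨_, hp, fun y hy => ContinuousAt.continuousWithinAt hy⟩
    · obtain rfl : k = 0 := by omega
      have h2 := ((continuousMultilinearCurryFin0 ℝ E F).symm.continuous.tendsto _).comp lim
      exact h2
  | succ r ih =>
    have qpos : ∀ᶠ p in l ×ˢ 𝓝 (0 : E), p.2 ≠ 0 → 0 < q p.2 := by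
      filter_upwards [(Filter.tendsto_snd (f := l)).eventually hqc] with p h2 h0
      have hn : 0 < ‖p.2‖ := norm_pos_iff.2 h0
      exact lt_of_lt_of_le (by positivity) h2
    set M := divisionOrder r (2 * m) with hM
    have hMeq : divisionOrder (r + 1) m = M + m + 3 := rfl
    have le1 : m + 1 ≤ divisionOrder (r + 1) m := add_one_le_divisionOrder _ _
    have le2 : m + 2 ≤ divisionOrder (r + 1) m := by rw [hMeq]; omega
    have le3 : M + 1 ≤ divisionOrder (r + 1) m := by rw [hMeq]; omega
    obtain ⟨B, hB, hb⟩ := CTendsto.exists_quotient_bound (d := 1) hc hqc (hu.mono le1)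
      (hO.mono fun i hi => hi.trans (isBigO_norm_pow_of_le le1)) le_rfl
    obtain ⟨B2, hB2, hb2⟩ := CTendsto.exists_quotient_bound (d := 2) hc hqc (hu.mono le2)
      (hO.mono fun i hi => hi.trans (isBigO_norm_pow_of_le le2)) (by norm_num)
    obtain ⟨B3, hB3, hb3⟩ := hu.exists_flat_bound hO
    have lim : Filter.Tendsto (fun p : ι × E => (q p.2)⁻¹ • u p.1 p.2) (l ×ˢ 𝓝 (0 : E)) (𝓝 0) := by
      refine squeeze_zero_norm' hb ?_
      simpa using tendsto_norm_snd_zero.const_mul B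
    -- the numerator of the derivative of the quotient
    let w : ι → E → E →L[ℝ] F := fun i z =>
      q z • fderiv ℝ (u i) z - (fderiv ℝ q z).smulRight (u i z)
    let w₀ : E → E →L[ℝ] F := fun z => q z • fderiv ℝ v z - (fderiv ℝ q z).smulRight (v z)
    have hfq : ContDiff ℝ ∞ (fderiv ℝ q) := hq.fderiv_right (by simp)
    have hw : CTendsto M l w w₀ 0 := by
      have a1 : CTendsto M l (fun i z => q z • fderiv ℝ (u i) z) (fun z => q z • fderiv ℝ v z) 0 :=
        (CTendsto.const (hq.contDiffAt.of_le (by exact_mod_cast le_top))).smul (hu.mono le3).fderiv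
      have a2 : CTendsto M l (fun i z => (fderiv ℝ q z).smulRight (u i z))
          (fun z => (fderiv ℝ q z).smulRight (v z)) 0 :=
        CTendsto.comp (Φ := fun p : (E →L[ℝ] ℝ) × F => p.1.smulRight p.2) (by fun_prop)
          ((CTendsto.const (hfq.contDiffAt.of_le (by exact_mod_cast le_top))).prodMk
            (hu.mono (by omega)))
      exact a1.sub a2
    have hder : ∀ᶠ p in l ×ˢ 𝓝 (0 : E), HasFDerivAt (fun z => (q z)⁻¹ • u p.1 z)
        ((q p.2 ^ 2)⁻¹ • w p.1 p.2) p.2 := by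
      filter_upwards [hu.smooth, eventually_eventually_prod_nhds
          (P := fun i z => ‖(q z)⁻¹ • u i z‖ ≤ B2 * ‖z‖ ^ 2) hb2, qpos,
        eventually_eventually_prod_nhds
          (P := fun i z => ‖u i z‖ ≤ B3 * ‖z‖ ^ divisionOrder (r + 1) m) hb3] with p h1 h2 h3 h4
      rcases eq_or_ne p.2 0 with h0 | h0
      · rw [h0] at h1 h2 h4 ⊢
        have hO1 : u p.1 =O[𝓝 0] fun z => ‖z‖ ^ (1 + 1) :=
          (Asymptotics.IsBigO.of_bound B3 (by simpa using h4)).trans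
            (isBigO_norm_pow_of_le (by omega))
        have hs : ContDiffAt ℝ (1 + 1 : ℕ) (u p.1) 0 := h1.of_le (by
          have : 1 + 1 ≤ divisionOrder (r + 1) m := by omega
          exact_mod_cast this)
        have u0 : u p.1 0 = 0 := by simpa using hO1.eq_zero_imp.self_of_nhds
        have du0 : fderiv ℝ (u p.1) 0 = 0 := by
          simpa using (isBigO_fderiv_of_isBigO hs hO1).eq_zero_imp.self_of_nhds
        have w0 : w p.1 0 = 0 := by ext; simp [w, u0, du0]
        rw [w0, smul_zero]
        refine .of_isLittleO ?_
        have : (fun z => (q z)⁻¹ • u p.1 z) =O[𝓝 0] fun z => ‖z‖ ^ 2 :=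
          Asymptotics.IsBigO.of_bound B2 (by simpa using h2)
        have h5 := this.trans_isLittleO (Asymptotics.isLittleO_norm_pow_id (E' := E) one_lt_two)
        simpa [u0] using h5
      · have hq0 := (h3 h0).ne'
        have d1 : HasFDerivAt (u p.1) (fderiv ℝ (u p.1) p.2) p.2 :=
          (h1.differentiableAt (by
            have : divisionOrder (r + 1) m ≠ 0 := by omega
            exact_mod_cast this)).hasFDerivAt
        have d2 : HasFDerivAt q (fderiv ℝ q p.2) p.2 := (hq.differentiable (by simp) _).hasFDerivAt
        have d3 : HasFDerivAt (fun z => (q z)⁻¹) (-(q p.2 ^ 2)⁻¹ • fderiv ℝ q p.2) p.2 :=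
          (hasDerivAt_inv hq0).comp_hasFDerivAt p.2 d2
        refine (d3.smul d1).congr_fderiv ?_
        ext x
        simp only [w, add_apply, smul_apply, sub_apply, ContinuousLinearMap.smulRight_apply,
          smul_eq_mul]
        rw [smul_sub, smul_smul, smul_smul]
        have : (q p.2 ^ 2)⁻¹ * q p.2 = (q p.2)⁻¹ := by field_simp
        rw [this, neg_mul, neg_smul, sub_eq_add_neg]
    refine CTendsto.of_fderiv lim (hder.mono fun p hp => hp.differentiableAt)
      (Filter.Eventually.of_forall fun _ => differentiableAt_const _) ?_
    have hwO : ∀ᶠ i in l, w i =O[𝓝 0] fun z => ‖z‖ ^ M := by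
      obtain ⟨pa, ha, pb, hb, H⟩ := Filter.eventually_prod_iff.1 hu.smooth
      filter_upwards [hO, ha] with i hi hai
      have hs := H hai hb.self_of_nhds
      have e1 : fderiv ℝ (u i) =O[𝓝 0] fun z => ‖z‖ ^ M :=
        isBigO_fderiv_of_isBigO (hs.of_le (by exact_mod_cast le3))
          (hi.trans (isBigO_norm_pow_of_le le3))
      have e2 : u i =O[𝓝 0] fun z => ‖z‖ ^ M := hi.trans (isBigO_norm_pow_of_le (by omega))
      have e3 : q =O[𝓝 0] fun _ => (1 : ℝ) := hq.continuous.continuousAt.isBigO_one ℝ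
      have e4 : fderiv ℝ q =O[𝓝 0] fun _ => (1 : ℝ) := hfq.continuous.continuousAt.isBigO_one ℝ
      have e5 : (fun z => q z • fderiv ℝ (u i) z) =O[𝓝 0] fun z => ‖z‖ ^ M := by
        simpa using e3.smul e1
      have e6 : (fun z => (fderiv ℝ q z).smulRight (u i z)) =O[𝓝 0] fun z => ‖z‖ ^ M := by
        have := e4.norm_left.mul e2.norm_left
        simp only [one_mul] at this
        refine (Asymptotics.IsBigO.of_bound 1 (Filter.Eventually.of_forall fun z => ?_)).trans this
        rw [ContinuousLinearMap.norm_smulRight_apply]; simp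
      exact e5.sub e6
    have key : CTendsto r l (fun i z => (q z ^ 2)⁻¹ • w i z) (fun _ => 0) 0 := by
      refine ih (m := 2 * m) (q := fun z => q z ^ 2) (c := c ^ 2) (hq.pow 2) (by positivity) ?_
        hw hwO
      filter_upwards [hqc] with z hz
      calc c ^ 2 * ‖z‖ ^ (2 * m) = (c * ‖z‖ ^ m) ^ 2 := by ring
        _ ≤ q z ^ 2 := by gcongr
    refine key.congr (hder.mono fun p hp => hp.fderiv) ?_
    exact Filter.Eventually.of_forall fun y => by simp

end CTendsto

/-! ### Shift functions at regular points -/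

section Regular

variable {G : Plane → Plane}

/-- A continuous shift function of a smooth map is smooth at the regular points of the field. -/
theorem contDiffAt_shift_of_ne_zero (hG : ContDiff ℝ ∞ G) {h : Plane → Plane} {α : Plane → ℝ}
    {z₀ : Plane} (h0 : G z₀ ≠ 0) (hh : ContDiffAt ℝ ∞ h z₀) (hα : ContinuousAt α z₀)
    (hflow : ∀ᶠ z in 𝓝 z₀, FlowsTo G z (α z) (h z)) : ContDiffAt ℝ ∞ α z₀ := by
  have hf0 := hflow.self_of_nhds
  obtain ⟨B⟩ := exists_flowBox hG (hf0.ne_zero hG h0)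
  obtain ⟨F, hF, hF0, hFl⟩ := hf0.exists_localFlow hG
  have hFc : ContDiff ℝ ∞ fun z => F z (α z₀) :=
    hF.comp (by fun_prop : ContDiff ℝ ∞ fun z : Plane => (z, α z₀))
  have e : α =ᶠ[𝓝 z₀] fun z => α z₀ + B.T (h z) - B.T (F z (α z₀)) := by
    have ev1 : ∀ᶠ z in 𝓝 z₀, FlowsTo G z (α z₀) (F z (α z₀)) :=
      (by fun_prop : Continuous fun z : Plane => (z, α z₀)).continuousAt.eventually hFl
    have ev2 : ∀ᶠ z in 𝓝 z₀, h z ∈ B.N :=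
      hh.continuousAt.eventually_mem (B.isOpen.mem_nhds B.mem)
    have ev3 : ∀ᶠ z in 𝓝 z₀, F z (α z₀) ∈ B.N :=
      hFc.continuous.continuousAt.eventually_mem (B.isOpen.mem_nhds (by rw [hF0]; exact B.mem))
    have ev4 : ∀ᶠ z in 𝓝 z₀, |α z - α z₀| < B.δ := by
      simpa [Real.dist_eq] using hα.eventually (Metric.ball_mem_nhds _ B.pos)
    filter_upwards [ev1, ev2, ev3, ev4, hflow] with z h1 h2 h3 h4 h5
    have h6 := (h1.symm hG).trans hG h5
    rw [neg_add_eq_sub] at h6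
    linarith [B.time_eq _ h3 _ h2 _ h4.le h6]
  refine ContDiffAt.congr_of_eventuallyEq ?_ e
  have hT : ContDiffAt ℝ ∞ B.T (F z₀ (α z₀)) := by rw [hF0]; exact B.contDiffAt
  exact (contDiffAt_const.add (B.contDiffAt.comp z₀ hh)).sub (hT.comp z₀ hFc.contDiffAt)

/-- Around a regular point, the convergence of shift functions at one point implies their
convergence, pointwise nearby and together with the derivatives at the point itself: on a small
ball the difference of the shift functions, once it is small at one point, is given by the time
function of a flow box. -/
theorem exists_nhds_ctendsto_shift (hG : ContDiff ℝ ∞ G) {ι : Type} {l : Filter ι} {r : ℕ}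
    {h : ι → Plane → Plane} {f : Plane → Plane} {α : ι → Plane → ℝ} {β : Plane → ℝ} {U : Set Plane}
    (hU : IsOpen U) {z₀ : Plane} (hz₀ : z₀ ∈ U) (h0 : G z₀ ≠ 0)
    (hconv : ∀ z ∈ U, CTendsto r l h f z) (hf : ContDiffAt ℝ ∞ f z₀)
    (hβ : ContinuousOn β U) (hα : ∀ i, ContinuousOn (α i) U)
    (hβf : ∀ z ∈ U, FlowsTo G z (β z) (f z)) (hαh : ∀ i, ∀ z ∈ U, FlowsTo G z (α i z) (h i z)) :
    ∃ B ∈ 𝓝 z₀, ∀ z₁ ∈ B, Filter.Tendsto (fun i => α i z₁) l (𝓝 (β z₁)) →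
      CTendsto r l α β z₀ ∧ ∀ z ∈ B, Filter.Tendsto (fun i => α i z) l (𝓝 (β z)) := by
  obtain ⟨b⟩ := exists_flowBox hG ((hβf z₀ hz₀).ne_zero hG h0)
  have hT : ContDiffAt ℝ r b.T (f z₀) := b.contDiffAt.of_le (by exact_mod_cast le_top)
  have c1 : CTendsto r l (fun i z => b.T (h i z)) (fun z => b.T (f z)) z₀ :=
    CTendsto.comp hT (hconv z₀ hz₀)
  have c2 : CTendsto r l (fun (_ : ι) z => b.T (f z)) (fun z => b.T (f z)) z₀ :=
    CTendsto.const (hT.comp z₀ (hf.of_le (by exact_mod_cast le_top)))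
  have c3 := c1.sub c2
  -- a ball on which everything lies in the flow box and the time differences are small
  have ev1 : ∀ᶠ q in l ×ˢ 𝓝 z₀, |b.T (h q.1 q.2) - b.T (f q.2)| < b.δ / 2 := by
    have := c3.tendsto_zero.eventually (Metric.ball_mem_nhds _ (half_pos b.pos))
    simpa [Real.dist_eq] using this
  have ev2 : ∀ᶠ q in l ×ˢ 𝓝 z₀, h q.1 q.2 ∈ b.N :=
    (hconv z₀ hz₀).tendsto_zero.eventually_mem (b.isOpen.mem_nhds b.mem)
  have ev3 : ∀ᶠ q in l ×ˢ 𝓝 z₀, f q.2 ∈ b.N :=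
    Filter.tendsto_snd.eventually (hf.continuousAt.eventually_mem (b.isOpen.mem_nhds b.mem))
  have ev4 : ∀ᶠ q in l ×ˢ 𝓝 z₀, q.2 ∈ U := Filter.tendsto_snd.eventually (hU.mem_nhds hz₀)
  obtain ⟨pa, ha, pb, hb, H⟩ := Filter.eventually_prod_iff.1 (ev1.and (ev2.and (ev3.and ev4)))
  obtain ⟨ρ, hρ, hball⟩ := Metric.eventually_nhds_iff_ball.1 hb
  refine ⟨Metric.ball z₀ ρ, Metric.ball_mem_nhds _ hρ, fun z₁ hz₁ hlim => ?_⟩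
  have hsmall : ∀ i, pa i → ∀ z ∈ Metric.ball z₀ ρ, |α i z - β z| ≤ b.δ →
      α i z - β z = b.T (h i z) - b.T (f z) := by
    intro i hi z hz hd
    obtain ⟨h1, h2, h3, h4⟩ := H hi (hball z hz)
    have h5 := ((hβf z h4).symm hG).trans hG (hαh i z h4)
    rw [neg_add_eq_sub] at h5
    linarith [b.time_eq _ h3 _ h2 _ hd h5]
  have key : ∀ᶠ i in l, ∀ z ∈ Metric.ball z₀ ρ, α i z - β z = b.T (h i z) - b.T (f z) := by
    have hz₁' : ∀ᶠ i in l, |α i z₁ - β z₁| < b.δ := by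
      simpa [Real.dist_eq] using hlim.eventually (Metric.ball_mem_nhds _ b.pos)
    filter_upwards [ha, hz₁'] with i hi hi1 z hz
    refine hsmall i hi z hz ?_
    by_contra hcon
    have hsub : Metric.ball z₀ ρ ⊆ U := fun w hw => (H hi (hball w hw)).2.2.2
    have hpre : IsPreconnected ((fun w => |α i w - β w|) '' Metric.ball z₀ ρ) :=
      (convex_ball z₀ ρ).isPreconnected.image _
        (((hα i).sub hβ).mono hsub).abs
    have hlt : |α i z₁ - β z₁| < b.δ / 2 := by
      rw [hsmall i hi z₁ hz₁ hi1.le]; exact (H hi (hball z₁ hz₁)).1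
    obtain ⟨w, hw, hwe⟩ := hpre.Icc_subset (mem_image_of_mem _ hz₁) (mem_image_of_mem _ hz)
      ⟨by linarith [b.pos], (not_le.1 hcon).le⟩
    have h1 := (H hi (hball w hw)).1
    rw [← hsmall i hi w hw (by simpa using hwe.le)] at h1
    simp only at hwe
    linarith [b.pos]
  constructor
  · have hβs : ContDiffAt ℝ ∞ β z₀ := contDiffAt_shift_of_ne_zero hG h0 hf
      (hβ.continuousAt (hU.mem_nhds hz₀)) (Filter.eventually_of_mem (hU.mem_nhds hz₀) hβf)
    have c4 := (CTendsto.const (l := l) (hβs.of_le (m := r) (by exact_mod_cast le_top))).add c3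
    refine c4.congr ?_ (Filter.Eventually.of_forall fun y => by simp)
    refine Filter.eventually_prod_iff.2 ⟨_, key, _, Metric.ball_mem_nhds z₀ hρ,
      fun {i} hi {y} hy => ?_⟩
    have := hi y hy
    simp only
    linarith
  · intro z hz
    rcases l.eq_or_neBot with hbot | hl
    · rw [hbot]; exact Filter.tendsto_bot
    · obtain ⟨i, hi⟩ := (ha.and ha).exists
      have hzU : z ∈ U := (H hi.1 (hball z hz)).2.2.2
      have hzN : f z ∈ b.N := (H hi.1 (hball z hz)).2.2.1
      have t1 : Filter.Tendsto (fun i => h i z) l (𝓝 (f z)) :=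
        (hconv z hzU).tendsto_zero.comp (Filter.tendsto_id.prodMk tendsto_const_nhds)
      have t2 := (b.continuousOn.continuousAt (b.isOpen.mem_nhds hzN)).tendsto.comp t1
      have t3 : Filter.Tendsto (fun i => β z + (b.T (h i z) - b.T (f z))) l (𝓝 (β z)) := by
        simpa using tendsto_const_nhds.add (t2.sub_const (b.T (f z)))
      refine t3.congr' ?_
      filter_upwards [key] with i hi
      linarith [hi z hz]

end Regular

/-! ### Lifting of homotopies along the orbits -/

section Lift

variable {G : Plane → Plane}

/-- `a` is a lift of the path `c` in the orbit of `z` over `[0, s]`. -/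
def IsTimeLift (G : Plane → Plane) (z : Plane) (c : ℝ → Plane) (s : ℝ) (a : ℝ → ℝ) : Prop :=
  a 0 = 0 ∧ ContinuousOn a (Icc 0 s) ∧ ∀ t ∈ Icc 0 s, FlowsTo G z (a t) (c t)

theorem IsTimeLift.mono {z : Plane} {c : ℝ → Plane} {s s' : ℝ} {a : ℝ → ℝ}
    (h : IsTimeLift G z c s a) (hs : s' ≤ s) : IsTimeLift G z c s' a :=
  ⟨h.1, h.2.1.mono (Icc_subset_Icc_right hs), fun t ht => h.2.2 t ⟨ht.1, ht.2.trans hs⟩⟩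

theorem IsTimeLift.unique (hG : ContDiff ℝ ∞ G) {z : Plane} {c : ℝ → Plane} {s : ℝ} {a a' : ℝ → ℝ}
    (hz : G z ≠ 0) (hc : Continuous c) (h : IsTimeLift G z c s a) (h' : IsTimeLift G z c s a') :
    ∀ t ∈ Icc 0 s, a t = a' t := by
  intro t ht
  have hd : ContinuousOn (fun t => a t - a' t) (Icc 0 s) := h.2.1.sub h'.2.1
  have h0s : (0 : ℝ) ∈ Icc 0 s := ⟨le_rfl, ht.1.trans ht.2⟩
  have key := isPreconnected_Icc.induction₂ (s := Icc 0 s)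
    (fun x y => a x - a' x = 0 ↔ a y - a' y = 0) (fun x hx => ?_) (fun x y w _ _ _ => Iff.trans)
    (fun x y _ _ => Iff.symm) h0s ht
  · exact sub_eq_zero.1 (key.1 (by rw [h.1, h'.1, sub_zero]))
  · by_cases hx0 : a x - a' x = 0
    · obtain ⟨B⟩ := exists_flowBox hG ((h.2.2 x hx).ne_zero hG hz)
      have ev1 : ∀ᶠ y in 𝓝[Icc 0 s] x, |a y - a' y| < B.δ := by
        have := (hd x hx).tendsto.eventually (Metric.ball_mem_nhds _ B.pos)
        simpa [Real.dist_eq, hx0] using this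
      have ev2 : ∀ᶠ y in 𝓝[Icc 0 s] x, c y ∈ B.N :=
        (hc.continuousAt.eventually_mem (B.isOpen.mem_nhds B.mem)).filter_mono nhdsWithin_le_nhds
      filter_upwards [ev1, ev2, self_mem_nhdsWithin] with y h1 h2 h3
      have h4 := ((h'.2.2 y h3).symm hG).trans hG (h.2.2 y h3)
      rw [neg_add_eq_sub] at h4
      have := B.time_eq _ h2 _ h2 _ h1.le h4
      exact ⟨fun _ => by linarith, fun _ => hx0⟩
    · filter_upwards [(hd x hx).eventually_ne hx0] with y hy
      exact iff_of_false hx0 hy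

/-- The paths of a continuous family lift simultaneously near each point. -/
theorem exists_isTimeLift (hG : ContDiff ℝ ∞ G) {H : ℝ → Plane → Plane} {U : Set Plane}
    (hU : IsOpen U) (hH : ∀ t, ∀ z ∈ U, ContinuousAt (Function.uncurry H) (t, z))
    (hH0 : ∀ z ∈ U, H 0 z = z) (horb : ∀ t, ∀ z ∈ U, G z ≠ 0 → H t z ∈ orbit G z)
    {z₀ : Plane} (hz₀ : z₀ ∈ U) (h0 : G z₀ ≠ 0) {s : ℝ} (hs : 0 ≤ s) :
    ∃ N, IsOpen N ∧ z₀ ∈ N ∧ N ⊆ U ∧ (∀ z ∈ N, G z ≠ 0) ∧ ∃ A : ℝ → Plane → ℝ,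
      (∀ z ∈ N, IsTimeLift G z (fun t => H t z) s (fun t => A t z)) ∧
      ∀ t ∈ Icc 0 s, ContinuousOn (A t) N := by
  have hHt : ∀ z ∈ U, Continuous fun t => H t z := fun z hz => continuous_iff_continuousAt.2
    fun t => (hH t z hz).comp (f := fun t : ℝ => (t, z)) (by fun_prop)
  have hHz : ∀ t, ContinuousOn (H t) U := fun t z hz =>
    ((hH t z hz).comp (f := fun z : Plane => (t, z)) (by fun_prop)).continuousWithinAt
  let P : ℝ → Prop := fun s => ∃ N, IsOpen N ∧ z₀ ∈ N ∧ N ⊆ U ∧ (∀ z ∈ N, G z ≠ 0) ∧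
    ∃ A : ℝ → Plane → ℝ, (∀ z ∈ N, IsTimeLift G z (fun t => H t z) s (fun t => A t z)) ∧
      ∀ t ∈ Icc 0 s, ContinuousOn (A t) N
  have hmono : ∀ x y, x ≤ y → P y → P x := by
    rintro x y hxy ⟨N, h1, h2, h3, h4, A, h5, h6⟩
    exact ⟨N, h1, h2, h3, h4, A, fun z hz => (h5 z hz).mono hxy,
      fun t ht => h6 t ⟨ht.1, ht.2.trans hxy⟩⟩
  have hstep : ∀ t₀, ∃ ε > 0, ∀ x y, 0 ≤ x → x ≤ y → |x - t₀| < ε → |y - t₀| < ε → P x → P y := by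
    intro t₀
    have hreg : G (H t₀ z₀) ≠ 0 := by
      obtain ⟨t, ht⟩ := horb t₀ z₀ hz₀ h0
      exact ht.ne_zero hG h0
    obtain ⟨B⟩ := exists_flowBox hG hreg
    have ev : ∀ᶠ q : ℝ × Plane in 𝓝 (t₀, z₀), H q.1 q.2 ∈ B.N :=
      (hH t₀ z₀ hz₀).eventually_mem (B.isOpen.mem_nhds B.mem)
    rw [nhds_prod_eq] at ev
    obtain ⟨pa, ha, pb, hb, hab⟩ := Filter.eventually_prod_iff.1 ev
    obtain ⟨ε, hε, hball⟩ := Metric.eventually_nhds_iff_ball.1 ha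
    obtain ⟨M, hM, hMo, hzM⟩ := eventually_nhds_iff.1 hb
    refine ⟨ε, hε, fun x y hx0 hxy hx hy => ?_⟩
    rintro ⟨N, h1, h2, h3, h4, A, h5, h6⟩
    have hbox : ∀ t ∈ Icc x y, ∀ z ∈ N ∩ M, H t z ∈ B.N := by
      intro t ht z hz
      refine hab (hball t ?_) (hM z hz.2)
      rw [Metric.mem_ball, Real.dist_eq]
      rw [abs_lt] at *
      constructor <;> linarith [ht.1, ht.2]
    have hminmax : ∀ t ∈ Icc 0 y, min t x ∈ Icc 0 x ∧ max t x ∈ Icc x y := fun t ht =>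
      ⟨⟨le_min ht.1 hx0, min_le_right _ _⟩, ⟨le_max_right _ _, max_le ht.2 hxy⟩⟩
    refine ⟨N ∩ M, h1.inter hMo, ⟨h2, hzM⟩, fun z hz => h3 hz.1, fun z hz => h4 z hz.1,
      fun t z => A (min t x) z + (B.T (H (max t x) z) - B.T (H x z)), fun z hz => ⟨?_, ?_, ?_⟩, ?_⟩
    · simp only [min_eq_left hx0, max_eq_right hx0, sub_self, add_zero]
      exact (h5 z hz.1).1
    · refine ContinuousOn.add ?_ (ContinuousOn.sub ?_ continuousOn_const)
      · exact (h5 z hz.1).2.1.comp (by fun_prop) fun t ht => (hminmax t ht).1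
      · refine B.continuousOn.comp ?_ fun t ht => hbox _ (hminmax t ht).2 z hz
        exact ((hHt z (h3 hz.1)).comp (by fun_prop)).continuousOn
    · intro t ht
      obtain ⟨m1, m2⟩ := hminmax t ht
      rcases le_total t x with htx | htx
      · simp only [min_eq_left htx, max_eq_right htx, sub_self, add_zero]
        exact (h5 z hz.1).2.2 t ⟨ht.1, htx⟩
      · simp only [min_eq_right htx, max_eq_left htx]
        refine ((h5 z hz.1).2.2 x ⟨hx0, le_rfl⟩).trans hG ?_
        exact B.flowsTo z (Icc x y) (fun t => H t z) isPreconnected_Icc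
          (hHt z (h3 hz.1)).continuousOn
          (fun t ht => ⟨hbox t ht z hz, horb t z (h3 hz.1) (h4 z hz.1)⟩) x ⟨le_rfl, hxy⟩ t ⟨htx, ht.2⟩
    · intro t ht
      obtain ⟨m1, m2⟩ := hminmax t ht
      have hsub : N ∩ M ⊆ U := fun z hz => h3 hz.1
      refine ((h6 _ m1).mono inter_subset_left).add (ContinuousOn.sub ?_ ?_)
      · exact B.continuousOn.comp ((hHz _).mono hsub) fun z hz => hbox _ m2 z hz
      · exact B.continuousOn.comp ((hHz _).mono hsub) fun z hz => hbox _ ⟨le_rfl, hxy⟩ z hz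
  have hP0 : P 0 := by
    refine ⟨U ∩ {z | G z ≠ 0}, hU.inter (isOpen_ne_fun hG.continuous continuous_const), ⟨hz₀, h0⟩,
      inter_subset_left, fun z hz => hz.2, fun _ _ => 0, fun z hz => ⟨rfl, continuousOn_const, ?_⟩,
      fun _ _ => continuousOn_const⟩
    intro t ht
    have : t = 0 := le_antisymm ht.2 ht.1
    subst this
    simp only [hH0 z hz.1]
    exact FlowsTo.refl z
  have key := isPreconnected_Icc.induction₂ (s := Icc 0 s) (fun x y => P x ↔ P y) (fun x hx => ?_)
    (fun x y w _ _ _ => Iff.trans) (fun x y _ _ => Iff.symm)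
    (⟨le_rfl, hs⟩ : (0 : ℝ) ∈ Icc 0 s) (⟨hs, le_rfl⟩ : s ∈ Icc 0 s)
  · exact key.1 hP0
  · obtain ⟨ε, hε, H⟩ := hstep x
    have ev : ∀ᶠ y in 𝓝[Icc 0 s] x, |y - x| < ε := by
      have := Metric.ball_mem_nhds x hε
      exact nhdsWithin_le_nhds (by simpa [Metric.ball, Real.dist_eq] using this)
    filter_upwards [ev, self_mem_nhdsWithin] with y hy hy2
    rcases le_total x y with hxy | hxy
    · exact ⟨H x y hx.1 hxy (by simpa) hy, hmono x y hxy⟩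
    · exact ⟨hmono y x hxy, H y x hy2.1 hxy hy (by simpa)⟩

/-- A homotopy along the orbits is given by a family of time functions, which is unique and
continuous at the regular points. -/
theorem exists_timeLift (hG : ContDiff ℝ ∞ G) {H : ℝ → Plane → Plane} {U : Set Plane}
    (hU : IsOpen U) (hH : ∀ t, ∀ z ∈ U, ContinuousAt (Function.uncurry H) (t, z))
    (hH0 : ∀ z ∈ U, H 0 z = z) (horb : ∀ t, ∀ z ∈ U, G z ≠ 0 → H t z ∈ orbit G z) :
    ∃ A : ℝ → Plane → ℝ, ∀ z ∈ U, G z ≠ 0 →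
      IsTimeLift G z (fun t => H t z) 1 (fun t => A t z) ∧
      ∀ t ∈ Icc (0 : ℝ) 1, ContinuousAt (A t) z := by
  have hHt : ∀ z ∈ U, Continuous fun t => H t z := fun z hz => continuous_iff_continuousAt.2
    fun t => (hH t z hz).comp (f := fun t : ℝ => (t, z)) (by fun_prop)
  have hex : ∀ z, ∃ a : ℝ → ℝ, z ∈ U → G z ≠ 0 → IsTimeLift G z (fun t => H t z) 1 a := by
    intro z
    by_cases h : z ∈ U ∧ G z ≠ 0
    · obtain ⟨N, -, hN, -, -, A, hA, -⟩ := exists_isTimeLift hG hU hH hH0 horb h.1 h.2 zero_le_one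
      exact ⟨fun t => A t z, fun _ _ => hA z hN⟩
    · exact ⟨0, fun h1 h2 => absurd ⟨h1, h2⟩ h⟩
  choose a ha using hex
  refine ⟨fun t z => a z t, fun z hz h0 => ⟨ha z hz h0, fun t ht => ?_⟩⟩
  obtain ⟨N, hNo, hN, hNU, hN0, A, hA, hAc⟩ :=
    exists_isTimeLift hG hU hH hH0 horb hz h0 zero_le_one
  refine ((hAc t ht).continuousAt (hNo.mem_nhds hN)).congr ?_
  filter_upwards [hNo.mem_nhds hN] with w hw
  exact (hA w hw).unique hG (hN0 w hw) (hHt w (hNU hw)) (ha w (hNU hw) (hN0 w hw)) t ht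

end Lift

/-! ### The weak Whitney topology and convergence near points -/

section WeakTopology

variable {F : Type} [NormedAddCommGroup F] [NormedSpace ℝ F] {V : Opens Plane}

omit [NormedSpace ℝ F] in
theorem zeroExt_apply (f : V → F) (z : V) : zeroExt f z = f z :=
  Subtype.val_injective.extend_apply f 0 z

theorem SmoothMaps.contDiffAt (f : SmoothMaps F V) {z : Plane} (hz : z ∈ V) :
    ContDiffAt ℝ ∞ (zeroExt f.1) z :=
  f.2.contDiffAt (V.isOpen.mem_nhds hz)

theorem SmoothMaps.closeOn_mem_nhds (f : SmoothMaps F V) {s : ℕ} {K : Set Plane} (hK : IsCompact K)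
    (hKV : K ⊆ V) {ε : ℝ} (hε : 0 < ε) :
    {h | CloseOn s K ε f h} ∈ @nhds _ (weakTopology F V s) f := by
  rw [@mem_nhds_iff]
  refine ⟨{h | ∃ ε' < ε, CloseOn s K ε' f h}, ?_, ?_, ?_⟩
  · rintro h ⟨ε', hε', H⟩
    exact H.mono subset_rfl hε'.le
  · rintro h ⟨ε', hε', H⟩
    refine ⟨K, hK, hKV, (ε - ε') / 2, by linarith, fun g hg => ⟨ε' + (ε - ε') / 2, by linarith, ?_⟩⟩
    intro k hk x hx
    have h1 := H k hk x hx
    have h2 := hg k hk x hx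
    calc _ ≤ _ := norm_sub_le_norm_sub_add_norm_sub _ (iteratedFDeriv ℝ k (zeroExt h.1) x) _
      _ < _ := by linarith
  · exact ⟨ε / 2, by linarith, fun k hk x hx => by simpa using hε⟩

/-- Convergence in the weak Whitney topology implies convergence near each point of `V`. -/
theorem SmoothMaps.ctendsto_nhds (f : SmoothMaps F V) (s : ℕ) {z : Plane} (hz : z ∈ V) :
    CTendsto s (@nhds _ (weakTopology F V s) f) (fun h : SmoothMaps F V => zeroExt h.1)
      (zeroExt f.1) z := by
  obtain ⟨ρ, hρ, hball⟩ := Metric.nhds_basis_closedBall.mem_iff.1 (V.isOpen.mem_nhds hz)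
  have hsm : ∀ᶠ q in (@nhds _ (weakTopology F V s) f) ×ˢ 𝓝 z,
      ContDiffAt ℝ s (zeroExt q.1.1) q.2 :=
    (Filter.tendsto_snd.eventually (V.isOpen.mem_nhds hz)).mono fun q hq =>
      (q.1.contDiffAt hq).of_le (by exact_mod_cast le_top)
  have hlim : ContDiffAt ℝ s (zeroExt f.1) z := (f.contDiffAt hz).of_le (by exact_mod_cast le_top)
  refine ⟨hsm, hlim, fun k hk => ?_⟩
  rw [Metric.tendsto_nhds]
  intro ε hε
  have e1 := f.closeOn_mem_nhds (s := s) (isCompact_closedBall z ρ) hball (half_pos hε)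
  have e2 : ∀ᶠ y in 𝓝 z, dist (iteratedFDeriv ℝ k (zeroExt f.1) y)
      (iteratedFDeriv ℝ k (zeroExt f.1) z) < ε / 2 :=
    Metric.tendsto_nhds.1 (hlim.continuousAt_iteratedFDeriv (by exact_mod_cast hk)).tendsto _
      (half_pos hε)
  refine Filter.eventually_prod_iff.2 ⟨_, e1, _,
    e2.and (Metric.closedBall_mem_nhds z hρ), fun {h} hh {y} hy => ?_⟩
  have h1 := hh k hk y hy.2
  rw [← dist_eq_norm] at h1
  calc _ ≤ _ := dist_triangle _ (iteratedFDeriv ℝ k (zeroExt f.1) y) _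
    _ < ε := by linarith [hy.1]

/-- Continuity into the weak topology follows from the convergence of the derivatives near
each point. -/
theorem SmoothMaps.tendsto_of_ctendsto {X : Type} {l : Filter X} {r : ℕ} {σ : X → SmoothMaps F V}
    {f : SmoothMaps F V}
    (h : ∀ z ∈ V, CTendsto r l (fun x => zeroExt (σ x).1) (zeroExt f.1) z) :
    Filter.Tendsto σ l (@nhds _ (weakTopology F V r) f) := by
  intro S hS
  rw [@mem_nhds_iff] at hS
  obtain ⟨O, hOS, hO, hfO⟩ := hS
  obtain ⟨K, hK, hKV, ε, hε, H⟩ := hO f hfO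
  have key : ∀ᶠ x in l, CloseOn r K ε f (σ x) := by
    have h1 : ∀ k ∈ Finset.range (r + 1), ∀ᶠ x in l, ∀ z ∈ K,
        ‖iteratedFDeriv ℝ k (zeroExt (σ x).1) z - iteratedFDeriv ℝ k (zeroExt f.1) z‖ < ε := by
      intro k hk
      have hk' : k ≤ r := by simpa [Nat.lt_succ_iff] using hk
      have h2 := hK.mem_prod_nhdsSet_of_forall (l := l)
        (s := {q : X × Plane | ‖iteratedFDeriv ℝ k (zeroExt (σ q.1).1) q.2 -
          iteratedFDeriv ℝ k (zeroExt f.1) q.2‖ < ε}) (fun z hz => ?_)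
      · obtain ⟨pa, ha, pb, hb, hab⟩ := Filter.eventually_prod_iff.1 h2
        filter_upwards [ha] with x hx z hz
        exact hab hx (hb.self_of_nhdsSet z hz)
      · have t1 := (h z (hKV hz)).tendsto k hk'
        have t2 := (((h z (hKV hz)).smooth_lim.continuousAt_iteratedFDeriv
          (by exact_mod_cast hk')).tendsto.comp (Filter.tendsto_snd (f := l) (g := 𝓝 z)))
        have t3 := (t1.sub t2).norm
        rw [sub_self, norm_zero] at t3
        exact t3.eventually_lt_const hε
    filter_upwards [(Filter.eventually_all_finset _).2 h1] with x hx k hk z hz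
    exact hx k (by simpa [Nat.lt_succ_iff] using hk) z hz
  exact Filter.mem_map.2 (key.mono fun x hx => hOS (H _ hx))

/-- The path from the identity to an element of `𝓔_id(G, V)`, extended to all real times, is
jointly continuous together with its first derivatives. -/
theorem exists_homotopy_of_mem_orbitMapsId {G : Plane → Plane} {h : SmoothMaps Plane V}
    (hh : h ∈ orbitMapsId G V) : ∃ H : ℝ → SmoothMaps Plane V,
      H 0 = SmoothMaps.incl V ∧ H 1 = h ∧ (∀ t, H t ∈ orbitMaps G V) ∧
      ∀ t, ∀ z ∈ V, CTendsto 1 (𝓝 t) (fun s => zeroExt (H s).1) (zeroExt (H t).1) z := by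
  let _ := SmoothMaps.weakTopology Plane V 1
  obtain ⟨γ, hγ⟩ : JoinedIn (orbitMaps G V) (SmoothMaps.incl V) h := hh
  refine ⟨γ.extend, γ.extend_zero, γ.extend_one, fun t => ?_, fun t z hz => ?_⟩
  · exact hγ _
  · have h1 := (γ.extend t).ctendsto_nhds 1 hz
    have hc : Filter.Tendsto γ.extend (𝓝 t) (𝓝 (γ.extend t)) := γ.continuous_extend.tendsto t
    refine ⟨?_, h1.smooth_lim, fun k hk => ?_⟩
    · exact (hc.prodMap Filter.tendsto_id).eventually h1.smooth
    · exact (h1.tendsto k hk).comp (hc.prodMap Filter.tendsto_id)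

end WeakTopology

/-! ### The flow near a zero of finite order -/

section LocalFlow

/-- A smooth map which is `O(‖z‖ ^ (m + 1))` has Lipschitz constant `O(r ^ m)` on the ball of
radius `r`. -/
theorem exists_lipschitz_of_isBigO {E F : Type} [NormedAddCommGroup E] [NormedSpace ℝ E]
    [NormedAddCommGroup F] [NormedSpace ℝ F] {m : ℕ} {f : E → F} (hf : ContDiffAt ℝ (m + 1 : ℕ) f 0)
    (hO : f =O[𝓝 0] fun z => ‖z‖ ^ (m + 1)) :
    ∃ C ≥ 0, ∃ ρ > 0, ∀ a b : E, ∀ r < ρ, ‖a‖ ≤ r → ‖b‖ ≤ r → ‖f a - f b‖ ≤ C * r ^ m * ‖a - b‖ := by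
  obtain ⟨C, hC, hb⟩ := (isBigO_fderiv_of_isBigO hf hO).exists_nonneg
  have hd : ∀ᶠ z in 𝓝 (0 : E), DifferentiableAt ℝ f z :=
    (hf.eventually (by simp)).mono fun z hz => hz.differentiableAt (by simp)
  obtain ⟨ρ, hρ, h⟩ := Metric.eventually_nhds_iff.1 (hb.bound.and hd)
  refine ⟨C, hC, ρ, hρ, fun a b r hr ha hb => ?_⟩
  refine (convex_closedBall (0 : E) r).norm_image_sub_le_of_norm_fderiv_le (𝕜 := ℝ)
    (fun z hz => (h ?_).2) (fun z hz => ?_) (by simpa using hb) (by simpa using ha)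
  · have hz' : ‖z‖ ≤ r := by simpa using hz
    simpa using hz'.trans_lt hr
  · have hz' : ‖z‖ ≤ r := by simpa using hz
    refine (h (by simpa using hz'.trans_lt hr)).1.trans ?_
    rw [norm_pow, norm_norm]
    gcongr

/-- The vector field `G` has a zero of exact order `p` at the origin: its size is comparable
to `‖z‖ ^ p`. -/
structure HasZeroOfOrder (G : Plane → Plane) (p : ℕ) : Prop where
  contDiff : ContDiff ℝ ∞ G
  one_le : 1 ≤ p
  isBigO : G =O[𝓝 0] fun z => ‖z‖ ^ p
  lower : ∃ c > 0, ∀ᶠ z in 𝓝 (0 : Plane), c * ‖z‖ ^ p ≤ ‖G z‖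

variable {G : Plane → Plane} {p : ℕ}

theorem HasZeroOfOrder.map_zero (hG : HasZeroOfOrder G p) : G 0 = 0 := by
  have h := hG.isBigO.eq_zero_imp.self_of_nhds
  exact h (by have := hG.one_le; simp; omega)

theorem IsCutoffFlow.apply_origin {R : ℝ} {F : Plane → ℝ → Plane} (hG : HasZeroOfOrder G p)
    (hF : IsCutoffFlow G R F) (hR : 0 < R) (t : ℝ) : F 0 t = 0 := by
  have h := hF.eq_of_isIntegralCurveOn (γ := fun _ => 0) (t := t) (fun s _ => by
    change HasDerivWithinAt (fun _ => (0 : Plane)) (G 0) _ _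
    rw [hG.map_zero]; exact hasDerivWithinAt_const _ _ _) (fun s _ => Metric.mem_ball_self hR)
  exact (h t right_mem_uIcc).symm

/-- Estimates for the flow near a zero of order `p`: as long as `|t| ‖z‖ ^ (p - 1)` is small, the
displacement is `t G(z)` up to a relatively small error; hence it controls `t`. -/
theorem exists_flow_estimates {R : ℝ} {F : Plane → ℝ → Plane} (hG : HasZeroOfOrder G p)
    (hF : IsCutoffFlow G R F) (hR : 0 < R) :
    ∃ ρ > 0, ∃ c₀ > 0, ∃ C > 0, ∀ z : Plane, ∀ t : ℝ, ‖z‖ < ρ → |t| * ‖z‖ ^ (p - 1) ≤ c₀ →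
      ‖F z t - z - t • G z‖ ≤ C * t ^ 2 * ‖z‖ ^ (2 * p - 1) ∧
      |t| * ‖z‖ ^ p ≤ C * ‖F z t - z‖ ∧ FlowsTo G z t (F z t) := by
  obtain ⟨m, rfl⟩ : ∃ m, p = m + 1 := ⟨p - 1, by have := hG.one_le; omega⟩
  obtain ⟨C₁, hC₁, hb₁⟩ := hG.isBigO.exists_nonneg
  obtain ⟨ρ₁, hρ₁, H₁⟩ := Metric.eventually_nhds_iff.1 hb₁.bound
  obtain ⟨C₂, hC₂, ρ₂, hρ₂, H₂⟩ := exists_lipschitz_of_isBigO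
    (hG.contDiff.contDiffAt.of_le (by exact_mod_cast le_top)) hG.isBigO
  obtain ⟨c, hc, hlow⟩ := hG.lower
  obtain ⟨ρ₃, hρ₃, H₃⟩ := Metric.eventually_nhds_iff.1 hlow
  have hGle : ∀ x : Plane, ‖x‖ < ρ₁ → ‖G x‖ ≤ C₁ * ‖x‖ ^ (m + 1) := by
    intro x hx
    have := H₁ (by simpa using hx : dist x 0 < ρ₁)
    simpa using this
  set K := C₁ * 2 ^ (m + 1) + 1 with hK
  have hK0 : 0 < K := by positivity
  set M := C₂ * 2 ^ m * K with hM
  have hM0 : 0 ≤ M := by positivity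
  set c₀ := min K⁻¹ (c / (2 * (M + 1))) with hc₀
  have hc₀0 : 0 < c₀ := by positivity
  refine ⟨min (min (ρ₁ / 2) (ρ₂ / 2)) (min ρ₃ (R / 2)), by positivity, c₀, hc₀0,
    max (M + 1) (2 / c), by positivity, fun z t hz ht => ?_⟩
  obtain ⟨⟨hz1, hz2⟩, hz3, hz4⟩ : (‖z‖ < ρ₁ / 2 ∧ ‖z‖ < ρ₂ / 2) ∧ ‖z‖ < ρ₃ ∧ ‖z‖ < R / 2 := by
    simpa [lt_min_iff] using hz
  rw [Nat.add_sub_cancel] at ht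
  rcases eq_or_ne z 0 with h0 | h0
  · subst h0
    rw [hF.apply_origin hG hR, hG.map_zero]
    refine ⟨by simp; positivity, by simp, flowsTo_of_zero hG.map_zero t⟩
  have hn : 0 < ‖z‖ := norm_pos_iff.2 h0
  have htK : |t| * K * ‖z‖ ^ (m + 1) ≤ ‖z‖ := by
    have h1 : |t| * ‖z‖ ^ m ≤ K⁻¹ := ht.trans (min_le_left _ _)
    calc |t| * K * ‖z‖ ^ (m + 1) = (|t| * ‖z‖ ^ m) * (K * ‖z‖) := by ring
      _ ≤ K⁻¹ * (K * ‖z‖) := by gcongr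
      _ = ‖z‖ := by field_simp
  -- the trajectory over `[0, |t|]` in the direction `σ`
  have traj : ∀ σ : ℝ, |σ| = 1 → ∀ s ∈ Icc 0 |t|, ‖F z (σ * s) - z‖ ≤ K * ‖z‖ ^ (m + 1) * s ∧
      ‖F z (σ * s)‖ ≤ 2 * ‖z‖ := by
    intro σ hσ
    have hR2 : ∀ s ∈ Icc 0 |t|, ‖F z (σ * s) - z‖ ≤ K * ‖z‖ ^ (m + 1) * s →
        ‖F z (σ * s)‖ ≤ 2 * ‖z‖ := by
      intro s hs h
      have h1 : K * ‖z‖ ^ (m + 1) * s ≤ ‖z‖ := by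
        calc _ ≤ K * ‖z‖ ^ (m + 1) * |t| := by gcongr; exact hs.2
          _ ≤ ‖z‖ := by linarith
      have h2 := norm_add_le (F z (σ * s) - z) z
      rw [sub_add_cancel] at h2
      linarith
    obtain ⟨Gt, hGt, hGtG⟩ := hF
    have hder : ∀ s, HasDerivAt (fun s => F z (σ * s) - z) (σ • Gt (F z (σ * s))) s := by
      intro s
      have h1 := (hGt.hasDerivAt z (σ * s)).scomp s ((hasDerivAt_id s).const_mul σ)
      simpa using h1.sub_const z
    have key := image_norm_le_of_norm_deriv_right_lt_deriv_boundary'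
      (f := fun s => F z (σ * s) - z) (a := 0) (b := |t|)
      (B := fun s => K * ‖z‖ ^ (m + 1) * s) (B' := fun _ => K * ‖z‖ ^ (m + 1))
      (fun s _ => (hder s).continuousAt.continuousWithinAt)
      (fun s _ => (hder s).hasDerivWithinAt) (by simp [hGt.zero]) (by fun_prop)
      (fun s _ => by simpa using ((hasDerivAt_id s).const_mul (K * ‖z‖ ^ (m + 1))).hasDerivWithinAt)
      (fun s hs hse => by
        have h2 := hR2 s (Ico_subset_Icc_self hs) hse.le
        rw [norm_smul, Real.norm_eq_abs, hσ, one_mul, hGtG _ (by simpa using by linarith)]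
        calc ‖G (F z (σ * s))‖ ≤ C₁ * ‖F z (σ * s)‖ ^ (m + 1) := hGle _ (by linarith)
          _ ≤ C₁ * (2 * ‖z‖) ^ (m + 1) := by gcongr
          _ = (C₁ * 2 ^ (m + 1)) * ‖z‖ ^ (m + 1) := by rw [mul_pow]; ring
          _ < K * ‖z‖ ^ (m + 1) := by
            rw [hK]; gcongr; linarith)
    exact fun s hs => ⟨key hs, hR2 s hs (key hs)⟩
  obtain ⟨σ, hσ, hσt⟩ : ∃ σ : ℝ, |σ| = 1 ∧ t = σ * |t| := by
    rcases le_total 0 t with h | h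
    · exact ⟨1, by simp, by rw [abs_of_nonneg h]; ring⟩
    · exact ⟨-1, by simp, by rw [abs_of_nonpos h]; ring⟩
  have htr := traj σ hσ
  have hball : ∀ s ∈ Icc 0 |t|, F z (σ * s) ∈ Metric.ball (0 : Plane) R := fun s hs => by
    have := (htr s hs).2
    simp only [mem_ball_zero_iff]; linarith
  have e1 : ‖F z t - z - t • G z‖ ≤ M * t ^ 2 * ‖z‖ ^ (2 * (m + 1) - 1) := by
    have hd : ∀ s ∈ Icc 0 |t|, HasDerivWithinAt (fun s => F z (σ * s) - z - (σ * s) • G z)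
        (σ • (G (F z (σ * s)) - G z)) (Icc 0 |t|) s := by
      intro s hs
      have h1 := (hF.hasDerivAt (hball s hs)).scomp s ((hasDerivAt_id s).const_mul σ)
      have h2 := (((hasDerivAt_id s).const_mul σ).smul_const (G z))
      have h3 := (h1.sub_const z).sub h2
      simp only [mul_one, ← smul_sub] at h3
      exact h3.hasDerivWithinAt
    have key := norm_image_sub_le_of_norm_deriv_le_segment' hd
      (C := M * |t| * ‖z‖ ^ (2 * (m + 1) - 1)) (fun s hs => by
        have hs' := Ico_subset_Icc_self hs
        obtain ⟨h1, h2⟩ := htr s hs'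
        rw [norm_smul, Real.norm_eq_abs, hσ, one_mul]
        calc ‖G (F z (σ * s)) - G z‖ ≤ C₂ * (2 * ‖z‖) ^ m * ‖F z (σ * s) - z‖ :=
              H₂ _ _ (2 * ‖z‖) (by linarith) h2 (by linarith)
          _ ≤ C₂ * (2 * ‖z‖) ^ m * (K * ‖z‖ ^ (m + 1) * |t|) := by
              gcongr
              exact h1.trans (by gcongr; exact hs.2.le)
          _ = M * |t| * ‖z‖ ^ (2 * (m + 1) - 1) := by
              rw [hM, show 2 * (m + 1) - 1 = m + (m + 1) by omega, pow_add, mul_pow]; ring)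
      |t| ⟨abs_nonneg _, le_rfl⟩
    simp only [← hσt, mul_zero, hF.zero, sub_self, zero_smul, sub_zero] at key
    calc _ ≤ _ := key
      _ = M * (|t| * |t|) * ‖z‖ ^ (2 * (m + 1) - 1) := by ring
      _ = _ := by rw [abs_mul_abs_self, sq]
  refine ⟨e1.trans ?_, ?_, ?_⟩
  · gcongr
    exact (le_max_left _ _).trans' (by linarith)
  · have hl : c * ‖z‖ ^ (m + 1) ≤ ‖G z‖ := H₃ (by simpa using hz3 : dist z 0 < ρ₃)
    have h1 : ‖t • G z‖ ≤ ‖F z t - z‖ + ‖F z t - z - t • G z‖ := by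
      have := norm_sub_le (F z t - z) (F z t - z - t • G z)
      rwa [sub_sub_cancel] at this
    rw [norm_smul, Real.norm_eq_abs] at h1
    have h2 : |t| * (c * ‖z‖ ^ (m + 1)) ≤ |t| * ‖G z‖ := by gcongr
    have h3 : M * t ^ 2 * ‖z‖ ^ (2 * (m + 1) - 1) ≤ c / 2 * (|t| * ‖z‖ ^ (m + 1)) := by
      have h4 : |t| * ‖z‖ ^ m ≤ c / (2 * (M + 1)) := ht.trans (min_le_right _ _)
      have h5 : M * (c / (2 * (M + 1))) ≤ c / 2 := by
        rw [← mul_div_assoc, div_le_div_iff₀ (by positivity) (by positivity)]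
        nlinarith
      calc M * t ^ 2 * ‖z‖ ^ (2 * (m + 1) - 1)
          = M * (|t| * ‖z‖ ^ m) * (|t| * ‖z‖ ^ (m + 1)) := by
            rw [show 2 * (m + 1) - 1 = m + (m + 1) by omega, pow_add, ← sq_abs]; ring
        _ ≤ M * (c / (2 * (M + 1))) * (|t| * ‖z‖ ^ (m + 1)) := by gcongr
        _ ≤ _ := by gcongr
    have h6 : |t| * ‖z‖ ^ (m + 1) ≤ 2 / c * ‖F z t - z‖ := by
      rw [div_mul_eq_mul_div, le_div_iff₀ hc]
      nlinarith
    exact h6.trans (by gcongr; exact le_max_right _ _)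
  · refine hF.flowsTo fun r hr => ?_
    have : r = σ * |r| ∧ |r| ≤ |t| := by
      rcases le_total 0 t with h | h
      · rw [uIcc_of_le h] at hr
        rw [abs_of_nonneg hr.1, abs_of_nonneg h]
        refine ⟨?_, hr.2⟩
        rcases h.eq_or_lt with h' | h'
        · rw [← h'] at hr; rw [le_antisymm hr.2 hr.1]; simp
        · rw [abs_of_pos h'] at hσt
          have : σ = 1 := by
            have h7 : t * (σ - 1) = 0 := by linarith
            linarith [(mul_eq_zero.1 h7).resolve_left h'.ne']
          rw [this, one_mul]
      · rw [uIcc_of_ge h] at hr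
        rw [abs_of_nonpos hr.2, abs_of_nonpos h]
        refine ⟨?_, by linarith [hr.1]⟩
        rcases h.eq_or_lt with h' | h'
        · rw [h'] at hr; rw [le_antisymm hr.2 hr.1]; simp
        · rw [abs_of_neg h'] at hσt
          have : σ = -1 := by
            have h7 : t * (σ + 1) = 0 := by linarith
            linarith [(mul_eq_zero.1 h7).resolve_left h'.ne]
          rw [this]; ring
    rw [this.1]
    exact hball _ ⟨abs_nonneg _, this.2⟩

/-- A continuous function on a preconnected set which avoids the values in `(c₁, c₀]` and is
at most `c₀` at one point is at most `c₁` everywhere. -/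
theorem IsPreconnected.le_of_gap {X : Type} [TopologicalSpace X] {S : Set X} (hS : IsPreconnected S)
    {φ : X → ℝ} (hφ : ContinuousOn φ S) {c₁ c₀ : ℝ} (hc : c₁ < c₀)
    (hgap : ∀ x ∈ S, φ x ≤ c₀ → φ x ≤ c₁) {x₀ : X} (hx₀ : x₀ ∈ S) (h0 : φ x₀ ≤ c₀) :
    ∀ x ∈ S, φ x ≤ c₁ := by
  intro x hx
  refine hgap x hx ?_
  by_contra hcon
  obtain ⟨y, hy, hye⟩ := (hS.image _ hφ).Icc_subset (mem_image_of_mem _ hx₀) (mem_image_of_mem _ hx)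
    ⟨h0, (not_le.1 hcon).le⟩
  have := hgap y hy hye.le
  linarith

end LocalFlow

/-! ### Homogeneous polynomials in two variables -/

section Polynomials

open MvPolynomial

theorem totalDegree_pderiv_lt {σ : Type*} (i : σ) {d : MvPolynomial σ ℝ} (h : pderiv i d ≠ 0) :
    (pderiv i d).totalDegree < d.totalDegree := by
  classical
  have key : ∀ m ∈ (pderiv i d).support, (m.sum fun _ e => e) + 1 ≤ d.totalDegree := by
    intro m hm
    rw [mem_support_iff, coeff_pderiv] at hm
    have h1 : m + Finsupp.single i 1 ∈ d.support := mem_support_iff.2 (left_ne_zero_of_mul hm)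
    have h2 := le_totalDegree h1
    rwa [Finsupp.sum_add_index' (by simp) (by simp), Finsupp.sum_single_index rfl] at h2
  obtain ⟨m, hm⟩ := support_nonempty.2 h
  have hpos := key m hm
  refine (Finset.sup_lt_iff (bot_lt_iff_ne_bot.2 ?_)).2 fun m hm => Nat.lt_of_succ_le (key m hm)
  rw [Nat.bot_eq_zero]; omega

theorem eq_C_of_pderiv_eq_zero {σ : Type*} {d : MvPolynomial σ ℝ} (h : ∀ i, pderiv i d = 0) :
    d = C (coeff 0 d) := by
  classical
  ext m
  rw [coeff_C]
  split_ifs with hm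
  · rw [hm]
  · obtain ⟨i, hi⟩ : ∃ i, m i ≠ 0 := by
      by_contra hcon
      push Not at hcon
      exact hm (Finsupp.ext fun i => (hcon i).symm)
    have h1 := congrArg (coeff (m - Finsupp.single i 1)) (h i)
    rw [coeff_pderiv, coeff_zero] at h1
    have h2 : m - Finsupp.single i 1 + Finsupp.single i 1 = m :=
      tsub_add_cancel_of_le (Finsupp.single_le_iff.2 (Nat.one_le_iff_ne_zero.2 hi))
    rw [h2] at h1
    refine (mul_eq_zero.1 h1).resolve_right ?_
    positivity

/-- A homogeneous polynomial without multiple factors has relatively prime partial derivatives: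
by Euler's identity, a common irreducible factor divides the polynomial itself, hence divides its
own derivatives. -/
theorem PolyStar.isRelPrime {p : ℕ} {g : MvPolynomial (Fin 2) ℝ} (hg : PolyStar p g) :
    IsRelPrime (pderiv 0 g) (pderiv 1 g) := by
  have hg0 : g ≠ 0 := hg.squarefree.ne_zero
  have euler := hg.homogeneous.sum_X_mul_pderiv
  rw [Fin.sum_univ_two, nsmul_eq_mul] at euler
  have hp : ((p + 1 : ℕ) : MvPolynomial (Fin 2) ℝ) ≠ 0 := by exact_mod_cast Nat.succ_ne_zero p
  have hpu : IsUnit ((p + 1 : ℕ) : MvPolynomial (Fin 2) ℝ) := by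
    have : ((p + 1 : ℕ) : MvPolynomial (Fin 2) ℝ) = C ((p + 1 : ℕ) : ℝ) := by simp
    rw [this]
    exact (isUnit_iff_ne_zero.2 (by positivity)).map C
  have hne : ¬(pderiv 0 g = 0 ∧ pderiv 1 g = 0) := by
    rintro ⟨h0, h1⟩
    rw [h0, h1, mul_zero, mul_zero, add_zero] at euler
    exact (mul_ne_zero hp hg0) euler.symm
  intro e he0 he1
  by_contra heu
  have hne0 : e ≠ 0 := by
    rintro rfl
    exact hne ⟨zero_dvd_iff.1 he0, zero_dvd_iff.1 he1⟩
  obtain ⟨d, hd, hde⟩ := WfDvdMonoid.exists_irreducible_factor heu hne0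
  have hd0 := hde.trans he0
  have hd1 := hde.trans he1
  have hdg : d ∣ g := by
    have : d ∣ ((p + 1 : ℕ) : MvPolynomial (Fin 2) ℝ) * g := by
      rw [← euler]; exact dvd_add (hd0.mul_left _) (hd1.mul_left _)
    exact hpu.dvd_mul_left.1 this
  obtain ⟨q, rfl⟩ := hdg
  have hdq : ¬ d ∣ q := fun h => hd.not_isUnit (hg.squarefree d (mul_dvd_mul_left d h))
  have hpd : ∀ i, pderiv i d = 0 := by
    intro i
    have h1 : d ∣ pderiv i (d * q) := by fin_cases i <;> assumption
    rw [pderiv_mul] at h1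
    have h2 : d ∣ pderiv i d * q := (dvd_add_left (dvd_mul_right d _)).1 h1
    have h3 : d ∣ pderiv i d := (hd.prime.dvd_or_dvd h2).resolve_right hdq
    by_contra hcon
    exact absurd (totalDegree_le_of_dvd_of_isDomain h3 hcon) (totalDegree_pderiv_lt i hcon).not_ge
  refine hd.not_isUnit ?_
  rw [eq_C_of_pderiv_eq_zero hpd]
  refine (isUnit_iff_ne_zero.2 fun h => hd.ne_zero ?_).map C
  rw [eq_C_of_pderiv_eq_zero hpd, h, C_0]

theorem IsHomogeneous.eval_smul {n : ℕ} {f : MvPolynomial (Fin 2) ℝ} (hf : f.IsHomogeneous n)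
    {A : Type*} [CommRing A] [Algebra ℝ A] (a : A) (z : Fin 2 → A) :
    aeval (fun i => a * z i) f = a ^ n * aeval z f := by
  simp only [aeval_def, eval₂_eq', Finset.mul_sum]
  refine Finset.sum_congr rfl fun m hm => ?_
  have h1 : ∑ i, m i = n := by
    rw [hf.degree_eq_sum_deg_support hm]
    exact (Finset.sum_subset (Finset.subset_univ _) fun i _ hi => by simpa using hi).symm
  simp only [mul_pow, Finset.prod_mul_distrib, Finset.prod_pow_eq_pow_sum, h1]
  ring

theorem IsHomogeneous.eval_smul_plane {n : ℕ} {f : MvPolynomial (Fin 2) ℝ} (hf : f.IsHomogeneous n)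
    (a : ℝ) (z : Plane) : eval (fun i => (a • z) i) f = a ^ n * eval (fun i => z i) f := by
  have := IsHomogeneous.eval_smul hf a (fun i => z i)
  simpa using this

/-- The components of the Hamiltonian field have no common real zero except the origin: otherwise
they would have a common linear factor. -/
theorem PolyStar.eq_zero_of_eval_pderiv {p : ℕ} {g : MvPolynomial (Fin 2) ℝ} (hg : PolyStar p g)
    {ζ : Fin 2 → ℝ} (h0 : eval ζ (pderiv 0 g) = 0) (h1 : eval ζ (pderiv 1 g) = 0) : ζ = 0 := by
  by_contra hζ
  obtain ⟨k, hk⟩ : ∃ k, ζ k ≠ 0 := Function.ne_iff.1 hζ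
  let ℓ : MvPolynomial (Fin 2) ℝ := C (ζ 1) * X 0 - C (ζ 0) * X 1
  have hdvd : ∀ {n : ℕ} {f : MvPolynomial (Fin 2) ℝ}, f.IsHomogeneous n → eval ζ f = 0 → ℓ ∣ f := by
    intro n f hf hfζ
    rw [← Ideal.mem_span_singleton, ← Ideal.Quotient.eq_zero_iff_mem]
    set A := MvPolynomial (Fin 2) ℝ ⧸ Ideal.span {ℓ}
    let π : MvPolynomial (Fin 2) ℝ →ₐ[ℝ] A := Ideal.Quotient.mkₐ ℝ (Ideal.span {ℓ})
    have hX : ∀ i, π (X i) = π (C (ζ k)⁻¹ * X k) * algebraMap ℝ A (ζ i) := by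
      intro i
      have e1 : algebraMap ℝ A (ζ i) = π (C (ζ i)) := (π.commutes (ζ i)).symm
      rw [e1, ← map_mul]
      refine Ideal.Quotient.eq.2 (Ideal.mem_span_singleton.2 ?_)
      have hC : (C (ζ k)⁻¹ : MvPolynomial (Fin 2) ℝ) * C (ζ k) = 1 := by
        rw [← C_mul, inv_mul_cancel₀ hk, C_1]
      have key : ∃ c : ℝ, C (ζ k) * X i - C (ζ i) * X k = C c * ℓ := by
        fin_cases i <;> fin_cases k
        · exact ⟨0, by simp⟩
        · exact ⟨1, by simp [ℓ]⟩
        · exact ⟨-1, by simp [ℓ]⟩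
        · exact ⟨0, by simp⟩
      obtain ⟨c, hc⟩ := key
      refine ⟨C (ζ k)⁻¹ * C c, ?_⟩
      linear_combination C (ζ k)⁻¹ * hc - X i * hC
    have hπ : π f = aeval (fun i => π (X i)) f := by
      conv_lhs => rw [← aeval_X_left_apply f]
      rw [← comp_aeval_apply]
    change π f = 0
    have h2 : aeval (fun i => algebraMap ℝ A (ζ i)) f = algebraMap ℝ A (aeval ζ f) :=
      aeval_algebraMap_apply A ζ f
    have h3 : aeval ζ f = 0 := by simpa using hfζ
    rw [hπ, funext hX, IsHomogeneous.eval_smul hf, h2, h3, map_zero, mul_zero]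
  have hu := hg.isRelPrime (hdvd hg.homogeneous.pderiv h0) (hdvd hg.homogeneous.pderiv h1)
  have := (hu.map (eval ζ)).ne_zero
  exact this (by simp [ℓ, mul_comm])

/-- A homogeneous polynomial pair which is everywhere parallel to the Hamiltonian field is a
homogeneous multiple of it. -/
theorem PolyStar.exists_eq_mul {p : ℕ} {g : MvPolynomial (Fin 2) ℝ} (hg : PolyStar p g) {k : ℕ}
    {Q₀ Q₁ : MvPolynomial (Fin 2) ℝ} (h0 : Q₀.IsHomogeneous k)
    (hpar : Q₀ * pderiv 0 g = Q₁ * -pderiv 1 g) :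
    ∃ β : MvPolynomial (Fin 2) ℝ, (β = 0 ∨ p ≤ k ∧ β.IsHomogeneous (k - p)) ∧
      Q₀ = β * -pderiv 1 g ∧ Q₁ = β * pderiv 0 g := by
  have hx : (pderiv 0 g).IsHomogeneous p := by simpa using hg.homogeneous.pderiv (i := 0)
  have hy : (pderiv 1 g).IsHomogeneous p := by simpa using hg.homogeneous.pderiv (i := 1)
  have hy0 : pderiv 1 g ≠ 0 := by
    intro h
    have hu : IsUnit (pderiv 0 g) := hg.isRelPrime dvd_rfl (h ▸ dvd_zero _)
    have h2 := hu.map (eval (0 : Fin 2 → ℝ))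
    have h3 := IsHomogeneous.eval_smul hx (0 : ℝ) (0 : Fin 2 → ℝ)
    rw [zero_pow (by have := hg.one_le; omega), zero_mul] at h3
    exact h2.ne_zero (by simpa using h3)
  obtain ⟨b, hb⟩ : pderiv 1 g ∣ Q₀ := by
    refine hg.isRelPrime.symm.dvd_of_dvd_mul_right (z := pderiv 0 g) ?_ 
    rw [hpar]; exact (dvd_neg.2 dvd_rfl).mul_left _
  let β : MvPolynomial (Fin 2) ℝ := if p ≤ k then homogeneousComponent (k - p) (-b) else 0
  have hβ : Q₀ = β * -pderiv 1 g := by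
    have e1 : Q₀ = ∑ j ∈ Finset.range ((-b).totalDegree + 1),
        homogeneousComponent j (-b) * -pderiv 1 g := by
      rw [← Finset.sum_mul, sum_homogeneousComponent, hb]; ring
    have e2 := congrArg (homogeneousComponent k) e1
    rw [homogeneousComponent_eq_self h0, map_sum] at e2
    rw [e2]
    have hh : ∀ j, homogeneousComponent k (homogeneousComponent j (-b) * -pderiv 1 g) =
        if j + p = k then homogeneousComponent j (-b) * -pderiv 1 g else 0 := by
      intro j
      rw [homogeneousComponent_of_mem (m := k) (n := j + p)
        ((homogeneousComponent_isHomogeneous j (-b)).mul hy.neg)]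
      simp only [eq_comm]
    simp only [hh]
    by_cases hpk : p ≤ k
    · simp only [β, if_pos hpk]
      rw [Finset.sum_eq_single (k - p)]
      · rw [if_pos (by omega)]
      · intro j _ hj; rw [if_neg (by omega)]
      · intro hj
        rw [if_pos (by omega), homogeneousComponent_eq_zero, zero_mul]
        have := Finset.mem_range.not.1 hj
        omega
    · simp only [β, if_neg hpk, zero_mul]
      exact Finset.sum_eq_zero fun j _ => by rw [if_neg (by omega)]
  refine ⟨β, ?_, hβ, ?_⟩
  · by_cases hpk : p ≤ k
    · right; simp only [β, if_pos hpk]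
      exact ⟨hpk, homogeneousComponent_isHomogeneous _ _⟩
    · left; simp [β, hpk]
  · have : (Q₁ - β * pderiv 0 g) * -pderiv 1 g = 0 := by
      rw [sub_mul, ← hpar, hβ]; ring
    exact sub_eq_zero.1 ((mul_eq_zero.1 this).resolve_right (neg_ne_zero.2 hy0))

theorem contDiff_eval_plane (f : MvPolynomial (Fin 2) ℝ) :
    ContDiff ℝ ∞ fun z : Plane => eval (fun i => z i) f := by
  simp only [eval_eq']
  fun_prop

theorem IsHomogeneous.exists_norm_eval_le {n : ℕ} {f : MvPolynomial (Fin 2) ℝ}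
    (hf : f.IsHomogeneous n) : ∃ C ≥ 0, ∀ z : Plane, |eval (fun i => z i) f| ≤ C * ‖z‖ ^ n := by
  refine ⟨∑ m ∈ f.support, |coeff m f|, Finset.sum_nonneg fun _ _ => abs_nonneg _, fun z => ?_⟩
  rw [eval_eq', Finset.sum_mul]
  refine (Finset.abs_sum_le_sum_abs _ _).trans (Finset.sum_le_sum fun m hm => ?_)
  rw [abs_mul]
  have h1 : ∑ i, m i = n := by
    rw [hf.degree_eq_sum_deg_support hm]
    exact (Finset.sum_subset (Finset.subset_univ _) fun i _ hi => by simpa using hi).symm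
  gcongr
  rw [← h1, ← Finset.prod_pow_eq_pow_sum, Finset.abs_prod]
  refine Finset.prod_le_prod (fun _ _ => abs_nonneg _) fun i _ => ?_
  rw [abs_pow]
  gcongr
  exact PiLp.norm_apply_le z i

/-- The diagonal of a multilinear form is a homogeneous polynomial. -/
theorem exists_eval_eq_diagonal {k : ℕ} (q : MultilinearMap ℝ (fun _ : Fin k => Plane) ℝ) :
    ∃ Q : MvPolynomial (Fin 2) ℝ, Q.IsHomogeneous k ∧
      ∀ z : Plane, eval (fun i => z i) Q = q fun _ => z := by
  classical
  let e : Fin 2 → Plane := fun i => EuclideanSpace.single i 1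
  refine ⟨∑ s : Fin k → Fin 2, C (q fun m => e (s m)) * ∏ m, X (s m), ?_, fun z => ?_⟩
  · refine IsHomogeneous.sum _ _ _ fun s _ => IsHomogeneous.C_mul ?_ _
    have := IsHomogeneous.prod Finset.univ (fun m => (X (s m) : MvPolynomial (Fin 2) ℝ))
      (fun _ => 1) fun m _ => isHomogeneous_X _ _
    simpa using this
  · have hz : z = ∑ i, z i • e i := by
      ext j; fin_cases j <;> simp [e]
    conv_rhs => rw [hz]
    rw [MultilinearMap.map_sum q (fun (_ : Fin k) (i : Fin 2) => z i • e i)]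
    rw [map_sum]
    refine Finset.sum_congr rfl fun s _ => ?_
    rw [q.map_smul_univ (fun m => z (s m)) fun m => e (s m)]
    simp [mul_comm]

end Polynomials

/-! ### The leading part of the field and division by it -/

section LeadingPart

variable {p : ℕ} {g : MvPolynomial (Fin 2) ℝ}

theorem contDiff_hamiltonianField (g : MvPolynomial (Fin 2) ℝ) :
    ContDiff ℝ ∞ (hamiltonianField g) := by
  refine (contDiff_euclidean).2 fun i => ?_
  fin_cases i
  · exact (contDiff_eval_plane _).neg
  · exact contDiff_eval_plane _

theorem PolyStar.hamiltonianField_smul (hg : PolyStar p g) (a : ℝ) (z : Plane) :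
    hamiltonianField g (a • z) = a ^ p • hamiltonianField g z := by
  have hx : (MvPolynomial.pderiv 0 g).IsHomogeneous p := by
    simpa using hg.homogeneous.pderiv (i := 0)
  have hy : (MvPolynomial.pderiv 1 g).IsHomogeneous p := by
    simpa using hg.homogeneous.pderiv (i := 1)
  ext i
  fin_cases i
  · simpa [hamiltonianField] using IsHomogeneous.eval_smul_plane hy a z
  · simpa [hamiltonianField] using IsHomogeneous.eval_smul_plane hx a z

theorem PolyStar.hamiltonianField_ne_zero (hg : PolyStar p g) {z : Plane} (hz : z ≠ 0) :
    hamiltonianField g z ≠ 0 := by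
  intro h
  have c0 := congrArg (fun v : Plane => v 0) h
  have c1 := congrArg (fun v : Plane => v 1) h
  simp [hamiltonianField] at c0 c1
  have := hg.eq_zero_of_eval_pderiv c1 c0
  exact hz (by ext i; exact congrFun this i)

theorem PolyStar.exists_le_norm_hamiltonianField (hg : PolyStar p g) :
    ∃ c > 0, ∀ z : Plane, c * ‖z‖ ^ p ≤ ‖hamiltonianField g z‖ := by
  have hcont := (contDiff_hamiltonianField g).continuous.norm
  obtain ⟨w, hw, hmin⟩ := (isCompact_sphere (0 : Plane) 1).exists_isMinOn
    (NormedSpace.sphere_nonempty.2 zero_le_one) hcont.continuousOn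
  have hw0 : w ≠ 0 := by rintro rfl; simp at hw
  refine ⟨‖hamiltonianField g w‖, norm_pos_iff.2 (hg.hamiltonianField_ne_zero hw0), fun z => ?_⟩
  rcases eq_or_ne z 0 with rfl | hz
  · have : ‖(0 : Plane)‖ ^ p = 0 := by
      rw [norm_zero, zero_pow (by have := hg.one_le; omega)]
    rw [this, mul_zero]; positivity
  · have hn : 0 < ‖z‖ := norm_pos_iff.2 hz
    have e : z = ‖z‖ • (‖z‖⁻¹ • z) := by rw [smul_smul, mul_inv_cancel₀ hn.ne', one_smul]
    conv_rhs => rw [e]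
    rw [hg.hamiltonianField_smul, norm_smul, norm_pow, norm_norm, mul_comm]
    gcongr
    exact hmin (by simp [norm_smul, hn.ne'])

theorem PolyStar.isBigO_hamiltonianField (hg : PolyStar p g) :
    hamiltonianField g =O[𝓝 0] fun z => ‖z‖ ^ p := by
  have hx : (MvPolynomial.pderiv 0 g).IsHomogeneous p := by
    simpa using hg.homogeneous.pderiv (i := 0)
  have hy : (MvPolynomial.pderiv 1 g).IsHomogeneous p := by
    simpa using hg.homogeneous.pderiv (i := 1)
  obtain ⟨C, hC, h1⟩ := IsHomogeneous.exists_norm_eval_le hx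
  obtain ⟨C', hC', h2⟩ := IsHomogeneous.exists_norm_eval_le hy
  refine Asymptotics.IsBigO.of_bound (C' + C) (Filter.Eventually.of_forall fun z => ?_)
  rw [norm_pow, norm_norm]
  have h3 : ∀ v : Plane, ‖v‖ ≤ |v 0| + |v 1| := by
    intro v
    rw [EuclideanSpace.norm_eq, Fin.sum_univ_two]
    refine Real.sqrt_le_iff.2 ⟨by positivity, ?_⟩
    simp only [Real.norm_eq_abs]
    nlinarith [abs_nonneg (v 0), abs_nonneg (v 1)]
  refine (h3 _).trans ?_
  have e0 : |hamiltonianField g z 0| ≤ C' * ‖z‖ ^ p := by simpa [hamiltonianField] using h2 z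
  have e1 : |hamiltonianField g z 1| ≤ C * ‖z‖ ^ p := by simpa [hamiltonianField] using h1 z
  linarith

/-- `G` has the leading part `e • B⁻¹ (H (B z))`, where `H` is the Hamiltonian field of `g`. -/
def HasLeadingPart (G : Plane → Plane) (p : ℕ) (g : MvPolynomial (Fin 2) ℝ) (e : ℝ)
    (B : Plane ≃L[ℝ] Plane) : Prop :=
  (fun z => B (G z) - e • hamiltonianField g (B z)) =O[𝓝 0] fun z => ‖z‖ ^ (p + 1)

/-- The data of property (*) near the origin: an adapted chart and its derivative. -/
structure StarChart (G : Plane → Plane) (p : ℕ) (g : MvPolynomial (Fin 2) ℝ) (η : Plane → ℝ)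
    (φ : OpenPartialHomeomorph Plane Plane) (B : Plane ≃L[ℝ] Plane) : Prop where
  contDiff : ContDiff ℝ ∞ G
  star : PolyStar p g
  contDiff_unit : ContDiff ℝ ∞ η
  unit_ne_zero : ∀ z, η z ≠ 0
  contDiffOn : ContDiffOn ℝ ∞ φ φ.source
  contDiffOn_symm : ContDiffOn ℝ ∞ φ.symm φ.target
  mem_source : 0 ∈ φ.source
  map_zero : φ 0 = 0
  hasFDerivAt : HasFDerivAt φ (B : Plane →L[ℝ] Plane) 0
  eq : ∀ z ∈ φ.source, fderiv ℝ φ z (G z) = η z • hamiltonianField g (φ z)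

namespace StarChart

variable {G : Plane → Plane} {η : Plane → ℝ} {φ : OpenPartialHomeomorph Plane Plane}

theorem fderiv_symm_comp (hφ : ContDiffOn ℝ ∞ φ φ.source)
    (hφ' : ContDiffOn ℝ ∞ φ.symm φ.target) {z : Plane} (hz : z ∈ φ.source) :
    (fderiv ℝ φ.symm (φ z)).comp (fderiv ℝ φ z) = ContinuousLinearMap.id ℝ Plane := by
  have d1 : DifferentiableAt ℝ φ z :=
    (hφ.contDiffAt (φ.open_source.mem_nhds hz)).differentiableAt (by simp)
  have d2 : DifferentiableAt ℝ φ.symm (φ z) :=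
    (hφ'.contDiffAt (φ.open_target.mem_nhds (φ.map_source hz))).differentiableAt (by simp)
  rw [← fderiv_comp z d2 d1]
  have : φ.symm ∘ φ =ᶠ[𝓝 z] id := φ.eventually_left_inverse hz
  rw [this.fderiv_eq, fderiv_id]

theorem _root_.PlaneShift.FieldStar.exists_starChart (hG : ContDiff ℝ ∞ G) (h : FieldStar G p g) :
    ∃ η φ B, StarChart G p g η φ B := by
  obtain ⟨hg, η, hη, hη0, φ, hφ, hφ', h0, hφ0, heq⟩ := h
  have h0t : (0 : Plane) ∈ φ.target := by rw [← hφ0]; exact φ.map_source h0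
  have hs0 : φ.symm 0 = 0 := by rw [← hφ0, φ.left_inv h0, hφ0]
  have e1 := fderiv_symm_comp hφ hφ' h0
  have e2 := fderiv_symm_comp (φ := φ.symm) hφ' (by simpa using hφ) h0t
  rw [hφ0] at e1
  simp only [OpenPartialHomeomorph.symm_symm, hs0] at e2
  let B := ContinuousLinearEquiv.equivOfInverse (fderiv ℝ φ 0) (fderiv ℝ φ.symm 0)
    (fun x => by simpa using congrArg (fun T => T x) e1)
    (fun x => by simpa using congrArg (fun T => T x) e2)
  refine ⟨η, φ, B, hG, hg, hη, hη0, hφ, hφ', h0, hφ0, ?_, heq⟩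
  have := ((hφ.contDiffAt (φ.open_source.mem_nhds h0)).differentiableAt (by simp)).hasFDerivAt
  exact this

variable {B : Plane ≃L[ℝ] Plane}

theorem contDiffAt (h : StarChart G p g η φ B) {z : Plane} (hz : z ∈ φ.source) :
    ContDiffAt ℝ ∞ φ z :=
  h.contDiffOn.contDiffAt (φ.open_source.mem_nhds hz)

theorem contDiffAt_symm (h : StarChart G p g η φ B) {z : Plane} (hz : z ∈ φ.target) :
    ContDiffAt ℝ ∞ φ.symm z :=
  h.contDiffOn_symm.contDiffAt (φ.open_target.mem_nhds hz)

theorem symm_zero (h : StarChart G p g η φ B) : φ.symm 0 = 0 := by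
  have := φ.left_inv h.mem_source
  rwa [h.map_zero] at this

theorem zero_mem_target (h : StarChart G p g η φ B) : (0 : Plane) ∈ φ.target := by
  rw [← h.map_zero]; exact φ.map_source h.mem_source

theorem source_mem_nhds (h : StarChart G p g η φ B) : φ.source ∈ 𝓝 (0 : Plane) :=
  φ.open_source.mem_nhds h.mem_source

theorem isBigO (h : StarChart G p g η φ B) : (φ : Plane → Plane) =O[𝓝 0] fun z => ‖z‖ := by
  have := h.hasFDerivAt.isBigO_sub
  simpa [h.map_zero] using this.norm_right

theorem isBigO_symm (h : StarChart G p g η φ B) :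
    (fun z : Plane => ‖z‖) =O[𝓝 0] fun z => ‖φ z‖ := by
  have h1 := ((h.contDiffAt_symm h.zero_mem_target).differentiableAt (by simp)).hasFDerivAt.isBigO_sub
  simp only [h.symm_zero, sub_zero] at h1
  have hc : Filter.Tendsto φ (𝓝 0) (𝓝 0) := by
    have := (h.contDiffAt h.mem_source).continuousAt.tendsto
    rwa [h.map_zero] at this
  have h2 := (h1.comp_tendsto hc).norm_norm
  refine Asymptotics.IsBigO.congr' h2 ?_ Filter.EventuallyEq.rfl
  filter_upwards [h.source_mem_nhds] with z hz
  simp [φ.left_inv hz]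

theorem eq_smul (h : StarChart G p g η φ B) {z : Plane} (hz : z ∈ φ.source) :
    G z = fderiv ℝ φ.symm (φ z) (η z • hamiltonianField g (φ z)) := by
  have := congrArg (fun T => T (G z)) (fderiv_symm_comp h.contDiffOn h.contDiffOn_symm hz)
  simp only [ContinuousLinearMap.comp_apply, ContinuousLinearMap.id_apply] at this
  rw [← this, h.eq z hz]

theorem ne_zero (h : StarChart G p g η φ B) {z : Plane} (hz : z ∈ φ.source) (hz0 : z ≠ 0) :
    G z ≠ 0 := by
  intro hG
  have h1 := h.eq z hz
  rw [hG, ContinuousLinearMap.map_zero] at h1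
  refine smul_ne_zero (h.unit_ne_zero z) (h.star.hamiltonianField_ne_zero ?_) h1.symm
  intro h0
  exact hz0 (φ.injOn hz h.mem_source (by rw [h0, h.map_zero]))

theorem isBigO_comp (h : StarChart G p g η φ B) :
    (fun z => hamiltonianField g (φ z)) =O[𝓝 0] fun z => ‖z‖ ^ p := by
  have hc : Filter.Tendsto φ (𝓝 0) (𝓝 0) := by
    have := (h.contDiffAt h.mem_source).continuousAt.tendsto
    rwa [h.map_zero] at this
  exact (h.star.isBigO_hamiltonianField.comp_tendsto hc).trans (h.isBigO.norm_left.pow p)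

theorem hasZeroOfOrder (h : StarChart G p g η φ B) : HasZeroOfOrder G p := by
  refine ⟨h.contDiff, h.star.one_le, ?_, ?_⟩
  · have hA : (fun z => fderiv ℝ φ.symm (φ z)) =O[𝓝 0] fun _ => (1 : ℝ) := by
      refine Filter.Tendsto.isBigO_one (c := fderiv ℝ φ.symm (φ 0)) ℝ ?_
      have h1 : ContDiffAt ℝ ∞ (fderiv ℝ φ.symm) (φ 0) := by
        rw [h.map_zero]; exact (h.contDiffAt_symm h.zero_mem_target).fderiv_right (by simp)
      exact ContinuousAt.comp (f := φ) h1.continuousAt (h.contDiffAt h.mem_source).continuousAt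
    have hη : η =O[𝓝 0] fun _ => (1 : ℝ) := h.contDiff_unit.continuous.continuousAt.isBigO_one ℝ
    have h2 := hA.norm_left.mul (hη.smul h.isBigO_comp).norm_left
    simp only [one_mul, one_smul] at h2
    refine Asymptotics.IsBigO.trans ?_ h2
    refine Asymptotics.IsBigO.of_bound 1 ?_
    filter_upwards [h.source_mem_nhds] with z hz
    rw [h.eq_smul hz]
    simpa using (fderiv ℝ φ.symm (φ z)).le_opNorm (η z • hamiltonianField g (φ z))
  · obtain ⟨c, hc, hlow⟩ := h.star.exists_le_norm_hamiltonianField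
    have h1 : (fun z : Plane => ‖z‖ ^ p) =O[𝓝 0] fun z => G z := by
      have s1 : (fun z : Plane => ‖z‖ ^ p) =O[𝓝 0] fun z => hamiltonianField g (φ z) := by
        refine (h.isBigO_symm.pow p).trans (Asymptotics.IsBigO.of_bound c⁻¹ ?_)
        refine Filter.Eventually.of_forall fun z => ?_
        rw [norm_pow, norm_norm, le_inv_mul_iff₀ hc]
        exact hlow _
      have hη : (fun z => (η z)⁻¹) =O[𝓝 0] fun _ => (1 : ℝ) :=
        (h.contDiff_unit.continuous.continuousAt.inv₀ (h.unit_ne_zero 0)).isBigO_one ℝ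
      have s2 : (fun z => hamiltonianField g (φ z)) =O[𝓝 0] fun z => fderiv ℝ φ z (G z) := by
        have := hη.smul (Asymptotics.isBigO_refl (fun z => fderiv ℝ φ z (G z)) (𝓝 0))
        simp only [one_smul] at this
        refine this.congr' ?_ Filter.EventuallyEq.rfl
        filter_upwards [h.source_mem_nhds] with z hz
        rw [h.eq z hz, smul_smul, inv_mul_cancel₀ (h.unit_ne_zero z), one_smul]
      have hD : (fun z => fderiv ℝ φ z) =O[𝓝 0] fun _ => (1 : ℝ) :=
        ((h.contDiffAt h.mem_source).fderiv_right (m := ∞) (by simp)).continuousAt.isBigO_one ℝ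
      have s3 : (fun z => fderiv ℝ φ z (G z)) =O[𝓝 0] G := by
        have h2 := hD.norm_left.mul (Asymptotics.isBigO_refl G (𝓝 0)).norm_norm
        simp only [one_mul] at h2
        refine (Asymptotics.IsBigO.of_bound 1 (Filter.Eventually.of_forall fun z => ?_)).trans
          h2.of_norm_right
        simpa using (fderiv ℝ φ z).le_opNorm (G z)
      exact s1.trans (s2.trans s3)
    obtain ⟨C, hC, hb⟩ := h1.exists_pos
    refine ⟨C⁻¹, by positivity, ?_⟩
    filter_upwards [hb.bound] with z hz
    rw [norm_pow, norm_norm] at hz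
    rwa [inv_mul_le_iff₀ hC]

theorem hasLeadingPart (h : StarChart G p g η φ B) : HasLeadingPart G p g (η 0) B := by
  have hGO := h.hasZeroOfOrder.isBigO
  obtain ⟨m, hm⟩ : ∃ m, p = m + 1 := ⟨p - 1, by have := h.star.one_le; omega⟩
  have hφs := h.contDiffAt h.mem_source
  have t1 : (fun z => (fderiv ℝ φ z - fderiv ℝ φ 0) (G z)) =O[𝓝 0] fun z => ‖z‖ ^ (p + 1) := by
    have h1 := ((hφs.fderiv_right (m := ∞) (by simp)).differentiableAt (by simp)).hasFDerivAt.isBigO_sub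
    simp only [sub_zero] at h1
    have h2 := h1.norm_norm.mul hGO.norm_left
    refine (Asymptotics.IsBigO.of_bound 1 (Filter.Eventually.of_forall fun z => ?_)).trans
      (h2.congr_right fun z => (pow_succ' _ _).symm)
    simpa using (fderiv ℝ φ z - fderiv ℝ φ 0).le_opNorm (G z)
  have t2 : (fun z => (η z - η 0) • hamiltonianField g (φ z)) =O[𝓝 0] fun z => ‖z‖ ^ (p + 1) := by
    have h1 := ((h.contDiff_unit.differentiable (by simp)) 0).hasFDerivAt.isBigO_sub
    simp only [sub_zero] at h1
    exact (h1.norm_right.smul h.isBigO_comp).congr_right fun z => by rw [pow_succ']; rfl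
  have hB : fderiv ℝ φ 0 = (B : Plane →L[ℝ] Plane) := h.hasFDerivAt.fderiv
  have t3 : (fun z => hamiltonianField g (φ z) - hamiltonianField g (B z)) =O[𝓝 0]
      fun z => ‖z‖ ^ (p + 1) := by
    obtain ⟨C, hC, ρ, hρ, hlip⟩ := exists_lipschitz_of_isBigO (m := m)
      ((contDiff_hamiltonianField g).contDiffAt.of_le (by exact_mod_cast le_top))
      (hm ▸ h.star.isBigO_hamiltonianField)
    have hquad : (fun z => φ z - B z) =O[𝓝 0] fun z => ‖z‖ ^ (1 + 1) := by
      have h11 : ((1 + 1 : ℕ) : ℕ∞ω) ≤ ∞ := WithTop.coe_le_coe.2 le_top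
      have := isBigO_sub_leading_term (u := φ) (k := 1) (hφs.of_le h11)
        (fun j hj => by
          obtain rfl : j = 0 := by omega
          ext x; simp [h.map_zero])
      simpa [iteratedFDeriv_one_apply, hB] using this
    obtain ⟨K, hK, hKb⟩ := h.isBigO.exists_pos
    obtain ⟨K', hK', hq⟩ := hquad.exists_pos
    set r := max K ‖(B : Plane →L[ℝ] Plane)‖ with hr
    have hr0 : 0 < r := hK.trans_le (le_max_left _ _)
    refine Asymptotics.IsBigO.of_bound (C * r ^ m * K') ?_
    filter_upwards [hKb.bound, hq.bound, Metric.ball_mem_nhds 0 (div_pos hρ hr0)] with z h1 h2 h3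
    rw [norm_norm] at h1
    rw [norm_pow, norm_norm] at h2 ⊢
    have h4 := hlip (φ z) (B z) (r * ‖z‖) (by rwa [mem_ball_zero_iff, lt_div_iff₀' hr0] at h3)
      (h1.trans (by gcongr; exact le_max_left _ _))
      (((B : Plane →L[ℝ] Plane).le_opNorm z).trans (by gcongr; exact le_max_right _ _))
    calc _ ≤ C * (r * ‖z‖) ^ m * ‖φ z - B z‖ := h4
      _ ≤ C * (r * ‖z‖) ^ m * (K' * ‖z‖ ^ (1 + 1)) := by gcongr
      _ = _ := by rw [hm, mul_pow]; ring
  have t4 := (t2.add (t3.const_smul_left (η 0))).sub t1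
  refine t4.congr' ?_ Filter.EventuallyEq.rfl
  filter_upwards [h.source_mem_nhds] with z hz
  have h1 := h.eq z hz
  simp only [sub_apply, hB, h1, Pi.smul_apply, sub_smul, smul_sub,
    ContinuousLinearEquiv.coe_coe]
  abel

end StarChart

end LeadingPart

section Division

variable {p : ℕ} {g : MvPolynomial (Fin 2) ℝ} {G : Plane → Plane}

/-- The space of `Plane`-valued continuous `k`-linear forms on the plane. -/
abbrev PlaneForm (k : ℕ) : Type := ContinuousMultilinearMap ℝ (fun _ : Fin k => Plane) Plane

instance finiteDimensional_planeForm (k : ℕ) : FiniteDimensional ℝ (PlaneForm k) :=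
  FiniteDimensional.of_injective
    (ContinuousMultilinearMap.toMultilinearMapLinear :
      PlaneForm k →ₗ[ℝ] MultilinearMap ℝ (fun _ : Fin k => Plane) Plane)
    ContinuousMultilinearMap.toMultilinearMap_injective

theorem PlaneForm.isBigO_diagonal {k : ℕ} (q : PlaneForm k) :
    (fun z : Plane => q fun _ => z) =O[𝓝 0] fun z => ‖z‖ ^ k := by
  refine Asymptotics.IsBigO.of_bound ‖q‖ (Filter.Eventually.of_forall fun z => ?_)
  rw [norm_pow, norm_norm]
  simpa using q.le_opNorm fun _ => z

/-- If the diagonal of a `k`-linear form is a multiple of `G` up to `O(‖z‖ ^ (k + 1))`, then it is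
a polynomial multiple of the leading part of `G`. -/
theorem HasZeroOfOrder.exists_diagonal_eq (hG : HasZeroOfOrder G p) (hg : PolyStar p g) {e : ℝ}
    (he : e ≠ 0) {B : Plane ≃L[ℝ] Plane} (hL : HasLeadingPart G p g e B) {k : ℕ}
    {q : PlaneForm k} {t : Plane → ℝ}
    (hq : (fun z => (q fun _ => z) - t z • G z) =O[𝓝 0] fun z => ‖z‖ ^ (k + 1)) :
    ∃ β : MvPolynomial (Fin 2) ℝ, (β = 0 ∨ p ≤ k ∧ β.IsHomogeneous (k - p)) ∧
      ∀ z, B (q fun _ => z) =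
        MvPolynomial.eval (fun i => B z i) β • e • hamiltonianField g (B z) := by
  obtain ⟨c, hc, hlow⟩ := hG.lower
  have htG : (fun z => t z • G z) =O[𝓝 0] fun z => ‖z‖ ^ k := by
    have := (q.isBigO_diagonal).sub (hq.trans (isBigO_norm_pow_of_le (Nat.le_succ k)))
    simpa using this
  have htr : (fun z => t z • (B (G z) - e • hamiltonianField g (B z))) =O[𝓝 0]
      fun z => ‖z‖ ^ (k + 1) := by
    obtain ⟨C, hC, hb⟩ := hL.exists_pos
    have h2 : (fun z => ‖z‖ * ‖t z • G z‖) =O[𝓝 0] fun z : Plane => ‖z‖ ^ (k + 1) := by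
      have := (Asymptotics.isBigO_refl (fun z : Plane => ‖z‖) (𝓝 0)).mul htG.norm_left
      exact this.congr_right fun z => by rw [pow_succ']
    refine (Asymptotics.IsBigO.of_bound (C * c⁻¹) ?_).trans h2
    filter_upwards [hb.bound, hlow] with z h3 h4
    rw [norm_smul, norm_mul, norm_norm, norm_norm, norm_smul]
    rw [norm_pow, norm_norm] at h3
    have h5 : ‖z‖ ^ p ≤ c⁻¹ * ‖G z‖ := by rwa [le_inv_mul_iff₀ hc]
    calc _ ≤ ‖t z‖ * (C * ‖z‖ ^ (p + 1)) := by gcongr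
      _ = ‖t z‖ * (C * (‖z‖ ^ p * ‖z‖)) := by rw [pow_succ]
      _ ≤ ‖t z‖ * (C * (c⁻¹ * ‖G z‖ * ‖z‖)) := by gcongr
      _ = _ := by ring
  have hmain : (fun z => B (q fun _ => z) - (t z * e) • hamiltonianField g (B z)) =O[𝓝 0]
      fun z => ‖z‖ ^ (k + 1) := by
    have h1 : (fun z => B ((q fun _ => z) - t z • G z)) =O[𝓝 0] fun z => ‖z‖ ^ (k + 1) :=
      ((B : Plane →L[ℝ] Plane).isBigO_comp _ _).trans hq
    refine (h1.add htr).congr_left fun z => ?_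
    rw [map_sub, map_smul, smul_sub, smul_smul]
    abel
  -- the wedge product with the Hamiltonian field
  let w : Plane → Plane → ℝ := fun u v => u 0 * v 1 - u 1 * v 0
  have hw : ∀ u v, |w u v| ≤ 2 * ‖u‖ * ‖v‖ := by
    intro u v
    have h0 := PiLp.norm_apply_le u 0
    have h1 := PiLp.norm_apply_le u 1
    have h2 := PiLp.norm_apply_le v 0
    have h3 := PiLp.norm_apply_le v 1
    rw [Real.norm_eq_abs] at h0 h1 h2 h3
    calc |w u v| ≤ |u 0 * v 1| + |u 1 * v 0| := abs_sub _ _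
      _ = |u 0| * |v 1| + |u 1| * |v 0| := by rw [abs_mul, abs_mul]
      _ ≤ ‖u‖ * ‖v‖ + ‖u‖ * ‖v‖ := by gcongr
      _ = _ := by ring
  have hHB : (fun z => hamiltonianField g (B z)) =O[𝓝 0] fun z => ‖z‖ ^ p := by
    have hc : Filter.Tendsto (fun z => B z) (𝓝 0) (𝓝 0) := by
      simpa using B.continuous.tendsto 0
    exact (hg.isBigO_hamiltonianField.comp_tendsto hc).trans
      (((B : Plane →L[ℝ] Plane).isBigO_id (𝓝 0)).norm_norm.pow p)
  have hW : (fun z => w (B (q fun _ => z)) (hamiltonianField g (B z))) = 0 := by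
    refine eq_zero_of_homogeneous_of_isBigO (k := k + p) (fun s z _ => ?_) ?_
    · have h1 : (q fun _ => s • z) = s ^ k • q fun _ => z := by
        have := q.map_smul_univ (fun _ => s) (fun _ => z)
        simpa using this
      rw [h1, map_smul, map_smul, hg.hamiltonianField_smul]
      simp only [w, PiLp.smul_apply, smul_eq_mul]
      ring
    · have h2 := hmain.norm_left.mul hHB.norm_left
      refine (Asymptotics.IsBigO.of_bound 2 (Filter.Eventually.of_forall fun z => ?_)).trans
        (h2.congr_right fun z => by rw [← pow_add, add_right_comm])
      have h3 : w (B (q fun _ => z)) (hamiltonianField g (B z)) =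
          w (B (q fun _ => z) - (t z * e) • hamiltonianField g (B z)) (hamiltonianField g (B z)) := by
        simp only [w, PiLp.sub_apply, PiLp.smul_apply, smul_eq_mul]
        ring
      rw [h3, norm_mul, norm_norm, norm_norm, ← mul_assoc]
      exact hw _ _
  -- the form in the coordinates given by `B`
  let q' : Fin 2 → MultilinearMap ℝ (fun _ : Fin k => Plane) ℝ := fun i =>
    (((EuclideanSpace.proj i : Plane →L[ℝ] ℝ).comp (B : Plane →L[ℝ] Plane) : Plane →L[ℝ] ℝ) :
      Plane →ₗ[ℝ] ℝ).compMultilinearMap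
      (q.toMultilinearMap.compLinearMap fun _ => ((B.symm : Plane →L[ℝ] Plane) : Plane →ₗ[ℝ] Plane))
  have hq' : ∀ i z, q' i (fun _ => z) = B (q fun _ => B.symm z) i := fun i z => rfl
  obtain ⟨Q₀, hQ₀, hQ₀e⟩ := exists_eval_eq_diagonal (q' 0)
  obtain ⟨Q₁, hQ₁, hQ₁e⟩ := exists_eval_eq_diagonal (q' 1)
  have hpar : Q₀ * MvPolynomial.pderiv 0 g = Q₁ * -MvPolynomial.pderiv 1 g := by
    refine MvPolynomial.funext fun x => ?_
    have h1 := congrFun hW (B.symm (WithLp.toLp 2 x))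
    have h2 := hQ₀e (WithLp.toLp 2 x)
    have h3 := hQ₁e (WithLp.toLp 2 x)
    simp only [w, B.apply_symm_apply, Pi.zero_apply, ← hq', ← h2, ← h3] at h1
    simp [hamiltonianField] at h1
    simp only [map_mul, map_neg]
    linarith
  obtain ⟨β, hβ, h0, h1⟩ := hg.exists_eq_mul hQ₀ hpar
  refine ⟨MvPolynomial.C e⁻¹ * β, ?_, fun z => ?_⟩
  · rcases hβ with rfl | ⟨h2, h3⟩
    · left; simp
    · exact Or.inr ⟨h2, h3.C_mul _⟩
  · have e0 : B (q fun _ => z) 0 = MvPolynomial.eval (fun i => B z i) Q₀ := by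
      rw [hQ₀e, hq', B.symm_apply_apply]
    have e1 : B (q fun _ => z) 1 = MvPolynomial.eval (fun i => B z i) Q₁ := by
      rw [hQ₁e, hq', B.symm_apply_apply]
    rw [h0] at e0
    rw [h1] at e1
    ext i
    fin_cases i
    · simp only [Fin.zero_eta, e0]
      simp [hamiltonianField]
      field_simp
    · simp only [Fin.mk_one, e1]
      simp [hamiltonianField]
      field_simp

/-- Division by `G`: there is a linear operator which associates with a `k`-linear form a
polynomial `∑ ℓ m q * L m`, and which finds the factor whenever the diagonal of the form is a
multiple of `G` up to `O(‖z‖ ^ (k + 1))`. -/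
def HasDivision (G : Plane → Plane) : Prop :=
  ∀ k, ∃ (N : ℕ) (ℓ : Fin N → PlaneForm k →L[ℝ] ℝ) (L : Fin N → Plane → ℝ),
    (∀ m, ContDiff ℝ ∞ (L m)) ∧
    (∀ m, (fun z => L m z • G z) =O[𝓝 0] fun z => ‖z‖ ^ k) ∧
    ∀ q : PlaneForm k,
      (∃ t : Plane → ℝ, (fun z => (q fun _ => z) - t z • G z) =O[𝓝 0] fun z => ‖z‖ ^ (k + 1)) →
      (fun z => (q fun _ => z) - (∑ m, ℓ m q * L m z) • G z) =O[𝓝 0] fun z => ‖z‖ ^ (k + 1)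

/-- The leading part of `G` can be divided by, as the partial derivatives of `g` are coprime. The
multiples of the leading part form a subspace on which the quotient is a linear function, and this
function is extended to all forms. -/
theorem HasZeroOfOrder.hasDivision (hG : HasZeroOfOrder G p) (hg : PolyStar p g) {e : ℝ}
    (he : e ≠ 0) {B : Plane ≃L[ℝ] Plane} (hL : HasLeadingPart G p g e B) : HasDivision G := by
  intro k
  by_cases hpk : p ≤ k
  swap
  · refine ⟨0, Fin.elim0, Fin.elim0, fun m => m.elim0, fun m => m.elim0, fun q ⟨t, ht⟩ => ?_⟩
    obtain ⟨β, hβ, hβe⟩ := hG.exists_diagonal_eq hg he hL ht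
    have hβ0 : β = 0 := hβ.resolve_right fun h => hpk h.1
    have : ∀ z, (q fun _ => z) = 0 := fun z => by
      have := hβe z
      have h2 : B (q fun _ => z) = 0 := by rw [this, hβ0]; simp
      exact B.map_eq_zero_iff.1 h2
    simpa [this] using Asymptotics.isBigO_zero _ _
  let V := MvPolynomial.homogeneousSubmodule (Fin 2) ℝ (k - p)
  have : Module.Finite ℝ V := Module.Finite.iff_fg.2 (MvPolynomial.homogeneousSubmodule_fg _ _ _)
  -- the form `z ↦ β (B z) • e • H (B z)` determined by `β`
  let T : V →ₗ[ℝ] Plane → Plane :=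
    { toFun := fun β z => MvPolynomial.eval (fun i => B z i) β.1 • e • hamiltonianField g (B z)
      map_add' := fun β β' => by ext1 z; simp [add_smul]
      map_smul' := fun a β => by
        ext1 z
        simp only [Submodule.coe_smul, MvPolynomial.smul_eval, RingHom.id_apply, Pi.smul_apply,
          smul_smul, mul_assoc] }
  have hT : LinearMap.ker T = ⊥ := by
    refine LinearMap.ker_eq_bot'.2 fun β hβ => ?_
    have h1 : MvPolynomial.X 0 * MvPolynomial.X 1 * β.1 = (0 : MvPolynomial (Fin 2) ℝ) := by
      refine MvPolynomial.funext fun x => ?_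
      have h2 := congrFun hβ (B.symm (WithLp.toLp 2 x))
      simp only [T, LinearMap.coe_mk, AddHom.coe_mk, B.apply_symm_apply, Pi.zero_apply] at h2
      by_cases hx : x = 0
      · simp [hx]
      · have h3 := (smul_eq_zero.1 h2).resolve_right (smul_ne_zero he
          (hg.hamiltonianField_ne_zero fun h => hx (by
            ext i; exact congrArg (fun v : Plane => v i) h)))
        have h4 : MvPolynomial.eval x β.1 = 0 := h3
        simp [h4]
    have h5 : (MvPolynomial.X 0 * MvPolynomial.X 1 : MvPolynomial (Fin 2) ℝ) ≠ 0 :=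
      mul_ne_zero (MvPolynomial.X_ne_zero _) (MvPolynomial.X_ne_zero _)
    exact Subtype.ext ((mul_eq_zero.1 h1).resolve_left h5)
  obtain ⟨S, hS⟩ := T.exists_leftInverse_of_injective hT
  let b := Module.finBasis ℝ V
  let D : PlaneForm k →ₗ[ℝ] Plane → Plane :=
    { toFun := fun q z => B (q fun _ => z)
      map_add' := fun q q' => by ext1 z; simp
      map_smul' := fun a q => by ext1 z; simp }
  let ℓ : Fin (Module.finrank ℝ V) → PlaneForm k →L[ℝ] ℝ := fun m =>
    LinearMap.toContinuousLinearMap ((b.coord m).comp (S.comp D))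
  refine ⟨Module.finrank ℝ V, ℓ, fun m z => MvPolynomial.eval (fun i => B z i) (b m).1,
    fun m => (contDiff_eval_plane _).comp B.contDiff, fun m => ?_, fun q ⟨t, ht⟩ => ?_⟩
  · obtain ⟨C, hC, hb⟩ := IsHomogeneous.exists_norm_eval_le (b m).2
    have h1 : (fun z : Plane => MvPolynomial.eval (fun i => B z i) (b m).1) =O[𝓝 0]
        fun z => ‖z‖ ^ (k - p) := by
      have h2 : (fun z : Plane => MvPolynomial.eval (fun i => B z i) (b m).1) =O[𝓝 0]
          fun z => ‖B z‖ ^ (k - p) := Asymptotics.IsBigO.of_bound C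
        (Filter.Eventually.of_forall fun z => by rw [norm_pow, norm_norm]; exact hb (B z))
      exact h2.trans (((B : Plane →L[ℝ] Plane).isBigO_id (𝓝 0)).norm_norm.pow _)
    refine (h1.smul hG.isBigO).congr_right fun z => ?_
    rw [smul_eq_mul, ← pow_add, Nat.sub_add_cancel hpk]
  · obtain ⟨β, hβ, hβe⟩ := hG.exists_diagonal_eq hg he hL ht
    have hβV : β ∈ V := by
      rcases hβ with rfl | h
      · exact zero_mem _
      · exact h.2
    have hD : D q = T ⟨β, hβV⟩ := funext hβe
    have hSD : S (D q) = ⟨β, hβV⟩ := by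
      rw [hD]; exact congrArg (fun f => f ⟨β, hβV⟩) hS
    have hsum : ∀ z : Plane, ∑ m, ℓ m q * MvPolynomial.eval (fun i => B z i) (b m).1 =
        MvPolynomial.eval (fun i => B z i) β := by
      intro z
      have h1 : ∑ m, ℓ m q • b m = (⟨β, hβV⟩ : V) := by
        rw [← hSD]; exact b.sum_repr _
      have h2 := congrArg (fun v : V => MvPolynomial.eval (fun i => B z i) v.1) h1
      simpa [MvPolynomial.smul_eval] using h2
    simp only [hsum]
    have h3 : (fun z => MvPolynomial.eval (fun i => B z i) β •
        (B (G z) - e • hamiltonianField g (B z))) =O[𝓝 0] fun z => ‖z‖ ^ (k + 1) := by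
      obtain ⟨C, hC, hb⟩ := IsHomogeneous.exists_norm_eval_le (n := k - p) (f := β) (by
        rcases hβ with rfl | h
        · exact MvPolynomial.isHomogeneous_zero _ _ _
        · exact h.2)
      have h1 : (fun z : Plane => MvPolynomial.eval (fun i => B z i) β) =O[𝓝 0]
          fun z => ‖z‖ ^ (k - p) := by
        have h2 : (fun z : Plane => MvPolynomial.eval (fun i => B z i) β) =O[𝓝 0]
            fun z => ‖B z‖ ^ (k - p) := Asymptotics.IsBigO.of_bound C
          (Filter.Eventually.of_forall fun z => by rw [norm_pow, norm_norm]; exact hb (B z))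
        exact h2.trans (((B : Plane →L[ℝ] Plane).isBigO_id (𝓝 0)).norm_norm.pow _)
      refine (h1.smul hL).congr_right fun z => ?_
      rw [smul_eq_mul, ← pow_add]; congr 1; omega
    have h4 := ((B.symm : Plane →L[ℝ] Plane).isBigO_comp _ (𝓝 (0 : Plane))).trans h3.neg_left
    refine h4.congr_left fun z => ?_
    have h5 : (q fun _ => z) = B.symm (B (q fun _ => z)) := (B.symm_apply_apply _).symm
    rw [h5, hβe z]
    simp only [ContinuousLinearEquiv.coe_coe, map_neg, map_smul, map_sub, B.symm_apply_apply]
    rw [smul_sub, neg_sub]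

end Division

/-! ### Polynomial approximations of a shift function at the origin -/

section JetApprox

theorem eventually_norm_lt {ρ : ℝ} (hρ : 0 < ρ) : ∀ᶠ z in 𝓝 (0 : Plane), ‖z‖ < ρ := by
  filter_upwards [Metric.ball_mem_nhds (0 : Plane) hρ] with z hz
  simpa using hz

variable {G : Plane → Plane} {p : ℕ} {R : ℝ} {F : Plane → ℝ → Plane}

theorem isBigO_sq_mul {β : Plane → ℝ} {p k : ℕ} (hp : 1 ≤ p) (hk : 2 ≤ k)
    (hβ : (fun z => β z * ‖z‖ ^ p) =O[𝓝 0] fun z => ‖z‖ ^ k) :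
    (fun z => β z ^ 2 * ‖z‖ ^ (2 * p - 1)) =O[𝓝 0] fun z => ‖z‖ ^ (k + 1) := by
  obtain ⟨C, hC, hb⟩ := hβ.exists_nonneg
  refine Asymptotics.IsBigO.of_bound (C ^ 2) ?_
  filter_upwards [hb.bound, eventually_norm_lt one_pos] with z h1 h2
  rcases eq_or_ne z 0 with rfl | hz
  · rw [norm_zero, zero_pow (by omega), mul_zero, norm_zero]; positivity
  have hn : 0 < ‖z‖ := norm_pos_iff.2 hz
  have h2' : ‖z‖ ≤ 1 := h2.le
  rw [norm_pow, norm_norm] at h1 ⊢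
  have h3 : ‖β z ^ 2 * ‖z‖ ^ (2 * p - 1)‖ * ‖z‖ = ‖β z * ‖z‖ ^ p‖ ^ 2 := by
    rw [norm_mul, norm_mul, norm_pow, norm_pow, norm_pow, norm_norm, mul_assoc, ← pow_succ, mul_pow,
      ← pow_mul]
    congr 2; omega
  have h4 : ‖z‖ ^ (2 * k - 1) ≤ ‖z‖ ^ (k + 1) := pow_le_pow_of_le_one hn.le h2' (by omega)
  refine le_of_mul_le_mul_right ?_ hn
  calc _ = _ := h3
    _ ≤ (C * ‖z‖ ^ k) ^ 2 := by gcongr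
    _ = C ^ 2 * ‖z‖ ^ (2 * k - 1) * ‖z‖ := by
      rw [mul_pow, ← pow_mul, mul_assoc, ← pow_succ]; congr 2; omega
    _ ≤ C ^ 2 * ‖z‖ ^ (k + 1) * ‖z‖ := by gcongr

theorem tendsto_mul_norm_pow_of_isBigO {β : Plane → ℝ} {p k : ℕ} (hp : 1 ≤ p) (hk : 2 ≤ k)
    (hβ : (fun z => β z * ‖z‖ ^ p) =O[𝓝 0] fun z => ‖z‖ ^ k) :
    Filter.Tendsto (fun z => |β z| * ‖z‖ ^ (p - 1)) (𝓝[≠] 0) (𝓝 0) := by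
  obtain ⟨C, hC, hb⟩ := hβ.exists_nonneg
  have h1 : ∀ᶠ z in 𝓝[≠] (0 : Plane), |β z| * ‖z‖ ^ (p - 1) ≤ C * ‖z‖ ^ (k - 1) := by
    filter_upwards [hb.bound.filter_mono nhdsWithin_le_nhds, self_mem_nhdsWithin] with z h1 hz
    have hn : 0 < ‖z‖ := norm_pos_iff.2 hz
    rw [norm_pow, norm_norm, norm_mul, norm_pow, norm_norm, Real.norm_eq_abs] at h1
    refine le_of_mul_le_mul_right ?_ hn
    rw [mul_assoc, mul_assoc, ← pow_succ, ← pow_succ, Nat.sub_add_cancel hp,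
      Nat.sub_add_cancel (by omega)]
    exact h1
  refine squeeze_zero' (Filter.Eventually.of_forall fun z => by positivity) h1 ?_
  have : Filter.Tendsto (fun z : Plane => C * ‖z‖ ^ (k - 1)) (𝓝 0) (𝓝 (C * ‖(0 : Plane)‖ ^ (k - 1))) :=
    (by fun_prop : Continuous fun z : Plane => C * ‖z‖ ^ (k - 1)).tendsto 0
  rw [norm_zero, zero_pow (by omega), mul_zero] at this
  exact this.mono_left nhdsWithin_le_nhds

/-- The map obtained from `h` by flowing back for the time `P`, minus the identity. It vanishes
where `P` is a shift function. -/
def defect (F : Plane → ℝ → Plane) (h : Plane → Plane) (P : Plane → ℝ) (z : Plane) : Plane :=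
  F (h z) (-(P z)) - z

/-- `P` approximates the shift function `α` of `h` at the origin to order `k`. -/
structure ApproxShift (p : ℕ) (F : Plane → ℝ → Plane) (h : Plane → Plane) (α P : Plane → ℝ)
    (k : ℕ) : Prop where
  isBigO : defect F h P =O[𝓝 0] fun z => ‖z‖ ^ k
  tendsto : Filter.Tendsto (fun z => |α z - P z| * ‖z‖ ^ (p - 1)) (𝓝[≠] 0) (𝓝 0)

theorem eventually_flowsTo_sub (hG : HasZeroOfOrder G p) (hF : IsCutoffFlow G R F) (hR : 0 < R)
    {X : Type} {l : Filter X} {h : X → Plane} {P α : X → ℝ} {z : X → Plane} {P₀ : ℝ}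
    (hh : Filter.Tendsto h l (𝓝 0)) (hP : Filter.Tendsto P l (𝓝 P₀))
    (hα : ∀ᶠ x in l, FlowsTo G (z x) (α x) (h x)) :
    ∀ᶠ x in l, FlowsTo G (z x) (α x - P x) (F (h x) (-(P x))) := by
  have h0 : ∀ s ∈ uIcc 0 (-P₀), F 0 s ∈ Metric.ball (0 : Plane) R := fun s _ => by
    rw [hF.apply_origin hG hR]; exact Metric.mem_ball_self hR
  have hlim : Filter.Tendsto (fun x => (h x, -(P x))) l (𝓝 (0, -P₀)) := hh.prodMk_nhds hP.neg
  filter_upwards [hlim.eventually (hF.eventually_mem_ball h0), hα] with x h1 h2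
  exact h2.trans hG.contDiff (hF.flowsTo h1)

/-- One step of the approximation: the factor of the leading term of the defect is added. -/
theorem ApproxShift.succ (hG : HasZeroOfOrder G p) (hF : IsCutoffFlow G R F) (hR : 0 < R) {k : ℕ}
    (hk : 2 ≤ k) {N : ℕ} {ℓ : Fin N → PlaneForm k →L[ℝ] ℝ} {L : Fin N → Plane → ℝ}
    (hLG : ∀ m, (fun z => L m z • G z) =O[𝓝 0] fun z => ‖z‖ ^ k)
    (hdiv : ∀ q : PlaneForm k,
      (∃ t : Plane → ℝ, (fun z => (q fun _ => z) - t z • G z) =O[𝓝 0] fun z => ‖z‖ ^ (k + 1)) →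
      (fun z => (q fun _ => z) - (∑ m, ℓ m q * L m z) • G z) =O[𝓝 0] fun z => ‖z‖ ^ (k + 1))
    {h : Plane → Plane} {α P : Plane → ℝ} (hh : ContinuousAt h 0) (hh0 : h 0 = 0)
    (hP : ContinuousAt P 0) (hdef : ContDiffAt ℝ (k + 1 : ℕ) (defect F h P) 0)
    (hα : ∀ᶠ z in 𝓝 0, FlowsTo G z (α z) (h z)) (hA : ApproxShift p F h α P k)
    {P' : Plane → ℝ} (hP' : ∀ z, P' z = P z + ∑ m,
      ℓ m ((k.factorial : ℝ)⁻¹ • iteratedFDeriv ℝ k (defect F h P) 0) * L m z) :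
    ApproxShift p F h α P' (k + 1) := by
  have hp := hG.one_le
  set q : PlaneForm k := (k.factorial : ℝ)⁻¹ • iteratedFDeriv ℝ k (defect F h P) 0 with hq
  set β : Plane → ℝ := fun z => ∑ m, ℓ m q * L m z with hβ
  set u := defect F h P with hu
  set t : Plane → ℝ := fun z => α z - P z with ht
  obtain ⟨ρ, hρ, c₀, hc₀, C, hC, hest⟩ := exists_flow_estimates hG hF hR
  obtain ⟨c, hc, hlow⟩ := hG.lower
  have hz0 : Filter.Tendsto (fun z : Plane => z) (𝓝 0) (𝓝 0) := Filter.tendsto_id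
  have hh' : Filter.Tendsto h (𝓝 0) (𝓝 0) := by simpa [ContinuousAt, hh0] using hh
  have hflow := eventually_flowsTo_sub hG hF hR (z := fun z => z) hh' hP hα
  have hu0 : u 0 = 0 := by simp [hu, defect, hh0, hF.apply_origin hG hR]
  -- the estimates for the remaining time `t`
  have hball : ∀ᶠ z in 𝓝 (0 : Plane), ‖z‖ < ρ := eventually_norm_lt hρ
  have h1 : ∀ᶠ z in 𝓝 (0 : Plane), ‖u z - t z • G z‖ ≤ C * (t z ^ 2 * ‖z‖ ^ (2 * p - 1)) ∧
      |t z| * ‖z‖ ^ p ≤ C * ‖u z‖ := by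
    have hsm := hA.tendsto.eventually_le_const hc₀
    rw [eventually_nhdsWithin_iff] at hsm
    filter_upwards [hsm, hflow, hball] with z h1 h2 h3
    rcases eq_or_ne z 0 with rfl | hz
    · rw [hu0, hG.map_zero, norm_zero, zero_pow (by omega), zero_pow (by omega)]
      simp
    · obtain ⟨e1, e2, e3⟩ := hest z (t z) h3 (h1 hz)
      have : F z (t z) = F (h z) (-(P z)) := e3.unique hG.contDiff h2
      rw [this] at e1 e2
      exact ⟨by rw [← mul_assoc]; exact e1, e2⟩
  have ht1 : (fun z => t z * ‖z‖ ^ p) =O[𝓝 0] fun z => ‖z‖ ^ k := by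
    refine (Asymptotics.IsBigO.of_bound C ?_).trans hA.isBigO
    filter_upwards [h1] with z hz
    simpa [abs_mul] using hz.2
  have ht2 : (fun z => u z - t z • G z) =O[𝓝 0] fun z => ‖z‖ ^ (k + 1) := by
    refine (Asymptotics.IsBigO.of_bound C ?_).trans (isBigO_sq_mul hp hk ht1)
    filter_upwards [h1] with z hz
    refine hz.1.trans (by gcongr; exact le_abs_self _)
  have hqu : (fun z => u z - q fun _ => z) =O[𝓝 0] fun z => ‖z‖ ^ (k + 1) :=
    isBigO_sub_leading_term hdef (jet_eq_zero_of_isBigO (hdef.of_le (by norm_cast; omega)) hA.isBigO)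
  have hqβ : (fun z => (q fun _ => z) - β z • G z) =O[𝓝 0] fun z => ‖z‖ ^ (k + 1) :=
    hdiv q ⟨t, (ht2.sub hqu).congr_left fun z => by abel⟩
  have hβ1 : (fun z => β z * ‖z‖ ^ p) =O[𝓝 0] fun z => ‖z‖ ^ k := by
    have e1 : (fun z => β z • G z) =O[𝓝 0] fun z => ‖z‖ ^ k := by
      have := Asymptotics.IsBigO.sum (s := Finset.univ) fun m (_ : m ∈ Finset.univ) =>
        (hLG m).const_smul_left (ℓ m q)
      refine this.congr_left fun z => ?_
      simp [hβ, Finset.sum_smul, smul_smul]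
    refine (Asymptotics.IsBigO.of_bound c⁻¹ ?_).trans e1
    filter_upwards [hlow] with z hz
    rw [norm_mul, norm_smul, norm_pow, norm_norm, le_inv_mul_iff₀ hc]
    calc _ = ‖β z‖ * (c * ‖z‖ ^ p) := by ring
      _ ≤ _ := by gcongr
  have hβ2 := tendsto_mul_norm_pow_of_isBigO hp hk hβ1
  have hneg : (fun z => (t z - β z) * ‖z‖ ^ p) =O[𝓝 0] fun z => ‖z‖ ^ k :=
    (ht1.sub hβ1).congr_left fun z => by ring
  refine ⟨?_, ?_⟩
  swap
  · refine (tendsto_mul_norm_pow_of_isBigO hp hk hneg).congr fun z => ?_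
    simp only [ht, hP', hβ, sub_sub]
  -- the new defect
  have hw2 : ∀ᶠ z in 𝓝 (0 : Plane), ‖z + u z‖ ≤ 2 * ‖z‖ := by
    have : u =O[𝓝 0] fun z => ‖z‖ ^ 2 := hA.isBigO.trans (isBigO_norm_pow_of_le hk)
    have h2 := (this.trans_isLittleO
      (Asymptotics.isLittleO_norm_pow_id (E' := Plane) one_lt_two)).bound one_pos
    filter_upwards [h2] with z hz
    have := norm_add_le z (u z)
    simp only [one_mul] at hz
    linarith
  obtain ⟨m, hm⟩ : ∃ m, p = m + 1 := ⟨p - 1, by omega⟩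
  obtain ⟨C₂, hC₂, ρ₂, hρ₂, hlip⟩ := exists_lipschitz_of_isBigO (m := m)
    (hG.contDiff.contDiffAt.of_le (by exact_mod_cast le_top)) (hm ▸ hG.isBigO)
  have hb1 : (fun z => F (z + u z) (-(β z)) - (z + u z) + β z • G (z + u z)) =O[𝓝 0]
      fun z => ‖z‖ ^ (k + 1) := by
    refine (Asymptotics.IsBigO.of_bound (C * 2 ^ (2 * p - 1)) ?_).trans (isBigO_sq_mul hp hk hβ1)
    have hsm := hβ2.eventually_le_const (show 0 < c₀ / 2 ^ (p - 1) by positivity)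
    rw [eventually_nhdsWithin_iff] at hsm
    have hball2 : ∀ᶠ z in 𝓝 (0 : Plane), ‖z‖ < ρ / 2 :=
      eventually_norm_lt (half_pos hρ)
    filter_upwards [hsm, hw2, hball2] with z h2 h3 h4
    rcases eq_or_ne z 0 with rfl | hz
    · rw [hu0, add_zero, hF.apply_origin hG hR, hG.map_zero]
      simp; positivity
    have h5 := h2 hz
    rw [le_div_iff₀ (by positivity)] at h5
    obtain ⟨e1, -, -⟩ := hest (z + u z) (-(β z)) (by linarith) (by
      rw [abs_neg]
      calc |β z| * ‖z + u z‖ ^ (p - 1) ≤ |β z| * (2 * ‖z‖) ^ (p - 1) := by gcongr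
        _ = |β z| * ‖z‖ ^ (p - 1) * 2 ^ (p - 1) := by rw [mul_pow]; ring
        _ ≤ c₀ := h5)
    rw [neg_smul, sub_neg_eq_add, neg_sq] at e1
    calc _ ≤ _ := e1
      _ ≤ C * β z ^ 2 * (2 * ‖z‖) ^ (2 * p - 1) := by gcongr
      _ = C * 2 ^ (2 * p - 1) * (β z ^ 2 * ‖z‖ ^ (2 * p - 1)) := by rw [mul_pow]; ring
      _ ≤ _ := by gcongr; exact le_abs_self _
  have hb2 : (fun z => β z • (G (z + u z) - G z)) =O[𝓝 0] fun z => ‖z‖ ^ (k + 1) := by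
    obtain ⟨K, hK, hKb⟩ := hβ1.exists_nonneg
    obtain ⟨K', hK', hKb'⟩ := hA.isBigO.exists_nonneg
    refine Asymptotics.IsBigO.of_bound (C₂ * 2 ^ m * K * K') ?_
    filter_upwards [hKb.bound, hKb'.bound, hw2, eventually_norm_lt (half_pos hρ₂),
      eventually_norm_lt one_pos] with z h2 h3 h4 h5 h6
    rcases eq_or_ne z 0 with rfl | hz
    · rw [hu0, add_zero, sub_self, smul_zero, norm_zero]; positivity
    have hn : 0 < ‖z‖ := norm_pos_iff.2 hz
    rw [norm_pow, norm_norm] at h2 h3 ⊢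
    rw [norm_mul, norm_pow, norm_norm] at h2
    have h7 := hlip (z + u z) z (2 * ‖z‖) (by linarith) h4 (by linarith)
    rw [add_sub_cancel_left] at h7
    have h8 : ‖β z‖ * ‖z‖ ^ m ≤ K * ‖z‖ ^ (k - 1) := by
      refine le_of_mul_le_mul_right ?_ hn
      rw [mul_assoc, mul_assoc, ← pow_succ, ← pow_succ, ← hm, Nat.sub_add_cancel (by omega)]
      exact h2
    rw [norm_smul]
    calc ‖β z‖ * ‖G (z + u z) - G z‖ ≤ ‖β z‖ * (C₂ * (2 * ‖z‖) ^ m * (K' * ‖z‖ ^ k)) := by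
          gcongr
          exact h7.trans (by gcongr)
      _ = C₂ * 2 ^ m * K' * ‖z‖ ^ k * (‖β z‖ * ‖z‖ ^ m) := by rw [mul_pow]; ring
      _ ≤ C₂ * 2 ^ m * K' * ‖z‖ ^ k * (K * ‖z‖ ^ (k - 1)) := by gcongr
      _ = C₂ * 2 ^ m * K * K' * ‖z‖ ^ (k + (k - 1)) := by rw [pow_add]; ring
      _ ≤ _ := by
        gcongr C₂ * 2 ^ m * K * K' * ?_
        exact pow_le_pow_of_le_one hn.le h6.le (by omega)
  refine (((hb1.add hqu).add hqβ).sub hb2).congr_left fun z => ?_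
  have e1 : F (h z) (-(P' z)) = F (z + u z) (-(β z)) := by
    rw [hP', neg_add, hF.add]
    congr 1
    simp [hu, defect]
  simp only [defect, e1, smul_sub]
  abel

variable {ι : Type} {l : Filter ι}

theorem ctendsto_defect (hF : IsCutoffFlow G R F) {h : ι → Plane → Plane} {f : Plane → Plane}
    {P : ι → Plane → ℝ} {P₀ : Plane → ℝ} {n : ℕ} (hh : CTendsto n l h f 0)
    (hP : CTendsto n l P P₀ 0) :
    CTendsto n l (fun i => defect F (h i) (P i)) (defect F f P₀) 0 := by
  have hΦ : ContDiff ℝ ∞ fun q : (Plane × ℝ) × Plane => F q.1.1 (-q.1.2) - q.2 :=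
    (hF.contDiff.comp (by fun_prop : ContDiff ℝ ∞ fun q : (Plane × ℝ) × Plane =>
      (q.1.1, -q.1.2))).sub contDiff_snd
  exact CTendsto.comp (Φ := fun q : (Plane × ℝ) × Plane => F q.1.1 (-q.1.2) - q.2)
    (hΦ.contDiffAt.of_le (by exact_mod_cast le_top))
    ((hh.prodMk hP).prodMk (CTendsto.const (v := fun z => z) contDiffAt_id))

/-- Smooth approximations of shift functions of any order, which depend continuously on the
maps: their coefficients are linear in the jets of the successive defects. -/
theorem exists_approxShift (hG : HasZeroOfOrder G p) (hD : HasDivision G)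
    (hF : IsCutoffFlow G R F) (hR : 0 < R) {M : ℕ} {h : ι → Plane → Plane} {f : Plane → Plane}
    (hh : CTendsto M l h f 0) (hh0 : ∀ᶠ i in l, h i 0 = 0) {α : ι → Plane → ℝ}
    (hα : ∀ᶠ i in l, ∀ᶠ z in 𝓝 0, FlowsTo G z (α i z) (h i z)) {a : ι → ℝ} {a₀ : ℝ}
    (ha : Filter.Tendsto a l (𝓝 a₀))
    (h2 : ∀ᶠ i in l, ApproxShift p F (h i) (α i) (fun _ => a i) 2) {k : ℕ} (hk : 2 ≤ k)
    (hkM : k ≤ M) :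
    ∃ (P : ι → Plane → ℝ) (P₀ : Plane → ℝ), (∀ n, CTendsto n l P P₀ 0) ∧
      ∀ᶠ i in l, ApproxShift p F (h i) (α i) (P i) k := by
  induction k, hk using Nat.le_induction with
  | base => exact ⟨fun i _ => a i, fun _ => a₀, fun n => CTendsto.const_param ha, h2⟩
  | succ k hk ih =>
    obtain ⟨P, P₀, hP, hA⟩ := ih (by omega)
    obtain ⟨N, ℓ, L, hL, hLG, hdiv⟩ := hD k
    have hdef := ctendsto_defect hF hh (hP M)
    have hsec : Filter.Tendsto (fun i => (i, (0 : Plane))) l (l ×ˢ 𝓝 0) :=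
      Filter.tendsto_id.prodMk tendsto_const_nhds
    let q : ι → PlaneForm k := fun i =>
      (k.factorial : ℝ)⁻¹ • iteratedFDeriv ℝ k (defect F (h i) (P i)) 0
    let q₀ : PlaneForm k := (k.factorial : ℝ)⁻¹ • iteratedFDeriv ℝ k (defect F f P₀) 0
    have hq : Filter.Tendsto q l (𝓝 q₀) :=
      ((hdef.tendsto k (by omega)).comp hsec).const_smul _
    have hc : Filter.Tendsto (fun i m => ℓ m (q i)) l (𝓝 fun m => ℓ m q₀) :=
      tendsto_pi_nhds.2 fun m => ((ℓ m).continuous.tendsto _).comp hq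
    refine ⟨fun i z => P i z + ∑ m, ℓ m (q i) * L m z, fun z => P₀ z + ∑ m, ℓ m q₀ * L m z,
      fun n => (hP n).add ?_, ?_⟩
    · have hLv : ContDiff ℝ ∞ fun z m => L m z := contDiff_pi.2 hL
      exact CTendsto.comp (Φ := fun v : (Fin N → ℝ) × (Fin N → ℝ) => ∑ m, v.1 m * v.2 m)
        (by fun_prop) ((CTendsto.const_param (x₀ := (0 : Plane)) hc).prodMk
          (CTendsto.const (v := fun z m => L m z)
            (hLv.contDiffAt.of_le (by exact_mod_cast le_top))))
    · have e1 : ∀ᶠ i in l, ContDiffAt ℝ M (h i) 0 := hsec.eventually hh.smooth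
      have e2 : ∀ᶠ i in l, ContDiffAt ℝ M (P i) 0 := hsec.eventually (hP M).smooth
      have e3 : ∀ᶠ i in l, ContDiffAt ℝ M (defect F (h i) (P i)) 0 := hsec.eventually hdef.smooth
      filter_upwards [e1, e2, e3, hh0, hα, hA] with i i1 i2 i3 i4 i5 i6
      exact ApproxShift.succ hG hF hR hk hLG hdiv i1.continuousAt i4 i2.continuousAt
        (i3.of_le (by exact_mod_cast hkM)) i5 i6 fun z => rfl

end JetApprox

/-! ### Shift functions near the origin -/

section ClosedFormula

/-- Hadamard's lemma with parameters. -/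
theorem exists_contDiff_quotient {E F : Type} [NormedAddCommGroup E] [NormedSpace ℝ E]
    [NormedAddCommGroup F] [NormedSpace ℝ F] [CompleteSpace F] {Φ : E × ℝ → F}
    (hΦ : ContDiff ℝ ∞ Φ) :
    ∃ Φ₁ : E × ℝ → F, ContDiff ℝ ∞ Φ₁ ∧ ∀ z t, Φ (z, t) = Φ (z, 0) + t • Φ₁ (z, t) := by
  let D : E × ℝ → F := fun x => fderiv ℝ Φ x (0, 1)
  have hD : ContDiff ℝ ∞ D := (hΦ.fderiv_right (by simp)).clm_apply contDiff_const
  let sg : C(unitInterval, E × ℝ) := ⟨fun s => (0, (s : ℝ)), by fun_prop⟩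
  let cst : E × ℝ →L[ℝ] C(unitInterval, E × ℝ) := ContinuousLinearMap.const ℝ unitInterval
  let line : E × ℝ → C(unitInterval, E × ℝ) := fun x => cst (x.1, 0) + x.2 • sg
  have hline : ContDiff ℝ ∞ line :=
    (cst.contDiff.comp (contDiff_fst.prodMk contDiff_const)).add (contDiff_snd.smul contDiff_const)
  let Op : C(unitInterval, F) →L[ℝ] F :=
    (ContinuousMap.evalCLM ℝ (1 : unitInterval)).comp (primitiveOp F)
  refine ⟨fun x => Op ((⟨D, hD.continuous⟩ : C(E × ℝ, F)).comp (line x)),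
    Op.contDiff.comp ((contDiff_superposition hD).comp hline), fun z t => ?_⟩
  have h1 : Op ((⟨D, hD.continuous⟩ : C(E × ℝ, F)).comp (line (z, t))) =
      ∫ s in (0 : ℝ)..1, D (z, s * t) := by
    change ∫ s in (0 : ℝ)..((1 : unitInterval) : ℝ), D (line (z, t) (projIcc 0 1 zero_le_one s)) = _
    refine intervalIntegral.integral_congr fun s hs => ?_
    rw [uIcc_of_le (by simp)] at hs
    simp only [line, cst, sg, ContinuousMap.add_apply, ContinuousMap.smul_apply,
      ContinuousMap.coe_mk, projIcc_of_mem zero_le_one hs]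
    congr 1
    simp [mul_comm]
  have h2 : ∀ s, HasDerivAt (fun s : ℝ => Φ (z, s * t)) (t • D (z, s * t)) s := by
    intro s
    have h3 := ((hΦ.differentiable (by simp)) (z, s * t)).hasFDerivAt.comp_hasDerivAt s
      ((hasDerivAt_const s z).prodMk ((hasDerivAt_id s).mul_const t))
    have h4 : ((0 : E), 1 * t) = t • ((0 : E), (1 : ℝ)) := by simp
    rw [h4, map_smul] at h3
    exact h3
  have hc : Continuous fun s : ℝ => t • D (z, s * t) :=
    (hD.continuous.comp (by fun_prop : Continuous fun s : ℝ => (z, s * t))).const_smul t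
  have h3 := intervalIntegral.integral_eq_sub_of_hasDerivAt (a := 0) (b := 1)
    (fun s _ => h2 s) (hc.intervalIntegrable _ _)
  rw [intervalIntegral.integral_smul, one_mul, zero_mul] at h3
  beta_reduce
  rw [h1, h3]; abel

variable {G : Plane → Plane} {p : ℕ} {R : ℝ} {F : Plane → ℝ → Plane}

/-- Taylor expansion of the flow of second order in the time, with a smooth remainder. -/
theorem IsCutoffFlow.exists_second_order (hF : IsCutoffFlow G R F) :
    ∃ E : Plane × ℝ → Plane, ContDiff ℝ ∞ E ∧
      ∀ z ∈ Metric.ball (0 : Plane) R, ∀ t, F z t = z + t • G z + t ^ 2 • E (z, t) := by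
  obtain ⟨F₁, hF₁, e1⟩ := exists_contDiff_quotient hF.contDiff
  obtain ⟨F₂, hF₂, e2⟩ := exists_contDiff_quotient hF₁
  refine ⟨F₂, hF₂, fun z hz t => ?_⟩
  have h1 : F₁ (z, 0) = G z := by
    have d1 : HasDerivAt (F z) (G z) 0 := by
      have := hF.hasDerivAt (x := z) (t := 0) (by rwa [hF.zero])
      rwa [hF.zero] at this
    have d2 : HasDerivAt (F z) (F₁ (z, 0)) 0 := by
      have h3 : HasDerivAt (fun t : ℝ => F₁ (z, t)) (fderiv ℝ F₁ (z, 0) (0, 1)) 0 :=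
        ((hF₁.differentiable (by simp)) (z, 0)).hasFDerivAt.comp_hasDerivAt (0 : ℝ)
          ((hasDerivAt_const _ z).prodMk (hasDerivAt_id _))
      have h4 := ((hasDerivAt_id (0 : ℝ)).smul h3).const_add z
      simp only [id, zero_smul, one_smul, zero_add] at h4
      refine h4.congr_of_eventuallyEq (Filter.Eventually.of_forall fun t => ?_)
      have := e1 z t
      simp only [Function.uncurry_apply_pair, hF.zero] at this
      exact this
    exact d2.unique d1
  have h2 := e1 z t
  simp only [Function.uncurry_apply_pair, hF.zero] at h2
  rw [h2, e2 z t, h1, smul_add, smul_smul, sq, add_assoc]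

/-- The smooth solution `τ = S (z, b)` of the equation `τ + τ² e(z, τ) = b` near the origin. -/
theorem exists_local_solution {e : Plane × ℝ → ℝ} (he : ContDiff ℝ ∞ e) :
    ∃ S : Plane × ℝ → ℝ, ContDiffAt ℝ ∞ S 0 ∧
      ∀ᶠ q in 𝓝 (0 : Plane × ℝ), S (q.1, q.2 + q.2 ^ 2 * e q) = q.2 := by
  let Ψ : Plane × ℝ → Plane × ℝ := fun q => (q.1, q.2 + q.2 ^ 2 * e q)
  have hΨ : ContDiff ℝ ∞ Ψ :=
    contDiff_fst.prodMk (contDiff_snd.add ((contDiff_snd.pow 2).mul he))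
  have hder : HasFDerivAt Ψ
      ((ContinuousLinearEquiv.refl ℝ (Plane × ℝ) : Plane × ℝ →L[ℝ] Plane × ℝ)) 0 := by
    have h1 : HasFDerivAt (fun q : Plane × ℝ => q.2) (ContinuousLinearMap.snd ℝ Plane ℝ) 0 :=
      hasFDerivAt_snd
    have h2 := (hasFDerivAt_fst (𝕜 := ℝ) (p := (0 : Plane × ℝ))).prodMk
      (h1.add ((h1.pow 2).mul ((he.differentiable (by simp)) 0).hasFDerivAt))
    refine h2.congr_fderiv ?_
    ext x <;> simp
  have hne : (∞ : ℕ∞ω) ≠ 0 := by simp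
  have hΨ0 : Ψ 0 = 0 := by simp [Ψ]
  refine ⟨fun q => (hΨ.contDiffAt.localInverse hder hne q).2, ?_, ?_⟩
  · have h1 := hΨ.contDiffAt.to_localInverse hder hne
    rw [hΨ0] at h1
    exact contDiffAt_snd.comp _ h1
  · have h1 := (hΨ.contDiffAt.hasStrictFDerivAt' hder hne).eventually_left_inverse
    filter_upwards [h1] with q hq
    exact congrArg Prod.snd hq

variable {ι : Type} {l : Filter ι}

/-- Near the origin, shift functions depend continuously on the maps. They are given by a closed
formula `P + ‖G‖² S(z, b)`, where `P` is a smooth approximation of high order and `b` is the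
quotient of a flat function by `‖G‖⁴`. -/
theorem exists_ctendsto_shift (hG : HasZeroOfOrder G p) (hD : HasDivision G)
    (hF : IsCutoffFlow G R F) (hR : 0 < R) (r : ℕ) :
    ∃ s : ℕ, ∀ {ι : Type} {l : Filter ι} {h : ι → Plane → Plane} {f : Plane → Plane}
      {α : ι → Plane → ℝ} {a : ι → ℝ} {a₀ : ℝ},
      CTendsto s l h f 0 → f 0 = 0 → (∀ᶠ i in l, h i 0 = 0) →
      (∀ᶠ q in l ×ˢ 𝓝 0, FlowsTo G q.2 (α q.1 q.2) (h q.1 q.2)) →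
      (∀ᶠ q in l ×ˢ 𝓝 0, q.2 ≠ 0 → ContinuousAt (α q.1) q.2) →
      Filter.Tendsto a l (𝓝 a₀) →
      (∀ᶠ i in l, ApproxShift p F (h i) (α i) (fun _ => a i) 2) →
      ∃ v v₀, CTendsto r l v v₀ 0 ∧ ∀ᶠ q in l ×ˢ 𝓝 0, q.2 ≠ 0 → α q.1 q.2 = v q.1 q.2 := by
  have hp := hG.one_le
  obtain ⟨M', hM'⟩ : ∃ M', M' = divisionOrder r (4 * p) := ⟨_, rfl⟩
  obtain ⟨M, hM⟩ : ∃ M, M = M' + 3 * p + 1 := ⟨_, rfl⟩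
  refine ⟨M, ?_⟩
  intro ι l h f α a a₀ hh hf0 hh0 hα hαc ha h2
  obtain ⟨P, P₀, hP, hA⟩ := exists_approxShift hG hD hF hR hh hh0 hα.curry ha h2 (k := M)
    (by omega) le_rfl
  have hdef := ctendsto_defect hF hh (hP M)
  obtain ⟨B, hB, hBb⟩ := hdef.exists_flat_bound (hA.mono fun i hi => hi.isBigO)
  obtain ⟨ρ, hρ, c₀, hc₀, C, hC, hest⟩ := exists_flow_estimates hG hF hR
  obtain ⟨c, hc, hlow⟩ := hG.lower
  -- the remaining time is uniformly small, by continuity along rays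
  have hlimh : Filter.Tendsto (fun q : ι × Plane => h q.1 q.2) (l ×ˢ 𝓝 0) (𝓝 0) := by
    have := hh.tendsto_zero; rwa [hf0] at this
  have hflow := eventually_flowsTo_sub hG hF hR hlimh (hP 0).tendsto_zero hα
  have hPc : ∀ᶠ q in l ×ˢ 𝓝 (0 : Plane), ContinuousAt (P q.1) q.2 :=
    (hP 0).smooth.mono fun q hq => hq.continuousAt
  have hray : ∀ᶠ q in l ×ˢ 𝓝 (0 : Plane), q.2 ≠ 0 →
      |α q.1 q.2 - P q.1 q.2| * ‖q.2‖ ^ (p - 1) ≤ c₀ := by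
    obtain ⟨pa, hpa, pb, hpb, hab⟩ := Filter.eventually_prod_iff.1
      (hBb.and (hflow.and (hPc.and hαc)))
    obtain ⟨ρ', hρ', hball⟩ := Metric.eventually_nhds_iff_ball.1 hpb
    obtain ⟨ρ₁, hρ₁, hρ₁1, hρ₁2, hρ₁3⟩ : ∃ ρ₁ > 0, ρ₁ ≤ ρ ∧ ρ₁ ≤ ρ' ∧ C * B * ρ₁ ≤ c₀ / 2 := by
      refine ⟨min (min ρ ρ') (c₀ / (2 * (C * B + 1))), by positivity,
        (min_le_left _ _).trans (min_le_left _ _), (min_le_left _ _).trans (min_le_right _ _), ?_⟩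
      calc C * B * min (min ρ ρ') (c₀ / (2 * (C * B + 1)))
          ≤ C * B * (c₀ / (2 * (C * B + 1))) := by gcongr; exact min_le_right _ _
        _ ≤ c₀ / 2 := by
          rw [← mul_div_assoc, div_le_div_iff₀ (by positivity) (by positivity)]
          nlinarith [mul_nonneg hC.le hB]
    obtain ⟨ρ₂, hρ₂, hρ₂1, hρ₂2⟩ : ∃ ρ₂ > 0, ρ₂ ≤ ρ₁ ∧ ρ₂ ≤ 1 :=
      ⟨min ρ₁ 1, by positivity, min_le_left _ _, min_le_right _ _⟩
    refine Filter.eventually_prod_iff.2 ⟨_, hpa.and hA, _, Metric.ball_mem_nhds 0 hρ₂,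
      fun {i} hi {z} hz hz0 => ?_⟩
    simp only at hz0 ⊢
    have hzn : ‖z‖ < ρ₂ := mem_ball_zero_iff.1 hz
    let φ : ℝ → ℝ := fun s => |α i (s • z) - P i (s • z)| * ‖s • z‖ ^ (p - 1)
    have hsz : ∀ s ∈ Ioc (0 : ℝ) 1, ‖s • z‖ < ρ₂ ∧ s • z ≠ 0 := by
      intro s hs
      refine ⟨?_, smul_ne_zero hs.1.ne' hz0⟩
      rw [norm_smul, Real.norm_eq_abs, abs_of_pos hs.1]
      nlinarith [hs.2, norm_nonneg z, hs.1]
    have hin : ∀ s ∈ Ioc (0 : ℝ) 1, s • z ∈ Metric.ball (0 : Plane) ρ' := fun s hs => by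
      rw [mem_ball_zero_iff]; linarith [(hsz s hs).1]
    have hφc : ContinuousOn φ (Ioc 0 1) := by
      intro s hs
      obtain ⟨-, -, k1, k2⟩ := hab hi.1 (hball _ (hin s hs))
      have hcs : ContinuousAt (fun s : ℝ => s • z) s := by fun_prop
      have j1 : ContinuousAt (fun s : ℝ => α i (s • z)) s :=
        ContinuousAt.comp (f := fun s : ℝ => s • z) (k2 (hsz s hs).2) hcs
      have j2 : ContinuousAt (fun s : ℝ => P i (s • z)) s :=
        ContinuousAt.comp (f := fun s : ℝ => s • z) k1 hcs
      exact ((j1.sub j2).abs.mul (hcs.norm.pow _)).continuousWithinAt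
    have hgap : ∀ s ∈ Ioc (0 : ℝ) 1, φ s ≤ c₀ → φ s ≤ c₀ / 2 := by
      intro s hs hle
      obtain ⟨k0, k1, -, -⟩ := hab hi.1 (hball _ (hin s hs))
      obtain ⟨hs1, hs2⟩ := hsz s hs
      have hn : 0 < ‖s • z‖ := norm_pos_iff.2 hs2
      obtain ⟨-, e2, e3⟩ := hest (s • z) (α i (s • z) - P i (s • z)) (by linarith) hle
      rw [e3.unique hG.contDiff k1] at e2
      have k0' : ‖F (h i (s • z)) (-(P i (s • z))) - s • z‖ ≤ B * ‖s • z‖ ^ M := k0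
      have e4 : φ s * ‖s • z‖ ≤ C * (B * ‖s • z‖ ^ M) := by
        simp only [φ]
        rw [mul_assoc, ← pow_succ, Nat.sub_add_cancel hp]
        exact e2.trans (by gcongr)
      have e5 : ‖s • z‖ ^ M ≤ ρ₁ * ‖s • z‖ := by
        calc ‖s • z‖ ^ M ≤ ‖s • z‖ ^ 2 :=
              pow_le_pow_of_le_one hn.le (by linarith) (by omega)
          _ = ‖s • z‖ * ‖s • z‖ := sq _
          _ ≤ ρ₁ * ‖s • z‖ := by gcongr; linarith
      refine le_of_mul_le_mul_right ?_ hn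
      calc φ s * ‖s • z‖ ≤ C * (B * ‖s • z‖ ^ M) := e4
        _ ≤ C * (B * (ρ₁ * ‖s • z‖)) := by gcongr
        _ = C * B * ρ₁ * ‖s • z‖ := by ring
        _ ≤ c₀ / 2 * ‖s • z‖ := by gcongr
    have hstart : ∃ s ∈ Ioc (0 : ℝ) 1, φ s ≤ c₀ := by
      have hc1 : Filter.Tendsto (fun s : ℝ => s • z) (𝓝[>] 0) (𝓝[≠] 0) := by
        refine tendsto_nhdsWithin_iff.2 ⟨?_, ?_⟩
        · have : Filter.Tendsto (fun s : ℝ => s • z) (𝓝 0) (𝓝 ((0 : ℝ) • z)) :=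
            (by fun_prop : Continuous fun s : ℝ => s • z).tendsto 0
          rw [zero_smul] at this
          exact this.mono_left nhdsWithin_le_nhds
        · filter_upwards [self_mem_nhdsWithin] with s hs
          exact smul_ne_zero (ne_of_gt hs) hz0
      have h3 := (hi.2.tendsto.comp hc1).eventually_le_const hc₀
      obtain ⟨s, h4, h5⟩ := (h3.and (Ioc_mem_nhdsGT one_pos)).exists
      exact ⟨s, h5, h4⟩
    obtain ⟨s₀, hs₀, hs₀'⟩ := hstart
    have := IsPreconnected.le_of_gap isPreconnected_Ioc hφc (by linarith : c₀ / 2 < c₀) hgap hs₀ hs₀' 1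
      ⟨one_pos, le_rfl⟩
    simp only [φ, one_smul] at this
    linarith
  -- the closed formula
  obtain ⟨E, hE, hEF⟩ := hF.exists_second_order
  have hGs := hG.contDiff
  have hG2 : ContDiff ℝ ∞ fun z => ‖G z‖ ^ 2 := hGs.norm_sq ℝ
  let e : Plane × ℝ → ℝ := fun q => inner ℝ (E (q.1, ‖G q.1‖ ^ 2 * q.2)) (G q.1)
  have he : ContDiff ℝ ∞ e :=
    (hE.comp (contDiff_fst.prodMk ((hG2.comp contDiff_fst).mul contDiff_snd))).inner ℝ
      (hGs.comp contDiff_fst)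
  obtain ⟨S, hS, hSe⟩ := exists_local_solution he
  let n : ι → Plane → ℝ := fun i z => inner ℝ (defect F (h i) (P i) z) (G z)
  let b : ι → Plane → ℝ := fun i z => ((‖G z‖ ^ 2) ^ 2)⁻¹ • n i z
  have hb : CTendsto r l b (fun _ => 0) 0 := by
    have hn : CTendsto M l n (fun z => inner ℝ (defect F f P₀ z) (G z)) 0 :=
      CTendsto.comp (Φ := fun q : Plane × Plane => (inner ℝ q.1 q.2 : ℝ))
        (contDiffAt_fst.inner ℝ contDiffAt_snd)
        (hdef.prodMk (CTendsto.const (v := G) (hGs.contDiffAt.of_le (by exact_mod_cast le_top))))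
    refine ctendsto_zero_inv_smul (m := 4 * p) (c := c ^ 4) (hG2.pow 2) (by positivity) ?_
      (hn.mono (by omega)) ?_
    · filter_upwards [hlow] with z hz
      calc c ^ 4 * ‖z‖ ^ (4 * p) = (c * ‖z‖ ^ p) ^ 4 := by ring
        _ ≤ ‖G z‖ ^ 4 := by gcongr
        _ = (‖G z‖ ^ 2) ^ 2 := by ring
    · filter_upwards [hA] with i hi
      have h1 : G =O[𝓝 0] fun _ => (1 : ℝ) := Filter.Tendsto.isBigO_one ℝ (hGs.continuous.tendsto 0)
      have h3 := (hi.isBigO.norm_left.mul h1.norm_left)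
      simp only [mul_one] at h3
      rw [← hM']
      refine (Asymptotics.IsBigO.of_bound 1 (Filter.Eventually.of_forall fun z => ?_)).trans
        (h3.trans (isBigO_norm_pow_of_le (by omega : M' ≤ M)))
      rw [norm_mul, norm_norm, norm_norm, one_mul]
      exact norm_inner_le_norm _ _
  refine ⟨fun i z => P i z + ‖G z‖ ^ 2 • S (z, b i z), fun z => P₀ z + ‖G z‖ ^ 2 • S (z, 0),
    (hP r).add ((CTendsto.const (v := fun z => ‖G z‖ ^ 2)
      (hG2.contDiffAt.of_le (by exact_mod_cast le_top))).smul (CTendsto.comp (Φ := S)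
        (v := fun z : Plane => (z, (0 : ℝ))) (u := fun i z => (z, b i z))
        (hS.of_le (by exact_mod_cast le_top))
        ((CTendsto.const (v := fun z => z) contDiffAt_id).prodMk hb))), ?_⟩
  -- the rescaled time is small
  let τ : ι × Plane → ℝ := fun q => (α q.1 q.2 - P q.1 q.2) / ‖G q.2‖ ^ 2
  have hz2 : Filter.Tendsto (fun q : ι × Plane => q.2) (l ×ˢ 𝓝 0) (𝓝 0) := Filter.tendsto_snd
  obtain ⟨δ, hδ, hδS⟩ := Metric.eventually_nhds_iff.1 hSe
  have hsmall : ∀ᶠ q in l ×ˢ 𝓝 (0 : Plane), C * B * (c ^ 2)⁻¹ * ‖q.2‖ < δ := by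
    have := (tendsto_norm_snd_zero (l := l) (E := Plane)).const_mul (C * B * (c ^ 2)⁻¹)
    rw [mul_zero] at this
    exact this.eventually_lt_const hδ
  filter_upwards [hray, hflow, hBb, hz2.eventually hlow, hz2.eventually (eventually_norm_lt hρ),
    hz2.eventually (eventually_norm_lt hδ), hz2.eventually (eventually_norm_lt hR),
    hz2.eventually (eventually_norm_lt one_pos), hsmall]
    with q q1 q2 q3 q4 q5 q6 q7 q8 q9 hq0
  obtain ⟨i, z⟩ := q
  simp only at q1 q2 q3 q4 q5 q6 q7 q8 q9 hq0 ⊢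
  have hn : 0 < ‖z‖ := norm_pos_iff.2 hq0
  have hGn : 0 < ‖G z‖ := lt_of_lt_of_le (by positivity) q4
  set t := α i z - P i z with ht
  obtain ⟨-, e2, e3⟩ := hest z t q5 (q1 hq0)
  have e4 : F z t = z + defect F (h i) (P i) z := by
    rw [e3.unique hG.contDiff q2, defect]; abel
  rw [e4, add_sub_cancel_left] at e2
  have hτt : t = ‖G z‖ ^ 2 * τ (i, z) := by
    simp only [τ, ← ht]; field_simp
  have hτ : |τ (i, z)| < δ := by
    have h4 : |t| * ‖z‖ ^ p ≤ C * (B * ‖z‖ ^ M) := e2.trans (by gcongr)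
    have h5 : |t| ≤ C * B * ‖z‖ ^ (2 * p + 1) := by
      refine le_of_mul_le_mul_right ?_ (by positivity : 0 < ‖z‖ ^ p)
      calc |t| * ‖z‖ ^ p ≤ C * B * ‖z‖ ^ M := by linarith
        _ ≤ C * B * ‖z‖ ^ (2 * p + 1 + p) := by
          gcongr C * B * ?_
          exact pow_le_pow_of_le_one hn.le q8.le (by omega)
        _ = _ := by rw [pow_add]; ring
    have h6 : c ^ 2 * ‖z‖ ^ (2 * p) ≤ ‖G z‖ ^ 2 := by
      calc c ^ 2 * ‖z‖ ^ (2 * p) = (c * ‖z‖ ^ p) ^ 2 := by ring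
        _ ≤ _ := by gcongr
    simp only [τ, ← ht]
    rw [abs_div, abs_of_pos (by positivity : 0 < ‖G z‖ ^ 2), div_lt_iff₀ (by positivity)]
    calc |t| ≤ C * B * ‖z‖ ^ (2 * p + 1) := h5
      _ = (C * B * (c ^ 2)⁻¹ * ‖z‖) * (c ^ 2 * ‖z‖ ^ (2 * p)) := by
        rw [pow_succ]; field_simp
      _ < δ * (c ^ 2 * ‖z‖ ^ (2 * p)) := by gcongr
      _ ≤ δ * ‖G z‖ ^ 2 := by gcongr
  have hbτ : b i z = τ (i, z) + τ (i, z) ^ 2 * e (z, τ (i, z)) := by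
    have h4 := hEF z (by simpa using q7) t
    rw [e4] at h4
    have h5 : defect F (h i) (P i) z = t • G z + t ^ 2 • E (z, t) := by
      have := congrArg (fun x => x - z) h4
      simp only [add_sub_cancel_left] at this
      rw [this]; abel
    simp only [b, n, e, h5, inner_add_left, inner_smul_left, real_inner_self_eq_norm_sq]
    rw [← hτt]
    simp only [conj_trivial, smul_eq_mul]
    have h6 : τ (i, z) = t / ‖G z‖ ^ 2 := rfl
    rw [h6]
    field_simp
  have h7 := hδS (y := (z, τ (i, z))) (by
    simpa [dist_zero_right, Prod.norm_def] using ⟨q6, hτ⟩)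
  simp only at h7
  rw [hbτ, h7, smul_eq_mul, ← hτt, ht]
  ring

end ClosedFormula

/-! ### Linear maps preserving a homogeneous polynomial -/

section LinearSymmetries

open MvPolynomial in
/-- In degree two, the Hamiltonian field is linear, and its matrix has trace zero. -/
theorem PolyStar.exists_quadratic {g : MvPolynomial (Fin 2) ℝ} (hg : PolyStar 1 g) :
    ∃ a b c : ℝ, b ^ 2 - a * c ≠ 0 ∧
      (∀ z : Plane, hamiltonianField g z = !₂[-(b * z 0 + c * z 1), a * z 0 + b * z 1]) ∧
      ∀ z : Plane, eval (fun i => z i) g = (a * z 0 ^ 2 + 2 * b * z 0 * z 1 + c * z 1 ^ 2) / 2 := by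
  have hconst : ∀ i j, ∃ a : ℝ, pderiv i (pderiv j g) = C a := by
    intro i j
    have h0 : (pderiv i (pderiv j g)).IsHomogeneous 0 := by
      simpa using (hg.homogeneous.pderiv (i := j)).pderiv (i := i)
    exact ⟨_, totalDegree_eq_zero_iff_eq_C.1 ((totalDegree_zero_iff_isHomogeneous _).2 h0)⟩
  obtain ⟨a, ha⟩ := hconst 0 0
  obtain ⟨b, hb⟩ := hconst 1 0
  obtain ⟨b', hb'⟩ := hconst 0 1
  obtain ⟨c, hc⟩ := hconst 1 1
  have e0 := (hg.homogeneous.pderiv (i := 0)).sum_X_mul_pderiv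
  have e1 := (hg.homogeneous.pderiv (i := 1)).sum_X_mul_pderiv
  have e2 := hg.homogeneous.sum_X_mul_pderiv
  rw [Fin.sum_univ_two] at e0 e1 e2
  rw [ha, hb] at e0
  rw [hb', hc] at e1
  simp only [Nat.add_sub_cancel, one_smul] at e0 e1
  have hbb : b = b' := by
    have h1 := congrArg (pderiv 1) (congrArg (pderiv 0) e2)
    rw [map_nsmul, map_nsmul, hb, ← e0, ← e1] at h1
    have h2 := congrArg (eval (0 : Fin 2 → ℝ)) h1
    simp [pderiv_X] at h2
    rw [map_ofNat constantCoeff 2] at h2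
    linarith
  subst hbb
  have hH : ∀ z : Plane, hamiltonianField g z = !₂[-(b * z 0 + c * z 1), a * z 0 + b * z 1] := by
    intro z
    rw [hamiltonianField, ← e0, ← e1]
    simp [mul_comm]
  refine ⟨a, b, c, ?_, hH, fun z => ?_⟩
  · intro h0
    have key : ∀ z : Plane, b * z 0 + c * z 1 = 0 → a * z 0 + b * z 1 = 0 → z = 0 := by
      intro z h1 h2
      by_contra hz
      refine hg.hamiltonianField_ne_zero hz ?_
      rw [hH, h1, h2]; ext i; fin_cases i <;> simp
    by_cases hbc : b = 0 ∧ c = 0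
    · have h1 := congrArg (fun v : Plane => v 1) (key !₂[0, 1] (by simp [hbc.2]) (by simp [hbc.1]))
      simp at h1
    · have h1 := key !₂[c, -b] (by simp; ring) (by simp; linarith)
      have h2 := congrArg (fun v : Plane => v 0) h1
      have h3 := congrArg (fun v : Plane => v 1) h1
      simp at h2 h3
      exact hbc ⟨h3, h2⟩
  · have h1 := congrArg (eval fun i => z i) e2
    rw [← e0, ← e1] at h1
    simp at h1
    linarith

/-- A linear symmetry of determinant one of a nondegenerate quadratic form lies in the algebra
spanned by the Hamiltonian matrix. -/
theorem quadratic_symmetry {a b c p q r s : ℝ} (hμ : b ^ 2 - a * c ≠ 0) (hdet : p * s - q * r = 1)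
    (h0 : a * p ^ 2 + 2 * b * p * r + c * r ^ 2 = a)
    (h1 : a * p * q + b * (p * s + q * r) + c * r * s = b)
    (h2 : a * q ^ 2 + 2 * b * q * s + c * s ^ 2 = c) {x y : ℝ} (hx : x = (p + s) / 2)
    (hy : y = (-b * p + a * q - c * r + b * s) / (2 * (b ^ 2 - a * c))) :
      x ^ 2 - (b ^ 2 - a * c) * y ^ 2 = 1 ∧
      p = x - y * b ∧ q = -(y * c) ∧ r = y * a ∧ s = x + y * b := by
  have l1 : a * (p - s) + 2 * b * r = 0 := by
    linear_combination s * h0 - r * h1 - (a * p + b * r) * hdet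
  have l2 : a * q + c * r = 0 := by
    linear_combination s * h1 - r * h2 - (a * q + b * s) * hdet
  have l3 : c * (p - s) = 2 * b * q := by
    linear_combination q * h1 - p * h2 + (b * q + c * s) * hdet
  have hy' : y * (2 * (b ^ 2 - a * c)) = -b * p + a * q - c * r + b * s := by
    rw [hy]; field_simp
  have yb : y * b = (s - p) / 2 := by
    apply mul_right_cancel₀ (mul_ne_zero two_ne_zero hμ)
    linear_combination b * hy' - c * l1 / 2 - a * l3 / 2
  have yc : y * c = -q := by
    apply mul_right_cancel₀ (mul_ne_zero two_ne_zero hμ)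
    linear_combination c * hy' - b * l3 - c * l2
  have ya : y * a = r := by
    apply mul_right_cancel₀ (mul_ne_zero two_ne_zero hμ)
    linear_combination a * hy' - b * l1 + a * l2
  have hp : p = x - y * b := by rw [hx, yb]; ring
  have hs : s = x + y * b := by rw [hx, yb]; ring
  refine ⟨?_, hp, by linarith, ya.symm, hs⟩
  have : q = -(y * c) := by linarith
  rw [hp, hs, this, ← ya] at hdet
  linear_combination hdet

/-- In degree two, the linear part `L` of the field satisfies `L² = ν ≠ 0`, and the linear maps of
determinant one which preserve the polynomial are the `x + y L` with `x² - ν y² = 1`. The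
functions `X` and `Y` read off the coefficients. -/
theorem PolyStar.exists_linear_part {g : MvPolynomial (Fin 2) ℝ} (hg : PolyStar 1 g)
    (B : Plane ≃L[ℝ] Plane) {e : ℝ} (he : e ≠ 0) :
    ∃ ν : ℝ, ν ≠ 0 ∧ ∃ L : Plane →L[ℝ] Plane, ∃ X Y δ : (Plane →L[ℝ] Plane) → ℝ,
      Continuous X ∧ Continuous Y ∧ Continuous δ ∧
      (∀ z, B (L z) = e • hamiltonianField g (B z)) ∧
      L.comp L = ν • ContinuousLinearMap.id ℝ Plane ∧
      (∀ x y : ℝ, X (x • ContinuousLinearMap.id ℝ Plane + y • L) = x ∧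
        Y (x • ContinuousLinearMap.id ℝ Plane + y • L) = y) ∧
      δ (ContinuousLinearMap.id ℝ Plane) = 1 ∧
      ∀ T : Plane →L[ℝ] Plane, (∀ z, MvPolynomial.eval (fun i => B (T z) i) g =
          MvPolynomial.eval (fun i => B z i) g) →
        (δ T = 1 ∨ δ T = -1) ∧ (δ T = 1 →
          T = X T • ContinuousLinearMap.id ℝ Plane + Y T • L ∧ X T ^ 2 - ν * Y T ^ 2 = 1) := by
  obtain ⟨a, b, c, hμ, hH, hgev⟩ := hg.exists_quadratic
  let M : Plane →ₗ[ℝ] Plane :=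
    { toFun := fun z => !₂[-(b * z 0 + c * z 1), a * z 0 + b * z 1]
      map_add' := fun z w => by ext i; fin_cases i <;> simp <;> ring
      map_smul' := fun t z => by ext i; fin_cases i <;> simp <;> ring }
  let Mc : Plane →L[ℝ] Plane := LinearMap.toContinuousLinearMap M
  have hM : ∀ z, Mc z = !₂[-(b * z 0 + c * z 1), a * z 0 + b * z 1] := fun z => rfl
  let L : Plane →L[ℝ] Plane := e • ((B.symm : Plane →L[ℝ] Plane).comp (Mc.comp (B : Plane →L[ℝ] Plane)))
  have hL : ∀ z, B (L z) = e • Mc (B z) := fun z => by simp [L]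
  let E : (Plane →L[ℝ] Plane) → Fin 2 → Fin 2 → ℝ :=
    fun T i j => B (T (B.symm (EuclideanSpace.single j 1))) i
  have hE : ∀ i j, Continuous fun T => E T i j := fun i j => by
    have h1 : Continuous fun T : Plane →L[ℝ] Plane => B (T (B.symm (EuclideanSpace.single j 1))) :=
      B.continuous.comp (ContinuousLinearMap.apply ℝ Plane _).continuous
    exact (EuclideanSpace.proj (𝕜 := ℝ) i).continuous.comp h1
  have hdec : ∀ z : Plane, z = z 0 • EuclideanSpace.single 0 1 + z 1 • EuclideanSpace.single 1 1 :=
    fun z => by ext i; fin_cases i <;> simp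
  have hET : ∀ T : Plane →L[ℝ] Plane, ∀ z i, B (T z) i = E T i 0 * B z 0 + E T i 1 * B z 1 := by
    intro T z i
    conv_lhs => rw [← B.symm_apply_apply z, hdec (B z)]
    simp [E]; ring
  have hELM : ∀ x y : ℝ, E (x • ContinuousLinearMap.id ℝ Plane + y • L) 0 0 = x - y * e * b ∧
      E (x • ContinuousLinearMap.id ℝ Plane + y • L) 0 1 = -(y * e * c) ∧
      E (x • ContinuousLinearMap.id ℝ Plane + y • L) 1 0 = y * e * a ∧
      E (x • ContinuousLinearMap.id ℝ Plane + y • L) 1 1 = x + y * e * b := by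
    intro x y
    simp only [E, add_apply, smul_apply, map_add, map_smul,
      hL, ContinuousLinearMap.id_apply, B.apply_symm_apply, hM]
    refine ⟨?_, ?_, ?_, ?_⟩ <;> simp <;> ring
  refine ⟨e ^ 2 * (b ^ 2 - a * c), by positivity, L, fun T => (E T 0 0 + E T 1 1) / 2,
    fun T => (-b * E T 0 0 + a * E T 0 1 - c * E T 1 0 + b * E T 1 1) / (2 * (b ^ 2 - a * c)) / e,
    fun T => E T 0 0 * E T 1 1 - E T 0 1 * E T 1 0, ?_, ?_, ?_, ?_, ?_, ?_, ?_, ?_⟩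
  · have := hE 0 0; have := hE 1 1; fun_prop
  · have := hE 0 0; have := hE 1 1; have := hE 0 1; have := hE 1 0; fun_prop
  · have := hE 0 0; have := hE 1 1; have := hE 0 1; have := hE 1 0; fun_prop
  · intro z; rw [hL, hM, hH]
  · ext1 z
    apply B.injective
    simp only [ContinuousLinearMap.comp_apply, hL, map_smul, hM, smul_apply,
      ContinuousLinearMap.id_apply]
    ext i; fin_cases i <;> simp <;> ring
  · intro x y
    obtain ⟨h1, h2, h3, h4⟩ := hELM x y
    constructor
    · simp only [h1, h4]; ring
    · simp only [h1, h2, h3, h4]; field_simp; ring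
  · obtain ⟨h1, h2, h3, h4⟩ := hELM 1 0
    have hid : (1 : ℝ) • ContinuousLinearMap.id ℝ Plane + (0 : ℝ) • L =
      ContinuousLinearMap.id ℝ Plane := by ext1 z; simp
    rw [hid] at h1 h2 h3 h4
    simp only [h1, h2, h3, h4]; ring
  · intro T hT
    have hq : ∀ u v : ℝ, a * (E T 0 0 * u + E T 0 1 * v) ^ 2 +
        2 * b * (E T 0 0 * u + E T 0 1 * v) * (E T 1 0 * u + E T 1 1 * v) +
        c * (E T 1 0 * u + E T 1 1 * v) ^ 2 = a * u ^ 2 + 2 * b * u * v + c * v ^ 2 := by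
      intro u v
      have h1 := hT (B.symm !₂[u, v])
      rw [hgev, hgev, hET, hET] at h1
      simp at h1
      linarith
    have h0 := hq 1 0
    have h2 := hq 0 1
    have h1 := hq 1 1
    simp only [mul_one, mul_zero, add_zero, zero_add] at h0 h1 h2
    refine ⟨?_, fun hdet => ?_⟩
    · have : (E T 0 0 * E T 1 1 - E T 0 1 * E T 1 0) ^ 2 = 1 := by
        apply mul_right_cancel₀ hμ
        have h1' : a * E T 0 0 * E T 0 1 + b * (E T 0 0 * E T 1 1 + E T 0 1 * E T 1 0) +
          c * E T 1 0 * E T 1 1 = b := by linear_combination (h1 - h0 - h2) / 2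
        have h0' : a * E T 0 0 ^ 2 + 2 * b * E T 0 0 * E T 1 0 + c * E T 1 0 ^ 2 = a := by
          linear_combination h0
        have h2' : a * E T 0 1 ^ 2 + 2 * b * E T 0 1 * E T 1 1 + c * E T 1 1 ^ 2 = c := by
          linear_combination h2
        linear_combination (a * E T 0 0 * E T 0 1 + b * (E T 0 0 * E T 1 1 + E T 0 1 * E T 1 0) +
          c * E T 1 0 * E T 1 1 + b) * h1' -
          (a * E T 0 1 ^ 2 + 2 * b * E T 0 1 * E T 1 1 + c * E T 1 1 ^ 2) * h0' - a * h2'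
      exact mul_self_eq_one_iff.1 (by rw [← sq]; exact this)
    · obtain ⟨k0, k1, k2, k3, k4⟩ := quadratic_symmetry (p := E T 0 0) (q := E T 0 1)
        (r := E T 1 0) (s := E T 1 1) hμ hdet (by linear_combination h0)
        (by linear_combination (h1 - h0 - h2) / 2) (by linear_combination h2) rfl rfl
      constructor
      · ext1 z
        apply B.injective
        simp only [add_apply, smul_apply, map_add, map_smul,
          hL, ContinuousLinearMap.id_apply, hM]
        have hc : ∀ u v : ℝ, u / e * (e * v) = u * v := fun u v => by field_simp
        ext i
        rw [hET]
        fin_cases i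
        · simp
          rw [hc]
          linear_combination (B z 0) * k1 + (B z 1) * k2
        · simp
          rw [hc]
          linear_combination (B z 0) * k3 + (B z 1) * k4
      · rw [← k0]; field_simp

end LinearSymmetries

/-! ### The flow of a linear field whose square is a scalar -/

section Trigonometry

/-- The functions `C` and `S` with `C' = ν S`, `S' = C`: trigonometric or hyperbolic according to
the sign of `ν`. The map `s ↦ (C s, S s)` parametrizes the component of the conic `x² - ν y² = 1`
through `(1, 0)`, with period `T` (zero in the hyperbolic case), and `asn` is the inverse of `S`
near this point. -/
structure TrigPair (ν : ℝ) (C S asn : ℝ → ℝ) (T : ℝ) : Prop where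
  cos_zero : C 0 = 1
  sin_zero : S 0 = 0
  hasDerivAt_cos : ∀ s, HasDerivAt C (ν * S s) s
  hasDerivAt_sin : ∀ s, HasDerivAt S (C s) s
  continuous_asn : Continuous asn
  asn_spec : ∀ x y, 0 < x → x ^ 2 - ν * y ^ 2 = 1 → C (asn y) = x ∧ S (asn y) = y
  period_pos : 0 < ν → T = 0
  period_neg : ν < 0 → T = 2 * Real.pi / √(-ν)
  exists_int : ∀ d, C d = 1 → S d = 0 → ∃ n : ℤ, d = n * T
  cos_period : C T = 1
  sin_period : S T = 0
  exists_lift : ∀ x y : ℝ → ℝ, ContinuousOn x (Icc 0 1) → ContinuousOn y (Icc 0 1) →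
    x 0 = 1 → y 0 = 0 → (∀ t ∈ Icc (0 : ℝ) 1, x t ^ 2 - ν * y t ^ 2 = 1) →
    ∃ a : ℝ → ℝ, a 0 = 0 ∧ ContinuousOn a (Icc 0 1) ∧
      ∀ t ∈ Icc (0 : ℝ) 1, C (a t) = x t ∧ S (a t) = y t

theorem exists_trigPair_pos {ν : ℝ} (hν : 0 < ν) : ∃ C S asn T, TrigPair ν C S asn T := by
  obtain ⟨k, hk, rfl⟩ : ∃ k : ℝ, 0 < k ∧ ν = k ^ 2 := ⟨√ν, Real.sqrt_pos.2 hν, (Real.sq_sqrt hν.le).symm⟩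
  have hasn : ∀ x y : ℝ, 0 < x → x ^ 2 - k ^ 2 * y ^ 2 = 1 →
      Real.cosh (k * (Real.arsinh (k * y) / k)) = x ∧
        Real.sinh (k * (Real.arsinh (k * y) / k)) / k = y := by
    intro x y hx hxy
    rw [mul_div_cancel₀ _ hk.ne', Real.cosh_arsinh, Real.sinh_arsinh]
    refine ⟨?_, by field_simp⟩
    rw [show 1 + (k * y) ^ 2 = x ^ 2 by linarith [mul_pow k y 2]]
    exact Real.sqrt_sq hx.le
  refine ⟨fun s => Real.cosh (k * s), fun s => Real.sinh (k * s) / k,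
    fun y => Real.arsinh (k * y) / k, 0, ?_⟩
  refine ⟨by simp, by simp, fun s => ?_, fun s => ?_, ?_, hasn, fun _ => rfl,
    fun h => absurd h (by simp [sq_nonneg]), fun d _ h2 => ⟨0, ?_⟩, by simp, by simp, ?_⟩
  · have := (Real.hasDerivAt_cosh (k * s)).comp s ((hasDerivAt_id s).const_mul k)
    refine this.congr_deriv ?_
    field_simp
  · have := ((Real.hasDerivAt_sinh (k * s)).comp s ((hasDerivAt_id s).const_mul k)).div_const k
    refine this.congr_deriv ?_
    field_simp
  · exact (Real.continuous_arsinh.comp (by fun_prop)).div_const k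
  · have : k * d = 0 := Real.sinh_eq_zero.1 ((div_eq_zero_iff.1 h2).resolve_right hk.ne')
    simpa [hk.ne'] using this
  · intro x y hx hy hx0 hy0 hxy
    refine ⟨fun t => Real.arsinh (k * y t) / k, by simp [hy0],
      (Real.continuous_arsinh.comp_continuousOn (by fun_prop)).div_const k, fun t ht => ?_⟩
    refine hasn _ _ ?_ (hxy t ht)
    by_contra hcon
    obtain ⟨s, hs, hs0⟩ := (isPreconnected_Icc.image _ hx).Icc_subset (mem_image_of_mem _ ht)
      (mem_image_of_mem x (⟨le_rfl, zero_le_one⟩ : (0 : ℝ) ∈ Icc 0 1))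
      (⟨not_lt.1 hcon, by rw [hx0]; exact zero_le_one⟩ : (0 : ℝ) ∈ Icc (x t) (x 0))
    have := hxy s hs
    rw [hs0] at this
    nlinarith [sq_nonneg (k * y s)]

theorem exists_trigPair_neg {ν : ℝ} (hν : ν < 0) : ∃ C S asn T, TrigPair ν C S asn T := by
  obtain ⟨k, hk, rfl⟩ : ∃ k : ℝ, 0 < k ∧ ν = -k ^ 2 :=
    ⟨√(-ν), Real.sqrt_pos.2 (by linarith), by rw [Real.sq_sqrt (by linarith)]; ring⟩
  have hasn : ∀ x y : ℝ, 0 < x → x ^ 2 - -k ^ 2 * y ^ 2 = 1 →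
      Real.cos (k * (Real.arcsin (k * y) / k)) = x ∧
        Real.sin (k * (Real.arcsin (k * y) / k)) / k = y := by
    intro x y hx hxy
    have hle : |k * y| ≤ 1 := by
      rw [abs_le_one_iff_mul_self_le_one]; nlinarith [sq_nonneg x]
    rw [mul_div_cancel₀ _ hk.ne', Real.cos_arcsin, Real.sin_arcsin (abs_le.1 hle).1 (abs_le.1 hle).2]
    refine ⟨?_, by field_simp⟩
    rw [show 1 - (k * y) ^ 2 = x ^ 2 by linarith [mul_pow k y 2]]
    exact Real.sqrt_sq hx.le
  refine ⟨fun s => Real.cos (k * s), fun s => Real.sin (k * s) / k,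
    fun y => Real.arcsin (k * y) / k, 2 * Real.pi / k, ?_⟩
  have hkT : k * (2 * Real.pi / k) = 2 * Real.pi := by field_simp
  refine ⟨by simp, by simp, fun s => ?_, fun s => ?_, ?_, hasn,
    fun h => absurd h (by simp [sq_nonneg]), fun _ => ?_, fun d h1 h2 => ?_, by simp [hkT],
    by simp [hkT], ?_⟩
  · have := (Real.hasDerivAt_cos (k * s)).comp s ((hasDerivAt_id s).const_mul k)
    refine this.congr_deriv ?_
    field_simp
  · have := ((Real.hasDerivAt_sin (k * s)).comp s ((hasDerivAt_id s).const_mul k)).div_const k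
    refine this.congr_deriv ?_
    field_simp
  · exact (Real.continuous_arcsin.comp (by fun_prop)).div_const k
  · rw [neg_neg, Real.sqrt_sq hk.le]
  · obtain ⟨n, hn⟩ := (Real.cos_eq_one_iff _).1 h1
    exact ⟨n, by field_simp; linarith⟩
  · intro x y hx hy hx0 hy0 hxy
    have hmem : ∀ t : unitInterval, (⟨x t, k * y t⟩ : ℂ) ∈ Submonoid.unitSphere ℂ := by
      intro t
      have := hxy t t.2
      rw [Submonoid.unitSphere, ← Submonoid.mem_carrier]
      simp only [mem_sphere_zero_iff_norm]
      rw [← sq_eq_sq₀ (norm_nonneg _) zero_le_one, Complex.sq_norm,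
        Complex.normSq_mk]
      linarith
    have hx' : Continuous fun t : unitInterval => x t := continuousOn_iff_continuous_domRestrict.1 hx
    have hy' : Continuous fun t : unitInterval => y t := continuousOn_iff_continuous_domRestrict.1 hy
    let γ : C(unitInterval, Circle) := ⟨fun t => ⟨⟨x t, k * y t⟩, hmem t⟩,
      Continuous.subtype_mk (by
        have : (fun t : unitInterval => (⟨x t, k * y t⟩ : ℂ)) =
          fun t : unitInterval => (x t : ℂ) + (k * y t : ℝ) * Complex.I := by
          funext t; apply Complex.ext <;> simp
        rw [this]
        exact (Complex.continuous_ofReal.comp hx').add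
          ((Complex.continuous_ofReal.comp (hy'.const_mul k)).mul continuous_const)) _⟩
    have hγ0 : γ 0 = Circle.exp 0 := by
      apply Subtype.ext
      rw [Circle.exp_zero]
      apply Complex.ext
      · exact hx0
      · change k * y 0 = 0
        rw [hy0, mul_zero]
    obtain ⟨Γ, h1, h2⟩ := Circle.isCoveringMap_exp.exists_path_lifts γ 0 hγ0
    have hΓ : ∀ t, Real.cos (Γ t) = x t ∧ Real.sin (Γ t) = k * y t := by
      intro t
      have h3 := congrArg (fun c : Circle => (c : ℂ)) (congrFun h1 t)
      simp only [Function.comp_apply, Circle.coe_exp] at h3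
      have hr := congrArg Complex.re h3
      have hi := congrArg Complex.im h3
      rw [Complex.exp_ofReal_mul_I_re] at hr
      rw [Complex.exp_ofReal_mul_I_im] at hi
      exact ⟨hr, hi⟩
    refine ⟨fun t => Γ (projIcc 0 1 zero_le_one t) / k, ?_, ?_, fun t ht => ?_⟩
    · simp only [projIcc_left]
      rw [show (⟨0, _⟩ : Icc (0 : ℝ) 1) = (0 : unitInterval) from rfl, h2, zero_div]
    · exact ((Γ.continuous.comp continuous_projIcc).div_const k).continuousOn
    · have := hΓ ⟨t, ht⟩
      beta_reduce
      rw [projIcc_of_mem _ ht]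
      simp only [mul_div_cancel₀ _ hk.ne', this.1, this.2, true_and]
      field_simp

theorem exists_trigPair {ν : ℝ} (hν : ν ≠ 0) : ∃ C S asn T, TrigPair ν C S asn T :=
  hν.lt_or_gt.elim exists_trigPair_neg exists_trigPair_pos

end Trigonometry

section LinearFlow

variable {G : Plane → Plane} {p : ℕ} {R : ℝ} {F : Plane → ℝ → Plane}

/-- The derivative at the origin of the time `t` map of a flow which fixes the origin. -/
noncomputable def linearFlow (F : Plane → ℝ → Plane) (t : ℝ) : Plane →L[ℝ] Plane :=
  fderiv ℝ (fun z => F z t) 0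

theorem IsCutoffFlow.hasFDerivAt_apply (hF : IsCutoffFlow G R F) (z : Plane) (t : ℝ) :
    HasFDerivAt (fun z => F z t) (fderiv ℝ (fun z => F z t) z) z := by
  have : ContDiff ℝ ∞ fun z => F z t := hF.contDiff.comp (contDiff_id.prodMk contDiff_const)
  exact (this.differentiable (by simp) z).hasFDerivAt

theorem IsCutoffFlow.linearFlow_zero (hF : IsCutoffFlow G R F) :
    linearFlow F 0 = ContinuousLinearMap.id ℝ Plane := by
  have : (fun z => F z 0) = id := funext hF.zero
  rw [linearFlow, this, fderiv_id]

theorem IsCutoffFlow.linearFlow_add (hG : HasZeroOfOrder G p) (hF : IsCutoffFlow G R F)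
    (hR : 0 < R) (s t : ℝ) : linearFlow F (s + t) = (linearFlow F t).comp (linearFlow F s) := by
  have h1 := hF.hasFDerivAt_apply 0 s
  have h2 := hF.hasFDerivAt_apply 0 t
  have h3 : HasFDerivAt (fun z => F z t) (fderiv ℝ (fun z => F z t) 0) (F 0 s) := by
    rwa [hF.apply_origin hG hR]
  have h4 := h3.comp (0 : Plane) h1
  have : (fun z => F z (s + t)) = (fun z => F z t) ∘ fun z => F z s := funext fun z => hF.add z s t
  rw [linearFlow, this]
  exact h4.fderiv

/-- The linearized flow at the zero of `G` is the flow of the linear part of `G`. -/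
theorem IsCutoffFlow.hasDerivAt_linearFlow (hG : HasZeroOfOrder G p) (hF : IsCutoffFlow G R F)
    (hR : 0 < R) (t : ℝ) :
    HasDerivAt (linearFlow F) ((fderiv ℝ G 0).comp (linearFlow F t)) t := by
  obtain ⟨E, hE, h2⟩ := hF.exists_second_order
  have hE0 : Continuous fun h : ℝ => fderiv ℝ (fun z => E (z, h)) 0 := by
    have : (fun h : ℝ => fderiv ℝ (fun z => E (z, h)) 0) =
        fun h => (fderiv ℝ E (0, h)).comp (ContinuousLinearMap.inl ℝ Plane ℝ) := by
      funext h
      have h1 : HasFDerivAt (fun z : Plane => (z, h)) (ContinuousLinearMap.inl ℝ Plane ℝ) 0 :=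
        hasFDerivAt_prodMk_left 0 h
      exact ((hE.differentiable (by simp) (0, h)).hasFDerivAt.comp (0 : Plane) h1).fderiv
    rw [this]
    exact ((hE.continuous_fderiv (by simp)).comp (by fun_prop)).clm_comp continuous_const
  have hexp : ∀ h : ℝ, linearFlow F h = ContinuousLinearMap.id ℝ Plane + h • fderiv ℝ G 0 +
      h ^ 2 • fderiv ℝ (fun z => E (z, h)) 0 := by
    intro h
    have e1 : (fun z => F z h) =ᶠ[𝓝 0] fun z => z + h • G z + h ^ 2 • E (z, h) := by
      filter_upwards [Metric.ball_mem_nhds (0 : Plane) hR] with z hz using h2 z hz h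
    have d2 : HasFDerivAt (fun z => E (z, h)) (fderiv ℝ (fun z => E (z, h)) 0) 0 :=
      ((hE.comp (contDiff_id.prodMk contDiff_const)).differentiable (by simp) 0).hasFDerivAt
    rw [linearFlow, e1.fderiv_eq]
    exact (((hasFDerivAt_id _).add ((hG.contDiff.differentiable (by simp) 0).hasFDerivAt.const_smul h)).add
      (d2.const_smul (h ^ 2))).fderiv
  have h0 : HasDerivAt (linearFlow F) (fderiv ℝ G 0) 0 := by
    rw [hasDerivAt_iff_tendsto_slope]
    have : Filter.Tendsto (fun h : ℝ => fderiv ℝ G 0 + h • fderiv ℝ (fun z => E (z, h)) 0) (𝓝[≠] 0)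
        (𝓝 (fderiv ℝ G 0)) := by
      have h3 : Continuous fun h : ℝ => fderiv ℝ G 0 + h • fderiv ℝ (fun z => E (z, h)) 0 := by
        fun_prop
      have := h3.tendsto 0
      have e : fderiv ℝ G 0 + (0 : ℝ) • fderiv ℝ (fun z => E (z, (0 : ℝ))) 0 = fderiv ℝ G 0 := by
        ext1 z; simp
      rw [e] at this
      exact this.mono_left nhdsWithin_le_nhds
    refine this.congr' ?_
    filter_upwards [self_mem_nhdsWithin] with h hh
    have hh : h ≠ 0 := hh
    rw [slope_def_module, hexp h, hF.linearFlow_zero, sub_zero, add_assoc, add_sub_cancel_left,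
      smul_add, smul_smul, smul_smul, inv_mul_cancel₀ hh, one_smul, sq, ← mul_assoc,
      inv_mul_cancel₀ hh, one_mul]
  have h1 : HasDerivAt (fun h => (linearFlow F (h - t)).comp (linearFlow F t))
      ((fderiv ℝ G 0).comp (linearFlow F t)) t := by
    have h3 : HasDerivAt (fun h => linearFlow F (h - t)) (fderiv ℝ G 0) t := by
      have h4 : HasDerivAt (linearFlow F) (fderiv ℝ G 0) (t - t) := by rwa [sub_self]
      exact h4.comp_sub_const t t
    simpa using h3.clm_comp (hasDerivAt_const t (linearFlow F t))
  refine h1.congr_of_eventuallyEq (.of_forall fun h => ?_)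
  beta_reduce
  rw [← hF.linearFlow_add hG hR]; congr 1; ring

theorem IsCutoffFlow.linearFlow_neg_comp (hG : HasZeroOfOrder G p) (hF : IsCutoffFlow G R F)
    (hR : 0 < R) (t : ℝ) :
    (linearFlow F (-t)).comp (linearFlow F t) = ContinuousLinearMap.id ℝ Plane := by
  rw [← hF.linearFlow_add hG hR, add_neg_cancel, hF.linearFlow_zero]

/-- If the linear part `L` of the field has square `ν`, then its flow is `C + S L`. -/
theorem IsCutoffFlow.linearFlow_eq (hG : HasZeroOfOrder G p) (hF : IsCutoffFlow G R F)
    (hR : 0 < R) {ν T : ℝ} {C S asn : ℝ → ℝ} (h : TrigPair ν C S asn T) {L : Plane →L[ℝ] Plane}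
    (hL : fderiv ℝ G 0 = L) (hLL : L.comp L = ν • ContinuousLinearMap.id ℝ Plane) (t : ℝ) :
    linearFlow F t = C t • ContinuousLinearMap.id ℝ Plane + S t • L := by
  have hd : ∀ s, HasDerivAt (fun s => (linearFlow F (-s)).comp
      (C s • ContinuousLinearMap.id ℝ Plane + S s • L)) 0 s := by
    intro s
    have h1 : HasDerivAt (fun s => linearFlow F (-s)) (-(L.comp (linearFlow F (-s)))) s := by
      have := (hF.hasDerivAt_linearFlow hG hR (-s)).scomp s (hasDerivAt_neg s)
      rw [hL, neg_smul, one_smul] at this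
      exact this
    have h2 := ((h.hasDerivAt_cos s).smul_const (ContinuousLinearMap.id ℝ Plane)).add
      ((h.hasDerivAt_sin s).smul_const L)
    have hcomm : L.comp (linearFlow F (-s)) = (linearFlow F (-s)).comp L := by
      have e1 := hF.hasDerivAt_linearFlow hG hR (-s)
      have e2 : HasDerivAt (linearFlow F) ((linearFlow F (-s)).comp L) (-s) := by
        have h5 : HasDerivAt (fun u => linearFlow F (u - -s)) L (-s) := by
          have h6 : HasDerivAt (linearFlow F) L (-s - -s) := by
            have := hF.hasDerivAt_linearFlow hG hR 0
            rw [hF.linearFlow_zero, hL, ContinuousLinearMap.comp_id] at this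
            rwa [sub_self]
          exact h6.comp_sub_const (-s) (-s)
        have h7 := (hasDerivAt_const (-s) (linearFlow F (-s))).clm_comp h5
        have h8 := h7.congr_of_eventuallyEq (f₁ := linearFlow F) (.of_forall fun u => ?_)
        · simpa using h8
        · beta_reduce
          rw [← hF.linearFlow_add hG hR]; congr 1; ring
      rw [hL] at e1
      exact e1.unique e2
    have h3 := h1.clm_comp h2
    refine h3.congr_deriv ?_
    rw [hcomm]
    ext1 z
    have hLz : ∀ z, L (L z) = ν • z := fun z => DFunLike.congr_fun hLL z
    simp [hLz, smul_smul, mul_comm]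
  have hc : ∀ s, (linearFlow F (-s)).comp (C s • ContinuousLinearMap.id ℝ Plane + S s • L) =
      ContinuousLinearMap.id ℝ Plane := by
    intro s
    have := is_const_of_deriv_eq_zero (fun s => (hd s).differentiableAt) (fun s => (hd s).deriv) s 0
    rw [this, neg_zero, hF.linearFlow_zero, h.cos_zero, h.sin_zero]
    ext1 z; simp
  have h1 := hF.linearFlow_neg_comp hG hR (-t)
  rw [neg_neg] at h1
  calc linearFlow F t = (linearFlow F t).comp ((linearFlow F (-t)).comp
        (C t • ContinuousLinearMap.id ℝ Plane + S t • L)) := by rw [hc]; ext1 z; simp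
    _ = _ := by rw [← ContinuousLinearMap.comp_assoc, h1]; ext1 z; simp

/-- At a zero of order at least two, the flow is tangent to the identity. -/
theorem IsCutoffFlow.linearFlow_eq_id (hG : HasZeroOfOrder G p) (hp : 2 ≤ p)
    (hF : IsCutoffFlow G R F) (hR : 0 < R) (t : ℝ) :
    linearFlow F t = ContinuousLinearMap.id ℝ Plane := by
  have hL : fderiv ℝ G 0 = 0 := by
    have : HasFDerivAt G (0 : Plane →L[ℝ] Plane) 0 := by
      rw [hasFDerivAt_iff_isLittleO, hG.map_zero]
      simp only [sub_zero, zero_apply]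
      have h1 : (fun z : Plane => ‖z‖ ^ p) =o[𝓝 0] fun z : Plane => z :=
        Asymptotics.isLittleO_norm_pow_id hp
      exact hG.isBigO.trans_isLittleO h1
    exact this.fderiv
  have hd : ∀ s, HasDerivAt (linearFlow F) 0 s := fun s => by
    have := hF.hasDerivAt_linearFlow hG hR s
    rwa [hL, ContinuousLinearMap.zero_comp] at this
  rw [is_const_of_deriv_eq_zero (fun s => (hd s).differentiableAt) (fun s => (hd s).deriv) t 0,
    hF.linearFlow_zero]

end LinearFlow

/-! ### Paths of linear symmetries -/

section LinearPaths

open MvPolynomial in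
theorem hasFDerivAt_eval_plane (f : MvPolynomial (Fin 2) ℝ) (z : Plane) :
    HasFDerivAt (fun z : Plane => eval (fun i => z i) f)
      (eval (fun i => z i) (pderiv 0 f) • (EuclideanSpace.proj 0 : Plane →L[ℝ] ℝ) +
        eval (fun i => z i) (pderiv 1 f) • (EuclideanSpace.proj 1 : Plane →L[ℝ] ℝ))
      z := by
  induction f using MvPolynomial.induction_on with
  | C a => simpa using hasFDerivAt_const a z
  | add f g hf hg =>
    simp only [map_add]
    refine (hf.add hg).congr_fderiv ?_
    ext1 w; simp; ring
  | mul_X f i hf =>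
    have hp : HasFDerivAt (fun z : Plane => z i)
        ((EuclideanSpace.proj i : Plane →L[ℝ] ℝ)) z :=
      ((EuclideanSpace.proj i : Plane →L[ℝ] ℝ)).hasFDerivAt
    have := hf.mul hp
    simp only [map_mul, eval_X]
    refine this.congr_fderiv ?_
    ext1 w
    fin_cases i <;> simp [pderiv_X] <;> ring

variable {G : Plane → Plane} {p : ℕ} {g : MvPolynomial (Fin 2) ℝ} {η : Plane → ℝ}
  {φ : OpenPartialHomeomorph Plane Plane} {B : Plane ≃L[ℝ] Plane} {R : ℝ} {F : Plane → ℝ → Plane}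

open MvPolynomial in
/-- For `deg g ≥ 3`, no nonzero linear field is tangent to the level sets of `g`. -/
theorem PolyStar.eq_zero_of_tangent (hg : PolyStar p g) (hp : 2 ≤ p) {T : Plane →L[ℝ] Plane}
    (hT : ∀ z, fderiv ℝ (fun z : Plane => eval (fun i => z i) g) z (T z) = 0) : T = 0 := by
  let Q : Fin 2 → MvPolynomial (Fin 2) ℝ := fun j =>
    C (T (EuclideanSpace.single 0 1) j) * X 0 + C (T (EuclideanSpace.single 1 1) j) * X 1
  have hQ : ∀ j, (Q j).IsHomogeneous 1 := fun j =>
    ((isHomogeneous_X _ _).C_mul _).add ((isHomogeneous_X _ _).C_mul _)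
  have hdec : ∀ z : Plane, z = z 0 • EuclideanSpace.single 0 1 + z 1 • EuclideanSpace.single 1 1 :=
    fun z => by ext i; fin_cases i <;> simp
  have hQT : ∀ z : Plane, ∀ j, eval (fun i => z i) (Q j) = T z j := by
    intro z j
    conv_rhs => rw [hdec z]
    simp [Q]; ring
  have hpar : Q 0 * pderiv 0 g = Q 1 * -pderiv 1 g := by
    rw [← sub_eq_zero]
    refine MvPolynomial.funext fun w => ?_
    have h1 := hT (WithLp.toLp 2 w)
    rw [(hasFDerivAt_eval_plane g _).fderiv] at h1
    have h2 := hQT (WithLp.toLp 2 w)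
    simp only [add_apply, smul_apply, PiLp.proj_apply, ← h2, smul_eq_mul] at h1
    simp only [map_sub, map_mul, map_neg, map_zero]
    linarith
  obtain ⟨β, hβ, h0, h1⟩ := hg.exists_eq_mul (hQ 0) hpar
  have hβ0 : β = 0 := hβ.resolve_right fun h => by omega
  rw [hβ0, zero_mul] at h0 h1
  ext z j
  have := hQT z j
  fin_cases j
  · simpa [h0] using this.symm
  · simpa [h1] using this.symm

/-- For `deg g ≥ 3`, the identity is isolated among the linear maps preserving `g`. -/
theorem PolyStar.exists_isolated (hg : PolyStar p g) (hp : 2 ≤ p) :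
    ∃ ε > 0, ∀ T : Plane →L[ℝ] Plane, ‖T - ContinuousLinearMap.id ℝ Plane‖ < ε →
      (∀ z, MvPolynomial.eval (fun i => T z i) g = MvPolynomial.eval (fun i => z i) g) →
      T = ContinuousLinearMap.id ℝ Plane := by
  by_contra! hcon
  choose T hT1 hT2 hT3 using fun n : ℕ => hcon (1 / (n + 1)) Nat.one_div_pos_of_nat
  let s : ℕ → ℝ := fun n => ‖T n - ContinuousLinearMap.id ℝ Plane‖
  have hs : ∀ n, 0 < s n := fun n => norm_pos_iff.2 (sub_ne_zero.2 (hT3 n))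
  have hs0 : Filter.Tendsto s Filter.atTop (𝓝 0) :=
    squeeze_zero (fun n => (hs n).le) (fun n => (hT1 n).le) tendsto_one_div_add_atTop_nhds_zero_nat
  let X : ℕ → Plane →L[ℝ] Plane := fun n => (s n)⁻¹ • (T n - ContinuousLinearMap.id ℝ Plane)
  have hX : ∀ n, X n ∈ Metric.sphere (0 : Plane →L[ℝ] Plane) 1 := fun n => by
    rw [mem_sphere_zero_iff_norm, norm_smul, norm_inv, Real.norm_of_nonneg (hs n).le]
    exact inv_mul_cancel₀ (hs n).ne'
  obtain ⟨Y, hY, u, hu, hlim⟩ := (isCompact_sphere (0 : Plane →L[ℝ] Plane) 1).tendsto_subseq hX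
  have hXz : ∀ z, Filter.Tendsto (fun n => X (u n) z) Filter.atTop (𝓝 (Y z)) := fun z =>
    ((ContinuousLinearMap.apply ℝ Plane z).continuous.tendsto Y).comp hlim
  have hY0 : Y = 0 := by
    refine hg.eq_zero_of_tangent hp fun z => ?_
    have hd := (hasFDerivAt_eval_plane g z)
    rw [hd.fderiv]
    have hz : ∀ n, T (u n) z = z + s (u n) • X (u n) z := fun n => by
      simp only [X, smul_apply, smul_smul, mul_inv_cancel₀ (hs _).ne', one_smul]
      simp
    have hsu : Filter.Tendsto (fun n => s (u n)) Filter.atTop (𝓝 0) := hs0.comp hu.tendsto_atTop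
    have hd0 : Filter.Tendsto (fun n => s (u n) • X (u n) z) Filter.atTop (𝓝 0) := by
      simpa using hsu.smul (hXz z)
    have hlim := (hasFDerivWithinAt_univ.2 hd).lim (c := fun n => (s (u n))⁻¹) hd0
      (.of_forall fun _ => mem_univ _) ((hXz z).congr fun n => by
        rw [smul_smul, inv_mul_cancel₀ (hs _).ne', one_smul])
    refine tendsto_nhds_unique hlim (tendsto_const_nhds.congr fun n => ?_)
    rw [← hz, hT2, sub_self, smul_zero]
  rw [hY0] at hY
  simp at hY

/-- The linear part of the field in degree two. -/
theorem fderiv_eq_of_hasLeadingPart (hG : G 0 = 0) {e : ℝ} (h : HasLeadingPart G 1 g e B)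
    {L : Plane →L[ℝ] Plane} (hL : ∀ z, B (L z) = e • hamiltonianField g (B z)) :
    fderiv ℝ G 0 = L := by
  have : HasFDerivAt G L 0 := by
    rw [hasFDerivAt_iff_isLittleO, hG]
    have h1 : (fun z => G z - L z) =O[𝓝 0] fun z => ‖z‖ ^ (1 + 1) := by
      refine ((B.symm : Plane →L[ℝ] Plane).isBigO_comp _ _).trans h |>.congr_left fun z => ?_
      rw [← hL, ← map_sub]
      exact B.symm_apply_apply _
    simpa using h1.trans_isLittleO (Asymptotics.isLittleO_norm_pow_id one_lt_two)
  exact this.fderiv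

/-- A path of linear symmetries of the leading part of the field which starts at the identity
follows the linear flow. -/
theorem StarChart.exists_linear_lift (h : StarChart G p g η φ B) (hF : IsCutoffFlow G R F)
    (hR : 0 < R) {A : ℝ → Plane →L[ℝ] Plane} (hA : ContinuousOn A (Icc 0 1))
    (hA0 : A 0 = ContinuousLinearMap.id ℝ Plane)
    (hAg : ∀ t ∈ Icc (0 : ℝ) 1, ∀ z, MvPolynomial.eval (fun i => B (A t z) i) g =
      MvPolynomial.eval (fun i => B z i) g) :
    ∃ a : ℝ → ℝ, a 0 = 0 ∧ ContinuousOn a (Icc 0 1) ∧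
      ∀ t ∈ Icc (0 : ℝ) 1, A t = linearFlow F (a t) := by
  have hG := h.hasZeroOfOrder
  have h01 : (0 : ℝ) ∈ Icc (0 : ℝ) 1 := ⟨le_rfl, zero_le_one⟩
  rcases h.star.one_le.eq_or_lt with hp | hp
  · subst hp
    obtain ⟨ν, hν, L, X, Y, δ, hX, hY, hδ, hL, hLL, hXY, hδ1, hsym⟩ :=
      h.star.exists_linear_part B (h.unit_ne_zero 0)
    obtain ⟨C, S, asn, T, hT⟩ := exists_trigPair hν
    have hDG := fderiv_eq_of_hasLeadingPart hG.map_zero h.hasLeadingPart hL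
    have hδA : ∀ t ∈ Icc (0 : ℝ) 1, 1 - δ (A t) ≤ 0 :=
      IsPreconnected.le_of_gap isPreconnected_Icc
        (φ := fun t => 1 - δ (A t)) (c₁ := 0) (c₀ := 1)
        (continuousOn_const.sub (hδ.comp_continuousOn hA)) zero_lt_one (fun t ht h1 => by
          rcases (hsym (A t) (hAg t ht)).1 with h2 | h2 <;> linarith) h01
        (by rw [hA0, hδ1]; norm_num)
    have hAt : ∀ t ∈ Icc (0 : ℝ) 1, A t = X (A t) • ContinuousLinearMap.id ℝ Plane + Y (A t) • L ∧
        X (A t) ^ 2 - ν * Y (A t) ^ 2 = 1 := fun t ht => by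
      have h1 := hsym (A t) (hAg t ht)
      exact h1.2 (h1.1.resolve_right fun h2 => by linarith [hδA t ht])
    have hid : ContinuousLinearMap.id ℝ Plane =
        (1 : ℝ) • ContinuousLinearMap.id ℝ Plane + (0 : ℝ) • L := by ext1 z; simp
    obtain ⟨a, ha0, ha, haa⟩ := hT.exists_lift (fun t => X (A t)) (fun t => Y (A t))
      (hX.comp_continuousOn hA) (hY.comp_continuousOn hA)
      (by rw [hA0, hid, (hXY 1 0).1]) (by rw [hA0, hid, (hXY 1 0).2]) fun t ht => (hAt t ht).2
    refine ⟨a, ha0, ha, fun t ht => ?_⟩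
    rw [hF.linearFlow_eq hG hR hT hDG hLL, (haa t ht).1, (haa t ht).2]
    exact (hAt t ht).1
  · obtain ⟨ε, hε, hiso⟩ := h.star.exists_isolated hp
    refine ⟨fun _ => 0, rfl, continuousOn_const, fun t ht => ?_⟩
    rw [hF.linearFlow_zero]
    let c : (Plane →L[ℝ] Plane) → Plane →L[ℝ] Plane := fun T =>
      (B : Plane →L[ℝ] Plane).comp (T.comp (B.symm : Plane →L[ℝ] Plane))
    have hc : Continuous c := by fun_prop
    have hc1 : c (ContinuousLinearMap.id ℝ Plane) = ContinuousLinearMap.id ℝ Plane := by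
      ext1 z; simp [c]
    have hcA : ∀ t ∈ Icc (0 : ℝ) 1, ‖c (A t) - ContinuousLinearMap.id ℝ Plane‖ ≤ 0 :=
      IsPreconnected.le_of_gap isPreconnected_Icc
        (φ := fun t => ‖c (A t) - ContinuousLinearMap.id ℝ Plane‖) (c₁ := 0) (c₀ := ε / 2)
        ((hc.comp_continuousOn hA).sub continuousOn_const).norm (by positivity) (fun t ht h1 => by
          rw [hiso (c (A t)) (by linarith) fun z => by simpa [c] using hAg t ht (B.symm z)]
          simp) h01 (by rw [hA0, hc1, sub_self, norm_zero]; positivity)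
    have h1 : c (A t) = ContinuousLinearMap.id ℝ Plane :=
      sub_eq_zero.1 (norm_le_zero_iff.1 (hcA t ht))
    ext1 z
    have := DFunLike.congr_fun h1 (B z)
    exact B.injective (by simpa [c] using this)

end LinearPaths

/-! ### Homotopies along the orbits near the singular point -/

section OrbitHomotopy

variable {G : Plane → Plane} {p : ℕ} {g : MvPolynomial (Fin 2) ℝ} {η : Plane → ℝ}
  {φ : OpenPartialHomeomorph Plane Plane} {B : Plane ≃L[ℝ] Plane} {R : ℝ} {F : Plane → ℝ → Plane}

/-- The polynomial `g`, read in the chart, is locally constant along the trajectories. -/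
theorem StarChart.eventually_eval_eq (h : StarChart G p g η φ B) (hF : IsCutoffFlow G R F)
    {x : Plane} (hx : x ∈ φ.source) (hxR : x ∈ Metric.ball (0 : Plane) R) :
    ∀ᶠ s in 𝓝 (0 : ℝ), ∀ w, FlowsTo G x s w →
      MvPolynomial.eval (fun i => φ w i) g = MvPolynomial.eval (fun i => φ x i) g := by
  have hc : ∀ᶠ s in 𝓝 (0 : ℝ), F x s ∈ φ.source ∩ Metric.ball (0 : Plane) R := by
    refine (hF.continuous_time x).continuousAt.eventually
      ((φ.open_source.inter Metric.isOpen_ball).mem_nhds ?_)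
    rw [hF.zero]; exact ⟨hx, hxR⟩
  obtain ⟨ε, hε, hball⟩ := Metric.eventually_nhds_iff_ball.1 hc
  have hd : ∀ s ∈ Metric.ball (0 : ℝ) ε,
      HasDerivAt (fun s => MvPolynomial.eval (fun i => φ (F x s) i) g) 0 s := by
    intro s hs
    have hy := hball s hs
    have h1 := hF.hasDerivAt hy.2
    have h2 : HasFDerivAt φ (fderiv ℝ φ (F x s)) (F x s) :=
      ((h.contDiffAt hy.1).differentiableAt (by simp)).hasFDerivAt
    have h3 := ((hasFDerivAt_eval_plane g (φ (F x s))).comp (F x s) h2).comp_hasDerivAt s h1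
    refine h3.congr_deriv ?_
    rw [ContinuousLinearMap.comp_apply, h.eq _ hy.1]
    simp only [hamiltonianField, add_apply, smul_apply, PiLp.proj_apply, smul_eq_mul, PiLp.smul_apply]
    simp
    ring_nf
  filter_upwards [Metric.ball_mem_nhds (0 : ℝ) hε] with s hs w hw
  have hseg : ∀ r ∈ uIcc 0 s, r ∈ Metric.ball (0 : ℝ) ε := fun r hr =>
    (convex_ball (0 : ℝ) ε).ordConnected.uIcc_subset (Metric.mem_ball_self hε) hs hr
  have hw' : w = F x s := hw.unique h.contDiff (hF.flowsTo fun r hr => (hball r (hseg r hr)).2)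
  have := Metric.isOpen_ball.is_const_of_deriv_eq_zero (convex_ball (0 : ℝ) ε).isPreconnected
    (fun r hr => (hd r hr).differentiableAt.differentiableWithinAt) (fun r hr => (hd r hr).deriv)
    hs (Metric.mem_ball_self hε)
  rw [hw', this, hF.zero]

/-- A homotopy from the identity along the orbits, on the neighbourhood `U` of the singular
point, together with its time functions `τ`. -/
structure OrbitHomotopy (G : Plane → Plane) (U : Set Plane) (H : ℝ → Plane → Plane)
    (τ : ℝ → Plane → ℝ) : Prop where
  ctendsto : ∀ t, ∀ z ∈ U, CTendsto 1 (𝓝 t) H (H t) z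
  zero : ∀ z ∈ U, H 0 z = z
  origin : ∀ t, H t 0 = 0
  lift : ∀ z ∈ U, G z ≠ 0 → IsTimeLift G z (fun t => H t z) 1 (fun t => τ t z)

theorem eventually_forall_Icc {P : ℝ → Plane → Prop}
    (h : ∀ t ∈ Icc (0 : ℝ) 1, ∀ᶠ q in 𝓝[Icc 0 1] t ×ˢ 𝓝 (0 : Plane), P q.1 q.2) :
    ∀ᶠ z in 𝓝 (0 : Plane), ∀ t ∈ Icc (0 : ℝ) 1, P t z := by
  have := isCompact_Icc.eventually_forall_of_forall_eventually (x₀ := (0 : Plane))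
    (K := Icc (0 : ℝ) 1) (P := fun z t => t ∈ Icc (0 : ℝ) 1 → P t z) (fun t ht => ?_)
  · exact this.mono fun z hz t ht => hz t ht ht
  · obtain ⟨pa, ha, pb, hb, H⟩ := Filter.eventually_prod_iff.1 (h t ht)
    rw [nhds_prod_eq]
    refine Filter.eventually_prod_iff.2 ⟨pb, hb, _, eventually_nhdsWithin_iff.1 ha, ?_⟩
    intro z hz s hs hs'
    exact H (hs hs') hz

namespace OrbitHomotopy

variable {U : Set Plane} {H : ℝ → Plane → Plane} {τ : ℝ → Plane → ℝ}

theorem tendsto_origin (hH : OrbitHomotopy G U H τ) (hU : U ∈ 𝓝 (0 : Plane)) (t : ℝ) :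
    Filter.Tendsto (fun q : ℝ × Plane => H q.1 q.2) (𝓝[Icc 0 1] t ×ˢ 𝓝 0) (𝓝 0) := by
  have := (hH.ctendsto t 0 (mem_of_mem_nhds hU)).tendsto_zero
  rw [hH.origin] at this
  exact this.mono_left (Filter.prod_mono_left _ nhdsWithin_le_nhds)

theorem continuousOn_fderiv (hH : OrbitHomotopy G U H τ) (hU : U ∈ 𝓝 (0 : Plane)) :
    ContinuousOn (fun t => fderiv ℝ (H t) 0) (Icc 0 1) := by
  intro t _
  have := (hH.ctendsto t 0 (mem_of_mem_nhds hU)).tendsto_fderiv le_rfl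
  have h2 : Filter.Tendsto (fun s : ℝ => (s, (0 : Plane))) (𝓝[Icc 0 1] t) (𝓝 t ×ˢ 𝓝 0) :=
    (Filter.tendsto_id.mono_left nhdsWithin_le_nhds).prodMk tendsto_const_nhds
  exact this.comp h2

theorem fderiv_zero (hH : OrbitHomotopy G U H τ) (hU : U ∈ 𝓝 (0 : Plane)) :
    fderiv ℝ (H 0) 0 = ContinuousLinearMap.id ℝ Plane := by
  have : H 0 =ᶠ[𝓝 0] id := by filter_upwards [hU] with z hz using hH.zero z hz
  rw [this.fderiv_eq, fderiv_id]

theorem hasFDerivAt (hH : OrbitHomotopy G U H τ) (hU : U ∈ 𝓝 (0 : Plane)) (t : ℝ) :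
    HasFDerivAt (H t) (fderiv ℝ (H t) 0) 0 :=
  ((hH.ctendsto t 0 (mem_of_mem_nhds hU)).smooth_lim.differentiableAt (by simp)).hasFDerivAt

theorem eventually_eval_eq (hH : OrbitHomotopy G U H τ) (hU : U ∈ 𝓝 (0 : Plane))
    (h : StarChart G p g η φ B) :
    ∀ᶠ z in 𝓝 (0 : Plane), ∀ t ∈ Icc (0 : ℝ) 1,
      MvPolynomial.eval (fun i => φ (H t z) i) g = MvPolynomial.eval (fun i => φ z i) g := by
  obtain ⟨F, hF⟩ := exists_isCutoffFlow h.contDiff 1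
  have hG0 := h.hasZeroOfOrder.map_zero
  have hnear : ∀ᶠ z in 𝓝 (0 : Plane), ∀ t ∈ Icc (0 : ℝ) 1,
      H t z ∈ φ.source ∩ Metric.ball (0 : Plane) 1 :=
    eventually_forall_Icc fun t _ => (hH.tendsto_origin hU t).eventually
      (Filter.inter_mem h.source_mem_nhds (Metric.ball_mem_nhds _ one_pos))
  filter_upwards [hnear, hU] with z hz hzU t ht
  have h01 : (0 : ℝ) ∈ Icc (0 : ℝ) 1 := ⟨le_rfl, zero_le_one⟩
  by_cases hGz : G z = 0
  · have : H t z = z := by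
      by_contra hcon
      have hz0 : z ≠ 0 := fun h0 => hcon (by rw [h0, hH.origin])
      have := hz 0 h01
      rw [hH.zero z hzU] at this
      exact h.ne_zero this.1 hz0 hGz
    rw [this]
  · have hl := hH.lift z hzU hGz
    have key := isPreconnected_Icc.induction₂ (s := Icc (0 : ℝ) 1)
      (fun s t => MvPolynomial.eval (fun i => φ (H s z) i) g =
        MvPolynomial.eval (fun i => φ (H t z) i) g) (fun s hs => ?_)
      (fun _ _ _ _ _ _ => Eq.trans) (fun _ _ _ _ => Eq.symm) ht h01
    · rw [key, hH.zero z hzU]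
    · have hc : Filter.Tendsto (fun t => τ t z - τ s z) (𝓝[Icc 0 1] s) (𝓝 0) := by
        simpa using (hl.2.1 s hs).sub_const (τ s z)
      filter_upwards [hc.eventually (h.eventually_eval_eq hF (hz s hs).1 (hz s hs).2),
        self_mem_nhdsWithin] with t ht htI
      refine (ht _ ?_).symm
      have := ((hl.2.2 s hs).symm h.contDiff).trans h.contDiff (hl.2.2 t htI)
      rwa [neg_add_eq_sub] at this

/-- The derivatives at the origin preserve the leading part of the first integral. -/
theorem eval_fderiv (hH : OrbitHomotopy G U H τ) (hU : U ∈ 𝓝 (0 : Plane))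
    (h : StarChart G p g η φ B) {t : ℝ} (ht : t ∈ Icc (0 : ℝ) 1) (z : Plane) :
    MvPolynomial.eval (fun i => B (fderiv ℝ (H t) 0 z) i) g =
      MvPolynomial.eval (fun i => B z i) g := by
  have hlim : ∀ {ψ : Plane → Plane} {T : Plane →L[ℝ] Plane}, ψ 0 = 0 → HasFDerivAt ψ T 0 →
      Filter.Tendsto (fun s : ℝ => (s ^ (p + 1))⁻¹ * MvPolynomial.eval (fun i => ψ (s • z) i) g)
        (𝓝[≠] 0) (𝓝 (MvPolynomial.eval (fun i => T z i) g)) := by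
    intro ψ T h0 hψ
    have h1 : HasDerivAt (fun s : ℝ => ψ (s • z)) (T z) 0 := by
      have h2 : HasDerivAt (fun s : ℝ => s • z) z 0 := by
        simpa using (hasDerivAt_id (0 : ℝ)).smul_const z
      have h3 : HasFDerivAt ψ T ((0 : ℝ) • z) := by rwa [zero_smul]
      exact h3.comp_hasDerivAt 0 h2
    have h4 := ((contDiff_eval_plane g).continuous.tendsto (T z)).comp
      (hasDerivAt_iff_tendsto_slope.1 h1)
    refine h4.congr' ?_
    filter_upwards [self_mem_nhdsWithin] with s hs
    have hs : s ≠ 0 := hs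
    simp only [Function.comp_apply, slope_def_module, zero_smul, h0, sub_zero]
    rw [IsHomogeneous.eval_smul_plane h.star.homogeneous, inv_pow]
  have hφt : HasFDerivAt (fun z => φ (H t z))
      ((B : Plane →L[ℝ] Plane).comp (fderiv ℝ (H t) 0)) 0 := by
    have h1 : HasFDerivAt φ (B : Plane →L[ℝ] Plane) (H t 0) := by
      rw [hH.origin]; exact h.hasFDerivAt
    exact h1.comp 0 (hH.hasFDerivAt hU t)
  have h1 := hlim (by rw [hH.origin, h.map_zero]) hφt
  have h2 := hlim h.map_zero h.hasFDerivAt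
  refine tendsto_nhds_unique h1 (h2.congr' ?_)
  have hs : Filter.Tendsto (fun s : ℝ => s • z) (𝓝[≠] 0) (𝓝 0) := by
    have : Continuous fun s : ℝ => s • z := by fun_prop
    simpa using (this.tendsto 0).mono_left nhdsWithin_le_nhds
  filter_upwards [hs.eventually (hH.eventually_eval_eq hU h)] with s hs
  rw [hs t ht]

/-- The time function of the homotopy at time `t` is, near the origin, close to the time `a t` of
the linear flow. On the scale `‖z‖ ^ (1 - p)` their difference cannot leave a neighbourhood of
zero along the homotopy. -/
theorem exists_tendsto (hH : OrbitHomotopy G U H τ) (hU : U ∈ 𝓝 (0 : Plane))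
    (h : StarChart G p g η φ B) (hF : IsCutoffFlow G R F) (hR : 0 < R) :
    ∃ a : ℝ, fderiv ℝ (H 1) 0 = linearFlow F a ∧
      Filter.Tendsto (fun z => |τ 1 z - a| * ‖z‖ ^ (p - 1)) (𝓝[≠] 0) (𝓝 0) := by
  have hG := h.hasZeroOfOrder
  obtain ⟨a, ha0, ha, haA⟩ := h.exists_linear_lift hF hR (hH.continuousOn_fderiv hU)
    (hH.fderiv_zero hU) fun t ht => hH.eval_fderiv hU h ht
  have h01 : (0 : ℝ) ∈ Icc (0 : ℝ) 1 := ⟨le_rfl, zero_le_one⟩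
  have h11 : (1 : ℝ) ∈ Icc (0 : ℝ) 1 := ⟨zero_le_one, le_rfl⟩
  refine ⟨a 1, haA 1 h11, ?_⟩
  -- The defects `F (H t z) (- a t) - z` are uniformly small.
  have hu : ∀ t ∈ Icc (0 : ℝ) 1, CTendsto 1 (𝓝[Icc 0 1] t)
      (fun s => defect F (H s) (fun _ => a s)) (defect F (H t) fun _ => a t) 0 := fun t ht =>
    ctendsto_defect hF ((hH.ctendsto t 0 (mem_of_mem_nhds hU)).mono_left nhdsWithin_le_nhds)
      (CTendsto.const_param (ha t ht))
  have hu0 : ∀ t, defect F (H t) (fun _ => a t) 0 = 0 := fun t => by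
    rw [defect, hH.origin, hF.apply_origin hG hR, sub_zero]
  have hdu : ∀ t ∈ Icc (0 : ℝ) 1, fderiv ℝ (defect F (H t) fun _ => a t) 0 = 0 := by
    intro t ht
    have h1 : HasFDerivAt (fun z => F z (-(a t))) (linearFlow F (-(a t))) (H t 0) := by
      rw [hH.origin]; exact hF.hasFDerivAt_apply 0 _
    have h2 := (h1.comp (0 : Plane) (hH.hasFDerivAt hU t)).sub (hasFDerivAt_id (0 : Plane))
    rw [haA t ht, hF.linearFlow_neg_comp hG hR, sub_self] at h2
    exact h2.fderiv
  have hsmall : ∀ ε > 0, ∀ᶠ z in 𝓝 (0 : Plane), ∀ t ∈ Icc (0 : ℝ) 1,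
      ‖defect F (H t) (fun _ => a t) z‖ ≤ ε * ‖z‖ := by
    intro ε hε
    have h1 : ∀ᶠ z in 𝓝 (0 : Plane), ∀ t ∈ Icc (0 : ℝ) 1,
        DifferentiableAt ℝ (defect F (H t) fun _ => a t) z ∧
        ‖fderiv ℝ (defect F (H t) fun _ => a t) z‖ ≤ ε := by
      refine eventually_forall_Icc (P := fun t z =>
        DifferentiableAt ℝ (defect F (H t) fun _ => a t) z ∧
        ‖fderiv ℝ (defect F (H t) fun _ => a t) z‖ ≤ ε) fun t ht => ?_
      have h2 := ((hu t ht).tendsto_fderiv le_rfl).norm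
      rw [hdu t ht, norm_zero] at h2
      filter_upwards [(hu t ht).smooth, h2.eventually_le_const hε] with q h3 h4
      exact ⟨h3.differentiableAt (by simp), h4⟩
    obtain ⟨ρ, hρ, h2⟩ := Metric.eventually_nhds_iff_ball.1 h1
    filter_upwards [Metric.ball_mem_nhds (0 : Plane) hρ] with z hz t ht
    have := (convex_ball (0 : Plane) ρ).norm_image_sub_le_of_norm_fderiv_le (𝕜 := ℝ)
      (fun w hw => (h2 w hw t ht).1) (fun w hw => (h2 w hw t ht).2) (Metric.mem_ball_self hρ) hz
    rwa [hu0, sub_zero, sub_zero] at this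
  have hflow : ∀ᶠ z in 𝓝 (0 : Plane), z ≠ 0 → ∀ t ∈ Icc (0 : ℝ) 1,
      FlowsTo G z (τ t z - a t) (F (H t z) (-(a t))) := by
    have h1 : ∀ᶠ z in 𝓝 (0 : Plane), ∀ t ∈ Icc (0 : ℝ) 1, G z ≠ 0 →
        FlowsTo G z (τ t z - a t) (F (H t z) (-(a t))) := by
      refine eventually_forall_Icc (P := fun t z => G z ≠ 0 →
        FlowsTo G z (τ t z - a t) (F (H t z) (-(a t)))) fun t ht => ?_
      have h0 : ∀ s ∈ uIcc 0 (-(a t)), F 0 s ∈ Metric.ball (0 : Plane) R := fun s _ => by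
        rw [hF.apply_origin hG hR]; exact Metric.mem_ball_self hR
      have hlim : Filter.Tendsto (fun q : ℝ × Plane => (H q.1 q.2, -(a q.1)))
          (𝓝[Icc 0 1] t ×ˢ 𝓝 0) (𝓝 (0, -(a t))) :=
        (hH.tendsto_origin hU t).prodMk_nhds (Filter.Tendsto.comp (ha t ht) Filter.tendsto_fst).neg
      filter_upwards [hlim.eventually (hF.eventually_mem_ball h0),
        Filter.tendsto_fst.eventually self_mem_nhdsWithin, Filter.tendsto_snd.eventually hU]
        with q h1 h2 h3 h4
      exact ((hH.lift q.2 h3 h4).2.2 q.1 h2).trans hG.contDiff (hF.flowsTo h1)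
    filter_upwards [h1, h.source_mem_nhds] with z hz hzs hz0 t ht
    exact hz t ht (h.ne_zero hzs hz0)
  obtain ⟨ρ, hρ, c₀, hc₀, C, hC, hest⟩ := exists_flow_estimates hG hF hR
  obtain ⟨m, hm⟩ : ∃ m, p = m + 1 := ⟨p - 1, by have := hG.one_le; omega⟩
  rw [Metric.tendsto_nhds]
  intro ε hε
  obtain ⟨ε', hε', h1, h2⟩ : ∃ ε' > 0, C * ε' < ε ∧ C * ε' < c₀ := by
    refine ⟨min ε c₀ / (2 * C), by positivity, ?_, ?_⟩
    · have := min_le_left ε c₀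
      rw [show C * (min ε c₀ / (2 * C)) = min ε c₀ / 2 by field_simp]; linarith
    · have := min_le_right ε c₀
      rw [show C * (min ε c₀ / (2 * C)) = min ε c₀ / 2 by field_simp]; linarith
  rw [eventually_nhdsWithin_iff]
  filter_upwards [hsmall ε' hε', hflow, eventually_norm_lt hρ, hU, h.source_mem_nhds]
    with z hz1 hz2 hz3 hzU hzs hz0
  have hz0 : z ≠ 0 := hz0
  have hzpos := norm_pos_iff.2 hz0
  have hl := hH.lift z hzU (h.ne_zero hzs hz0)
  have key := IsPreconnected.le_of_gap isPreconnected_Icc (S := Icc (0 : ℝ) 1)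
    (φ := fun t => |τ t z - a t| * ‖z‖ ^ (p - 1)) ((hl.2.1.sub ha).abs.mul continuousOn_const) h2
    (fun t ht hle => ?_) h01 (by simp [hl.1, ha0, hc₀.le]) 1 h11
  · rw [Real.dist_eq, sub_zero, abs_of_nonneg (by positivity)]
    exact key.trans_lt h1
  · obtain ⟨-, e2, e3⟩ := hest z _ hz3 hle
    rw [e3.unique hG.contDiff (hz2 hz0 t ht)] at e2
    have e4 := hz1 t ht
    rw [defect] at e4
    rw [hm, pow_succ, ← mul_assoc] at e2
    have e5 : |τ t z - a t| * ‖z‖ ^ m * ‖z‖ ≤ C * ε' * ‖z‖ :=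
      e2.trans (by rw [mul_assoc]; exact mul_le_mul_of_nonneg_left e4 hC.le)
    rw [hm, Nat.add_sub_cancel]
    exact le_of_mul_le_mul_right e5 hzpos

end OrbitHomotopy

end OrbitHomotopy

/-! ### Existence of smooth shift functions -/

section Existence

variable {G : Plane → Plane} {p : ℕ} {g : MvPolynomial (Fin 2) ℝ} {η : Plane → ℝ}
  {φ : OpenPartialHomeomorph Plane Plane} {B : Plane ≃L[ℝ] Plane} {R : ℝ} {F : Plane → ℝ → Plane}

/-- A time `a` for which the linear flow agrees with the derivative of `h` approximates the shift
function of `h` to second order. -/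
theorem approxShift_const (hG : HasZeroOfOrder G p) (hF : IsCutoffFlow G R F) (hR : 0 < R)
    {h : Plane → Plane} {α : Plane → ℝ} {a : ℝ} (hh : ContDiffAt ℝ ∞ h 0) (h0 : h 0 = 0)
    (hd : fderiv ℝ h 0 = linearFlow F a)
    (hα : Filter.Tendsto (fun z => |α z - a| * ‖z‖ ^ (p - 1)) (𝓝[≠] 0) (𝓝 0)) :
    ApproxShift p F h α (fun _ => a) 2 := by
  refine ⟨?_, hα⟩
  have hs : ContDiffAt ℝ ∞ (defect F h fun _ => a) 0 :=
    (hF.contDiff.contDiffAt.comp (0 : Plane) (hh.prodMk contDiffAt_const)).sub contDiffAt_id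
  refine isBigO_pow_of_jet_eq_zero (contDiffAt_infty.1 hs 2) fun j hj => ?_
  rw [← norm_eq_zero]
  interval_cases j
  · rw [norm_iteratedFDeriv_zero, defect, h0, hF.apply_origin hG hR, sub_zero, norm_zero]
  · have h1 : HasFDerivAt (fun z => F z (-a)) (linearFlow F (-a)) (h 0) := by
      rw [h0]; exact hF.hasFDerivAt_apply 0 _
    have h2 := (h1.comp (0 : Plane) (hh.differentiableAt (by simp)).hasFDerivAt).sub
      (hasFDerivAt_id (0 : Plane))
    rw [hd, hF.linearFlow_neg_comp hG hR, sub_self] at h2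
    rw [norm_iteratedFDeriv_one]
    exact norm_eq_zero.2 h2.fderiv

/-- The derivative at the origin of a map with a differentiable shift function. -/
theorem fderiv_eq_linearFlow (hG : HasZeroOfOrder G p) (hF : IsCutoffFlow G R F) (hR : 0 < R)
    {h : Plane → Plane} {α : Plane → ℝ} (hα : DifferentiableAt ℝ α 0)
    (hflow : ∀ᶠ z in 𝓝 0, FlowsTo G z (α z) (h z)) : fderiv ℝ h 0 = linearFlow F (α 0) := by
  have h0 : ∀ s ∈ uIcc 0 (α 0), F 0 s ∈ Metric.ball (0 : Plane) R := fun s _ => by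
    rw [hF.apply_origin hG hR]; exact Metric.mem_ball_self hR
  have hlim : Filter.Tendsto (fun z : Plane => (z, α z)) (𝓝 0) (𝓝 (0, α 0)) :=
    Filter.Tendsto.prodMk_nhds Filter.tendsto_id hα.continuousAt
  have he : h =ᶠ[𝓝 0] fun z => F z (α z) := by
    filter_upwards [hlim.eventually (hF.eventually_mem_ball h0), hflow] with z h1 h2
    exact h2.unique hG.contDiff (hF.flowsTo h1)
  rw [he.fderiv_eq]
  have hd := (hF.contDiff.differentiable (by simp) ((0 : Plane), α 0)).hasFDerivAt
  have h1 := hd.comp (f := fun z : Plane => (z, α z)) (0 : Plane) ((hasFDerivAt_id (𝕜 := ℝ) (0 : Plane)).prodMk hα.hasFDerivAt)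
  have h2 := hd.comp (f := fun z : Plane => (z, α 0)) (0 : Plane) (hasFDerivAt_prodMk_left (𝕜 := ℝ) (0 : Plane) (α 0))
  have h3 : HasFDerivAt (fun t : ℝ => F 0 t) (0 : ℝ →L[ℝ] Plane) (α 0) := by
    have : (fun t : ℝ => F 0 t) = fun _ => 0 := funext fun t => hF.apply_origin hG hR t
    rw [this]; exact hasFDerivAt_const _ _
  have h4 := h3.unique (hd.comp (f := fun t : ℝ => ((0 : Plane), t)) (α 0) (hasFDerivAt_prodMk_right (𝕜 := ℝ) (0 : Plane) (α 0)))
  refine h1.fderiv.trans (Eq.trans ?_ h2.fderiv.symm)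
  ext1 w
  have h5 := DFunLike.congr_fun h4 (fderiv ℝ α 0 w)
  simp only [ContinuousLinearMap.comp_apply, ContinuousLinearMap.inr_apply, zero_apply] at h5
  simp only [ContinuousLinearMap.comp_apply, ContinuousLinearMap.prod_apply,
    ContinuousLinearMap.inl_apply, ContinuousLinearMap.id_apply]
  have : ((w, fderiv ℝ α 0 w) : Plane × ℝ) = (w, 0) + (0, fderiv ℝ α 0 w) := by simp
  rw [this, map_add, ← h5, add_zero]

/-- A shift function which is continuous off the origin extends smoothly to the origin, provided
it is close to a constant there in the scale of the field. -/
theorem exists_contDiffAt_update (hG : HasZeroOfOrder G p) (hD : HasDivision G)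
    (hF : IsCutoffFlow G R F) (hR : 0 < R) {h : Plane → Plane} {α : Plane → ℝ} {a : ℝ}
    (hh : ContDiffAt ℝ ∞ h 0) (h0 : h 0 = 0)
    (hflow : ∀ᶠ z in 𝓝 0, FlowsTo G z (α z) (h z))
    (hα : ∀ᶠ z in 𝓝 0, z ≠ 0 → ContinuousAt α z)
    (h2 : ApproxShift p F h α (fun _ => a) 2) :
    ∃ c : ℝ, ContDiffAt ℝ ∞ (Function.update α 0 c) 0 := by
  have key : ∀ r : ℕ, ∃ c, ContDiffAt ℝ r (Function.update α 0 c) 0 := by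
    intro r
    obtain ⟨s, hs⟩ := exists_ctendsto_shift hG hD hF hR r
    obtain ⟨v, v₀, hv, hvα⟩ := hs (ι := Unit) (l := pure ()) (h := fun _ => h) (f := h)
      (α := fun _ => α) (a := fun _ => a) (a₀ := a)
      (CTendsto.const (hh.of_le (by exact_mod_cast le_top))) h0 (by simpa using h0)
      (by simpa [Filter.pure_prod] using hflow) (by simpa [Filter.pure_prod] using hα)
      tendsto_const_nhds (by simpa using h2)
    have hc := hv.smooth
    rw [Filter.pure_prod, Filter.eventually_map] at hc hvα
    refine ⟨v () 0, hc.self_of_nhds.congr_of_eventuallyEq ?_⟩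
    filter_upwards [hvα] with z hz
    by_cases hz0 : z = 0
    · subst hz0; simp
    · rw [Function.update_of_ne hz0]; exact hz hz0
  choose c hc using key
  have heq : ∀ r, c r = c 0 := by
    have hlim : ∀ r, Filter.Tendsto α (𝓝[≠] 0) (𝓝 (c r)) := fun r => by
      have h1 := (hc r).continuousAt.tendsto.mono_left (nhdsWithin_le_nhds (s := {(0 : Plane)}ᶜ))
      rw [Function.update_self] at h1
      refine h1.congr' ?_
      filter_upwards [self_mem_nhdsWithin] with z hz using Function.update_of_ne hz _ _
    exact fun r => tendsto_nhds_unique (hlim r) (hlim 0)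
  exact ⟨c 0, contDiffAt_infty.2 fun r => heq r ▸ hc r⟩

/-- Every element of `𝓔_id(G, V)` has a smooth shift function, if `V` lies in the adapted chart. -/
theorem StarChart.exists_isShiftFunction (h : StarChart G p g η φ B) {V : Opens Plane}
    (h0V : (0 : Plane) ∈ V) (hV : (V : Set Plane) ⊆ φ.source) {f : SmoothMaps Plane V}
    (hf : f ∈ orbitMapsId G V) : ∃ α : SmoothMaps ℝ V, IsShiftFunction G f α := by
  have hG := h.hasZeroOfOrder
  have hVn : (V : Set Plane) ∈ 𝓝 (0 : Plane) := V.isOpen.mem_nhds h0V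
  obtain ⟨F, hF⟩ := exists_isCutoffFlow h.contDiff 1
  obtain ⟨H, H0, H1, Horb, Hc⟩ := exists_homotopy_of_mem_orbitMapsId hf
  let K : ℝ → Plane → Plane := fun t => zeroExt (H t).1
  have hKorb : ∀ t, ∀ z ∈ (V : Set Plane), K t z ∈ orbit G z := fun t z hz => by
    have := (Horb t).1 z ⟨z, hz⟩ (self_mem_orbit z)
    rwa [← zeroExt_apply (H t).1 ⟨z, hz⟩] at this
  have hK0 : ∀ z ∈ (V : Set Plane), K 0 z = z := fun z hz => by
    change zeroExt (H 0).1 ((⟨z, hz⟩ : V) : Plane) = z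
    rw [zeroExt_apply, H0]; rfl
  have hKorigin : ∀ t, K t 0 = 0 := fun t => by
    obtain ⟨s, hs⟩ := hKorb t 0 h0V
    exact hs.eq_of_zero hG.contDiff hG.map_zero
  obtain ⟨τ, hτ⟩ := exists_timeLift hG.contDiff (H := K) V.isOpen (fun t z hz => by
    have := (Hc t z hz).tendsto_zero
    rw [← nhds_prod_eq] at this
    exact this) hK0 fun t z hz _ => hKorb t z hz
  have hH : OrbitHomotopy G V K τ := ⟨Hc, hK0, hKorigin, fun z hz hz0 => (hτ z hz hz0).1⟩
  obtain ⟨a, ha, hlim⟩ := hH.exists_tendsto hVn h hF one_pos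
  have h11 : (1 : ℝ) ∈ Icc (0 : ℝ) 1 := ⟨zero_le_one, le_rfl⟩
  have hK1 : K 1 = zeroExt f.1 := by simp only [K, H1]
  have hKs : ∀ z ∈ (V : Set Plane), ContDiffAt ℝ ∞ (K 1) z := fun z hz => (H 1).contDiffAt hz
  have hflow : ∀ z ∈ (V : Set Plane), FlowsTo G z (τ 1 z) (K 1 z) := by
    intro z hz
    by_cases hz0 : z = 0
    · subst hz0; rw [hKorigin]; exact flowsTo_of_zero hG.map_zero _
    · exact (hτ z hz (h.ne_zero (hV hz) hz0)).1.2.2 1 h11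
  have hcont : ∀ z ∈ (V : Set Plane), z ≠ 0 → ContinuousAt (τ 1) z := fun z hz hz0 =>
    (hτ z hz (h.ne_zero (hV hz) hz0)).2 1 h11
  obtain ⟨c, hc⟩ := exists_contDiffAt_update hG
    (hG.hasDivision h.star (h.unit_ne_zero 0) h.hasLeadingPart) hF one_pos
    (hKs 0 h0V) (hKorigin 1) (by filter_upwards [hVn] with z hz using hflow z hz)
    (by filter_upwards [hVn] with z hz using hcont z hz)
    (approxShift_const hG hF one_pos (hKs 0 h0V) (hKorigin 1) ha hlim)
  let α : Plane → ℝ := Function.update (τ 1) 0 c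
  have hα : ∀ z ∈ (V : Set Plane), ContDiffAt ℝ ∞ α z := by
    intro z hz
    by_cases hz0 : z = 0
    · subst hz0; exact hc
    · refine contDiffAt_shift_of_ne_zero hG.contDiff (h.ne_zero (hV hz) hz0) (hKs z hz) ?_ ?_
      · exact (hcont z hz hz0).congr (by
          filter_upwards [isOpen_ne.mem_nhds hz0] with w hw using (Function.update_of_ne hw _ _).symm)
      · filter_upwards [isOpen_ne.mem_nhds hz0, V.isOpen.mem_nhds hz] with w hw hwV
        simp only [α, Function.update_of_ne hw]
        exact hflow w hwV
  refine ⟨⟨fun z => α z, fun z hz => ?_⟩, fun z => ?_⟩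
  · refine ContDiffAt.contDiffWithinAt ((hα z hz).congr_of_eventuallyEq ?_)
    filter_upwards [V.isOpen.mem_nhds hz] with w hw using zeroExt_apply _ (⟨w, hw⟩ : V)
  · have hz : K 1 z = f z := by rw [hK1, zeroExt_apply]
    change FlowsTo G z (α z) (f z)
    rw [← hz]
    by_cases hz0 : (z : Plane) = 0
    · rw [hz0, hKorigin]; exact flowsTo_of_zero hG.map_zero _
    · simp only [α, Function.update_of_ne hz0]
      exact hflow z z.2

end Existence

/-! ### Continuous dependence of shift functions -/

section Continuity

variable {G : Plane → Plane} {p : ℕ} {g : MvPolynomial (Fin 2) ℝ} {η : Plane → ℝ}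
  {φ : OpenPartialHomeomorph Plane Plane} {B : Plane ≃L[ℝ] Plane} {R : ℝ} {F : Plane → ℝ → Plane}

/-- If the index filter contains the limit index `i₀` itself, the limit may be taken to be `u i₀`: all
derivatives of the two agree at the point. -/
theorem CTendsto.of_pure {ι : Type} {E F : Type} [NormedAddCommGroup E] [NormedSpace ℝ E]
    [NormedAddCommGroup F] [NormedSpace ℝ F] {n : ℕ} {l : Filter ι} {u : ι → E → F} {v : E → F}
    {x₀ : E} (h : CTendsto n l u v x₀) {i₀ : ι} (hi : pure i₀ ≤ l) : CTendsto n l u (u i₀) x₀ := by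
  have hle : pure (i₀, x₀) ≤ l ×ˢ 𝓝 x₀ := by
    rw [← Filter.prod_pure_pure]; exact Filter.prod_mono hi (pure_le_nhds x₀)
  refine ⟨h.smooth, Filter.eventually_pure.1 (hle h.smooth), fun k hk => ?_⟩
  have h1 := (h.tendsto k hk).mono_left hle
  rw [Filter.tendsto_pure_left] at h1
  have h2 : iteratedFDeriv ℝ k (u i₀) x₀ = iteratedFDeriv ℝ k v x₀ := by
    by_contra hne
    exact h1 _ (isOpen_compl_singleton.mem_nhds (Ne.symm hne)) rfl
  rw [h2]; exact h.tendsto k hk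

/-- Convergence at the singular point of the shift functions of a convergent family of maps. -/
theorem exists_ctendsto_shift_origin (hG : HasZeroOfOrder G p) (hD : HasDivision G) (r : ℕ) :
    ∃ s : ℕ, ∀ {ι : Type} {l : Filter ι} {h : ι → Plane → Plane} {α : ι → Plane → ℝ} {i₀ : ι},
      pure i₀ ≤ l → CTendsto s l h (h i₀) 0 →
      (∀ i, ContDiffAt ℝ ∞ (h i) 0) →
      (∀ᶠ z in 𝓝 0, ∀ i, ContDiffAt ℝ ∞ (α i) z ∧ FlowsTo G z (α i z) (h i z)) →
      (p = 1 → Filter.Tendsto (fun i => α i 0) l (𝓝 (α i₀ 0))) →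
      CTendsto r l α (α i₀) 0 := by
  obtain ⟨F, hF⟩ := exists_isCutoffFlow hG.contDiff 1
  obtain ⟨s, hs⟩ := exists_ctendsto_shift hG hD hF one_pos r
  refine ⟨s, fun {ι l h α i₀} hi hh hhs hα h0 => ?_⟩
  have hα0 : ∀ i, ContDiffAt ℝ ∞ (α i) 0 := fun i => (hα.self_of_nhds i).1
  have hh0 : ∀ i, h i 0 = 0 := fun i =>
    (hα.self_of_nhds i).2.eq_of_zero hG.contDiff hG.map_zero
  let a : ι → ℝ := fun i => if p = 1 then α i 0 else 0
  have hfd : ∀ i, fderiv ℝ (h i) 0 = linearFlow F (a i) := by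
    intro i
    rw [fderiv_eq_linearFlow hG hF one_pos ((hα0 i).differentiableAt (by simp))
      (hα.mono fun z hz => (hz i).2)]
    by_cases hp : p = 1
    · simp only [a, if_pos hp]
    · have hp2 : 2 ≤ p := by have := hG.one_le; omega
      rw [hF.linearFlow_eq_id hG hp2 one_pos, hF.linearFlow_eq_id hG hp2 one_pos]
  have hat : Filter.Tendsto a l (𝓝 (a i₀)) := by
    by_cases hp : p = 1
    · simp only [a, if_pos hp]; exact h0 hp
    · simp only [a, if_neg hp]; exact tendsto_const_nhds
  have happ : ∀ i, ApproxShift p F (h i) (α i) (fun _ => a i) 2 := by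
    intro i
    refine approxShift_const hG hF one_pos (hhs i) (hh0 i) (hfd i) ?_
    have hc : ContinuousAt (fun z => |α i z - a i| * ‖z‖ ^ (p - 1)) 0 :=
      ((hα0 i).continuousAt.sub continuousAt_const).abs.mul (by fun_prop)
    have h1 : |α i 0 - a i| * ‖(0 : Plane)‖ ^ (p - 1) = 0 := by
      by_cases hp : p = 1
      · simp [a, hp]
      · have : p - 1 ≠ 0 := by have := hG.one_le; omega
        simp [this]
    have h2 := hc.tendsto
    rw [h1] at h2
    exact h2.mono_left nhdsWithin_le_nhds
  have hαq : ∀ᶠ q in l ×ˢ 𝓝 (0 : Plane), ∀ i, ContDiffAt ℝ ∞ (α i) q.2 ∧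
      FlowsTo G q.2 (α i q.2) (h i q.2) := Filter.tendsto_snd.eventually hα
  obtain ⟨v, v₀, hv, hvα⟩ := hs (α := α) hh (hh0 i₀) (.of_forall hh0)
    (hαq.mono fun q hq => (hq q.1).2) (hαq.mono fun q hq _ => (hq q.1).1.continuousAt) hat
    (.of_forall happ)
  have heq : ∀ᶠ q in l ×ˢ 𝓝 (0 : Plane), α q.1 q.2 = v q.1 q.2 := by
    filter_upwards [hvα, eventually_eventually_prod_nhds (P := fun i y => y ≠ 0 → α i y = v i y) hvα,
      hv.smooth, hαq] with q h1 h2 h3 h4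
    by_cases hq : q.2 = 0
    · have l1 := (h4 q.1).1.continuousAt.tendsto.mono_left (nhdsWithin_le_nhds (s := {q.2}ᶜ))
      have l2 := h3.continuousAt.tendsto.mono_left (nhdsWithin_le_nhds (s := {q.2}ᶜ))
      refine tendsto_nhds_unique (l1.congr' ?_) l2
      filter_upwards [h2.filter_mono nhdsWithin_le_nhds, self_mem_nhdsWithin] with y hy hyq
      exact hy (by rw [hq] at hyq; exact hyq)
    · exact h1 hq
  exact (hv.congr heq (Filter.EventuallyEq.refl _ _)).of_pure hi

/-- Near the singular point, shift functions which converge there converge pointwise. -/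
theorem eventually_tendsto_of_ctendsto (hG : HasZeroOfOrder G p) {ι : Type} {l : Filter ι} {r : ℕ}
    {h : ι → Plane → Plane} {α : ι → Plane → ℝ} {β : Plane → ℝ} {f : Plane → Plane}
    (hf : ContinuousAt f 0) (hf0 : f 0 = 0) (hα : CTendsto r l α β 0) (hβ : ContinuousAt β 0)
    (hflow : ∀ᶠ z in 𝓝 0, (∀ i, FlowsTo G z (α i z) (h i z)) ∧ FlowsTo G z (β z) (f z))
    (hh : ∀ᶠ z in 𝓝 0, Filter.Tendsto (fun i => h i z) l (𝓝 (f z)))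
    (hne : ∀ᶠ z in 𝓝 0, z ≠ 0 → f z ≠ 0) :
    ∀ᶠ z in 𝓝 0, z ≠ 0 → Filter.Tendsto (fun i => α i z) l (𝓝 (β z)) := by
  obtain ⟨F, hF⟩ := exists_isCutoffFlow hG.contDiff 1
  obtain ⟨ρ, hρ, c₀, hc₀, C, hC, hest⟩ := exists_flow_estimates hG hF one_pos
  have h1 : Filter.Tendsto (fun q : ι × Plane => α q.1 q.2 - β q.2) (l ×ˢ 𝓝 0) (𝓝 0) := by
    have := hα.tendsto_zero.sub (hβ.tendsto.comp Filter.tendsto_snd)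
    simpa using this
  have h2 : ∀ᶠ q in l ×ˢ 𝓝 (0 : Plane), |α q.1 q.2 - β q.2| < c₀ := by
    have := h1.abs.eventually_lt_const (u := c₀) (by simpa using hc₀)
    exact this
  have h3 : ∀ᶠ z in 𝓝 (0 : Plane), ‖f z‖ < min ρ 1 := by
    have := hf.norm.tendsto.eventually_lt_const (u := min ρ 1) (by rw [hf0]; simp [hρ])
    exact this
  obtain ⟨pa, ha, pb, hb, H⟩ := Filter.eventually_prod_iff.1 h2
  filter_upwards [hflow, hh, hne, h3, hb] with z hz1 hz2 hz3 hz4 hz5 hz0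
  have hfz := norm_pos_iff.2 (hz3 hz0)
  have h4 : ∀ᶠ i in l, |α i z - β z| ≤ C * ‖h i z - f z‖ / ‖f z‖ ^ p := by
    filter_upwards [ha] with i hi
    have hd : FlowsTo G (f z) (α i z - β z) (h i z) := by
      have := (hz1.2.symm hG.contDiff).trans hG.contDiff (hz1.1 i)
      rwa [neg_add_eq_sub] at this
    have hle : |α i z - β z| * ‖f z‖ ^ (p - 1) ≤ c₀ :=
      (mul_le_of_le_one_right (abs_nonneg _) (pow_le_one₀ hfz.le
        (hz4.trans_le (min_le_right _ _)).le)).trans (H hi hz5).le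
    obtain ⟨-, e2, e3⟩ := hest _ _ (hz4.trans_le (min_le_left _ _)) hle
    rw [e3.unique hG.contDiff hd] at e2
    rwa [le_div_iff₀ (by positivity)]
  have h5 : Filter.Tendsto (fun i => C * ‖h i z - f z‖ / ‖f z‖ ^ p) l (𝓝 0) := by
    have := ((hz2.sub_const (f z)).norm.const_mul C).div_const (‖f z‖ ^ p)
    simpa using this
  rw [tendsto_iff_norm_sub_tendsto_zero]
  exact squeeze_zero' (.of_forall fun _ => norm_nonneg _) h4 h5

theorem SmoothMaps.weakTopology_mono {F : Type} [NormedAddCommGroup F] [NormedSpace ℝ F]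
    (V : Opens Plane) {r s : ℕ} (h : r ≤ s) : weakTopology F V s ≤ weakTopology F V r := by
  rw [TopologicalSpace.le_def]
  intro U hU f hf
  obtain ⟨K, hK, hKV, ε, hε, H⟩ := hU f hf
  exact ⟨K, hK, hKV, ε, hε, fun k hk => H k fun j hj => hk j (hj.trans h)⟩

/-- A choice of smooth shift functions is tamely continuous; in degree two, provided that their
values at the singular point depend continuously on the map. -/
theorem StarChart.tamelyContinuousOn (h : StarChart G p g η φ B) {V : Opens Plane}
    (h0V : (0 : Plane) ∈ V) (hconn : IsConnected (V : Set Plane))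
    (hV : (V : Set Plane) ⊆ φ.source) {U : Set (SmoothMaps Plane V)}
    {σ : SmoothMaps Plane V → SmoothMaps ℝ V} (hσ : ∀ f ∈ U, IsShiftFunction G f (σ f))
    {s₀ : ℕ} (h0 : p = 1 → ∀ f ∈ U, Filter.Tendsto (fun k => (σ k).1 ⟨0, h0V⟩)
      (@nhdsWithin _ (SmoothMaps.weakTopology Plane V s₀) f U) (𝓝 ((σ f).1 ⟨0, h0V⟩))) :
    SmoothMaps.TamelyContinuousOn σ U := by
  have hG := h.hasZeroOfOrder
  have hVn : (V : Set Plane) ∈ 𝓝 (0 : Plane) := V.isOpen.mem_nhds h0V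
  intro r
  obtain ⟨s₁, hs₁⟩ := exists_ctendsto_shift_origin hG
    (hG.hasDivision h.star (h.unit_ne_zero 0) h.hasLeadingPart) r
  obtain ⟨s, hsr, hss₀, hss₁⟩ : ∃ s, r ≤ s ∧ s₀ ≤ s ∧ s₁ ≤ s :=
    ⟨max r (max s₀ s₁), le_max_left _ _, (le_max_left _ _).trans (le_max_right _ _),
      (le_max_right _ _).trans (le_max_right _ _)⟩
  refine ⟨s, fun f hf => ?_⟩
  let l : Filter U := Filter.comap Subtype.val (@nhds _ (SmoothMaps.weakTopology Plane V s) f)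
  have hl : @nhdsWithin _ (SmoothMaps.weakTopology Plane V s) f U = Filter.map Subtype.val l := by
    rw [Filter.map_comap, Subtype.range_coe]; rfl
  have hpure : (pure (⟨f, hf⟩ : U) : Filter U) ≤ l := by
    rw [← Filter.map_le_iff_le_comap, Filter.map_pure]
    exact @pure_le_nhds _ (SmoothMaps.weakTopology Plane V s) f
  let K : U → Plane → Plane := fun k => zeroExt k.1.1
  let α : U → Plane → ℝ := fun k => zeroExt (σ k.1).1
  let i₀ : U := ⟨f, hf⟩
  have hKs : ∀ i, ∀ z ∈ V, ContDiffAt ℝ ∞ (K i) z := fun i z hz => i.1.contDiffAt hz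
  have hαs : ∀ i, ∀ z ∈ V, ContDiffAt ℝ ∞ (α i) z := fun i z hz => (σ i.1).contDiffAt hz
  have hflow : ∀ i, ∀ z ∈ V, FlowsTo G z (α i z) (K i z) := fun i z hz => by
    have := hσ i.1 i.2 ⟨z, hz⟩
    rwa [← zeroExt_apply (i.1).1 ⟨z, hz⟩, ← zeroExt_apply (σ i.1).1 ⟨z, hz⟩] at this
  have hconv : ∀ z ∈ V, CTendsto s l K (K i₀) z := fun z hz => by
    have h1 := f.ctendsto_nhds s hz
    have h2 : Filter.Tendsto (Prod.map Subtype.val id) (l ×ˢ 𝓝 z)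
        (@nhds _ (SmoothMaps.weakTopology Plane V s) f ×ˢ 𝓝 z) :=
      Filter.tendsto_comap.prodMap Filter.tendsto_id
    exact ⟨h2.eventually h1.smooth, h1.smooth_lim, fun k hk => (h1.tendsto k hk).comp h2⟩
  have horigin : CTendsto r l α (α i₀) 0 := by
    refine hs₁ hpure ((hconv 0 h0V).mono hss₁) (fun i => hKs i 0 h0V) ?_ fun hp => ?_
    · filter_upwards [hVn] with z hz i using ⟨hαs i z hz, hflow i z hz⟩
    · have h1 := h0 hp f hf
      have hle : Filter.map Subtype.val l ≤
          @nhdsWithin _ (SmoothMaps.weakTopology Plane V s₀) f U := by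
        rw [← hl]
        exact inf_le_inf_right _ (nhds_mono (SmoothMaps.weakTopology_mono V hss₀))
      have h2 := Filter.tendsto_map'_iff.1 (h1.mono_left hle)
      have e : ∀ i : U, α i 0 = (σ i.1).1 ⟨0, h0V⟩ := fun i => zeroExt_apply _ (⟨0, h0V⟩ : V)
      simp only [e]
      exact h2
  have hnear := eventually_tendsto_of_ctendsto hG (f := K i₀) (hKs i₀ 0 h0V).continuousAt
    ((hflow i₀ 0 h0V).eq_of_zero hG.contDiff hG.map_zero) horigin (hαs i₀ 0 h0V).continuousAt
    (by filter_upwards [hVn] with z hz using ⟨fun i => hflow i z hz, hflow i₀ z hz⟩)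
    (by
      filter_upwards [hVn] with z hz
      exact (hconv z hz).tendsto_zero.comp (Filter.tendsto_id.prodMk tendsto_const_nhds))
    (by
      filter_upwards [hVn] with z hz hz0 hfz
      have := (hflow i₀ z hz).ne_zero hG.contDiff (h.ne_zero (hV hz) hz0)
      rw [hfz] at this
      exact this hG.map_zero)
  let P : Plane → Prop := fun z => z ≠ 0 → Filter.Tendsto (fun i => α i z) l (𝓝 (α i₀ z))
  have hOpen : IsOpen ((V : Set Plane) ∩ {0}ᶜ) := V.isOpen.inter isOpen_compl_singleton
  have hbox : ∀ z ∈ V, z ≠ 0 → ∃ N ∈ 𝓝 z, ∀ z₁ ∈ N,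
      Filter.Tendsto (fun i => α i z₁) l (𝓝 (α i₀ z₁)) →
      CTendsto r l α (α i₀) z ∧ ∀ w ∈ N, Filter.Tendsto (fun i => α i w) l (𝓝 (α i₀ w)) :=
    fun z hz hz0 => exists_nhds_ctendsto_shift hG.contDiff hOpen ⟨hz, hz0⟩
      (h.ne_zero (hV hz) hz0) (fun w hw => (hconv w hw.1).mono hsr) (hKs i₀ z hz)
      (fun w hw => (hαs i₀ w hw.1).continuousAt.continuousWithinAt)
      (fun i w hw => (hαs i w hw.1).continuousAt.continuousWithinAt)
      (fun w hw => hflow i₀ w hw.1) fun i w hw => hflow i w hw.1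
  have hall : ∀ z ∈ (V : Set Plane), P z := by
    intro z hz
    refine (hconn.isPreconnected.induction₂ (fun x y => P x ↔ P y) (fun x hx => ?_)
      (fun _ _ _ _ _ _ => Iff.trans) (fun _ _ _ _ => Iff.symm) h0V hz).1 fun hcon => (hcon rfl).elim
    by_cases hx0 : x = 0
    · subst hx0
      filter_upwards [hnear.filter_mono nhdsWithin_le_nhds] with y hy
      exact ⟨fun _ => hy, fun _ hcon => (hcon rfl).elim⟩
    · obtain ⟨N, hN, H⟩ := hbox x hx hx0
      filter_upwards [nhdsWithin_le_nhds hN, nhdsWithin_le_nhds (isOpen_ne.mem_nhds hx0)] with y hy hy0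
      exact ⟨fun hP _ => (H x (mem_of_mem_nhds hN) (hP hx0)).2 y hy,
        fun hP _ => (H y hy (hP hy0)).2 x (mem_of_mem_nhds hN)⟩
  have hfin : ∀ z ∈ V, CTendsto r l α (α i₀) z := by
    intro z hz
    by_cases hz0 : z = 0
    · rw [hz0]; exact horigin
    · obtain ⟨N, hN, H⟩ := hbox z hz hz0
      exact (H z (mem_of_mem_nhds hN) (hall z hz hz0)).1
  have := SmoothMaps.tendsto_of_ctendsto (σ := fun i : U => σ i.1) (f := σ f) hfin
  change Filter.Tendsto σ (@nhdsWithin _ (SmoothMaps.weakTopology Plane V s) f U)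
    (@nhds _ (SmoothMaps.weakTopology ℝ V r) (σ f))
  rw [hl, Filter.tendsto_map'_iff]
  exact this

end Continuity

/-! ### The period function of a center -/

section Period

variable {G : Plane → Plane} {p : ℕ} {g : MvPolynomial (Fin 2) ℝ} {η : Plane → ℝ}
  {φ : OpenPartialHomeomorph Plane Plane} {B : Plane ≃L[ℝ] Plane} {R : ℝ} {F : Plane → ℝ → Plane}

/-- An integral curve of `G` up to a change of time, given by its speed `k`. -/
theorem IsCutoffFlow.flowsTo_integral (hF : IsCutoffFlow G R F) {c : ℝ → Plane} {k : ℝ → ℝ} {T : ℝ}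
    (hT : 0 ≤ T) {O : Set ℝ} (hO : IsOpen O) (hKO : Icc 0 T ⊆ O) (hk : ContinuousOn k O)
    (hc : ∀ s ∈ Icc 0 T, HasDerivAt c (k s • G (c s)) s)
    (hcR : ∀ s ∈ Icc 0 T, c s ∈ Metric.ball (0 : Plane) R) :
    FlowsTo G (c 0) (∫ u in (0 : ℝ)..T, k u) (c T) := by
  have h0T : (0 : ℝ) ∈ Icc 0 T := ⟨le_rfl, hT⟩
  have hTT : T ∈ Icc 0 T := ⟨hT, le_rfl⟩
  let t : ℝ → ℝ := fun s => ∫ u in (0 : ℝ)..s, k u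
  have ht0 : t 0 = 0 := intervalIntegral.integral_same
  have ht : ∀ s ∈ Icc 0 T, HasDerivAt t (k s) s := by
    intro s hs
    refine intervalIntegral.integral_hasDerivAt_right ?_
      (hk.stronglyMeasurableAtFilter hO s (hKO hs)) (hk.continuousAt (hO.mem_nhds (hKO hs)))
    refine (hk.mono fun u hu => hKO ?_).intervalIntegrable
    rw [uIcc_of_le hs.1] at hu
    exact ⟨hu.1, hu.2.trans hs.2⟩
  have htc : ContinuousOn t (Icc 0 T) := fun s hs => (ht s hs).continuousAt.continuousWithinAt
  have heq : ∀ s ∈ Icc 0 T, c s = F (c 0) (t s) := by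
    obtain ⟨Gt, h1, h2⟩ := hF
    obtain ⟨K, hK⟩ := h1.lipschitz
    obtain ⟨M, hM⟩ := isCompact_Icc.exists_bound_of_continuousOn (hk.mono hKO)
    refine ODE_solution_unique_of_mem_Icc_right (v := fun s y => k s • Gt y) (s := fun _ => univ)
      (K := M.toNNReal * K) (fun s hs => ?_) (fun s hs => (hc s hs).continuousAt.continuousWithinAt)
      (fun s hs => ?_) (fun _ _ => mem_univ _)
      (fun s hs => (((h1.hasDerivAt _ _).scomp s (ht s hs)).continuousAt).continuousWithinAt)
      (fun s hs => ((h1.hasDerivAt _ _).scomp s (ht s (Ico_subset_Icc_self hs))).hasDerivWithinAt)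
      (fun _ _ => mem_univ _) ?_
    · refine LipschitzWith.lipschitzOnWith (LipschitzWith.of_dist_le_mul fun x y => ?_)
      rw [dist_smul₀, NNReal.coe_mul, mul_assoc]
      exact mul_le_mul ((hM s (Ico_subset_Icc_self hs)).trans (Real.le_coe_toNNReal M))
        (hK.dist_le_mul x y) dist_nonneg NNReal.zero_le_coe
    · rw [h2 _ (hcR s (Ico_subset_Icc_self hs))]
      exact (hc s (Ico_subset_Icc_self hs)).hasDerivWithinAt
    · simp only [ht0, h1.zero]
  rw [heq T hTT]
  refine hF.flowsTo fun r hr => ?_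
  -- The intermediate values of the time change are all attained.
  obtain ⟨s, hs, rfl⟩ : r ∈ t '' Icc 0 T := by
    have hpre := (isPreconnected_Icc (a := (0 : ℝ)) (b := T)).image t htc
    refine hpre.ordConnected.uIcc_subset ⟨0, h0T, ht0⟩ ⟨T, hTT, rfl⟩ hr
  rw [← heq s hs]
  exact hcR s hs

/-- In degree two, the trajectories near the origin are closed if the eigenvalues of the linear
part are imaginary: in the chart they are the orbits of the linear Hamiltonian field. Their period
`θ` is a smooth function. In the remaining case `T = 0` and there is nothing to prove. -/
theorem StarChart.exists_period (h : StarChart G 1 g η φ B) {ν T : ℝ} {C S asn : ℝ → ℝ}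
    (hν : ν ≠ 0) {L : Plane →L[ℝ] Plane} (hL : ∀ z, B (L z) = η 0 • hamiltonianField g (B z))
    (hLL : L.comp L = ν • ContinuousLinearMap.id ℝ Plane) (hT : TrigPair ν C S asn T) :
    ∃ W ∈ 𝓝 (0 : Plane), W ⊆ φ.source ∧ ∃ θ : Plane → ℝ, θ 0 = T ∧
      ∀ z ∈ W, ContDiffAt ℝ ∞ θ z ∧ FlowsTo G z (θ z) z := by
  rcases hν.lt_or_gt with hneg | hpos
  swap
  · refine ⟨φ.source, h.source_mem_nhds, subset_rfl, fun _ => 0, (hT.period_pos hpos).symm,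
      fun z _ => ⟨contDiffAt_const, FlowsTo.refl z⟩⟩
  have hG := h.hasZeroOfOrder
  obtain ⟨F, hF⟩ := exists_isCutoffFlow h.contDiff 1
  obtain ⟨μ, hμ, M, -, -, -, -, -, -, hM, hMM, -⟩ :=
    h.star.exists_linear_part (ContinuousLinearEquiv.refl ℝ Plane) (one_ne_zero (α := ℝ))
  have hM : ∀ z, M z = hamiltonianField g z := fun z => by simpa using hM z
  have hMMz : ∀ z, M (M z) = μ • z := fun z => by simpa using DFunLike.congr_fun hMM z
  set e := η 0 with he
  have he0 : e ≠ 0 := h.unit_ne_zero 0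
  have hνμ : ν = e ^ 2 * μ := by
    have h1 : ∀ z, B (ν • z) = (e ^ 2 * μ) • B z := fun z => by
      have h2 : L (L z) = ν • z := by simpa using DFunLike.congr_fun hLL z
      rw [← h2, hL, ← hM, hL, ← hM, map_smul, hMMz, smul_smul, smul_smul]
      congr 1; ring
    have h3 := h1 (B.symm (EuclideanSpace.single 0 1))
    rw [map_smul, B.apply_symm_apply] at h3
    simpa using congrArg (fun v : Plane => v 0) h3
  have hμneg : μ < 0 := by
    by_contra hcon
    have : 0 ≤ e ^ 2 * μ := mul_nonneg (sq_nonneg _) (not_lt.1 hcon)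
    linarith
  obtain ⟨C', S', asn', T', hT'⟩ := exists_trigPair hμ
  have hTT : T' / e = T ∨ T' / e = -T := by
    rw [hT.period_neg hneg, hT'.period_neg hμneg, hνμ, neg_mul_eq_mul_neg,
      Real.sqrt_mul (sq_nonneg e), Real.sqrt_sq_eq_abs]
    rcases abs_choice e with h1 | h1
    · left; rw [h1]; field_simp
    · right; rw [h1]; field_simp
  have hT'0 : 0 ≤ T' := by rw [hT'.period_neg hμneg]; positivity
  -- The flow of the linear Hamiltonian field in the chart.
  let Q : ℝ → Plane →L[ℝ] Plane := fun s => C' s • ContinuousLinearMap.id ℝ Plane + S' s • M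
  have hQd : ∀ s, HasDerivAt Q (M.comp (Q s)) s := by
    intro s
    refine (((hT'.hasDerivAt_cos s).smul_const (ContinuousLinearMap.id ℝ Plane)).add
      ((hT'.hasDerivAt_sin s).smul_const M)).congr_deriv ?_
    ext1 z
    simp [Q, hMMz, smul_smul, mul_comm]
    abel
  have hQc : Continuous Q := continuous_iff_continuousAt.2 fun s => (hQd s).continuousAt
  have hQ0 : Q 0 = ContinuousLinearMap.id ℝ Plane := by
    ext1 z; simp [Q, hT'.cos_zero, hT'.sin_zero]
  have hQT : Q T' = ContinuousLinearMap.id ℝ Plane := by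
    ext1 z; simp [Q, hT'.cos_period, hT'.sin_period]
  obtain ⟨K, hK⟩ := isCompact_Icc.exists_bound_of_continuousOn (hQc.continuousOn (s := Icc 0 T'))
  have hK0 : 0 ≤ K := (norm_nonneg _).trans (hK 0 ⟨le_rfl, hT'0⟩)
  obtain ⟨r, hr, hball⟩ : ∃ r > 0, ∀ w ∈ Metric.ball (0 : Plane) r, w ∈ φ.target ∧
      φ.symm w ∈ Metric.ball (0 : Plane) 1 ∧ |(η (φ.symm w))⁻¹| ≤ |e⁻¹| + 1 := by
    have h1 : ContinuousAt φ.symm 0 := (h.contDiffAt_symm h.zero_mem_target).continuousAt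
    have h2 : ∀ᶠ w in 𝓝 (0 : Plane), φ.symm w ∈ Metric.ball (0 : Plane) 1 :=
      h1.eventually (Metric.isOpen_ball.mem_nhds (by rw [h.symm_zero]; exact Metric.mem_ball_self one_pos))
    have h3 : ContinuousAt (fun w => |(η (φ.symm w))⁻¹|) 0 :=
      ((h.contDiff_unit.continuous.continuousAt.comp h1).inv₀ (h.unit_ne_zero _)).abs
    have h4 := h3.eventually_le_const (u := |e⁻¹| + 1) (by beta_reduce; rw [h.symm_zero]; linarith)
    obtain ⟨r, hr, H⟩ := Metric.eventually_nhds_iff_ball.1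
      ((φ.open_target.eventually_mem h.zero_mem_target).and (h2.and h4))
    exact ⟨r, hr, H⟩
  let k : Plane → ℝ → ℝ := fun z s => (η (φ.symm (Q s (φ z))))⁻¹
  let W : Set Plane := φ.source ∩ φ ⁻¹' Metric.ball (0 : Plane) (r / (K + 1))
  have hWo : IsOpen W := φ.isOpen_inter_preimage Metric.isOpen_ball
  have hW0 : (0 : Plane) ∈ W := ⟨h.mem_source, by
    rw [mem_preimage, h.map_zero]; exact Metric.mem_ball_self (by positivity)⟩
  have hWn : W ∈ 𝓝 (0 : Plane) := hWo.mem_nhds hW0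
  have hQW : ∀ z ∈ W, ∀ s ∈ Icc 0 T', Q s (φ z) ∈ Metric.ball (0 : Plane) r := by
    intro z hz s hs
    have h1 := hz.2
    rw [mem_preimage, mem_ball_zero_iff, lt_div_iff₀ (by positivity)] at h1
    rw [mem_ball_zero_iff]
    calc ‖Q s (φ z)‖ ≤ K * ‖φ z‖ := (Q s).le_of_opNorm_le (hK s hs) _
      _ ≤ ‖φ z‖ * (K + 1) := by nlinarith [norm_nonneg (φ z)]
      _ < r := h1
  have hkc : ∀ z s, Q s (φ z) ∈ Metric.ball (0 : Plane) r →
      ContinuousAt (fun w => (η (φ.symm w))⁻¹) (Q s (φ z)) := fun z s hz =>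
    (h.contDiff_unit.continuous.continuousAt.comp
      (h.contDiffAt_symm (hball _ hz).1).continuousAt).inv₀ (h.unit_ne_zero _)
  let O : Plane → Set ℝ := fun z => {s | Q s (φ z) ∈ Metric.ball (0 : Plane) r}
  have hQz : ∀ w, Continuous fun s => Q s w := fun w => hQc.clm_apply continuous_const
  have hO : ∀ z, IsOpen (O z) := fun z => Metric.isOpen_ball.preimage (hQz (φ z))
  have hkO : ∀ z, ContinuousOn (k z) (O z) := fun z s hs =>
    ((hkc z s hs).comp (f := fun s => Q s (φ z)) (hQz (φ z)).continuousAt).continuousWithinAt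
  let θ : Plane → ℝ := fun z => ∫ s in (0 : ℝ)..T', k z s
  have hθc : ∀ z ∈ W, ContinuousAt θ z := by
    intro z hz
    have hI : ∀ s ∈ uIoc 0 T', s ∈ Icc 0 T' := fun s hs => by
      rw [uIoc_of_le hT'0] at hs; exact Ioc_subset_Icc_self hs
    refine intervalIntegral.continuousAt_of_dominated_interval (bound := fun _ => |e⁻¹| + 1) ?_ ?_
      intervalIntegrable_const (.of_forall fun s hs => ?_)
    · filter_upwards [hWo.mem_nhds hz] with y hy
      exact ((hkO y).mono fun s hs => hQW y hy s (hI s hs)).aestronglyMeasurable measurableSet_uIoc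
    · filter_upwards [hWo.mem_nhds hz] with y hy
      exact .of_forall fun s hs => (hball _ (hQW y hy s (hI s hs))).2.2
    · exact (hkc z s (hQW z hz s (hI s hs))).comp (f := fun y => Q s (φ y))
        ((Q s).continuous.continuousAt.comp (h.contDiffAt hz.1).continuousAt)
  have hθ0 : θ 0 = T' / e := by
    have h1 : k 0 = fun _ => e⁻¹ := by
      funext s; simp only [k, h.map_zero, (Q s).map_zero, h.symm_zero, ← he]
    change ∫ s in (0 : ℝ)..T', k 0 s = _
    rw [h1, intervalIntegral.integral_const, sub_zero, smul_eq_mul, div_eq_mul_inv]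
  have hflow : ∀ z ∈ W, FlowsTo G z (θ z) z := by
    intro z hz
    have := hF.flowsTo_integral (c := fun s => φ.symm (Q s (φ z))) hT'0 (hO z) (hQW z hz) (hkO z)
      (fun s hs => ?_) fun s hs => (hball _ (hQW z hz s hs)).2.1
    · simp only [hQ0, hQT, ContinuousLinearMap.id_apply, φ.left_inv hz.1] at this
      exact this
    · have hw := (hball _ (hQW z hz s hs)).1
      have h1 : HasDerivAt (fun s => Q s (φ z)) (M (Q s (φ z))) s := by
        simpa using (hQd s).clm_apply (hasDerivAt_const s (φ z))
      have h2 := ((h.contDiffAt_symm hw).differentiableAt (by simp)).hasFDerivAt.comp_hasDerivAt s h1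
      refine h2.congr_deriv ?_
      have hx := φ.map_target hw
      have h3 := h.eq _ hx
      rw [φ.right_inv hw, ← hM] at h3
      have h4 := DFunLike.congr_fun (fderiv_symm_comp h.contDiffOn h.contDiffOn_symm hx)
        (G (φ.symm (Q s (φ z))))
      rw [ContinuousLinearMap.comp_apply, h3, φ.right_inv hw, map_smul,
        ContinuousLinearMap.id_apply] at h4
      rw [← h4, smul_smul, inv_mul_cancel₀ (h.unit_ne_zero _), one_smul]
  have hDG := fderiv_eq_of_hasLeadingPart hG.map_zero h.hasLeadingPart hL
  have hlin : linearFlow F T = ContinuousLinearMap.id ℝ Plane := by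
    rw [hF.linearFlow_eq hG one_pos hT hDG hLL, hT.cos_period, hT.sin_period]
    ext1 z; simp
  have hlinθ : linearFlow F (θ 0) = ContinuousLinearMap.id ℝ Plane := by
    rw [hθ0]
    rcases hTT with h1 | h1
    · rw [h1, hlin]
    · have := hF.linearFlow_neg_comp hG one_pos T
      rw [hlin, ContinuousLinearMap.comp_id] at this
      rw [h1, this]
  have hsm : ∀ z ∈ W, ContDiffAt ℝ ∞ θ z := by
    intro z hz
    by_cases hz0 : z = 0
    · subst hz0
      have hlim : Filter.Tendsto (fun z => |θ z - θ 0| * ‖z‖ ^ (1 - 1)) (𝓝[≠] 0) (𝓝 0) := by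
        have h1 : ContinuousAt (fun z => |θ z - θ 0| * ‖z‖ ^ (1 - 1)) 0 :=
          ((hθc 0 hz).sub continuousAt_const).abs.mul (by fun_prop)
        have h2 := h1.tendsto
        rw [sub_self, abs_zero, zero_mul] at h2
        exact h2.mono_left nhdsWithin_le_nhds
      obtain ⟨c, hc⟩ := exists_contDiffAt_update hG
        (hG.hasDivision h.star (h.unit_ne_zero 0) h.hasLeadingPart) hF one_pos
        (h := fun z => z) (α := θ) (a := θ 0) contDiffAt_id rfl
        (by filter_upwards [hWn] with z hz using hflow z hz)
        (by filter_upwards [hWn] with z hz _ using hθc z hz)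
        (approxShift_const hG hF one_pos contDiffAt_id rfl (by rw [hlinθ]; exact fderiv_id) hlim)
      have hc' : c = θ 0 := by
        have l1 := hc.continuousAt.tendsto.mono_left (nhdsWithin_le_nhds (s := {(0 : Plane)}ᶜ))
        rw [Function.update_self] at l1
        refine tendsto_nhds_unique (l1.congr' ?_)
          ((hθc 0 hz).tendsto.mono_left nhdsWithin_le_nhds)
        filter_upwards [self_mem_nhdsWithin] with z hz using Function.update_of_ne hz _ _
      rwa [hc', Function.update_eq_self] at hc
    · exact contDiffAt_shift_of_ne_zero hG.contDiff (h.ne_zero hz.1 hz0) contDiffAt_id (hθc z hz)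
        (by filter_upwards [hWo.mem_nhds hz] with y hy using hflow y hy)
  rcases hTT with h1 | h1
  · exact ⟨W, hWn, inter_subset_left, θ, by rw [hθ0, h1], fun z hz => ⟨hsm z hz, hflow z hz⟩⟩
  · exact ⟨W, hWn, inter_subset_left, fun z => -θ z, by beta_reduce; rw [hθ0, h1, neg_neg],
      fun z hz => ⟨(hsm z hz).neg, (hflow z hz).symm hG.contDiff⟩⟩

end Period

/-! ### Choice of the shift functions -/

section Choice

variable {G : Plane → Plane} {p : ℕ} {g : MvPolynomial (Fin 2) ℝ} {η : Plane → ℝ}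
  {φ : OpenPartialHomeomorph Plane Plane} {B : Plane ≃L[ℝ] Plane} {R : ℝ} {F : Plane → ℝ → Plane}

theorem TrigPair.sq_sub_sq {ν T : ℝ} {C S asn : ℝ → ℝ} (h : TrigPair ν C S asn T) (s : ℝ) :
    C s ^ 2 - ν * S s ^ 2 = 1 := by
  have hd : ∀ s, HasDerivAt (fun s => C s ^ 2 - ν * S s ^ 2) 0 s := fun s =>
    (((h.hasDerivAt_cos s).pow 2).sub (((h.hasDerivAt_sin s).pow 2).const_mul ν)).congr_deriv
      (by simp; ring)
  have := is_const_of_deriv_eq_zero (fun s => (hd s).differentiableAt) (fun s => (hd s).deriv) s 0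
  rw [this, h.cos_zero, h.sin_zero]; ring

/-- For `deg g ≥ 3`, any choice of smooth shift functions is tamely continuous. -/
theorem StarChart.exists_tame_of_two_le (h : StarChart G p g η φ B) (hp : 2 ≤ p) {V : Opens Plane}
    (h0V : (0 : Plane) ∈ V) (hconn : IsConnected (V : Set Plane))
    (hV : (V : Set Plane) ⊆ φ.source) :
    ∃ σ : SmoothMaps Plane V → SmoothMaps ℝ V,
      SmoothMaps.TamelyContinuousOn σ (orbitMapsId G V) ∧
      ∀ k ∈ orbitMapsId G V, IsShiftFunction G k (σ k) := by
  have : ∀ k : SmoothMaps Plane V, ∃ α : SmoothMaps ℝ V,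
      k ∈ orbitMapsId G V → IsShiftFunction G k α := by
    intro k
    by_cases hk : k ∈ orbitMapsId G V
    · obtain ⟨α, hα⟩ := h.exists_isShiftFunction h0V hV hk
      exact ⟨α, fun _ => hα⟩
    · exact ⟨⟨fun _ => 0, (contDiffOn_const (c := (0 : ℝ))).congr fun x hx =>
        zeroExt_apply (fun _ : V => (0 : ℝ)) (⟨x, hx⟩ : V)⟩, fun h => absurd h hk⟩
  choose σ hσ using this
  exact ⟨σ, h.tamelyContinuousOn (s₀ := 0) h0V hconn hV hσ (fun hp1 => by omega), hσ⟩

/-- In degree two, near `f`, the shift functions can be normalized, by adding integer multiples of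
the period function, so that their values at the origin are close to that of `f`. -/
theorem StarChart.exists_nhds_tame (h : StarChart G 1 g η φ B) : ∃ W ∈ 𝓝 (0 : Plane),
    ∀ V : Opens Plane, (0 : Plane) ∈ V → IsConnected (V : Set Plane) → (V : Set Plane) ⊆ W →
      ∀ f ∈ orbitMapsId G V, ∃ U ⊆ orbitMapsId G V,
        U ∈ @nhdsWithin _ (SmoothMaps.weakTopology Plane V 1) f (orbitMapsId G V) ∧
        ∃ σ : SmoothMaps Plane V → SmoothMaps ℝ V,
          SmoothMaps.TamelyContinuousOn σ U ∧ ∀ k ∈ U, IsShiftFunction G k (σ k) := by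
  have hG := h.hasZeroOfOrder
  obtain ⟨F, hF⟩ := exists_isCutoffFlow h.contDiff 1
  obtain ⟨ν, hν, L, X, Y, -, hX, hY, -, hL, hLL, hXY, -, -⟩ :=
    h.star.exists_linear_part B (h.unit_ne_zero 0)
  obtain ⟨C, S, asn, T, hT⟩ := exists_trigPair hν
  have hDG := fderiv_eq_of_hasLeadingPart hG.map_zero h.hasLeadingPart hL
  obtain ⟨W, hW, hWs, θ, hθ0, hθ⟩ := h.exists_period hν hL hLL hT
  refine ⟨W, hW, fun V h0V hconn hVW f hf => ?_⟩
  have hVs := hVW.trans hWs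
  have hVn : (V : Set Plane) ∈ 𝓝 (0 : Plane) := V.isOpen.mem_nhds h0V
  obtain ⟨αf, hαf⟩ := h.exists_isShiftFunction h0V hVs hf
  let o : V := ⟨0, h0V⟩
  -- The derivatives at the origin, in the coordinates `X`, `Y` and relative to that of `f`.
  let D : SmoothMaps Plane V → Plane →L[ℝ] Plane := fun k =>
    (linearFlow F (-(αf.1 o))).comp (fderiv ℝ (zeroExt k.1) 0)
  have hD : ∀ k, Filter.Tendsto D (@nhds _ (SmoothMaps.weakTopology Plane V 1) k) (𝓝 (D k)) := by
    intro k
    have h1 := (k.ctendsto_nhds 1 h0V).tendsto_fderiv le_rfl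
    have h2 : Filter.Tendsto (fun k' : SmoothMaps Plane V => (k', (0 : Plane)))
        (@nhds _ (SmoothMaps.weakTopology Plane V 1) k)
        (@nhds _ (SmoothMaps.weakTopology Plane V 1) k ×ˢ 𝓝 0) :=
      Filter.tendsto_id.prodMk tendsto_const_nhds
    have h3 : Continuous fun A : Plane →L[ℝ] Plane => (linearFlow F (-(αf.1 o))).comp A := by fun_prop
    exact (h3.tendsto _).comp (h1.comp h2)
  have hDα : ∀ k : SmoothMaps Plane V, ∀ α : SmoothMaps ℝ V, IsShiftFunction G k α →
      D k = linearFlow F (α.1 o - αf.1 o) := by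
    intro k α hα
    have hd : DifferentiableAt ℝ (zeroExt α.1) 0 := (α.contDiffAt h0V).differentiableAt (by simp)
    have h1 := fderiv_eq_linearFlow hG hF one_pos (h := zeroExt k.1) hd (by
      filter_upwards [hVn] with z hz
      have := hα ⟨z, hz⟩
      rwa [← zeroExt_apply k.1 ⟨z, hz⟩, ← zeroExt_apply α.1 ⟨z, hz⟩] at this)
    have h2 : zeroExt α.1 (0 : Plane) = α.1 o := zeroExt_apply _ o
    simp only [D]
    rw [h1, h2, ← hF.linearFlow_add hG one_pos, sub_eq_add_neg]
  have hlf : ∀ s, X (linearFlow F s) = C s ∧ Y (linearFlow F s) = S s := fun s => by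
    rw [hF.linearFlow_eq hG one_pos hT hDG hLL]; exact hXY _ _
  let U : Set (SmoothMaps Plane V) := {k | k ∈ orbitMapsId G V ∧ 0 < X (D k)}
  have key : ∀ k : SmoothMaps Plane V, ∃ α : SmoothMaps ℝ V, k ∈ U → IsShiftFunction G k α ∧
      α.1 o = αf.1 o + asn (Y (D k)) := by
    intro k
    by_cases hk : k ∈ U
    swap
    · exact ⟨αf, fun h => absurd h hk⟩
    obtain ⟨α, hα⟩ := h.exists_isShiftFunction h0V hVs hk.1
    have hDk := hDα k α hα
    set d := α.1 o - αf.1 o with hd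
    obtain ⟨hXd, hYd⟩ := hlf d
    have hasn := hT.asn_spec (C d) (S d) (by rw [← hXd, ← hDk]; exact hk.2) (hT.sq_sub_sq d)
    have heq : linearFlow F (asn (S d)) = linearFlow F d := by
      rw [hF.linearFlow_eq hG one_pos hT hDG hLL, hF.linearFlow_eq hG one_pos hT hDG hLL,
        hasn.1, hasn.2]
    have hid : linearFlow F (d - asn (S d)) = linearFlow F 0 := by
      rw [sub_eq_add_neg, hF.linearFlow_add hG one_pos, ← heq, hF.linearFlow_neg_comp hG one_pos,
        hF.linearFlow_zero]
    obtain ⟨n, hn⟩ := hT.exists_int (d - asn (S d)) (by rw [← (hlf _).1, hid, (hlf _).1, hT.cos_zero])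
      (by rw [← (hlf _).2, hid, (hlf _).2, hT.sin_zero])
    have hper : ∀ z ∈ V, FlowsTo G z (-(n * θ z)) z := by
      intro z hz
      have h1 := (hθ z (hVW hz)).2
      have hnat : ∀ m : ℕ, FlowsTo G z (m * θ z) z := by
        intro m
        induction m with
        | zero => simpa using FlowsTo.refl z
        | succ m ih =>
          have := ih.trans hG.contDiff h1
          rwa [show (m : ℝ) * θ z + θ z = ((m + 1 : ℕ) : ℝ) * θ z by push_cast; ring] at this
      rcases Int.eq_nat_or_neg n with ⟨m, rfl | rfl⟩
      · simpa using (hnat m).symm hG.contDiff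
      · simpa using hnat m
    have hsm : ContDiffOn ℝ ∞ (zeroExt fun z : V => -(n * θ z) + α.1 z) (V : Set Plane) := by
      intro z hz
      have h1 : ContDiffAt ℝ ∞ (fun z => -(n * θ z) + zeroExt α.1 z) z :=
        (contDiffAt_const.mul (hθ z (hVW hz)).1).neg.add (α.contDiffAt hz)
      refine (h1.congr_of_eventuallyEq ?_).contDiffWithinAt
      filter_upwards [V.isOpen.mem_nhds hz] with w hw
      rw [zeroExt_apply _ (⟨w, hw⟩ : V), zeroExt_apply α.1 (⟨w, hw⟩ : V)]
    refine ⟨⟨_, hsm⟩, fun _ => ⟨fun z => (hper z z.2).trans hG.contDiff (hα z), ?_⟩⟩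
    change -(n * θ 0) + α.1 o = _
    rw [hθ0, ← hn, hDk, hYd]
    ring
  choose σ hσ using key
  refine ⟨U, fun k hk => hk.1, ?_, σ, ?_, fun k hk => (hσ k hk).1⟩
  · have hDf : 0 < X (D f) := by
      rw [hDα f αf hαf, sub_self, (hlf 0).1, hT.cos_zero]; exact one_pos
    have h1 : ∀ᶠ k in @nhds _ (SmoothMaps.weakTopology Plane V 1) f, 0 < X (D k) :=
      ((hX.tendsto _).comp (hD f)).eventually_const_lt hDf
    exact Filter.mem_of_superset (Filter.inter_mem
      (Filter.mem_inf_of_right (Filter.mem_principal_self _)) (Filter.mem_inf_of_left h1))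
      fun k hk => hk
  · refine h.tamelyContinuousOn (s₀ := 1) h0V hconn hVs (fun k hk => (hσ k hk).1) fun _ k hk => ?_
    have h1 : Filter.Tendsto (fun k' => αf.1 o + asn (Y (D k')))
        (@nhdsWithin _ (SmoothMaps.weakTopology Plane V 1) k U)
        (𝓝 (αf.1 o + asn (Y (D k)))) :=
      (((hT.continuous_asn.comp hY).tendsto _).comp ((hD k).mono_left inf_le_left)).const_add _
    rw [← (hσ k hk).2] at h1
    refine h1.congr' ?_
    exact Filter.mem_of_superset (Filter.mem_inf_of_right (Filter.mem_principal_self _))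
      fun k' hk' => (hσ k' hk').2.symm

end Choice

end PlaneShift

theorem theorem3p2 (G : PlaneShift.Plane → PlaneShift.Plane) (hG : ContDiff ℝ ∞ G)
    (p : ℕ) (g : MvPolynomial (Fin 2) ℝ) (hGg : PlaneShift.FieldStar G p g) :
    ∃ W ∈ 𝓝 (0 : PlaneShift.Plane), ∀ V : Opens PlaneShift.Plane,
      (0 : PlaneShift.Plane) ∈ V → IsConnected (V : Set PlaneShift.Plane) →
      (V : Set PlaneShift.Plane) ⊆ W →
      (∀ f ∈ PlaneShift.orbitMapsId G V,
        ∃ U : Set (PlaneShift.SmoothMaps PlaneShift.Plane V),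
          U ⊆ PlaneShift.orbitMapsId G V ∧
          U ∈ @nhdsWithin _ (PlaneShift.SmoothMaps.weakTopology PlaneShift.Plane V p) f
            (PlaneShift.orbitMapsId G V) ∧
          ∃ σ : PlaneShift.SmoothMaps PlaneShift.Plane V → PlaneShift.SmoothMaps ℝ V,
            PlaneShift.SmoothMaps.TamelyContinuousOn σ U ∧
            ∀ h ∈ U, PlaneShift.IsShiftFunction G h (σ h)) ∧
      (3 ≤ g.totalDegree →
        ∃ σ : PlaneShift.SmoothMaps PlaneShift.Plane V → PlaneShift.SmoothMaps ℝ V,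
          PlaneShift.SmoothMaps.TamelyContinuousOn σ (PlaneShift.orbitMapsId G V) ∧
          ∀ h ∈ PlaneShift.orbitMapsId G V, PlaneShift.IsShiftFunction G h (σ h)) := by
  obtain ⟨η, φ, B, h⟩ := hGg.exists_starChart hG
  rcases h.star.one_le.eq_or_lt with hp | hp
  · subst hp
    obtain ⟨W, hW, H⟩ := h.exists_nhds_tame
    refine ⟨W, hW, fun V h0V hconn hVW => ⟨H V h0V hconn hVW, fun h3 => ?_⟩⟩
    rw [h.star.homogeneous.totalDegree h.star.squarefree.ne_zero] at h3
    omega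
  · refine ⟨φ.source, h.source_mem_nhds, fun V h0V hconn hVW => ?_⟩
    obtain ⟨σ, hσ, hshift⟩ := h.exists_tame_of_two_le hp h0V hconn hVW
    exact ⟨fun f _ => ⟨_, subset_rfl,
      Filter.mem_inf_of_right (Filter.mem_principal_self _), σ, hσ, hshift⟩, fun _ => ⟨σ, hσ, hshift⟩⟩
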